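/- An instance of Knapsack with multiplicities consists of $n\ge 0$ items, where item $i$ has size $s_i$, value $v_i$ and multiplicity $u_i$, and of a capacity $t$; all of these are nonnegative integers. The task is to find integers $x_1,\dots,x_n$ with $0\le x_i\le u_i$ and $\sum_i s_ix_i\le t$ for which $\sum_i v_ix_i$ is maximum. Let $v=\max_i v_i$ (with $v=0$ if $n=0$). Theorem. Knapsack with multiplicities can be solved deterministically in $O(n+v^3)$ time on the word RAM, if arithmetic on integers of size polynomial in the sum of the input integers takes constant time. Precisely: there are a fixed deterministic word-RAM program $P$ and constants $c,C\in\mathbb N$ such that, for every instance and every word length $w$ with $(S+2)^c\le 2^w$, where $S=n+t+\sum_i(s_i+v_i+u_i)$ is the sum of the input integers, the program $P$, started with the input $n,t,s_1,\dots,s_n,v_1,\dots,v_n,u_1,\dots,u_n$ in the memory cells $0,1,2,\dots$ and zeros everywhere else, halts after at most $C\,(n+v^3+1)$ steps with an optimal solution $x_1,\dots,x_n$ in the memory cells $0,\dots,n-1$. Here a word RAM with word length $w$ has finitely many registers and a memory of cells addressed by words. Registers and cells hold words, i.e. integers in $\{0,\dots,2^w-1\}$. In one step it loads a constant into a register, reads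 or writes the memory cell whose address is in a register, jumps (unconditionally, or if one register is less than, or equal to, another), or applies to two registers one of the operations addition, subtraction, multiplication (modulo $2^w$), integer division, remainder, bitwise and/or/xor, or left/right shift. It halts when the program counter leaves the program. -/

import Mathlib

/-! ### A word RAM with unit-cost instructions -/

namespace WordRAM

/-- The binary operations on words. -/
inductive Op where
  | add | sub | mul | div | mod | and | or | xor | shl | shr

/-- The result of an operation on words of `w` bits; words are the natural numbers below `2 ^ w`,
and results are reduced modulo `2 ^ w`.  Division by zero gives `0`. -/
def Op.eval (w : ℕ) : Op → ℕ → ℕ → ℕ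
  | .add, a, b => (a + b) % 2 ^ w
  | .sub, a, b => (a + (2 ^ w - b)) % 2 ^ w
  | .mul, a, b => (a * b) % 2 ^ w
  | .div, a, b => (a / b) % 2 ^ w
  | .mod, a, b => (a % b) % 2 ^ w
  | .and, a, b => (a &&& b) % 2 ^ w
  | .or, a, b => (a ||| b) % 2 ^ w
  | .xor, a, b => (a ^^^ b) % 2 ^ w
  | .shl, a, b => (a <<< b) % 2 ^ w
  | .shr, a, b => (a >>> b) % 2 ^ w

/-- Instructions.  `d`, `a`, `b` are numbers of registers and `l` is a position in the program. -/
inductive Instr where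
  /-- Write the constant `k` to register `d`. -/
  | const (d k : ℕ)
  /-- Apply `o` to the registers `a` and `b` and write the result to register `d`. -/
  | op (o : Op) (d a b : ℕ)
  /-- Read the memory cell whose address is in register `a` into register `d`. -/
  | load (d a : ℕ)
  /-- Write register `b` to the memory cell whose address is in register `a`. -/
  | store (a b : ℕ)
  /-- Continue at position `l`. -/
  | jump (l : ℕ)
  /-- Continue at position `l` if register `a` is less than register `b`. -/
  | jlt (a b l : ℕ)
  /-- Continue at position `l` if the registers `a` and `b` are equal. -/
  | jeq (a b l : ℕ)

/-- A program is a finite list of instructions (so it uses finitely many registers). -/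
abbrev Program := List Instr

/-- A configuration: program counter, registers and memory. -/
structure State where
  pc : ℕ
  reg : ℕ → ℕ
  mem : ℕ → ℕ

/-- Execution of one instruction on a machine with words of `w` bits. -/
def Instr.exec (w : ℕ) (σ : State) : Instr → State
  | .const d k => ⟨σ.pc + 1, Function.update σ.reg d (k % 2 ^ w), σ.mem⟩
  | .op o d a b => ⟨σ.pc + 1, Function.update σ.reg d (o.eval w (σ.reg a) (σ.reg b)), σ.mem⟩
  | .load d a => ⟨σ.pc + 1, Function.update σ.reg d (σ.mem (σ.reg a)), σ.mem⟩
  | .store a b => ⟨σ.pc + 1, σ.reg, Function.update σ.mem (σ.reg a) (σ.reg b)⟩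
  | .jump l => ⟨l, σ.reg, σ.mem⟩
  | .jlt a b l => ⟨if σ.reg a < σ.reg b then l else σ.pc + 1, σ.reg, σ.mem⟩
  | .jeq a b l => ⟨if σ.reg a = σ.reg b then l else σ.pc + 1, σ.reg, σ.mem⟩

/-- The machine has halted when the program counter is outside the program. -/
def Halted (P : Program) (σ : State) : Prop := P.length ≤ σ.pc

/-- One step of the machine: execute the instruction at the program counter, at cost one.
A halted configuration does not change. -/
def step (w : ℕ) (P : Program) (σ : State) : State :=
  match P[σ.pc]? with
  | some i => i.exec w σ
  | none => σ

/-- The initial configuration: the input is in the first memory cells, and everything else,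
registers included, is zero. -/
def init (input : List ℕ) : State := ⟨0, fun _ => 0, fun a => input.getD a 0⟩

/-- On the given input, and with words of `w` bits, the program `P` halts after at most `T` steps
with a memory content that satisfies `Q`. -/
def HaltsWithin (w : ℕ) (P : Program) (input : List ℕ) (T : ℕ) (Q : (ℕ → ℕ) → Prop) : Prop :=
  ∃ k ≤ T, Halted P ((step w P)^[k] (init input)) ∧ Q ((step w P)^[k] (init input)).mem

end WordRAM

/-! ### Knapsack with multiplicities -/

/-- An instance of Knapsack with multiplicities: `n` items with sizes, values and multiplicities,
and the capacity of the knapsack. -/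
structure Knapsack where
  n : ℕ
  size : Fin n → ℕ
  value : Fin n → ℕ
  mult : Fin n → ℕ
  capacity : ℕ

namespace Knapsack

/-- Taking `x i` copies of item `i` for each `i` respects the multiplicities and the capacity. -/
def Feasible (I : Knapsack) (x : Fin I.n → ℕ) : Prop :=
  (∀ i, x i ≤ I.mult i) ∧ ∑ i, I.size i * x i ≤ I.capacity

/-- `x` is a feasible solution of maximum total value. -/
def IsOptimal (I : Knapsack) (x : Fin I.n → ℕ) : Prop :=
  I.Feasible x ∧ ∀ y, I.Feasible y → ∑ i, I.value i * y i ≤ ∑ i, I.value i * x i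

/-- The maximum item value (zero if there are no items). -/
def maxValue (I : Knapsack) : ℕ := Finset.univ.sup I.value

/-- The input integers: the number of items, the capacity, and then the sizes, the values and the
multiplicities of the items. -/
def encode (I : Knapsack) : List ℕ :=
  I.n :: I.capacity :: (List.ofFn I.size ++ List.ofFn I.value ++ List.ofFn I.mult)

end Knapsack

/-! ### A structured language for the word RAM -/

/-! Write V for the maximum value. Order the copies of all items of positive value by the ratio of
size and value, and fill the knapsack greedily until a critical item c no longer fits completely.

Proximity (`exists_optimal_near`): some optimal solution y differs from the greedy solution g in at
most 2V copies. Among the optimal solutions take y nearest to g, and view the difference as a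
multiset of unit changes. Their signed values are nonzero integers between -V and V. The sum of
these is at least 0 because y is optimal. It is at most V because g leaves less than the size of c
unused, an added copy is at most as efficient as c, and a removed copy is at least as efficient.
Such integers can be ordered so that all partial sums take at most 2V different values
(`exists_bounded_order`), hence 2V or more of them contain a nonempty part with sum zero
(`exists_zero_sum`). Undoing this part keeps the value, does not increase the size, and brings y
closer to g, a contradiction.

Dynamic program: items of equal value a form a class. From a class only the number of copies
matters, since the smallest copies are the best ones (`Inst.preSize_le`), and the least size is a
convex function of that number. By proximity at most 4V + 1 numbers per class are relevant, and
after each class the value deviates from that of g by at most 2V². So a table with 4V² + 1 columns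
and a row for each class records the least size for every deviation, and following its predecessors
from the best admissible column gives an optimal solution (`Inst.IsTable.optimal`). Within one
residue class modulo a, the row of class a is a (min,+)-convolution of the row before with a convex
function (`Inst.ext_convex`). Its entries are the row minima of a Monge matrix, and an iterative
form of the SMAWK algorithm finds them in linear time (`minimaCmd_spec`). One row of the table then
takes O(V²) time, and the table O(V³).

Linear time in n: nothing is sorted. The critical key, and in each class the first and the last copy
of the relevant range, are found by weighted selection with medians of medians (`selectLoop_spec`).
The at most 4V copies of the range are listed in O(V²) time for each class.

Machine: the algorithm is written in a small language of while programs over natural numbers, whose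
semantics counts machine instructions and admits no overflow. Compiled programs simulate it
(`Run.sim`). All numbers that occur are bounded by a fixed power of the sum of the input, so the
words are long enough. -/

namespace WordRAM

/-- Program variables, kept in registers. -/
inductive Var where
  | n | t | vmax | kk | rr | nn | hh | str
  | i | tot | used | val
  | sb | sl | sw | sp | st | pv | g | gi | ia | ib | cn | lo | ew | si | so | x0 | x1
  | a | ci | cl | cum | z0 | wl | cur | rem | j | best | bk | cx | qa | ofs | ac
  | rs | r | len | db | lev | stp | nr | src | dst | ll | c | col | k | q | pp | tgt | row | tp
  | p | pq | cc | e0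
  deriving DecidableEq

/-- Arrays.  `raw` is the part of the memory that holds the input. -/
inductive Arr where
  | raw | key | cls | cnt | tot | gcnt | bk | bw | tb | tl | tw | sol | el | pg | gx | dt | ar
  | lst | ln | ag | ofs | qn | win
  deriving DecidableEq

/-- The state of a structured program. -/
@[ext] structure St where
  reg : Var → ℕ
  mem : Arr → ℕ → ℕ

/-- Assignment to a variable. -/
def St.setR (σ : St) (x : Var) (v : ℕ) : St := ⟨Function.update σ.reg x v, σ.mem⟩

/-- Assignment to an array cell. -/
def St.setM (σ : St) (A : Arr) (i v : ℕ) : St :=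
  ⟨σ.reg, Function.update σ.mem A (Function.update (σ.mem A) i v)⟩

section
variable (σ : St) (x y : Var) (A C : Arr) (i v : ℕ)

@[simp] theorem St.reg_setR_self : (σ.setR x v).reg x = v := by simp [St.setR]
@[simp] theorem St.reg_setR_ne (h : y ≠ x) : (σ.setR x v).reg y = σ.reg y := by
  simp [St.setR, h]
@[simp] theorem St.mem_setR : (σ.setR x v).mem = σ.mem := rfl
@[simp] theorem St.reg_setM : (σ.setM A i v).reg = σ.reg := rfl
@[simp] theorem St.mem_setM_self : (σ.setM A i v).mem A = Function.update (σ.mem A) i v := by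
  simp [St.setM]
@[simp] theorem St.mem_setM_ne (h : C ≠ A) : (σ.setM A i v).mem C = σ.mem C := by
  simp [St.setM, h]

end

/-- Expressions. -/
inductive Ex where
  | var (x : Var) | lit (k : ℕ)
  | add (a b : Ex) | sub (a b : Ex) | mul (a b : Ex) | div (a b : Ex) | mod (a b : Ex)
  | ld (A : Arr) (e : Ex)

instance : Coe Var Ex := ⟨Ex.var⟩
instance (k : ℕ) : OfNat Ex k := ⟨Ex.lit k⟩
instance : Add Ex := ⟨Ex.add⟩
instance : Sub Ex := ⟨Ex.sub⟩
instance : Mul Ex := ⟨Ex.mul⟩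
instance : Div Ex := ⟨Ex.div⟩
instance : Mod Ex := ⟨Ex.mod⟩

/-- Bounds: an exclusive bound on all values, and on the indices of each array. -/
structure Bound where
  word : ℕ
  lim : Arr → ℕ

/-- The value of an expression, computed with natural numbers. -/
def Ex.eval (σ : St) : Ex → ℕ
  | var x => σ.reg x
  | lit k => k
  | add a b => a.eval σ + b.eval σ
  | sub a b => a.eval σ - b.eval σ
  | mul a b => a.eval σ * b.eval σ
  | div a b => a.eval σ / b.eval σ
  | mod a b => a.eval σ % b.eval σ
  | ld A e => σ.mem A (e.eval σ)

/-- No overflow, no negative difference and no index out of range occurs in the evaluation. -/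
def Ex.ok (B : Bound) (σ : St) : Ex → Prop
  | var _ => True
  | lit k => k < B.word
  | add a b => a.ok B σ ∧ b.ok B σ ∧ a.eval σ + b.eval σ < B.word
  | sub a b => a.ok B σ ∧ b.ok B σ ∧ b.eval σ ≤ a.eval σ
  | mul a b => a.ok B σ ∧ b.ok B σ ∧ a.eval σ * b.eval σ < B.word
  | div a b => a.ok B σ ∧ b.ok B σ
  | mod a b => a.ok B σ ∧ b.ok B σ
  | ld A e => e.ok B σ ∧ e.eval σ < B.lim A

/-- The number of machine instructions that evaluate an expression. -/
def Ex.cost : Ex → ℕ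
  | var _ => 1
  | lit _ => 1
  | add a b => a.cost + b.cost + 1
  | sub a b => a.cost + b.cost + 1
  | mul a b => a.cost + b.cost + 1
  | div a b => a.cost + b.cost + 1
  | mod a b => a.cost + b.cost + 1
  -- Five instructions turn the index into an address, and one loads the cell.
  | ld _ e => e.cost + 6

/-- Conditions.  A conjunction is evaluated from left to right. -/
inductive Cond where
  | lt (a b : Ex) | le (a b : Ex) | eq (a b : Ex) | ne (a b : Ex) | and (c d : Cond)

def Cond.eval (σ : St) : Cond → Prop
  | lt a b => a.eval σ < b.eval σ
  | le a b => a.eval σ ≤ b.eval σ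
  | eq a b => a.eval σ = b.eval σ
  | ne a b => a.eval σ ≠ b.eval σ
  | and c d => c.eval σ ∧ d.eval σ

def Cond.ok (B : Bound) (σ : St) : Cond → Prop
  | lt a b => a.ok B σ ∧ b.ok B σ
  | le a b => a.ok B σ ∧ b.ok B σ
  | eq a b => a.ok B σ ∧ b.ok B σ
  | ne a b => a.ok B σ ∧ b.ok B σ
  | and c d => c.ok B σ ∧ (c.eval σ → d.ok B σ)

def Cond.cost : Cond → ℕ
  | lt a b => a.cost + b.cost + 2
  | le a b => a.cost + b.cost + 2
  | eq a b => a.cost + b.cost + 2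
  | ne a b => a.cost + b.cost + 2
  | and c d => c.cost + d.cost

/-- Commands. -/
inductive Cmd where
  | skip
  | asg (x : Var) (e : Ex)
  | sto (A : Arr) (i e : Ex)
  | seq (c d : Cmd)
  | ite (b : Cond) (c d : Cmd)
  | while (b : Cond) (c : Cmd)

infix:62 " ::= " => Cmd.asg
infixr:60 " ;; " => Cmd.seq

/-! ### Timed semantics and proof rules for structured programs -/

/-- `Run B c σ τ k`: command `c` leads from `σ` to `τ` in at most `k` machine steps, without
exceeding the bounds. -/
inductive Run (B : Bound) : Cmd → St → St → ℕ → Prop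
  | skip (σ) : Run B .skip σ σ 0
  | asg (σ x e) : e.ok B σ → Run B (.asg x e) σ (σ.setR x (e.eval σ)) (e.cost + 1)
  | sto (σ A i e) : i.ok B σ → e.ok B σ → i.eval σ < B.lim A →
      Run B (.sto A i e) σ (σ.setM A (i.eval σ) (e.eval σ)) (i.cost + e.cost + 6)
  | seq {c d σ τ ρ k l} : Run B c σ τ k → Run B d τ ρ l → Run B (.seq c d) σ ρ (k + l)
  | iteT {b c d σ τ k} : b.ok B σ → b.eval σ → Run B c σ τ k →
      Run B (.ite b c d) σ τ (b.cost + k + 1)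
  | iteF {b c d σ τ k} : b.ok B σ → ¬ b.eval σ → Run B d σ τ k →
      Run B (.ite b c d) σ τ (b.cost + k + 1)
  | whileF {b c σ} : b.ok B σ → ¬ b.eval σ → Run B (.while b c) σ σ b.cost
  | whileT {b c σ τ ρ k l} : b.ok B σ → b.eval σ → Run B c σ τ k → Run B (.while b c) τ ρ l →
      Run B (.while b c) σ ρ (b.cost + k + 1 + l)

/-- From `σ` and time `k`, command `c` terminates in a state and at a time that satisfy `Q`. -/
def WP (B : Bound) (c : Cmd) (σ : St) (k : ℕ) (Q : St → ℕ → Prop) : Prop :=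
  ∃ τ l, Run B c σ τ l ∧ Q τ (k + l)

section
variable {B : Bound} {σ : St} {k : ℕ} {Q : St → ℕ → Prop}

@[simp] theorem WP_skip : WP B .skip σ k Q ↔ Q σ k := by
  constructor
  · rintro ⟨τ, l, h, hQ⟩; cases h; exact hQ
  · intro h; exact ⟨_, _, .skip σ, h⟩

@[simp] theorem WP_asg {x e} :
    WP B (.asg x e) σ k Q ↔ e.ok B σ ∧ Q (σ.setR x (e.eval σ)) (k + (e.cost + 1)) := by
  constructor
  · rintro ⟨τ, l, h, hQ⟩; cases h; exact ⟨‹_›, hQ⟩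
  · intro h; exact ⟨_, _, .asg _ _ _ h.1, h.2⟩

@[simp] theorem WP_sto {A i e} :
    WP B (.sto A i e) σ k Q ↔ i.ok B σ ∧ e.ok B σ ∧ i.eval σ < B.lim A ∧
      Q (σ.setM A (i.eval σ) (e.eval σ)) (k + (i.cost + e.cost + 6)) := by
  constructor
  · rintro ⟨τ, l, h, hQ⟩; cases h; exact ⟨‹_›, ‹_›, ‹_›, hQ⟩
  · intro h; exact ⟨_, _, .sto _ _ _ _ h.1 h.2.1 h.2.2.1, h.2.2.2⟩

@[simp] theorem WP_seq {c d} :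
    WP B (.seq c d) σ k Q ↔ WP B c σ k fun τ l => WP B d τ l Q := by
  constructor
  · rintro ⟨τ, l, h, hQ⟩
    cases h with
    | seq h₁ h₂ => exact ⟨_, _, h₁, _, _, h₂, by rwa [add_assoc]⟩
  · rintro ⟨τ, l, h₁, ρ, l', h₂, hQ⟩
    exact ⟨_, _, .seq h₁ h₂, by rwa [← add_assoc]⟩

@[simp] theorem WP_ite {b c d} :
    WP B (.ite b c d) σ k Q ↔ b.ok B σ ∧
      (b.eval σ → WP B c σ (k + (b.cost + 1)) Q) ∧
      (¬ b.eval σ → WP B d σ (k + (b.cost + 1)) Q) := by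
  constructor
  · rintro ⟨τ, l, h, hQ⟩
    cases h with
    | iteT hb ht h₁ =>
      refine ⟨hb, fun _ => ⟨_, _, h₁, ?_⟩, fun h => absurd ht h⟩
      convert hQ using 1; ring
    | iteF hb ht h₁ =>
      refine ⟨hb, fun h => absurd h ht, fun _ => ⟨_, _, h₁, ?_⟩⟩
      convert hQ using 1; ring
  · rintro ⟨hb, h₁, h₂⟩
    by_cases ht : b.eval σ
    · obtain ⟨τ, l, h, hQ⟩ := h₁ ht
      exact ⟨_, _, .iteT hb ht h, by convert hQ using 1; ring⟩
    · obtain ⟨τ, l, h, hQ⟩ := h₂ ht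
      exact ⟨_, _, .iteF hb ht h, by convert hQ using 1; ring⟩

theorem WP.mono {c} {Q' : St → ℕ → Prop} (h : WP B c σ k Q) (hQ : ∀ τ l, Q τ l → Q' τ l) :
    WP B c σ k Q' := by
  obtain ⟨τ, l, hr, hq⟩ := h
  exact ⟨τ, l, hr, hQ _ _ hq⟩

/-- The variables that a command may change. -/
def Cmd.wr : Cmd → Var → Bool
  | .skip, _ => false
  | .asg x _, y => decide (x = y)
  | .sto _ _ _, _ => false
  | .seq c d, y => c.wr y || d.wr y
  | .ite _ c d, y => c.wr y || d.wr y
  | .while _ c, y => c.wr y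

/-- The arrays that a command may change. -/
def Cmd.wa : Cmd → Arr → Bool
  | .skip, _ => false
  | .asg _ _, _ => false
  | .sto A _ _, C => decide (A = C)
  | .seq c d, y => c.wa y || d.wa y
  | .ite _ c d, y => c.wa y || d.wa y
  | .while _ c, y => c.wa y

/-- The states agree on everything that `c` does not change. -/
structure Frame (c : Cmd) (σ τ : St) : Prop where
  reg : ∀ x, c.wr x = false → τ.reg x = σ.reg x
  mem : ∀ A, c.wa A = false → τ.mem A = σ.mem A

theorem Frame.refl (c : Cmd) (σ : St) : Frame c σ σ := ⟨fun _ _ => rfl, fun _ _ => rfl⟩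

theorem Frame.trans {c : Cmd} {σ τ ρ : St} (h : Frame c σ τ) (h' : Frame c τ ρ) : Frame c σ ρ :=
  ⟨fun x hx => (h'.reg x hx).trans (h.reg x hx), fun x hx => (h'.mem x hx).trans (h.mem x hx)⟩

/-- `wr` and `wa` can be computed, so `rfl` shows for a concrete program that it leaves a variable
or an array alone. Most facts are carried past a subroutine in this way. -/
theorem Run.frame {c : Cmd} {σ τ : St} {k : ℕ} (h : Run B c σ τ k) : Frame c σ τ := by
  induction h with
  | skip σ => exact .refl _ _
  | asg σ x e _ =>
    refine ⟨fun y hy => ?_, fun _ _ => rfl⟩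
    simp only [Cmd.wr, decide_eq_false_iff_not] at hy
    exact St.reg_setR_ne _ _ _ _ (Ne.symm hy)
  | sto σ A i e _ _ _ =>
    refine ⟨fun _ _ => rfl, fun C hy => ?_⟩
    simp only [Cmd.wa, decide_eq_false_iff_not] at hy
    exact St.mem_setM_ne _ _ _ _ _ (Ne.symm hy)
  | seq _ _ ih₁ ih₂ =>
    constructor
    · intro x hx
      simp only [Cmd.wr, Bool.or_eq_false_iff] at hx
      rw [ih₂.reg x hx.2, ih₁.reg x hx.1]
    · intro x hx
      simp only [Cmd.wa, Bool.or_eq_false_iff] at hx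
      rw [ih₂.mem x hx.2, ih₁.mem x hx.1]
  | iteT _ _ _ ih =>
    constructor
    · intro x hx
      simp only [Cmd.wr, Bool.or_eq_false_iff] at hx
      exact ih.reg x hx.1
    · intro x hx
      simp only [Cmd.wa, Bool.or_eq_false_iff] at hx
      exact ih.mem x hx.1
  | iteF _ _ _ ih =>
    constructor
    · intro x hx
      simp only [Cmd.wr, Bool.or_eq_false_iff] at hx
      exact ih.reg x hx.2
    · intro x hx
      simp only [Cmd.wa, Bool.or_eq_false_iff] at hx
      exact ih.mem x hx.2
  | whileF _ _ => exact .refl _ _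
  | whileT _ _ _ _ ih₁ ih₂ =>
    exact Frame.trans ⟨ih₁.reg, ih₁.mem⟩ ih₂

theorem WP.frame {c} (h : WP B c σ k Q) : WP B c σ k fun τ l => Q τ l ∧ Frame c σ τ := by
  obtain ⟨τ, l, hr, hq⟩ := h
  exact ⟨τ, l, hr, hq, hr.frame⟩

/-- The time at which a command starts does not matter. -/
theorem WP.shift {c} (h : WP B c σ 0 fun τ l => Q τ (k + l)) : WP B c σ k Q := by
  obtain ⟨τ, l, hr, hq⟩ := h
  exact ⟨τ, l, hr, by simpa using hq⟩

/-- The rule for loops, with an invariant that may mention the time and a decreasing measure. -/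
theorem WP_while {b : Cond} {c : Cmd} (Inv : St → ℕ → Prop) (μ : St → ℕ) (h0 : Inv σ k)
    (hstep : ∀ τ l, Frame c σ τ → Inv τ l → b.ok B τ ∧ (b.eval τ →
      WP B c τ (l + (b.cost + 1)) fun τ' l' => Inv τ' l' ∧ μ τ' < μ τ)) :
    WP B (.while b c) σ k fun τ l => ∃ l', l = l' + b.cost ∧ Inv τ l' ∧ ¬ b.eval τ ∧
      Frame c σ τ := by
  suffices H : ∀ m τ l, Frame c σ τ → Inv τ l → μ τ = m → WP B (.while b c) τ l fun τ l =>
      ∃ l', l = l' + b.cost ∧ Inv τ l' ∧ ¬ b.eval τ ∧ Frame c σ τ from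
    H _ σ k (.refl _ _) h0 rfl
  intro m
  induction m using Nat.strong_induction_on with
  | _ m ih =>
    intro τ l hF hI hm
    obtain ⟨hok, hb⟩ := hstep τ l hF hI
    by_cases ht : b.eval τ
    · obtain ⟨τ', l', hr, hI', hμ⟩ := hb ht
      obtain ⟨ρ, l'', hr', hQ⟩ := ih _ (hm ▸ hμ) τ' _ (hF.trans hr.frame) hI' rfl
      refine ⟨ρ, _, .whileT hok ht hr hr', ?_⟩
      convert hQ using 1; ring_nf
    · exact ⟨τ, _, .whileF hok ht, l, rfl, hI, ht, hF⟩

/-- A counting loop; the upper bound is a variable. -/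
def Cmd.for (x : Var) (e : Ex) (y : Var) (c : Cmd) : Cmd :=
  x ::= e ;; .while (.lt x y) (c ;; x ::= (x : Ex) + 1)

/-- The rule for counting loops. -/
theorem WP_for {x y : Var} {e : Ex} {c : Cmd} (Inv : ℕ → St → ℕ → Prop) (hxy : y ≠ x)
    (hx : c.wr x = false) (hy : c.wr y = false)
    (hok : e.ok B σ) (hN : σ.reg y < B.word) (h1 : 1 < B.word) (hle : e.eval σ ≤ σ.reg y)
    (h0 : Inv (e.eval σ) (σ.setR x (e.eval σ)) (k + (e.cost + 1)))
    (hstep : ∀ i τ l, e.eval σ ≤ i → i < σ.reg y → Frame (.for x e y c) σ τ → τ.reg x = i →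
      Inv i τ l →
      -- The `5` is the successful test together with the jump back, and the `4` is the increment;
      -- they make up the `9` in `WP_for'`. The `4` in the conclusion is the last, failing test.
      WP B c τ (l + 5) fun τ' l' => Inv (i + 1) (τ'.setR x (i + 1)) (l' + 4)) :
    WP B (.for x e y c) σ k fun τ l => ∃ l', l = l' + 4 ∧ Inv (σ.reg y) τ l' ∧
      τ.reg x = σ.reg y ∧ Frame (.for x e y c) σ τ := by
  have hfr : ∀ τ, Frame (c ;; x ::= (x : Ex) + 1) (σ.setR x (e.eval σ)) τ →
      Frame (.for x e y c) σ τ := by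
    intro τ h
    constructor
    · intro z hz
      simp only [Cmd.for, Cmd.wr, Bool.or_eq_false_iff, decide_eq_false_iff_not] at hz
      rw [h.reg z (by simp [Cmd.wr, hz]), St.reg_setR_ne]
      exact Ne.symm hz.1
    · intro z hz
      simp only [Cmd.for, Cmd.wa, Bool.or_eq_false_iff] at hz
      rw [h.mem z (by simp [Cmd.wa, hz]), St.mem_setR]
  unfold Cmd.for
  rw [WP_seq, WP_asg]
  refine ⟨hok, ?_⟩
  refine (WP_while (fun τ l => ∃ i, τ.reg x = i ∧ e.eval σ ≤ i ∧ i ≤ σ.reg y ∧ Inv i τ l)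
    (fun τ => σ.reg y - τ.reg x) ⟨e.eval σ, by simp, le_rfl, hle, h0⟩ ?_).mono ?_
  · rintro τ l hF ⟨i, hi, hei, hiy, hI⟩
    have hFy : τ.reg y = σ.reg y := by
      rw [hF.reg y (by simp [Cmd.wr, hy, Ne.symm hxy]), St.reg_setR_ne _ _ _ _ hxy]
    refine ⟨⟨trivial, trivial⟩, fun hb => ?_⟩
    have hb' : τ.reg x < τ.reg y := hb
    rw [WP_seq]
    refine (hstep i τ l hei (by omega) (hfr τ hF) hi hI).frame.mono ?_
    rintro τ' l' ⟨h, hF'⟩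
    have hx' : τ'.reg x = i := by rw [hF'.reg x hx, hi]
    rw [WP_asg]
    refine ⟨⟨trivial, h1, ?_⟩, ⟨i + 1, ?_, by omega, by omega, ?_⟩, ?_⟩
    · change τ'.reg x + 1 < _
      omega
    · rw [St.reg_setR_self]
      change τ'.reg x + 1 = _
      omega
    · have : ((x : Ex) + 1).eval τ' = i + 1 := by
        change τ'.reg x + 1 = _
        omega
      rw [this]
      exact h
    · rw [St.reg_setR_self]
      change _ - (τ'.reg x + 1) < _
      omega
  · rintro τ l ⟨l', hl, ⟨i, hi, hei, hiy, hI⟩, hb, hF⟩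
    have hFy : τ.reg y = σ.reg y := by
      rw [hF.reg y (by simp [Cmd.wr, hy, Ne.symm hxy]), St.reg_setR_ne _ _ _ _ hxy]
    have hb' : ¬ τ.reg x < τ.reg y := hb
    have : i = σ.reg y := by omega
    subst this
    exact ⟨l', hl, hI, hi, by simpa [Cmd.for] using hfr τ hF⟩

/-- The rule for counting loops whose body takes bounded time. -/
theorem WP_for' {x y : Var} {e : Ex} {c : Cmd} (Inv : ℕ → St → Prop) (T : ℕ) (hxy : y ≠ x)
    (hx : c.wr x = false) (hy : c.wr y = false)
    (hok : e.ok B σ) (hN : σ.reg y < B.word) (h1 : 1 < B.word) (hle : e.eval σ ≤ σ.reg y)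
    (h0 : Inv (e.eval σ) (σ.setR x (e.eval σ)))
    (hstep : ∀ i τ, e.eval σ ≤ i → i < σ.reg y → Frame (.for x e y c) σ τ → τ.reg x = i →
      Inv i τ →
      WP B c τ 0 fun τ' l' => Inv (i + 1) (τ'.setR x (i + 1)) ∧ l' + 9 ≤ T) :
    WP B (.for x e y c) σ k fun τ l => Inv (σ.reg y) τ ∧
      τ.reg x = σ.reg y ∧ Frame (.for x e y c) σ τ ∧
      l ≤ k + e.cost + 5 + T * (σ.reg y - e.eval σ) := by
  refine (WP_for (fun i τ l => Inv i τ ∧ l ≤ k + e.cost + 1 + T * (i - e.eval σ)) hxy hx hy hok hN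
    h1 hle ⟨h0, by omega⟩ ?_).mono ?_
  · rintro i τ l hi hi' hF hxi ⟨hI, hl⟩
    apply WP.shift
    refine (hstep i τ hi hi' hF hxi hI).mono ?_
    rintro τ' l' ⟨h, hl'⟩
    refine ⟨h, ?_⟩
    rw [Nat.sub_add_comm hi, mul_add]
    omega
  · rintro τ l ⟨l', hl, ⟨hI, hl'⟩, hx', hF⟩
    exact ⟨hI, hx', hF, by omega⟩

end

section
variable (B : Bound) (σ : St) (a b : Ex) (x : Var) (m : ℕ) (A : Arr)

@[simp] theorem Ex.eval_var : (Ex.var x).eval σ = σ.reg x := rfl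
@[simp] theorem Ex.eval_lit : (ofNat(m) : Ex).eval σ = m := rfl
@[simp] theorem Ex.eval_add : (a + b).eval σ = a.eval σ + b.eval σ := rfl
@[simp] theorem Ex.eval_sub : (a - b).eval σ = a.eval σ - b.eval σ := rfl
@[simp] theorem Ex.eval_mul : (a * b).eval σ = a.eval σ * b.eval σ := rfl
@[simp] theorem Ex.eval_div : (a / b).eval σ = a.eval σ / b.eval σ := rfl
@[simp] theorem Ex.eval_mod : (a % b).eval σ = a.eval σ % b.eval σ := rfl
@[simp] theorem Ex.eval_ld : (Ex.ld A a).eval σ = σ.mem A (a.eval σ) := rfl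

@[simp] theorem Ex.ok_var : (Ex.var x).ok B σ := trivial
@[simp] theorem Ex.ok_lit : (ofNat(m) : Ex).ok B σ ↔ m < B.word := Iff.rfl
@[simp] theorem Ex.ok_add : (a + b).ok B σ ↔
    a.ok B σ ∧ b.ok B σ ∧ a.eval σ + b.eval σ < B.word := Iff.rfl
@[simp] theorem Ex.ok_sub : (a - b).ok B σ ↔ a.ok B σ ∧ b.ok B σ ∧ b.eval σ ≤ a.eval σ := Iff.rfl
@[simp] theorem Ex.ok_mul : (a * b).ok B σ ↔
    a.ok B σ ∧ b.ok B σ ∧ a.eval σ * b.eval σ < B.word := Iff.rfl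
@[simp] theorem Ex.ok_div : (a / b).ok B σ ↔ a.ok B σ ∧ b.ok B σ := Iff.rfl
@[simp] theorem Ex.ok_mod : (a % b).ok B σ ↔ a.ok B σ ∧ b.ok B σ := Iff.rfl
@[simp] theorem Ex.ok_ld : (Ex.ld A a).ok B σ ↔ a.ok B σ ∧ a.eval σ < B.lim A := Iff.rfl

@[simp] theorem Ex.cost_var : (Ex.var x).cost = 1 := rfl
@[simp] theorem Ex.cost_lit : (ofNat(m) : Ex).cost = 1 := rfl
@[simp] theorem Ex.cost_add : (a + b).cost = a.cost + b.cost + 1 := rfl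
@[simp] theorem Ex.cost_sub : (a - b).cost = a.cost + b.cost + 1 := rfl
@[simp] theorem Ex.cost_mul : (a * b).cost = a.cost + b.cost + 1 := rfl
@[simp] theorem Ex.cost_div : (a / b).cost = a.cost + b.cost + 1 := rfl
@[simp] theorem Ex.cost_mod : (a % b).cost = a.cost + b.cost + 1 := rfl
@[simp] theorem Ex.cost_ld : (Ex.ld A a).cost = a.cost + 6 := rfl

variable (c d : Cond)

@[simp] theorem Cond.eval_lt : (Cond.lt a b).eval σ ↔ a.eval σ < b.eval σ := Iff.rfl
@[simp] theorem Cond.eval_le : (Cond.le a b).eval σ ↔ a.eval σ ≤ b.eval σ := Iff.rfl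
@[simp] theorem Cond.eval_eq : (Cond.eq a b).eval σ ↔ a.eval σ = b.eval σ := Iff.rfl
@[simp] theorem Cond.eval_ne : (Cond.ne a b).eval σ ↔ a.eval σ ≠ b.eval σ := Iff.rfl
@[simp] theorem Cond.eval_and : (Cond.and c d).eval σ ↔ c.eval σ ∧ d.eval σ := Iff.rfl
@[simp] theorem Cond.ok_lt : (Cond.lt a b).ok B σ ↔ a.ok B σ ∧ b.ok B σ := Iff.rfl
@[simp] theorem Cond.ok_le : (Cond.le a b).ok B σ ↔ a.ok B σ ∧ b.ok B σ := Iff.rfl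
@[simp] theorem Cond.ok_eq : (Cond.eq a b).ok B σ ↔ a.ok B σ ∧ b.ok B σ := Iff.rfl
@[simp] theorem Cond.ok_ne : (Cond.ne a b).ok B σ ↔ a.ok B σ ∧ b.ok B σ := Iff.rfl
@[simp] theorem Cond.ok_and : (Cond.and c d).ok B σ ↔ c.ok B σ ∧ (c.eval σ → d.ok B σ) := Iff.rfl
@[simp] theorem Cond.cost_lt : (Cond.lt a b).cost = a.cost + b.cost + 2 := rfl
@[simp] theorem Cond.cost_le : (Cond.le a b).cost = a.cost + b.cost + 2 := rfl
@[simp] theorem Cond.cost_eq : (Cond.eq a b).cost = a.cost + b.cost + 2 := rfl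
@[simp] theorem Cond.cost_ne : (Cond.ne a b).cost = a.cost + b.cost + 2 := rfl
@[simp] theorem Cond.cost_and : (Cond.and c d).cost = c.cost + d.cost := rfl

end

end WordRAM

/-! ### Compilation to word RAM instructions -/

namespace WordRAM

/-- The register of a variable.  Register `0` holds the first address of the interleaved arrays,
register `1` holds zero, and the registers from `100` on hold intermediate results. -/
def Var.idx (x : Var) : ℕ := x.ctorIdx + 2

theorem Var.idx_inj {x y : Var} (h : x.idx = y.idx) : x = y := by
  have h' : x.ctorIdx = y.ctorIdx := by simpa [Var.idx] using h
  have := congrArg Var.ofNat h'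
  simpa [Var.ofNat_ctorIdx] using this

theorem Var.idx_lt (x : Var) : x.idx < 100 := by cases x <;> decide

theorem Var.two_le_idx (x : Var) : 2 ≤ x.idx := by simp [Var.idx]

/-- The lengths of the arrays depend on the instance, so no fixed division of the memory suits them.
They are interleaved with period 64 instead, and the offset identifies the array. Only `raw` stays
contiguous, at address zero, since it holds input and output. -/
def Arr.off : Arr → ℕ
  | .raw => 0
  | A => A.ctorIdx

def Arr.scale : Arr → ℕ
  | .raw => 1
  | _ => 64

/-- The register that holds the first address of an array. -/
def Arr.base : Arr → ℕ
  | .raw => 1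
  | _ => 0

theorem Arr.off_lt (A : Arr) : A.off < 64 := by cases A <;> decide

/-- The address of a cell of an array, if the interleaved arrays start at `o`. -/
def addr (o : ℕ) (A : Arr) (i : ℕ) : ℕ := i * A.scale + A.off + if A = .raw then 0 else o

theorem Arr.off_inj {A C : Arr} (hA : A ≠ .raw) (hC : C ≠ .raw) (h : A.off = C.off) : A = C := by
  have e : ∀ A : Arr, A ≠ .raw → A.off = A.ctorIdx := by intro A hA; cases A <;> simp_all [Arr.off]
  rw [e A hA, e C hC] at h
  have := congrArg Arr.ofNat h
  simpa [Arr.ofNat_ctorIdx] using this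

/-- Addresses of `raw` lie below `o` and all others do not; among the others the residue modulo 64,
counted from `o`, determines the array and the quotient determines the index. -/
theorem addr_inj {o : ℕ} {A C : Arr} {i j : ℕ} (hi : A = .raw → i < o) (hj : C = .raw → j < o)
    (h : addr o A i = addr o C j) : A = C ∧ i = j := by
  have s : ∀ A : Arr, A ≠ .raw → A.scale = 64 := by intro A hA; cases A <;> simp_all [Arr.scale]
  have hAo := A.off_lt
  have hCo := C.off_lt
  by_cases hA : A = .raw <;> by_cases hC : C = .raw
  · subst hA hC
    simpa [addr, Arr.scale, Arr.off] using h
  · subst hA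
    have := hi rfl
    simp [addr, hC, Arr.scale, Arr.off] at h
    omega
  · subst hC
    have := hj rfl
    simp [addr, hA, Arr.scale, Arr.off] at h
    omega
  · simp only [addr, hA, hC, s A hA, s C hC, if_false] at h
    have h1 : A.off = C.off := by omega
    exact ⟨Arr.off_inj hA hC h1, by omega⟩

/-- Replace the index in register `d` by the address of the cell. -/
def Arr.code (A : Arr) (d : ℕ) : List Instr :=
  [.const (d + 1) A.scale, .op .mul d d (d + 1), .const (d + 1) A.off, .op .add d d (d + 1),
    .op .add d d A.base]

/-- Code that puts the value of an expression in register `d`. -/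
def Ex.code : ℕ → Ex → List Instr
  -- The machine has no instruction that copies a register; the bitwise or of a register with itself
  -- does it.
  | d, var x => [.op .or d x.idx x.idx]
  | d, lit k => [.const d k]
  | d, add a b => a.code d ++ b.code (d + 1) ++ [.op .add d d (d + 1)]
  | d, sub a b => a.code d ++ b.code (d + 1) ++ [.op .sub d d (d + 1)]
  | d, mul a b => a.code d ++ b.code (d + 1) ++ [.op .mul d d (d + 1)]
  | d, div a b => a.code d ++ b.code (d + 1) ++ [.op .div d d (d + 1)]
  | d, mod a b => a.code d ++ b.code (d + 1) ++ [.op .mod d d (d + 1)]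
  | d, ld A e => e.code d ++ A.code d ++ [.load d d]

theorem Ex.length_code (e : Ex) (d : ℕ) : (e.code d).length = e.cost := by
  induction e generalizing d <;> simp_all [Ex.code, Ex.cost, Arr.code] <;> omega

/-- This can be less than the cost: `≤` and `≠` compile to a single jump on the opposite condition,
whereas `Cond.cost` is only an upper bound and counts two jumps for every comparison. -/
def Cond.size : Cond → ℕ
  | .lt a b => a.cost + b.cost + 2
  | .le a b => a.cost + b.cost + 1
  | .eq a b => a.cost + b.cost + 2
  | .ne a b => a.cost + b.cost + 1
  | .and c d => c.size + d.size

/-- Code at position `o` that continues behind it if the condition holds, and else at `l`. -/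
def Cond.code : ℕ → ℕ → Cond → List Instr
  | o, l, .lt a b => a.code 100 ++ b.code 101 ++ [.jlt 100 101 (o + (a.cost + b.cost + 2)), .jump l]
  | _, l, .le a b => a.code 100 ++ b.code 101 ++ [.jlt 101 100 l]
  | o, l, .eq a b => a.code 100 ++ b.code 101 ++ [.jeq 100 101 (o + (a.cost + b.cost + 2)), .jump l]
  | _, l, .ne a b => a.code 100 ++ b.code 101 ++ [.jeq 100 101 l]
  | o, l, .and c d => c.code o l ++ d.code (o + c.size) l

theorem Cond.length_code (c : Cond) (o l : ℕ) : (c.code o l).length = c.size := by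
  induction c generalizing o l <;> simp_all [Cond.code, Cond.size, Ex.length_code] <;> omega

def Cmd.size : Cmd → ℕ
  | .skip => 0
  | .asg _ e => e.cost + 1
  | .sto _ i e => i.cost + e.cost + 6
  | .seq c d => c.size + d.size
  | .ite b c d => b.size + c.size + 1 + d.size
  | .while b c => b.size + c.size + 1

/-- Code at position `o` for a command. -/
def Cmd.code : ℕ → Cmd → List Instr
  | _, .skip => []
  | _, .asg x e => e.code 100 ++ [.op .or x.idx 100 100]
  | _, .sto A i e => e.code 100 ++ i.code 101 ++ A.code 101 ++ [.store 101 100]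
  | o, .seq c d => c.code o ++ d.code (o + c.size)
  | o, .ite b c d => b.code o (o + (b.size + c.size + 1)) ++ c.code (o + b.size) ++
      [.jump (o + (b.size + c.size + 1 + d.size))] ++ d.code (o + (b.size + c.size + 1))
  | o, .while b c => b.code o (o + (b.size + c.size + 1)) ++ c.code (o + b.size) ++ [.jump o]

theorem Cmd.length_code (c : Cmd) (o : ℕ) : (c.code o).length = c.size := by
  induction c generalizing o <;>
    simp_all [Cmd.code, Cmd.size, Ex.length_code, Cond.length_code, Arr.code] <;> omega

/-! ### Correctness of the compilation -/

/-- The instructions `l` are in the program at position `o`. -/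
def At (P : Program) (o : ℕ) (l : List Instr) : Prop := ∀ i ∈ l.zipIdx o, P[i.2]? = some i.1

theorem At_nil {P o} : At P o [] := by simp [At]

theorem At_cons {P o i l} : At P o (i :: l) ↔ P[o]? = some i ∧ At P (o + 1) l := by
  simp [At, List.zipIdx_cons]

theorem At_append {P o l l'} : At P o (l ++ l') ↔ At P o l ∧ At P (o + l.length) l' := by
  induction l generalizing o with
  | nil => simp [At_nil]
  | cons a l ih => simp [At_cons, ih, and_assoc, add_comm, add_left_comm]

theorem At_self (P : Program) : At P 0 P := by
  intro i hi
  rw [List.mem_zipIdx_iff_getElem?] at hi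
  exact hi

/-- The machine gets from `m` to `m'` in at most `k` steps. -/
def Reach (w : ℕ) (P : Program) (m : State) (k : ℕ) (m' : State) : Prop :=
  ∃ j ≤ k, (step w P)^[j] m = m'

theorem Reach.refl {w P m} : Reach w P m 0 m := ⟨0, le_rfl, rfl⟩

theorem Reach.trans {w P m k m' k' m''} (h : Reach w P m k m') (h' : Reach w P m' k' m'') :
    Reach w P m (k + k') m'' := by
  obtain ⟨j, hj, rfl⟩ := h
  obtain ⟨j', hj', rfl⟩ := h'
  exact ⟨j' + j, by omega, Function.iterate_add_apply _ _ _ _⟩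

theorem Reach.mono {w P m k k' m'} (h : Reach w P m k m') (hk : k ≤ k') : Reach w P m k' m' := by
  obtain ⟨j, hj, h⟩ := h
  exact ⟨j, hj.trans hk, h⟩

theorem Reach.one {w P m} {i : Instr} (h : P[m.pc]? = some i) : Reach w P m 1 (i.exec w m) :=
  ⟨1, le_rfl, by simp [step, h]⟩

/-- The machine state `m` represents `σ`, up to the program counter and auxiliary registers. -/
structure Rel (o : ℕ) (B : Bound) (σ : St) (m : State) : Prop where
  reg : ∀ x : Var, m.reg x.idx = σ.reg x
  zero : m.reg 0 = o
  one : m.reg 1 = 0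
  mem : ∀ A i, i < B.lim A → m.mem (addr o A i) = σ.mem A i
  reg_lt : ∀ x, σ.reg x < B.word
  mem_lt : ∀ A i, i < B.lim A → σ.mem A i < B.word

/-- Words of `w` bits are big enough for the bounds, if the interleaved arrays start at `o`. -/
structure Fits (w o : ℕ) (B : Bound) : Prop where
  word : B.word = 2 ^ w
  big : 64 < 2 ^ w
  raw : B.lim .raw ≤ o
  lim : ∀ A i, i < B.lim A → addr o A i < 2 ^ w

section
variable {w o : ℕ} {B : Bound} {P : Program} {σ : St}

/-- `Ex.ok` demands no bound for differences, quotients and remainders, because they are at most the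
first operand. -/
theorem Ex.eval_lt {m : State} (hR : Rel o B σ m) : ∀ {e : Ex}, e.ok B σ → e.eval σ < B.word
  | var x, _ => hR.reg_lt x
  | lit _, h => h
  | add _ _, h => h.2.2
  | sub a _, h => lt_of_le_of_lt (Nat.sub_le _ _) (Ex.eval_lt hR (e := a) h.1)
  | mul _ _, h => h.2.2
  | div a _, h => lt_of_le_of_lt (Nat.div_le_self _ _) (Ex.eval_lt hR (e := a) h.1)
  | mod a _, h => lt_of_le_of_lt (Nat.mod_le _ _) (Ex.eval_lt hR (e := a) h.1)
  | ld A _, h => hR.mem_lt A _ h.2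

/-- The effect of a piece of code that evaluates something to register `d`. -/
def Evals (w : ℕ) (P : Program) (d n v : ℕ) (m : State) : Prop :=
  ∃ m', Reach w P m n m' ∧ m'.pc = m.pc + n ∧ m'.mem = m.mem ∧ (∀ r < d, m'.reg r = m.reg r) ∧
    m'.reg d = v

/-- Registers from 100 on are scratch space: the evaluation of expressions changes only these and
thus does not affect the represented state. -/
theorem Rel.of_eq {m m' : State} (h : Rel o B σ m) (hr : ∀ r < 100, m'.reg r = m.reg r)
    (hm : m'.mem = m.mem) : Rel o B σ m' :=
  ⟨fun x => by rw [hr _ x.idx_lt, h.reg], by rw [hr _ (by norm_num), h.zero],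
    by rw [hr _ (by norm_num), h.one], by rw [hm]; exact h.mem, h.reg_lt, h.mem_lt⟩

theorem evals_addr (hW : Fits w o B) {A : Arr} {d n v : ℕ} {m : State} (hm : Rel o B σ m)
    (hv : v < B.lim A) (hd : 100 ≤ d) (h : Evals w P d n v m) (hP : At P (m.pc + n) (A.code d)) :
    Evals w P d (n + 5) (addr o A v) m := by
  obtain ⟨m', hr, hpc, hmem, hreg, hv'⟩ := h
  have hb := hW.lim A v hv
  have h64 := hW.big
  have hAo := A.off_lt
  have hsc : A.scale ≤ 64 := by cases A <;> simp [Arr.scale]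
  have hbase : m'.reg A.base = if A = .raw then 0 else o := by
    have hb : A.base < d := lt_of_lt_of_le (by cases A <;> simp [Arr.base]) hd
    rw [hreg _ hb]
    cases A <;> simp [Arr.base, hm.zero, hm.one]
  have hbd : A.base ≠ d := by
    have hb : A.base < d := lt_of_lt_of_le (by cases A <;> simp [Arr.base]) hd
    exact hb.ne
  have hbd' : A.base ≠ d + 1 := by
    have hb : A.base < d := lt_of_lt_of_le (by cases A <;> simp [Arr.base]) hd
    omega
  simp only [Arr.code, At_cons, ← hpc] at hP
  obtain ⟨h1, h2, h3, h4, h5, -⟩ := hP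
  have h12 := (Reach.one (w := w) h1).trans (Reach.one (w := w) h2)
  have h13 := h12.trans (Reach.one (w := w) h3)
  have h14 := h13.trans (Reach.one (w := w) h4)
  have h15 := h14.trans (Reach.one (w := w) h5)
  refine ⟨_, hr.trans h15, ?_, ?_, ?_, ?_⟩
  · simp [Instr.exec]; omega
  · simp [Instr.exec, hmem]
  · intro r hr
    simp only [Instr.exec]
    rw [Function.update_of_ne (by omega), Function.update_of_ne (by omega),
      Function.update_of_ne (by omega), Function.update_of_ne (by omega),
      Function.update_of_ne (by omega), hreg r hr]
  · simp only [addr] at hb ⊢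
    simp [Instr.exec, Op.eval, hv', hbd, hbd', hbase]
    exact Nat.mod_eq_of_lt hb

/-- The scratch registers serve as an evaluation stack. The second operand is evaluated to register
`d + 1` and everything below is left alone, in particular the first operand in register `d`. -/
theorem evals_bin {op : Op} {d n n' v v' u : ℕ} {m : State} (h : Evals w P d n v m)
    (h' : ∀ m', m'.pc = m.pc + n → m'.mem = m.mem → (∀ r < d, m'.reg r = m.reg r) →
      Evals w P (d + 1) n' v' m')
    (hu : op.eval w v v' = u) (hP : P[m.pc + n + n']? = some (.op op d d (d + 1))) :
    Evals w P d (n + n' + 1) u m := by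
  obtain ⟨m₁, hr, hpc, hmem, hreg, hv⟩ := h
  obtain ⟨m₂, hr', hpc', hmem', hreg', hv'⟩ := h' m₁ hpc hmem hreg
  have hP' : P[m₂.pc]? = some (.op op d d (d + 1)) := by rw [hpc', hpc, hP]
  refine ⟨_, (hr.trans hr').trans (Reach.one hP'), ?_, ?_, ?_, ?_⟩
  · simp [Instr.exec]; omega
  · simp [Instr.exec, hmem, hmem']
  · intro r hr
    simp only [Instr.exec]
    rw [Function.update_of_ne (by omega), hreg' r (by omega), hreg r hr]
  · simp [Instr.exec, hv', hreg' d (by omega), hv, hu]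

theorem Ex.evals (hW : Fits w o B) (e : Ex) (d : ℕ) (hd : 100 ≤ d) (m : State)
    (hm : Rel o B σ m) (hP : At P m.pc (e.code d)) (hok : e.ok B σ) :
    Evals w P d e.cost (e.eval σ) m := by
  have hbin : ∀ (op : Op) (a b : Ex) (u : ℕ), (∀ (d : ℕ) (_ : 100 ≤ d) (m : State)
      (_ : Rel o B σ m) (_ : At P m.pc (a.code d)) (_ : a.ok B σ), Evals w P d a.cost (a.eval σ) m) →
      (∀ (d : ℕ) (_ : 100 ≤ d) (m : State)
      (_ : Rel o B σ m) (_ : At P m.pc (b.code d)) (_ : b.ok B σ), Evals w P d b.cost (b.eval σ) m) →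
      a.ok B σ → b.ok B σ → op.eval w (a.eval σ) (b.eval σ) = u →
      ∀ (d : ℕ) (_ : 100 ≤ d) (m : State) (_ : Rel o B σ m),
      At P m.pc (a.code d ++ b.code (d + 1) ++ [.op op d d (d + 1)]) →
      Evals w P d (a.cost + b.cost + 1) u m := by
    intro op a b u ha hb hoa hob hu d hd m hm hP
    simp only [At_append, List.length_append, Ex.length_code, At_cons] at hP
    refine evals_bin (ha d hd m hm hP.1.1 hoa) (fun m' h1 h2 h3 => ?_) hu ?_
    · refine hb (d + 1) (by omega) m' (hm.of_eq (fun r hr => h3 r (by omega)) h2) ?_ hob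
      rw [h1]; exact hP.1.2
    · rw [add_assoc]; exact hP.2.1
  induction e generalizing d m with
  | var x =>
    have hx := hm.reg_lt x
    rw [hW.word] at hx
    simp only [Ex.code, At_cons] at hP
    refine ⟨_, Reach.one hP.1, ?_, ?_, ?_, ?_⟩
    · simp [Instr.exec, Ex.cost]
    · simp [Instr.exec]
    · intro r hr
      simp only [Instr.exec]
      rw [Function.update_of_ne (by omega)]
    · simp [Instr.exec, Op.eval, Ex.eval, hm.reg, Nat.mod_eq_of_lt hx]
  | lit k =>
    simp only [Ex.code, At_cons] at hP
    have hx : k < B.word := hok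
    rw [hW.word] at hx
    refine ⟨_, Reach.one hP.1, ?_, ?_, ?_, ?_⟩
    · simp [Instr.exec, Ex.cost]
    · simp [Instr.exec]
    · intro r hr
      simp only [Instr.exec]
      rw [Function.update_of_ne (by omega)]
    · simp [Instr.exec, Ex.eval, Nat.mod_eq_of_lt hx]
  | add a b iha ihb =>
    refine hbin .add a b _ iha ihb hok.1 hok.2.1 ?_ d hd m hm hP
    exact Nat.mod_eq_of_lt (hW.word ▸ hok.2.2)
  | sub a b iha ihb =>
    refine hbin .sub a b _ iha ihb hok.1 hok.2.1 ?_ d hd m hm hP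
    have h1 : a.eval σ < B.word := Ex.eval_lt hm hok.1
    have h2 : b.eval σ ≤ a.eval σ := hok.2.2
    rw [hW.word] at h1
    simp only [Op.eval, Ex.eval]
    have : a.eval σ + (2 ^ w - b.eval σ) = (a.eval σ - b.eval σ) + 2 ^ w := by omega
    rw [this, Nat.add_mod_right, Nat.mod_eq_of_lt (by omega)]
  | mul a b iha ihb =>
    refine hbin .mul a b _ iha ihb hok.1 hok.2.1 ?_ d hd m hm hP
    exact Nat.mod_eq_of_lt (hW.word ▸ hok.2.2)
  | div a b iha ihb =>
    refine hbin .div a b _ iha ihb hok.1 hok.2 ?_ d hd m hm hP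
    have h1 : a.eval σ < B.word := Ex.eval_lt hm hok.1
    exact Nat.mod_eq_of_lt (lt_of_le_of_lt (Nat.div_le_self _ _) (hW.word ▸ h1))
  | mod a b iha ihb =>
    refine hbin .mod a b _ iha ihb hok.1 hok.2 ?_ d hd m hm hP
    have h1 : a.eval σ < B.word := Ex.eval_lt hm hok.1
    exact Nat.mod_eq_of_lt (lt_of_le_of_lt (Nat.mod_le _ _) (hW.word ▸ h1))
  | ld A e ih =>
    simp only [Ex.code, At_append, At_cons, Ex.length_code, List.length_append] at hP
    obtain ⟨m', hr, hpc, hmem, hreg, hv⟩ :=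
      evals_addr hW hm hok.2 hd (ih d hd m hm hP.1.1 hok.1) hP.1.2
    have hP' : P[m'.pc]? = some (.load d d) := by
      rw [hpc]; exact hP.2.1
    refine ⟨_, hr.trans (Reach.one hP'), ?_, ?_, ?_, ?_⟩
    · simp [Instr.exec, Ex.cost]; omega
    · simp [Instr.exec, hmem]
    · intro r hr
      simp only [Instr.exec]
      rw [Function.update_of_ne (by omega), hreg r hr]
    · simp only [Instr.exec, Function.update_self, hv, hmem, Ex.eval]
      exact hm.mem A _ hok.2

/-- Two expressions are evaluated to registers `100` and `101`. -/
theorem evals_two (hW : Fits w o B) {a b : Ex} {m : State} (hm : Rel o B σ m)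
    (hP : At P m.pc (a.code 100 ++ b.code 101)) (ha : a.ok B σ) (hb : b.ok B σ) :
    ∃ m', Reach w P m (a.cost + b.cost) m' ∧ m'.pc = m.pc + (a.cost + b.cost) ∧ m'.mem = m.mem ∧
      Rel o B σ m' ∧ m'.reg 100 = a.eval σ ∧ m'.reg 101 = b.eval σ := by
  simp only [At_append, Ex.length_code] at hP
  obtain ⟨m₁, hr, hpc, hmem, hreg, hv⟩ := a.evals hW 100 le_rfl m hm hP.1 ha
  have hm₁ := hm.of_eq hreg hmem
  obtain ⟨m₂, hr', hpc', hmem', hreg', hv'⟩ := b.evals hW 101 (by omega) m₁ hm₁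
    (by rw [hpc]; exact hP.2) hb
  refine ⟨m₂, hr.trans hr', by omega, by rw [hmem', hmem],
    hm₁.of_eq (fun r hr => hreg' r (by omega)) hmem', ?_, hv'⟩
  rw [hreg' _ (by omega), hv]

theorem sim_jump (hW : Fits w o B) {m : State} (hm : Rel o B σ m) {a b : Ex} (ha : a.ok B σ)
    (hb : b.ok B σ) (p : Prop) [Decidable p] (jmp : ℕ → Instr)
    (hj : ∀ (m' : State) l, m'.reg 100 = a.eval σ → m'.reg 101 = b.eval σ →
      (jmp l).exec w m' = ⟨if p then l else m'.pc + 1, m'.reg, m'.mem⟩) {l : ℕ}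
    (hP : At P m.pc (a.code 100 ++ b.code 101 ++ [jmp l])) :
    ∃ m', Reach w P m (a.cost + b.cost + 1) m' ∧ Rel o B σ m' ∧
      m'.pc = if p then l else m.pc + (a.cost + b.cost) + 1 := by
  rw [At_append] at hP
  obtain ⟨m', hr, hpc, hmem, hR, h1, h2⟩ := evals_two hW hm hP.1 ha hb
  have hP' : P[m'.pc]? = some (jmp l) := by
    have := hP.2
    simp only [At_cons, List.length_append, Ex.length_code] at this
    rw [hpc]; exact this.1
  refine ⟨_, hr.trans (Reach.one hP'), ?_, ?_⟩
  · rw [hj m' l h1 h2]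
    exact hR.of_eq (fun _ _ => rfl) rfl
  · rw [hj m' l h1 h2, hpc]

/-- Used for `≤` and `≠`: the jump leads to `l` if the opposite condition `p` holds. The double
negation matches the form in which `Cond.sim` speaks about the condition itself. -/
theorem sim_neg (hW : Fits w o B) {m : State} (hm : Rel o B σ m) {a b : Ex} (ha : a.ok B σ)
    (hb : b.ok B σ) (p : Prop) [Decidable p] (jmp : ℕ → Instr)
    (hj : ∀ (m' : State) l, m'.reg 100 = a.eval σ → m'.reg 101 = b.eval σ →
      (jmp l).exec w m' = ⟨if p then l else m'.pc + 1, m'.reg, m'.mem⟩) {l : ℕ}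
    (hP : At P m.pc (a.code 100 ++ b.code 101 ++ [jmp l])) :
    ∃ m', Reach w P m (a.cost + b.cost + 2) m' ∧ Rel o B σ m' ∧
      (¬ p → m'.pc = m.pc + (a.cost + b.cost + 1)) ∧ (¬ ¬ p → m'.pc = l) := by
  obtain ⟨m', hr, hR, hpc⟩ := sim_jump hW hm ha hb p jmp hj hP
  refine ⟨m', hr.mono (by omega), hR, fun h => ?_, fun h => ?_⟩
  · rw [hpc, if_neg h]; omega
  · rw [hpc, if_pos (not_not.1 h)]

/-- Used for `<` and `=`: a conditional jump skips the unconditional jump to `l`. -/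
theorem sim_pos (hW : Fits w o B) {m : State} (hm : Rel o B σ m) {a b : Ex} (ha : a.ok B σ)
    (hb : b.ok B σ) (p : Prop) [Decidable p] (jmp : ℕ → Instr)
    (hj : ∀ (m' : State) l, m'.reg 100 = a.eval σ → m'.reg 101 = b.eval σ →
      (jmp l).exec w m' = ⟨if p then l else m'.pc + 1, m'.reg, m'.mem⟩) {l : ℕ}
    (hP : At P m.pc (a.code 100 ++ b.code 101 ++
        [jmp (m.pc + (a.cost + b.cost + 2)), .jump l])) :
    ∃ m', Reach w P m (a.cost + b.cost + 2) m' ∧ Rel o B σ m' ∧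
      (p → m'.pc = m.pc + (a.cost + b.cost + 2)) ∧ (¬ p → m'.pc = l) := by
  rw [show ∀ i j : Instr, [i, j] = [i] ++ [j] from fun _ _ => rfl, ← List.append_assoc,
    At_append] at hP
  obtain ⟨m', hr, hR, hpc⟩ := sim_jump hW hm ha hb p jmp hj hP.1
  by_cases hp : p
  · refine ⟨m', hr.mono (by omega), hR, fun _ => ?_, fun h => absurd hp h⟩
    rw [hpc, if_pos hp]
  · rw [if_neg hp] at hpc
    have hP' : P[m'.pc]? = some (.jump l) := by
      have := hP.2
      simp only [At_cons, List.length_append, Ex.length_code, List.length_cons,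
        List.length_nil] at this
      rw [hpc, add_assoc]; exact this.1
    exact ⟨_, hr.trans (Reach.one hP'), hR.of_eq (fun _ _ => rfl) rfl, fun h => absurd h hp,
      fun _ => rfl⟩

theorem Cond.sim (hW : Fits w o B) (c : Cond) (l : ℕ) (m : State) (hm : Rel o B σ m)
    (hP : At P m.pc (c.code m.pc l)) (hok : c.ok B σ) :
    ∃ m', Reach w P m c.cost m' ∧ Rel o B σ m' ∧
      (c.eval σ → m'.pc = m.pc + c.size) ∧ (¬ c.eval σ → m'.pc = l) := by
  induction c generalizing m with
  | lt a b =>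
    exact sim_pos hW hm hok.1 hok.2 (a.eval σ < b.eval σ) (Instr.jlt 100 101)
      (by intro m' l h1 h2; simp [Instr.exec, h1, h2]) hP
  | le a b =>
    obtain ⟨m', h1, h2, h3, h4⟩ := sim_neg hW hm hok.1 hok.2 (b.eval σ < a.eval σ)
      (Instr.jlt 101 100) (by intro m' l h1 h2; simp [Instr.exec, h1, h2]) hP
    refine ⟨m', h1, h2, fun h => h3 (not_lt.2 h), fun h => h4 ?_⟩
    rw [not_not]; exact not_le.1 h
  | eq a b =>
    exact sim_pos hW hm hok.1 hok.2 (a.eval σ = b.eval σ) (Instr.jeq 100 101)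
      (by intro m' l h1 h2; simp [Instr.exec, h1, h2]) hP
  | ne a b =>
    exact sim_neg hW hm hok.1 hok.2 (a.eval σ = b.eval σ) (Instr.jeq 100 101)
      (by intro m' l h1 h2; simp [Instr.exec, h1, h2]) hP
  | and c d ihc ihd =>
    simp only [Cond.code, At_append, Cond.length_code] at hP
    obtain ⟨m₁, hr, hR, h1, h2⟩ := ihc m hm hP.1 hok.1
    by_cases hc : c.eval σ
    · obtain ⟨m₂, hr', hR', h1', h2'⟩ := ihd m₁ hR (by rw [h1 hc]; exact hP.2) (hok.2 hc)
      refine ⟨m₂, hr.trans hr', hR', fun h => ?_, fun h => h2' fun hd => h ⟨hc, hd⟩⟩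
      rw [h1' h.2, h1 hc, Cond.size, add_assoc]
    · exact ⟨m₁, hr.mono (by simp [Cond.cost]), hR, fun h => absurd h.1 hc, fun _ => h2 hc⟩

/-- Compiled commands do what they should. -/
theorem Run.sim (hW : Fits w o B) {c : Cmd} {τ : St} {k : ℕ} (h : Run B c σ τ k) (m : State)
    (hm : Rel o B σ m) (hP : At P m.pc (c.code m.pc)) :
    ∃ m', Reach w P m k m' ∧ Rel o B τ m' ∧ m'.pc = m.pc + c.size := by
  induction h generalizing m with
  | skip σ => exact ⟨m, .refl, hm, rfl⟩
  | asg σ x e hok =>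
    simp only [Cmd.code, At_append, At_cons, Ex.length_code] at hP
    obtain ⟨m', hr, hpc, hmem, hreg, hv⟩ := e.evals hW 100 le_rfl m hm hP.1 hok
    have hlt := Ex.eval_lt hm hok
    have hlt' : e.eval σ < 2 ^ w := hW.word ▸ hlt
    have hm' := hm.of_eq hreg hmem
    have hx := x.two_le_idx
    refine ⟨_, hr.trans (Reach.one (by rw [hpc]; exact hP.2.1)), ⟨?_, ?_, ?_, ?_, ?_, ?_⟩, ?_⟩
    · intro y
      by_cases hy : y = x
      · subst hy
        simp [Instr.exec, Op.eval, hv, Nat.mod_eq_of_lt hlt']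
      · simp only [Instr.exec]
        rw [Function.update_of_ne (fun h => hy (Var.idx_inj h)), hm'.reg, St.reg_setR_ne _ _ _ _ hy]
    · simp only [Instr.exec]
      rw [Function.update_of_ne (by omega), hm'.zero]
    · simp only [Instr.exec]
      rw [Function.update_of_ne (by omega), hm'.one]
    · exact hm'.mem
    · intro y
      by_cases hy : y = x
      · subst hy; simpa using hlt
      · simpa [hy] using hm.reg_lt y
    · exact hm.mem_lt
    · simp [Instr.exec, hpc, Cmd.size]; omega
  | sto σ A i e hi he hlim =>
    simp only [Cmd.code, At_append, At_cons, Ex.length_code, List.length_append] at hP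
    obtain ⟨m₁, hr, hpc, hmem, hreg, hv⟩ := e.evals hW 100 le_rfl m hm hP.1.1.1 he
    have hm₁ := hm.of_eq hreg hmem
    obtain ⟨m₂, hr', hpc', hmem', hreg', hv'⟩ := evals_addr hW hm₁ hlim (by omega)
      (i.evals hW 101 (by omega) m₁ hm₁ (by rw [hpc]; exact hP.1.1.2) hi)
      (by rw [hpc, add_assoc]; exact hP.1.2)
    have hm₂ := hm₁.of_eq (fun r hr => hreg' r (by omega)) hmem'
    have hlt := Ex.eval_lt hm he
    have hP' : P[m₂.pc]? = some (.store 101 100) := by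
      rw [hpc', hpc, add_assoc, ← add_assoc e.cost]; exact hP.2.1
    refine ⟨_, (hr.trans (hr'.trans (Reach.one hP'))).mono (by omega),
      ⟨hm₂.reg, hm₂.zero, hm₂.one, ?_, hm.reg_lt, ?_⟩, ?_⟩
    · intro C j hj
      simp only [Instr.exec, hv', hreg' 100 (by omega), hv]
      -- `raw` ends before the interleaved arrays begin. This makes `addr_inj` applicable, so
      -- writing one cell leaves the representations of all others intact.
      have hraw := hW.raw
      by_cases hC : C = A
      · subst hC
        by_cases hij : j = i.eval σ
        · subst hij; simp
        · rw [Function.update_of_ne, hm₂.mem _ _ hj, St.mem_setM_self, Function.update_of_ne hij]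
          exact fun h => hij (addr_inj (fun h => by subst h; omega) (fun h => by subst h; omega) h).2
      · rw [Function.update_of_ne, hm₂.mem _ _ hj, St.mem_setM_ne _ _ _ _ _ hC]
        exact fun h => hC (addr_inj (fun h => by subst h; omega) (fun h => by subst h; omega) h).1
    · intro C j hj
      by_cases hC : C = A
      · subst hC
        rw [St.mem_setM_self]
        by_cases hij : j = i.eval σ
        · subst hij; simpa using hlt
        · rw [Function.update_of_ne hij]; exact hm.mem_lt _ _ hj
      · rw [St.mem_setM_ne _ _ _ _ _ hC]; exact hm.mem_lt _ _ hj
    · simp [Instr.exec, hpc', hpc, Cmd.size]; omega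
  | seq h₁ h₂ ih₁ ih₂ =>
    simp only [Cmd.code, At_append, Cmd.length_code] at hP
    obtain ⟨m₁, hr, hR, hpc⟩ := ih₁ m hm hP.1
    obtain ⟨m₂, hr', hR', hpc'⟩ := ih₂ m₁ hR (by rw [hpc]; exact hP.2)
    exact ⟨m₂, hr.trans hr', hR', by rw [hpc', hpc, Cmd.size, add_assoc]⟩
  | @iteT b c d σ τ k hb ht h₁ ih =>
    simp only [Cmd.code, At_append, At_cons, Cmd.length_code, Cond.length_code,
      List.length_append] at hP
    obtain ⟨m₁, hr, hR, h1, -⟩ := b.sim hW _ m hm hP.1.1.1 hb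
    have h1 := h1 ht
    obtain ⟨m₂, hr', hR', hpc'⟩ := ih m₁ hR (by rw [h1]; exact hP.1.1.2)
    have hP' : P[m₂.pc]? = some (.jump (m.pc + (b.size + c.size + 1 + d.size))) := by
      rw [hpc', h1, add_assoc]; exact hP.1.2.1
    exact ⟨_, (hr.trans hr').trans (Reach.one hP'), hR'.of_eq (fun _ _ => rfl) rfl, rfl⟩
  | @iteF b c d σ τ k hb ht h₁ ih =>
    simp only [Cmd.code, At_append, At_cons, Cmd.length_code, Cond.length_code,
      List.length_append, List.length_cons, List.length_nil] at hP
    obtain ⟨m₁, hr, hR, -, h1⟩ := b.sim hW _ m hm hP.1.1.1 hb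
    have h1 := h1 ht
    obtain ⟨m₂, hr', hR', hpc'⟩ := ih m₁ hR (by rw [h1]; exact hP.2)
    exact ⟨_, (hr.trans hr').mono (by omega), hR', by rw [hpc', h1]; simp only [Cmd.size]; omega⟩
  | whileF hb ht =>
    simp only [Cmd.code, At_append] at hP
    obtain ⟨m₁, hr, hR, -, h1⟩ := Cond.sim hW _ _ m hm hP.1.1 hb
    exact ⟨m₁, hr, hR, h1 ht⟩
  | @whileT b c σ τ ρ k l hb ht h₁ h₂ ih₁ ih₂ =>
    -- A second copy is kept for the remaining iterations, which run the same code from the same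
    -- position after the jump back.
    have hP0 := hP
    simp only [Cmd.code, At_append, At_cons, Cmd.length_code, Cond.length_code,
      List.length_append] at hP
    obtain ⟨m₁, hr, hR, h1, -⟩ := b.sim hW _ m hm hP.1.1 hb
    have h1 := h1 ht
    obtain ⟨m₂, hr', hR', hpc'⟩ := ih₁ m₁ hR (by rw [h1]; exact hP.1.2)
    have hP' : P[m₂.pc]? = some (.jump m.pc) := by
      rw [hpc', h1, add_assoc]; exact hP.2.1
    obtain ⟨m₃, hr₃, hR₃, hpc₃⟩ := ih₂ ⟨m.pc, m₂.reg, m₂.mem⟩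
      (hR'.of_eq (fun _ _ => rfl) rfl) hP0
    exact ⟨m₃, ((hr.trans hr').trans (Reach.one hP')).trans hr₃, hR₃, hpc₃⟩

end

end WordRAM

/-! ### Row minima of Monge matrices -/

namespace WordRAM

/-- The inequality of Monge for the leading `L × L` part of `M`. -/
def Monge (L : ℕ) (M : ℕ → ℕ → ℕ) : Prop :=
  ∀ i i' j j', i ≤ i' → i' < L → j ≤ j' → j' < L → M i j + M i' j' ≤ M i j' + M i' j

section
variable {L s n c k : ℕ} {M : ℕ → ℕ → ℕ} {f h : ℕ → ℕ}

/-- This and `Monge.bwd` are the two directions of total monotonicity: a right column that is at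
least as good in one row stays so in all lower rows, and a left column that is at least as good
stays so in all upper rows. -/
theorem Monge.fwd (hM : Monge L M) {i i' j j' : ℕ} (hi : i ≤ i') (hi' : i' < L) (hj : j ≤ j')
    (hj' : j' < L) (h : M i j' ≤ M i j) : M i' j' ≤ M i' j := by
  have := hM i i' j j' hi hi' hj hj'
  omega

theorem Monge.bwd (hM : Monge L M) {i i' j j' : ℕ} (hi : i ≤ i') (hi' : i' < L) (hj : j ≤ j')
    (hj' : j' < L) (h : M i' j ≤ M i' j') : M i j ≤ M i j' := by
  have := hM i i' j j' hi hi' hj hj'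
  omega

/-- The rows that are considered with step `s`. -/
def rowOf (s q : ℕ) : ℕ := (q + 1) * s - 1

theorem rowOf_lt (hs : 0 < s) {q : ℕ} (hn : n * s ≤ L) (hq : q < n) : rowOf s q < L := by
  have : (q + 1) * s ≤ n * s := Nat.mul_le_mul_right _ hq
  have : 1 * s ≤ (q + 1) * s := Nat.mul_le_mul_right _ (by omega)
  unfold rowOf
  omega

theorem rowOf_mono {q q' : ℕ} (h : q ≤ q') : rowOf s q ≤ rowOf s q' :=
  Nat.sub_le_sub_right (Nat.mul_le_mul_right _ (by omega)) _

/-- Strictly increasing column numbers. -/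
def Incr (L k : ℕ) (f : ℕ → ℕ) : Prop := (∀ a b, a < b → b < k → f a < f b) ∧ ∀ a < k, f a < L

/-- The stack `f` of `k` columns in the reduction of the first `c` columns of `h`; the columns
may also be dominated by those in `E`. -/
structure Stack (M : ℕ → ℕ → ℕ) (L s n : ℕ) (h : ℕ → ℕ) (c : ℕ) (E : Set ℕ) (f : ℕ → ℕ) (k : ℕ) :
    Prop where
  le : k ≤ n
  incr : Incr L k f
  chain : ∀ t, t + 1 < k → M (rowOf s t) (f t) ≤ M (rowOf s t) (f (t + 1))
  dom : ∀ q < n, ∀ c' < c, (∃ t < k, M (rowOf s q) (f t) ≤ M (rowOf s q) (h c')) ∨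
    ∃ x ∈ E, M (rowOf s q) x ≤ M (rowOf s q) (h c')
  sub : ∀ t < k, ∃ c' < c, f t = h c'

theorem Stack.congr {E : Set ℕ} (H : Stack M L s n h c E f k) {g : ℕ → ℕ} (hg : ∀ t < k, g t = f t) :
    Stack M L s n h c E g k := by
  refine ⟨H.le, ⟨fun a b hab hb => ?_, fun a ha => ?_⟩, fun t ht => ?_, fun q hq c' hc' => ?_,
    fun t ht => ?_⟩
  · rw [hg a (by omega), hg b hb]; exact H.incr.1 a b hab hb
  · rw [hg a ha]; exact H.incr.2 a ha
  · rw [hg t (by omega), hg _ ht]; exact H.chain t ht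
  · refine (H.dom q hq c' hc').imp_left ?_
    rintro ⟨t, ht, h⟩
    exact ⟨t, ht, by rwa [hg t ht]⟩
  · rw [hg t ht]; exact H.sub t ht

/-- The uppermost column loses to the new column in its own row `k`, hence in all rows from there on
by `Monge.fwd`. In the rows before, it loses to its predecessor on the stack, by the chain condition
and `Monge.bwd`. So it is needed nowhere. -/
theorem Stack.pop (hM : Monge L M) (hs : 0 < s) (hn : n * s ≤ L)
    (H : Stack M L s n h c {h c} f (k + 1)) (hc : h c < L) (hh : ∀ c' < c, h c' < h c)
    (hlt : M (rowOf s k) (h c) < M (rowOf s k) (f k)) : Stack M L s n h c {h c} f k := by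
  have hfc : ∀ t < k + 1, f t < h c := fun t ht => by
    obtain ⟨c', hc', e⟩ := H.sub t ht
    rw [e]; exact hh c' hc'
  refine ⟨by have := H.le; omega, ⟨fun a b hab hb => H.incr.1 a b hab (by omega),
    fun a ha => H.incr.2 a (by omega)⟩, fun t ht => H.chain t (by omega), fun q hq c' hc' => ?_,
    fun t ht => H.sub t (by omega)⟩
  rcases H.dom q hq c' hc' with ⟨t, ht, hle⟩ | h'
  · rcases Nat.lt_succ_iff_lt_or_eq.1 ht with ht | rfl
    · exact .inl ⟨t, ht, hle⟩
    · by_cases hqt : t ≤ q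
      · exact .inr ⟨h c, rfl, (hM.fwd (rowOf_mono hqt) (rowOf_lt hs hn hq)
          (hfc t (by omega)).le hc hlt.le).trans hle⟩
      · obtain ⟨u, rfl⟩ : ∃ u, t = u + 1 := ⟨t - 1, by omega⟩
        refine .inl ⟨u, by omega, (hM.bwd (rowOf_mono (by omega : q ≤ u)) (rowOf_lt hs hn ?_)
          (H.incr.1 u (u + 1) (by omega) (by omega)).le (H.incr.2 _ (by omega))
          (H.chain u (by omega))).trans hle⟩
        have := H.le; omega
  · exact .inr h'

/-- The comparison that ended the pops is exactly the chain condition for the new uppermost column.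
Being on the stack now, the column need no longer be named as an outside dominator. -/
theorem Stack.push (H : Stack M L s n h c {h c} f k) (hc : h c < L) (hh : ∀ c' < c, h c' < h c)
    (hk : k < n) (hle : ∀ t, t + 1 = k → M (rowOf s t) (f t) ≤ M (rowOf s t) (h c)) {g : ℕ → ℕ}
    (hg : ∀ t < k, g t = f t) (hgk : g k = h c) : Stack M L s n h (c + 1) ∅ g (k + 1) := by
  have hfc : ∀ t < k, f t < h c := fun t ht => by
    obtain ⟨c', hc', e⟩ := H.sub t ht
    rw [e]; exact hh c' hc'
  have H' := H.congr hg
  refine ⟨hk, ⟨fun a b hab hb => ?_, fun a ha => ?_⟩, fun t ht => ?_, fun q hq c' hc' => .inl ?_,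
    fun t ht => ?_⟩
  · rcases Nat.lt_succ_iff_lt_or_eq.1 hb with hb | rfl
    · exact H'.incr.1 a b hab hb
    · rw [hg a hab, hgk]; exact hfc a hab
  · rcases Nat.lt_succ_iff_lt_or_eq.1 ha with ha | rfl
    · exact H'.incr.2 a ha
    · rwa [hgk]
  · by_cases ht' : t + 1 < k
    · exact H'.chain t ht'
    · obtain rfl : t + 1 = k := by omega
      rw [hg t (by omega), hgk]; exact hle t rfl
  · rcases Nat.lt_succ_iff_lt_or_eq.1 hc' with hc' | rfl
    · rcases H'.dom q hq c' hc' with ⟨t, ht, h'⟩ | ⟨x, rfl, h'⟩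
      · exact ⟨t, by omega, h'⟩
      · exact ⟨k, by omega, by rwa [hgk]⟩
    · exact ⟨k, by omega, by rw [hgk]⟩
  · rcases Nat.lt_succ_iff_lt_or_eq.1 ht with ht | rfl
    · obtain ⟨c', hc', e⟩ := H'.sub t ht
      exact ⟨c', by omega, e⟩
    · exact ⟨c, by omega, hgk⟩

/-- On a full stack the uppermost column belongs to the last row. It wins against the new column
there, and hence in all rows by `Monge.bwd`. -/
theorem Stack.drop (hM : Monge L M) (hs : 0 < s) (hn : n * s ≤ L)
    (H : Stack M L s n h c {h c} f k) (hc : h c < L)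
    (hh : ∀ c' < c, h c' < h c) (hk : ¬ k < n) (h0 : 0 < n)
    (hle : ∀ t, t + 1 = k → M (rowOf s t) (f t) ≤ M (rowOf s t) (h c)) :
    Stack M L s n h (c + 1) ∅ f k := by
  have hkn : k = n := by have := H.le; omega
  obtain ⟨u, rfl⟩ : ∃ u, k = u + 1 := ⟨k - 1, by omega⟩
  have hfc : f u ≤ h c := by
    obtain ⟨c', hc', e⟩ := H.sub u (by omega)
    rw [e]; exact (hh c' hc').le
  have key : ∀ q < n, M (rowOf s q) (f u) ≤ M (rowOf s q) (h c) := fun q hq =>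
    hM.bwd (rowOf_mono (by omega)) (rowOf_lt hs hn (by omega)) hfc hc (hle u rfl)
  refine ⟨H.le, H.incr, H.chain, fun q hq c' hc' => .inl ?_, fun t ht => ?_⟩
  · rcases Nat.lt_succ_iff_lt_or_eq.1 hc' with hc' | rfl
    · rcases H.dom q hq c' hc' with ⟨t, ht, h'⟩ | ⟨x, rfl, h'⟩
      · exact ⟨t, by omega, h'⟩
      · exact ⟨u, by omega, (key q hq).trans h'⟩
    · exact ⟨u, by omega, key q hq⟩
  · obtain ⟨c', hc', e⟩ := H.sub t ht
    exact ⟨c', by omega, e⟩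

end

/-! ### Reduction of the columns in linear time -/

/-- The entry of the matrix in row `i` and column `j`. -/
def entry (i j : Ex) : Ex :=
  .ld .dt ((Var.db : Ex) + Var.a * j) + .ld .gx ((Var.nn : Ex) + i - j)

/-- The matrix whose row minima are wanted. -/
def St.mat (σ : St) (i j : ℕ) : ℕ :=
  σ.mem .dt (σ.reg .db + σ.reg .a * j) + σ.mem .gx (σ.reg .nn + i - j)

/-- The entries of the leading `L × L` part of the matrix can be computed. -/
structure MatOk (B : Bound) (σ : St) (L : ℕ) : Prop where
  le : L ≤ σ.reg .nn
  dt : ∀ j < L, σ.reg .db + σ.reg .a * j < B.lim .dt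
  gx : σ.reg .nn + L ≤ B.lim .gx
  dtw : B.lim .dt ≤ B.word
  gxw : B.lim .gx ≤ B.word
  sum : ∀ i < L, ∀ j < L, σ.mat i j < B.word

/-- Nothing that determines the matrix has changed. -/
structure SameMat (σ τ : St) : Prop where
  dt : τ.mem .dt = σ.mem .dt
  gx : τ.mem .gx = σ.mem .gx
  db : τ.reg .db = σ.reg .db
  a : τ.reg .a = σ.reg .a
  nn : τ.reg .nn = σ.reg .nn

theorem SameMat.mat_eq {σ τ : St} (h : SameMat σ τ) : τ.mat = σ.mat := by
  funext i j
  simp [St.mat, h.dt, h.gx, h.db, h.a, h.nn]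

@[simp] theorem eval_entry {σ : St} {i j : Ex} :
    (entry i j).eval σ = σ.mat (i.eval σ) (j.eval σ) := rfl

@[simp] theorem cost_entry {i j : Ex} : (entry i j).cost = i.cost + 2 * j.cost + 20 := by
  simp [entry]; ring

theorem entry_ok {B : Bound} {σ τ : St} {L : ℕ} (h : MatOk B σ L) (hs : SameMat σ τ) {i j : Ex}
    (hi : i.ok B τ) (hj : j.ok B τ) (hiL : i.eval τ < L) (hjL : j.eval τ < L) :
    (entry i j).ok B τ := by
  have h1 := h.dt _ hjL
  have h2 := h.gx
  have h3 := h.le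
  have h4 := h.sum _ hiL _ hjL
  have h5 := h.dtw
  have h6 := h.gxw
  rw [← hs.mat_eq] at h4
  simp only [entry, Ex.ok_add, Ex.ok_ld, Ex.ok_var, Ex.ok_mul, Ex.ok_sub, hi, hj, Ex.eval_var,
    Ex.eval_add, Ex.eval_mul, Ex.eval_sub, Ex.eval_ld, hs.nn, hs.db, hs.a, true_and]
  simp only [St.mat, hs.nn, hs.db, hs.a] at h4
  refine ⟨⟨⟨?_, ?_⟩, h1⟩, ⟨⟨?_, ?_⟩, ?_⟩, h4⟩ <;> omega

/-- Reduce the list of columns at `src` to a list at `dst` that has at most one column for each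
row. -/
def reduceCmd : Cmd :=
  Var.k ::= 0 ;;
  .for .c 0 .len (
    Var.col ::= .ld .lst ((Var.src : Ex) + Var.c) ;;
    .while (.and (.lt 0 Var.k) (.lt (entry ((Var.k : Ex) * Var.stp - 1) Var.col)
        (entry ((Var.k : Ex) * Var.stp - 1) (.ld .lst ((Var.dst : Ex) + Var.k - 1)))))
      (Var.k ::= (Var.k : Ex) - 1) ;;
    .ite (.lt Var.k Var.nr) (.sto .lst ((Var.dst : Ex) + Var.k) Var.col ;;
      Var.k ::= (Var.k : Ex) + 1) .skip)

set_option maxHeartbeats 1000000 in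
theorem reduceCmd_spec {B : Bound} {σ : St} {L len s n k₀ : ℕ} (hm : MatOk B σ L)
    (hM : Monge L σ.mat) (hlen : σ.reg .len = len) (hs : σ.reg .stp = s) (hn : σ.reg .nr = n)
    (hd : σ.reg .src + L = σ.reg .dst) (hs0 : 0 < s) (hn0 : 0 < n) (hns : n * s ≤ L)
    (hlL : len ≤ L) (hlim : σ.reg .dst + L < B.lim .lst) (hw : B.lim .lst ≤ B.word)
    (hinc : Incr L len fun c => σ.mem .lst (σ.reg .src + c)) :
    WP B reduceCmd σ k₀ fun τ l =>
      Stack σ.mat L s n (fun c => σ.mem .lst (σ.reg .src + c)) len ∅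
        (fun t => τ.mem .lst (σ.reg .dst + t)) (τ.reg .k) ∧
      (∀ x < σ.reg .dst, τ.mem .lst x = σ.mem .lst x) ∧ l ≤ k₀ + 300 * len + 300 := by
  set h := fun c => σ.mem .lst (σ.reg .src + c) with hh
  have hsL : s ≤ L := (Nat.le_mul_of_pos_left s hn0).trans hns
  have hunL : n ≤ L := (Nat.le_mul_of_pos_right n hs0).trans hns
  rw [reduceCmd, WP_seq, WP_asg]
  refine ⟨by simp; omega, ?_⟩
  refine (WP_for (x := .c) (y := .len) (fun c τ l =>
    Stack σ.mat L s n h c ∅ (fun t => τ.mem .lst (σ.reg .dst + t)) (τ.reg .k) ∧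
    -- The height of the stack is the potential of an amortised analysis. Each column is pushed at
    -- most once, and a push pays for the later pop.
    (∀ x < σ.reg .dst, τ.mem .lst x = σ.mem .lst x) ∧ l + 100 * τ.reg .k ≤ k₀ + 300 * c + 100)
    (by decide) rfl rfl (by simp; omega) (by simp; omega) (by omega) (by simp) ?_ ?_).mono ?_
  · simp only [Ex.eval_lit, Ex.cost_lit]
    refine ⟨⟨by simp, ⟨by simp, by simp⟩, by simp, by simp, by simp⟩, by simp, by simp⟩
  · rintro c τ l - hc hF hxc ⟨hS, hlow, hl⟩
    have hc : c < len := by simpa [hlen] using hc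
    have e1 : τ.reg .src = σ.reg .src := (hF.reg _ rfl).trans (by simp)
    have e2 : τ.reg .dst = σ.reg .dst := (hF.reg _ rfl).trans (by simp)
    have e3 : τ.reg .stp = s := (hF.reg _ rfl).trans (by simp [hs])
    have e4 : τ.reg .nr = n := (hF.reg _ rfl).trans (by simp [hn])
    have hsame : SameMat σ τ := ⟨hF.mem _ rfl, hF.mem _ rfl, (hF.reg _ rfl).trans (by simp),
      (hF.reg _ rfl).trans (by simp), (hF.reg _ rfl).trans (by simp)⟩
    have hcol : τ.mem .lst (σ.reg .src + c) = h c := hlow _ (by omega)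
    have hcL := hinc.2 c hc
    have hcc : ∀ c' < c, h c' < h c := fun c' hc' => hinc.1 c' c hc' hc
    rw [WP_seq, WP_asg]
    refine ⟨by simp [e1, hxc]; omega, ?_⟩
    set τ₁ := τ.setR .col (Ex.eval τ (.ld .lst ((Var.src : Ex) + Var.c))) with hτ₁
    have f1 : τ₁.reg .col = h c := by simp [τ₁, e1, hxc, hcol]
    rw [WP_seq]
    -- During the pops the current column already counts as a dominator, although it is not on the
    -- stack yet.
    refine (WP_while (σ := τ₁) (fun ρ l => Stack σ.mat L s n h c {h c}
      (fun t => τ.mem .lst (σ.reg .dst + t)) (ρ.reg .k) ∧ l + 100 * ρ.reg .k ≤ k₀ + 300 * c + 120)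
      (fun ρ => ρ.reg .k) ⟨⟨hS.le, ?_, hS.chain, ?_, hS.sub⟩, ?_⟩ ?_).mono ?_
    · simpa [τ₁] using hS.incr
    · intro q hq c' hc'
      exact .inl ((hS.dom q hq c' hc').resolve_right (by simp))
    · simp [τ₁] at hl ⊢; omega
    · rintro ρ l' hF' ⟨hS', hl'⟩
      have g1 : ρ.reg .col = h c := (hF'.reg _ rfl).trans f1
      have g2 : ρ.reg .stp = s := (hF'.reg _ rfl).trans (by simp [τ₁, e3])
      have g3 : ρ.reg .dst = σ.reg .dst := (hF'.reg _ rfl).trans (by simp [τ₁, e2])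
      have g4 : ρ.mem .lst = τ.mem .lst := hF'.mem _ rfl
      have hsame' : SameMat σ ρ := ⟨(hF'.mem _ rfl).trans hsame.dt, (hF'.mem _ rfl).trans hsame.gx,
        (hF'.reg _ rfl).trans hsame.db,
        (hF'.reg _ rfl).trans hsame.a, (hF'.reg _ rfl).trans hsame.nn⟩
      have hkn := hS'.le
      refine ⟨?_, ?_⟩
      · simp only [Cond.ok_and, Cond.ok_lt, Cond.eval_lt, Ex.eval_lit, Ex.eval_var]
        refine ⟨⟨by simp; omega, trivial⟩, fun hk => ?_⟩
        obtain ⟨u, hu⟩ : ∃ u, ρ.reg .k = u + 1 := ⟨ρ.reg .k - 1, by omega⟩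
        have hks : (u + 1) * s ≤ L := (Nat.mul_le_mul_right s (by omega)).trans hns
        have hks' : s ≤ (u + 1) * s := Nat.le_mul_of_pos_left _ (by omega)
        have hLw : L < B.word := by omega
        have hrow : ((Var.k : Ex) * Var.stp - 1).ok B ρ := by
          simp [g2, hu]; omega
        have hrow' : ((Var.k : Ex) * Var.stp - 1).eval ρ < L := by
          simp [g2, hu]; omega
        have htop : ρ.mem .lst (σ.reg .dst + u) < L := by
          rw [g4]; exact hS'.incr.2 u (by omega)
        refine ⟨entry_ok hm hsame' hrow (by simp) hrow' (by simpa [g1] using hcL),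
          entry_ok hm hsame' hrow (by simp [g3, hu]; omega) hrow' ?_⟩
        simp [g3, hu]
        exact htop
      · simp only [Cond.eval_and, Cond.eval_lt, Ex.eval_lit, Ex.eval_var, eval_entry]
        rintro ⟨hk, hlt⟩
        obtain ⟨u, hu⟩ : ∃ u, ρ.reg .k = u + 1 := ⟨ρ.reg .k - 1, by omega⟩
        rw [hsame'.mat_eq] at hlt
        have hlt : σ.mat (rowOf s u) (h c) < σ.mat (rowOf s u) (τ.mem .lst (σ.reg .dst + u)) := by
          simpa [g1, g2, g3, g4, hu, rowOf, ← Nat.add_assoc] using hlt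
        rw [hu] at hS'
        rw [WP_asg]
        refine ⟨by simp [hu]; omega, ⟨?_, ?_⟩, ?_⟩
        · simpa [hu] using hS'.pop hM hs0 hns hcL hcc hlt
        · simp [hu] at hl' ⊢; omega
        · simp [hu]
    · rintro ρ l' ⟨l'', rfl, ⟨hS', hl'⟩, hb, hF'⟩
      have g1 : ρ.reg .col = h c := (hF'.reg _ rfl).trans f1
      have g2 : ρ.reg .stp = s := (hF'.reg _ rfl).trans (by simp [τ₁, e3])
      have g3 : ρ.reg .dst = σ.reg .dst := (hF'.reg _ rfl).trans (by simp [τ₁, e2])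
      have g4 : ρ.mem .lst = τ.mem .lst := hF'.mem _ rfl
      have g5 : ρ.reg .nr = n := (hF'.reg _ rfl).trans (by simp [τ₁, e4])
      have hsame' : SameMat σ ρ := ⟨(hF'.mem _ rfl).trans hsame.dt, (hF'.mem _ rfl).trans hsame.gx,
        (hF'.reg _ rfl).trans hsame.db,
        (hF'.reg _ rfl).trans hsame.a, (hF'.reg _ rfl).trans hsame.nn⟩
      have hkn := hS'.le
      have hle : ∀ t, t + 1 = ρ.reg .k → σ.mat (rowOf s t) (τ.mem .lst (σ.reg .dst + t)) ≤
          σ.mat (rowOf s t) (h c) := by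
        intro t ht
        -- On a nonempty stack the loop can only have ended because the comparison in its condition
        -- failed.
        by_contra hcon
        refine hb ⟨by simp [← ht], ?_⟩
        simp only [Cond.eval_lt, eval_entry, hsame'.mat_eq]
        simpa [g1, g2, g3, g4, ← ht, rowOf, ← Nat.add_assoc] using hcon
      rw [WP_ite]
      refine ⟨by simp, fun hk => ?_, fun hk => ?_⟩
      · have hk : ρ.reg .k < n := by simpa [g5] using hk
        simp only [WP_seq, WP_sto, WP_asg]
        refine ⟨by simp [g3]; omega, by simp, by simp [g3]; omega, by simp; omega, ?_, ?_, ?_⟩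
        · have := hS'.push hcL hcc hk hle (g := fun t => Function.update (ρ.mem .lst)
            (σ.reg .dst + ρ.reg .k) (h c) (σ.reg .dst + t))
            (fun t ht => by simp [g4, Nat.ne_of_lt ht]) (by simp)
          simpa [g1, g3] using this
        · intro x hx
          simp [g3]
          rw [Function.update_of_ne (by omega), g4, hlow x hx]
        · simp at hl' ⊢; omega
      · have hk : ¬ ρ.reg .k < n := by simpa [g5] using hk
        simp only [WP_skip]
        refine ⟨?_, ?_, ?_⟩
        · simpa [g4] using hS'.drop hM hs0 hns hcL hcc hk hn0 hle
        · simpa [g4] using hlow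
        · simp at hl' ⊢; omega
  · rintro τ l ⟨l', rfl, ⟨hS, hlow, hl⟩, -, -⟩
    simp only [St.reg_setR_ne _ _ _ _ (show Var.len ≠ .k by decide), hlen] at hS hl
    exact ⟨hS, hlow, by omega⟩

end WordRAM

/-! ### Minima of the even-numbered rows between those of the odd-numbered rows -/

namespace WordRAM

section
variable {L s n len : ℕ} {M : ℕ → ℕ → ℕ}

/-- `x` is a column among the first `len` columns of `g` in which row `r` has its minimum. -/
def RowMin (M : ℕ → ℕ → ℕ) (L len : ℕ) (g : ℕ → ℕ) (r x : ℕ) : Prop :=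
  (∃ t < len, g t = x) ∧ ∀ c < L, M r x ≤ M r c

/-- The minima `f` of the rows in `S` are in columns that increase weakly. -/
structure RowMins (M : ℕ → ℕ → ℕ) (L s len : ℕ) (g : ℕ → ℕ) (S : ℕ → Prop) (f : ℕ → ℕ) :
    Prop where
  min : ∀ q, S q → RowMin M L len g (rowOf s q) (f (rowOf s q))
  mono : ∀ q q', S q → S q' → q ≤ q' → f (rowOf s q) ≤ f (rowOf s q')

theorem rowOf_inj (hs : 0 < s) {q q' : ℕ} (h : rowOf s q = rowOf s q') : q = q' := by
  have h1 : 1 * s ≤ (q + 1) * s := Nat.mul_le_mul_right _ (by omega)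
  have h2 : 1 * s ≤ (q' + 1) * s := Nat.mul_le_mul_right _ (by omega)
  unfold rowOf at h
  have h3 : (q + 1) * s = (q' + 1) * s := by omega
  have := Nat.eq_of_mul_eq_mul_right hs h3
  omega

theorem rowOf_succ (hs : 0 < s) (q : ℕ) : rowOf s q + s = rowOf s (q + 1) := by
  have h1 : 1 * s ≤ (q + 1) * s := Nat.mul_le_mul_right _ (by omega)
  unfold rowOf
  rw [Nat.add_mul (q + 1) 1 s]
  omega

/-- This is the reason for counting rows from `s - 1`: doubling the step keeps precisely the rows
with odd numbers, so the recursion to the odd rows only changes `s`. -/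
theorem rowOf_double (q : ℕ) : rowOf (s + s) q = rowOf s (2 * q + 1) := by
  unfold rowOf
  congr 1; ring

theorem Incr.inj {k : ℕ} {f : ℕ → ℕ} (h : Incr L k f) {a b : ℕ} (ha : a < k) (hb : b < k)
    (e : f a = f b) : a = b := by
  rcases lt_trichotomy a b with h' | h' | h'
  · have := h.1 a b h' hb; omega
  · exact h'
  · have := h.1 b a h' ha; omega

theorem Incr.le_iff {k : ℕ} {f : ℕ → ℕ} (h : Incr L k f) {a b : ℕ} (ha : a < k) (hb : b < k) :
    f a ≤ f b ↔ a ≤ b := by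
  constructor
  · intro hab
    by_contra hlt
    have := h.1 b a (by omega) ha; omega
  · intro hab
    rcases hab.lt_or_eq with hab | rfl
    · exact (h.1 a b hab hb).le
    · rfl

/-- The rows that have been treated before row number `q`, when only the rows with an odd number
were treated at first. -/
def Treated (n q q' : ℕ) : Prop := q' < n ∧ (q' < q ∨ q' % 2 = 1)

/-- The state of the search for the row minima before row number `q`, at position `p`. -/
structure Search (M : ℕ → ℕ → ℕ) (L s n len : ℕ) (g : ℕ → ℕ) (q : ℕ) (f : ℕ → ℕ) (p : ℕ) : Prop
    where
  mins : RowMins M L s len g (Treated n q) f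
  pos : q < n → p < len
  left : q < n → ∀ t < p, M (rowOf s q) (g p) ≤ M (rowOf s q) (g t)
  below : q < n → ∀ q', Treated n q q' → q' < q → f (rowOf s q') ≤ g p
  above : q < n → ∀ q', Treated n q q' → q ≤ q' → g p ≤ f (rowOf s q')

/-- Row `q` attains its minimum between position `p`, which belongs to the preceding odd row, and
position `T`, which belongs to the next odd row or is the end of the list. Columns before `p` lose
by the invariant. Columns behind `T` lose in row `q + 1`, hence in row `q` by `Monge.bwd`. So
scanning from `p` to `T` suffices, and the next scan can start at `T`. -/
theorem Search.next (hM : Monge L M) {g f f' : ℕ → ℕ} {q p T : ℕ} (hs : 0 < s) (hn : n * s ≤ L)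
    (hg : Incr L len g) (hdom : ∀ q < n, ∀ c < L, ∃ t < len, M (rowOf s q) (g t) ≤ M (rowOf s q) c)
    (H : Search M L s n len g q f p) (hq : q < n) (hq2 : q % 2 = 0) (hpT : p ≤ T) (hT : T < len)
    (hT1 : q + 1 < n → g T = f (rowOf s (q + 1))) (hT2 : ¬ q + 1 < n → T + 1 = len)
    {b : ℕ} (hpb : p ≤ b) (hbT : b ≤ T)
    (hb : ∀ t ≤ T, p ≤ t → M (rowOf s q) (g b) ≤ M (rowOf s q) (g t))
    (hf : ∀ q', q' ≠ q → f' (rowOf s q') = f (rowOf s q')) (hfq : f' (rowOf s q) = g b) :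
    Search M L s n len g (q + 2) f' T := by
  have hbl : b < len := by omega
  have hmin : ∀ c < L, M (rowOf s q) (g b) ≤ M (rowOf s q) c := by
    intro c hc
    obtain ⟨t, ht, h⟩ := hdom q hq c hc
    refine le_trans ?_ h
    by_cases htp : t < p
    · exact (hb p hpT le_rfl).trans (H.left hq t htp)
    · by_cases htT : t ≤ T
      · exact hb t htT (by omega)
      · have hq1 : q + 1 < n := by by_contra h; have := hT2 h; omega
        have hq1' : Treated n q (q + 1) := ⟨hq1, .inr (by omega)⟩
        refine (hb T le_rfl hpT).trans
          (hM.bwd (rowOf_mono (Nat.le_succ q)) (rowOf_lt hs hn hq1) (hg.1 T t (by omega) ht).le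
            (hg.2 t ht) ?_)
        rw [hT1 hq1]
        exact (H.mins.min _ hq1').2 _ (hg.2 t ht)
  have htr : ∀ q', Treated n (q + 2) q' → q' = q ∨ Treated n q q' ∧ q' ≠ q := by
    intro q' h
    by_cases e : q' = q
    · exact .inl e
    · exact .inr ⟨⟨h.1, by have := h.2; omega⟩, e⟩
  have hge : ∀ q', Treated n q q' → q < q' → g T ≤ f (rowOf s q') := by
    intro q' h hlt
    have hq1 : q + 1 < n := by have := h.1; omega
    rw [hT1 hq1]
    exact H.mins.mono _ _ ⟨hq1, .inr (by omega)⟩ h (by omega)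
  refine ⟨⟨?_, ?_⟩, fun _ => hT, ?_, ?_, ?_⟩
  · intro q' h
    rcases htr q' h with rfl | ⟨h', hne⟩
    · rw [hfq]; exact ⟨⟨b, hbl, rfl⟩, hmin⟩
    · rw [hf _ hne]; exact H.mins.min q' h'
  · intro q₁ q₂ h₁ h₂ h12
    rcases htr q₁ h₁ with rfl | ⟨h₁', hne₁⟩ <;> rcases htr q₂ h₂ with rfl | ⟨h₂', hne₂⟩
    · rfl
    · rw [hfq, hf _ hne₂]
      exact ((hg.le_iff hbl hT).2 hbT).trans (hge q₂ h₂' (by omega))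
    · rw [hfq, hf _ hne₁]
      exact (H.below hq q₁ h₁' (by omega)).trans ((hg.le_iff (by omega) hbl).2 hpb)
    · rw [hf _ hne₁, hf _ hne₂]; exact H.mins.mono _ _ h₁' h₂' h12
  -- The column at `T` is optimal in row `q + 1`, so the columns before it do not beat it there, nor
  -- in row `q + 2` by `Monge.fwd`.
  · intro hq' t ht
    have hq1' : Treated n q (q + 1) := ⟨by omega, .inr (by omega)⟩
    refine hM.fwd (rowOf_mono (Nat.le_succ (q + 1))) (rowOf_lt hs hn hq') (hg.1 t T ht hT).le
      (hg.2 T hT) ?_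
    rw [hT1 (by omega)]
    exact (H.mins.min _ hq1').2 _ (hg.2 t (by omega))
  · intro hq' q' h hlt
    have hq1' : Treated n q (q + 1) := ⟨by omega, .inr (by omega)⟩
    rcases htr q' h with rfl | ⟨h', hne⟩
    · rw [hfq]; exact (hg.le_iff hbl hT).2 hbT
    · rw [hf _ hne, hT1 (by omega)]
      exact H.mins.mono _ _ h' hq1' (by omega)
  · intro hq' q' h hle
    rcases htr q' h with rfl | ⟨h', hne⟩
    · omega
    · rw [hf _ hne]; exact hge q' h' (by omega)

end

/-- Move `pp` to the position of column `tgt`, and find the best column on the way. -/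
def scanCmd : Cmd :=
  .while (.ne (.ld .lst ((Var.src : Ex) + Var.pp)) Var.tgt) (
    Var.pp ::= (Var.pp : Ex) + 1 ;;
    Var.col ::= .ld .lst ((Var.src : Ex) + Var.pp) ;;
    .ite (.lt (entry Var.row Var.col) (entry Var.row Var.best)) (Var.best ::= Var.col) .skip)

/-- The loop recognises its end by the column and not by the position. As the list increases
strictly, column `tgt` occurs only at position `T`. -/
theorem scanCmd_spec {B : Bound} {σ : St} {L len k₀ T : ℕ} (hm : MatOk B σ L)
    (hg : Incr L len fun c => σ.mem .lst (σ.reg .src + c)) (hT : T < len)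
    (htgt : σ.mem .lst (σ.reg .src + T) = σ.reg .tgt) (hp : σ.reg .pp ≤ T)
    (hbest : σ.reg .best = σ.mem .lst (σ.reg .src + σ.reg .pp)) (hrow : σ.reg .row < L)
    (hlim : σ.reg .src + len < B.lim .lst) (hw : B.lim .lst ≤ B.word) :
    WP B scanCmd σ k₀ fun τ l => τ.reg .pp = T ∧
      (∃ b, σ.reg .pp ≤ b ∧ b ≤ T ∧ τ.reg .best = σ.mem .lst (σ.reg .src + b) ∧
        ∀ t ≤ T, σ.reg .pp ≤ t → σ.mat (σ.reg .row) (τ.reg .best) ≤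
          σ.mat (σ.reg .row) (σ.mem .lst (σ.reg .src + t))) ∧
      l ≤ k₀ + 120 * (T - σ.reg .pp) + 40 := by
  set g := fun c => σ.mem .lst (σ.reg .src + c) with hgdef
  refine (WP_while (fun τ l => σ.reg .pp ≤ τ.reg .pp ∧ τ.reg .pp ≤ T ∧
      (∃ b, σ.reg .pp ≤ b ∧ b ≤ τ.reg .pp ∧ τ.reg .best = g b ∧
        ∀ t ≤ τ.reg .pp, σ.reg .pp ≤ t → σ.mat (σ.reg .row) (τ.reg .best) ≤
          σ.mat (σ.reg .row) (g t)) ∧ l ≤ k₀ + 120 * (τ.reg .pp - σ.reg .pp))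
    (fun τ => T - τ.reg .pp) ⟨le_rfl, hp, ⟨_, le_rfl, le_rfl, hbest, ?_⟩, by omega⟩ ?_).mono ?_
  · intro t h1 h2
    rw [show t = σ.reg .pp by omega, hbest]
  · rintro τ l hF ⟨hp1, hp2, ⟨b, hb1, hb2, hb3, hb4⟩, hl⟩
    have e1 : τ.reg .src = σ.reg .src := hF.reg _ rfl
    have e2 : τ.reg .tgt = σ.reg .tgt := hF.reg _ rfl
    have e3 : τ.reg .row = σ.reg .row := hF.reg _ rfl
    have e4 : τ.mem .lst = σ.mem .lst := hF.mem _ rfl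
    have hsame : SameMat σ τ := ⟨hF.mem _ rfl, hF.mem _ rfl, hF.reg _ rfl, hF.reg _ rfl,
      hF.reg _ rfl⟩
    refine ⟨by simp [e1]; omega, fun hne => ?_⟩
    have hne : τ.reg .pp ≠ T := by
      intro h
      apply hne
      simp [e1, e4, h, htgt, e2]
    have hgp := hg.2 (τ.reg .pp + 1) (by omega)
    simp only [hgdef] at hgp
    set v := σ.mem .lst (σ.reg .src + (τ.reg .pp + 1)) with hv
    simp only [WP_seq, WP_asg, WP_ite]
    have hs2 : ∀ x y z, x ≠ Var.db → x ≠ .a → x ≠ .nn → y ≠ Var.db → y ≠ .a → y ≠ .nn →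
        SameMat σ ((τ.setR x z).setR y v) := by
      intro x y z h1 h2 h3 h4 h5 h6
      exact ⟨hsame.dt, hsame.gx, by simp [h1.symm, h4.symm, hsame.db],
        by simp [h2.symm, h5.symm, hsame.a], by simp [h3.symm, h6.symm, hsame.nn]⟩
    have hs3 := hs2 .pp .col (τ.reg .pp + 1) (by decide) (by decide) (by decide) (by decide)
      (by decide) (by decide)
    refine ⟨by simp; omega, by simp [e1]; omega, ?_⟩
    simp only [Ex.eval_add, Ex.eval_var, Ex.eval_lit, Ex.eval_ld, e1, St.mem_setR, e4,
      St.reg_setR_self, St.reg_setR_ne _ _ _ _ (show Var.src ≠ .pp by decide), ← hv]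
    have hbl : τ.reg .best < L := by rw [hb3]; exact hg.2 b (by omega)
    refine ⟨⟨entry_ok hm hs3 (by simp) (by simp) (by simpa [e3] using hrow) (by simpa using hgp),
      entry_ok hm hs3 (by simp) (by simp) (by simpa [e3] using hrow) (by simpa using hbl)⟩, ?_, ?_⟩
    · intro hlt
      simp [hs3.mat_eq, e3] at hlt
      refine ⟨by simp, ⟨by simp; omega, by simp; omega, ⟨τ.reg .pp + 1, by omega, by simp,
        by simp [g, v], ?_⟩, ?_⟩, ?_⟩
      · intro t h1 h2
        simp at h1 ⊢
        by_cases ht : t ≤ τ.reg .pp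
        · exact hlt.le.trans (hb4 t ht h2)
        · rw [show t = τ.reg .pp + 1 by omega]
      · simp; omega
      · simp; omega
    · intro hlt
      simp [hs3.mat_eq, e3] at hlt
      simp only [WP_skip]
      refine ⟨⟨by simp; omega, by simp; omega, ⟨b, by omega, by simp; omega,
        by simpa using hb3, ?_⟩, ?_⟩, ?_⟩
      · intro t h1 h2
        simp at h1 ⊢
        by_cases ht : t ≤ τ.reg .pp
        · exact hb4 t ht h2
        · rw [show t = τ.reg .pp + 1 by omega]
          exact hlt
      · simp; omega
      · simp; omega
  · rintro τ l ⟨l', rfl, ⟨hp1, hp2, ⟨b, hb1, hb2, hb3, hb4⟩, hl⟩, hne, hF⟩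
    have e1 : τ.reg .src = σ.reg .src := hF.reg _ rfl
    have e2 : τ.reg .tgt = σ.reg .tgt := hF.reg _ rfl
    have e4 : τ.mem .lst = σ.mem .lst := hF.mem _ rfl
    have hpT : τ.reg .pp = T := by
      refine hg.inj (by omega) hT ?_
      simpa [e1, e2, e4, ← htgt] using hne
    rw [hpT] at hb2 hb4 hl
    exact ⟨hpT, ⟨b, hb1, hb2, hb3, hb4⟩, by simp; omega⟩

/-- Find the minima of the rows with an even number. -/
def levelCmd : Cmd :=
  Var.pp ::= 0 ;; Var.q ::= 0 ;;
  .while (.lt Var.q Var.nr) (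
    Var.row ::= ((Var.q : Ex) + 1) * Var.stp - 1 ;;
    .ite (.lt ((Var.q : Ex) + 1) Var.nr) (Var.tgt ::= .ld .ag ((Var.row : Ex) + Var.stp))
      (Var.tgt ::= .ld .lst ((Var.src : Ex) + Var.len - 1)) ;;
    Var.best ::= .ld .lst ((Var.src : Ex) + Var.pp) ;;
    scanCmd ;;
    .sto .ag Var.row Var.best ;;
    Var.q ::= (Var.q : Ex) + 2)

set_option maxHeartbeats 1000000 in
theorem levelCmd_spec {B : Bound} {σ : St} {L len s n k₀ : ℕ} (hm : MatOk B σ L)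
    (hM : Monge L σ.mat) (hlen : σ.reg .len = len) (hs : σ.reg .stp = s) (hn : σ.reg .nr = n)
    (hs0 : 0 < s) (hn0 : 0 < n) (hns : n * s ≤ L)
    (hg : Incr L len fun c => σ.mem .lst (σ.reg .src + c))
    (hdom : ∀ q < n, ∀ c < L, ∃ t < len, σ.mat (rowOf s q) (σ.mem .lst (σ.reg .src + t)) ≤
      σ.mat (rowOf s q) c)
    (hmin : RowMins σ.mat L s len (fun c => σ.mem .lst (σ.reg .src + c)) (Treated n 0) (σ.mem .ag))
    (hlim : σ.reg .src + len < B.lim .lst) (hw : B.lim .lst ≤ B.word)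
    (hag : 2 * L + 2 < B.lim .ag) (hw' : B.lim .ag ≤ B.word) :
    WP B levelCmd σ k₀ fun τ l =>
      RowMins σ.mat L s len (fun c => σ.mem .lst (σ.reg .src + c)) (· < n) (τ.mem .ag) ∧
      l ≤ k₀ + 200 * len + 200 * n + 200 := by
  set g := fun c => σ.mem .lst (σ.reg .src + c) with hgdef
  have hsL : s ≤ L := (Nat.le_mul_of_pos_left s hn0).trans hns
  have hunL : n ≤ L := (Nat.le_mul_of_pos_right n hs0).trans hns
  have hlen0 : 0 < len := by
    obtain ⟨t, ht, -⟩ := hdom 0 hn0 0 (by omega)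
    omega
  simp only [levelCmd, WP_seq, WP_asg]
  refine ⟨by simp; omega, by simp; omega, ?_⟩
  -- `q` advances in steps of two and may end at `n + 1`. The position `pp` never moves back, so the
  -- scans for all rows together are linear in `len + n`.
  refine (WP_while (fun τ l => (∃ u, τ.reg .q = 2 * u) ∧ τ.reg .q ≤ n + 1 ∧ τ.reg .pp < len ∧
    Search σ.mat L s n len g (τ.reg .q) (τ.mem .ag) (τ.reg .pp) ∧
      l ≤ k₀ + 4 + 100 * τ.reg .q + 120 * τ.reg .pp)
    (fun τ => n + 2 - τ.reg .q) ⟨⟨0, by simp⟩, by simp, by simpa using hlen0, ⟨by simpa using hmin,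
      fun _ => by simpa using hlen0,
      by simp, by simp, ?_⟩, by simp⟩ ?_).mono ?_
  · intro _ q' hq' _
    obtain ⟨t, ht, e⟩ := (hmin.min q' (by simpa using hq')).1
    simp only [St.mem_setR]
    rw [← e, hg.le_iff (by simpa using hlen0) ht]
    simp
  · rintro τ l hF ⟨⟨u, hu⟩, hqn1, hpl, hS, hl⟩
    have e1 : τ.reg .src = σ.reg .src := (hF.reg _ rfl).trans (by simp)
    have e3 : τ.reg .stp = s := (hF.reg _ rfl).trans (by simp [hs])
    have e4 : τ.reg .nr = n := (hF.reg _ rfl).trans (by simp [hn])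
    have e5 : τ.mem .lst = σ.mem .lst := hF.mem _ rfl
    have e6 : τ.reg .len = len := (hF.reg _ rfl).trans (by simp [hlen])
    have hsame : SameMat σ τ := ⟨hF.mem _ rfl, hF.mem _ rfl, (hF.reg _ rfl).trans (by simp),
      (hF.reg _ rfl).trans (by simp), (hF.reg _ rfl).trans (by simp)⟩
    refine ⟨by simp, fun hq => ?_⟩
    have hq : τ.reg .q < n := by simpa [e4] using hq
    set q := τ.reg .q with hqdef
    have hqs : (q + 1) * s ≤ L := (Nat.mul_le_mul_right s (by omega)).trans hns
    have hqs' : s ≤ (q + 1) * s := Nat.le_mul_of_pos_left _ (by omega)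
    have hrL := rowOf_lt hs0 hns hq
    set p := τ.reg .pp with hpdef
    -- the target
    obtain ⟨T, hT, hpT, hT1, hT2⟩ : ∃ T < len, p ≤ T ∧
        (q + 1 < n → g T = τ.mem .ag (rowOf s (q + 1))) ∧ (¬ q + 1 < n → T + 1 = len) := by
      by_cases hq1 : q + 1 < n
      · have htr : Treated n q (q + 1) := ⟨hq1, .inr (by omega)⟩
        obtain ⟨T, hT, e⟩ := (hS.mins.min _ htr).1
        refine ⟨T, hT, ?_, fun _ => e, fun h => absurd hq1 h⟩
        rw [← hg.le_iff hpl hT, e]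
        exact hS.above hq _ htr (by omega)
      · exact ⟨len - 1, by omega, by omega, fun h => absurd h hq1, fun _ => by omega⟩
    have main : ∀ l₀ ≤ l + 45, WP B (Var.best ::= .ld .lst ((Var.src : Ex) + Var.pp) ;; scanCmd ;;
        .sto .ag Var.row Var.best ;; Var.q ::= (Var.q : Ex) + 2)
        ((τ.setR .row (rowOf s q)).setR .tgt (g T)) l₀ fun τ l =>
        ((∃ u, τ.reg .q = 2 * u) ∧ τ.reg .q ≤ n + 1 ∧ τ.reg .pp < len ∧
        Search σ.mat L s n len g (τ.reg .q) (τ.mem .ag) (τ.reg .pp) ∧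
        l ≤ k₀ + 4 + 100 * τ.reg .q + 120 * τ.reg .pp) ∧ n + 2 - τ.reg .q < n + 2 - q := by
      intro l₀ hl₀
      simp only [WP_seq, WP_asg]
      refine ⟨by simp [e1, ← hpdef]; omega, ?_⟩
      set σ' := ((τ.setR .row (rowOf s q)).setR .tgt (g T)).setR .best
        (Ex.eval ((τ.setR .row (rowOf s q)).setR .tgt (g T))
          (.ld .lst ((Var.src : Ex) + Var.pp))) with hσ'
      have hm' : SameMat σ σ' := ⟨by simp [σ', hsame.dt], by simp [σ', hsame.gx],
        by simp [σ', hsame.db], by simp [σ', hsame.a], by simp [σ', hsame.nn]⟩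
      have hmo : MatOk B σ' L := ⟨by rw [hm'.nn]; exact hm.le, by rw [hm'.db, hm'.a]; exact hm.dt,
        by rw [hm'.nn]; exact hm.gx, hm.dtw, hm.gxw, by rw [hm'.mat_eq]; exact hm.sum⟩
      have c1 : σ'.reg .src = σ.reg .src := by simp [σ', e1]
      have c2 : σ'.mem .lst = σ.mem .lst := by simp [σ', e5]
      have c3 : σ'.reg .pp = p := by simp [σ', p]
      have c4 : σ'.reg .row = rowOf s q := by simp [σ']
      have c5 : σ'.mem .ag = τ.mem .ag := by simp [σ']
      have c6 : σ'.reg .q = q := by simp [σ', q]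
      refine (scanCmd_spec (σ := σ') (len := len) (T := T) hmo (by rw [c1, c2]; exact hg) hT
        (by rw [c1, c2]; simp [σ', g]) (by rw [c3]; exact hpT)
        (by rw [c1, c2, c3]; simp [σ', e1, e5, p]) (by rw [c4]; exact hrL)
        (by rw [c1]; exact hlim) hw).frame.mono ?_
      rintro ρ l₁ ⟨⟨hpp, ⟨b, hb1, hb2, hb3, hb4⟩, hl₁⟩, hFr⟩
      rw [c1, c2, c3] at *
      rw [c4] at hb4
      have d1 : ρ.reg .row = rowOf s q := (hFr.reg _ rfl).trans c4
      have d2 : ρ.reg .q = q := (hFr.reg _ rfl).trans c6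
      have d3 : ρ.mem .ag = τ.mem .ag := (hFr.mem _ rfl).trans c5
      simp only [WP_sto]
      refine ⟨by simp, by simp, by simp [d1]; omega, by simp [d2]; omega, ⟨⟨u + 1, ?_⟩, ?_, ?_, ?_,
        ?_⟩, ?_⟩
      · simp [d2]; omega
      · simp [d2]; omega
      · simpa [hpp] using hT
      · have := hS.next (f' := Function.update (ρ.mem .ag) (rowOf s q) (ρ.reg .best)) (b := b)
          hM hs0 hns hg hdom hq (by omega) hpT hT hT1 hT2 hb1 hb2 ?_ ?_ ?_
        · simpa [d1, d2, hpp] using this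
        · intro t ht ht'
          have := hb4 t ht ht'
          rw [hb3, hm'.mat_eq] at this
          exact this
        · intro q' hq'
          rw [Function.update_of_ne (fun h => hq' (rowOf_inj hs0 h)), d3]
        · simp [hb3, g]
      · simp [d2, hpp] at hl₁ ⊢; omega
      · simp [d2]; omega
    rw [WP_seq, WP_asg]
    refine ⟨by simp [e3, ← hqdef]; omega, ?_⟩
    have hev : Ex.eval τ (((Var.q : Ex) + 1) * Var.stp - 1) = rowOf s q := by
      simp [e3, rowOf, q]
    rw [hev, WP_seq, WP_ite]
    refine ⟨by simp [← hqdef]; omega, fun hq1 => ?_, fun hq1 => ?_⟩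
    · have hq1 : q + 1 < n := by simpa [e4, q] using hq1
      rw [WP_asg]
      have hr1 := rowOf_lt hs0 hns hq1
      have hr2 := rowOf_succ hs0 q
      refine ⟨by simp [e3]; omega, ?_⟩
      have := main (l + ((Cond.lt (Var.q : Ex) Var.nr).cost + 1) +
        ((((Var.q : Ex) + 1) * Var.stp - 1).cost + 1) +
        ((Cond.lt ((Var.q : Ex) + 1) Var.nr).cost + 1) +
        ((Ex.ld .ag ((Var.row : Ex) + Var.stp)).cost + 1)) (by simp)
      simpa [e3, hr2, hT1 hq1, WP_seq] using this
    · have hq1 : ¬ q + 1 < n := by simpa [e4, q] using hq1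
      rw [WP_asg]
      have hr1 := hT2 hq1
      refine ⟨by simp [e1, e6]; omega, ?_⟩
      have := main (l + ((Cond.lt (Var.q : Ex) Var.nr).cost + 1) +
        ((((Var.q : Ex) + 1) * Var.stp - 1).cost + 1) +
        ((Cond.lt ((Var.q : Ex) + 1) Var.nr).cost + 1) +
        ((Ex.ld .lst ((Var.src : Ex) + Var.len - 1)).cost + 1)) (by simp)
      have hh : σ.reg .src + len - 1 = σ.reg .src + T := by omega
      simpa [e1, e5, e6, hh, g, WP_seq] using this
  · rintro τ l ⟨l', rfl, ⟨⟨u, hu⟩, hqn1, hpl, hS, hl⟩, hb, hF⟩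
    have e4 : τ.reg .nr = n := (hF.reg _ rfl).trans (by simp [hn])
    have hq : n ≤ τ.reg .q := by simpa [e4] using hb
    refine ⟨⟨fun q' hq' => hS.mins.min q' ⟨hq', .inl (by omega)⟩, fun q₁ q₂ h₁ h₂ h =>
      hS.mins.mono q₁ q₂ ⟨h₁, .inl (by omega)⟩ ⟨h₂, .inl (by omega)⟩ h⟩, ?_⟩
    simp; omega

end WordRAM

/-! ### The recursion over row steps 1, 2, 4, … as two loops -/

namespace WordRAM

/-- The `e`-th list of columns. -/
def St.lev (σ : St) (L e c : ℕ) : ℕ := σ.mem .lst (e * L + c)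

/-- The list `g` of `m` columns contains those in which the rows with step `s` have their minima. -/
structure Dominating (M : ℕ → ℕ → ℕ) (L s m : ℕ) (g : ℕ → ℕ) : Prop where
  incr : Incr L m g
  dom : ∀ q < L / s, ∀ c < L, ∃ t < m, M (rowOf s q) (g t) ≤ M (rowOf s q) c

/-- The lists of columns up to number `e` are as they should. -/
structure Levels (M : ℕ → ℕ → ℕ) (L e : ℕ) (lev : ℕ → ℕ → ℕ) (len : ℕ → ℕ) : Prop where
  zero : len 0 ≤ L
  dom : ∀ i ≤ e, Dominating M L (2 ^ i) (len i) (lev i)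
  le : ∀ i < e, len (i + 1) ≤ L / 2 ^ i
  dom' : ∀ i < e, Dominating M L (2 ^ i) (len (i + 1)) (lev (i + 1))
  sub : ∀ i < e, ∀ t < len (i + 1), ∃ c < len i, lev (i + 1) t = lev i c

section
variable {L e : ℕ} {M : ℕ → ℕ → ℕ} {lev : ℕ → ℕ → ℕ} {len : ℕ → ℕ}

theorem Dominating.double {s m : ℕ} {g : ℕ → ℕ} (h : Dominating M L s m g) :
    Dominating M L (s + s) m g := by
  refine ⟨h.incr, fun q hq c hc => ?_⟩
  rw [rowOf_double]
  refine h.dom _ ?_ c hc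
  have : L / (s + s) = L / s / 2 := by rw [← mul_two, Nat.div_div_eq_div_mul]
  omega

theorem Levels.len_le (h : Levels M L e lev len) {i : ℕ} (hi : i ≤ e) : len i ≤ L := by
  cases i with
  | zero => exact h.zero
  | succ i => exact (h.le i hi).trans (Nat.div_le_self _ _)

/-- After a reduction there are no more columns than rows of the previous step, which is at most
twice the present number of rows plus one. So the work of each level is proportional to its number
of rows, and the sum over the levels is geometric. -/
theorem Levels.len_le' (h : Levels M L e lev len) (he : 2 ^ e ≤ L) :
    len e ≤ 3 * (L / 2 ^ e) := by
  cases e with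
  | zero => have := h.zero; simp; omega
  | succ i =>
    have h1 := h.le i (by omega)
    have h2 : L / 2 ^ (i + 1) = L / 2 ^ i / 2 := by rw [pow_succ, Nat.div_div_eq_div_mul]
    have h3 : 0 < L / 2 ^ (i + 1) := Nat.div_pos he (by positivity)
    omega

theorem Levels.succ (h : Levels M L e lev len) {lev' : ℕ → ℕ → ℕ} {len' : ℕ → ℕ}
    (hlev : ∀ i ≤ e, ∀ c < L, lev' i c = lev i c) (hlen : ∀ i ≤ e, len' i = len i)
    (H : Stack M L (2 ^ e) (L / 2 ^ e) (lev e) (len e) ∅ (lev' (e + 1)) (len' (e + 1))) :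
    Levels M L (e + 1) lev' len' := by
  have hdom' : Dominating M L (2 ^ e) (len' (e + 1)) (lev' (e + 1)) := by
    refine ⟨H.incr, fun q hq c hc => ?_⟩
    obtain ⟨t, ht, hle⟩ := (h.dom e le_rfl).dom q hq c hc
    obtain ⟨t', ht', hle'⟩ := (H.dom q hq t ht).resolve_right (by simp)
    exact ⟨t', ht', hle'.trans hle⟩
  have hcongr : ∀ s m, m ≤ L → ∀ i ≤ e, Dominating M L s m (lev i) → Dominating M L s m (lev' i) := by
    intro s m hm i hi hd
    refine ⟨⟨fun a b hab hb => ?_, fun a ha => ?_⟩, fun q hq c hc => ?_⟩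
    · rw [hlev i hi a (by omega), hlev i hi b (by omega)]; exact hd.incr.1 a b hab hb
    · rw [hlev i hi a (by omega)]; exact hd.incr.2 a ha
    · obtain ⟨t, ht, hle⟩ := hd.dom q hq c hc
      exact ⟨t, ht, by rwa [hlev i hi t (by omega)]⟩
  refine ⟨by rw [hlen 0 (by omega)]; exact h.zero, fun i hi => ?_, fun i hi => ?_, fun i hi => ?_,
    fun i hi t ht => ?_⟩
  · rcases Nat.lt_succ_iff_lt_or_eq.1 (Nat.lt_succ_iff.2 hi) with hi | rfl
    · rw [hlen i (by omega)]
      exact hcongr _ _ (h.len_le (by omega)) i (by omega) (h.dom i (by omega))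
    · rw [pow_succ, mul_two]
      exact hdom'.double
  · rcases Nat.lt_succ_iff_lt_or_eq.1 hi with hi | rfl
    · rw [hlen _ (by omega)]; exact h.le i hi
    · exact H.le
  · rcases Nat.lt_succ_iff_lt_or_eq.1 hi with hi | rfl
    · rw [hlen _ (by omega)]
      exact hcongr _ _ (h.len_le (by omega)) _ (by omega) (h.dom' i (by omega))
    · exact hdom'
  · rcases Nat.lt_succ_iff_lt_or_eq.1 hi with hi | rfl
    · rw [hlen _ (by omega)] at ht
      have := h.len_le (i := i + 1) (by omega)
      obtain ⟨c, hc, e'⟩ := h.sub i hi t ht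
      have := h.len_le (i := i) (by omega)
      refine ⟨c, by rwa [hlen _ (by omega)], ?_⟩
      rw [hlev _ (by omega) t (by omega), hlev _ (by omega) c (by omega), e']
    · obtain ⟨c, hc, e'⟩ := H.sub t ht
      have := h.len_le (i := i) (by omega)
      refine ⟨c, by rwa [hlen _ (by omega)], ?_⟩
      rw [e', hlev _ (by omega) c (by omega)]

end

/-- Compute the lists of columns. -/
def downCmd : Cmd :=
  Var.lev ::= 0 ;; Var.src ::= 0 ;; Var.stp ::= 1 ;;
  .for .c 0 .ll (.sto .lst Var.c Var.c) ;;
  .sto .ln 0 Var.ll ;;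
  .while (.le Var.stp Var.ll) (
    Var.nr ::= (Var.ll : Ex) / Var.stp ;;
    Var.dst ::= (Var.src : Ex) + Var.ll ;;
    Var.len ::= .ld .ln Var.lev ;;
    reduceCmd ;;
    Var.lev ::= (Var.lev : Ex) + 1 ;;
    .sto .ln Var.lev Var.k ;;
    Var.src ::= Var.dst ;;
    Var.stp ::= (Var.stp : Ex) + Var.stp)

set_option maxHeartbeats 1000000 in
theorem downCmd_spec {B : Bound} {σ : St} {L k₀ : ℕ} (hm : MatOk B σ L)
    (hM : Monge L σ.mat) (hL : σ.reg .ll = L) (hL0 : 0 < L)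
    (hlim : (L + 2) * L + 2 < B.lim .lst) (hw : B.lim .lst ≤ B.word)
    (hln : L + 2 < B.lim .ln) (hw' : B.lim .ln ≤ B.word) :
    WP B downCmd σ k₀ fun τ l => ∃ e, τ.reg .lev = e ∧ τ.reg .src = e * L ∧ τ.reg .stp = 2 ^ e ∧
      e ≤ L ∧ L < 2 ^ e ∧ (∀ d < e, 2 ^ d ≤ L) ∧ Levels σ.mat L e (τ.lev L) (τ.mem .ln) ∧ l ≤ k₀ + 3000 * L + 1000 := by
  -- List number `e` is stored from cell `e * L` on. The crude bound `e ≤ L` suffices for the room,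
  -- since cells that are never touched cost no time.
  have hLL : L * L < (L + 2) * L := by nlinarith
  have hLL2 : (L + 2) * L = L * L + 2 * L := by ring
  have hL1 : L ≤ L * L := Nat.le_mul_of_pos_left L hL0
  simp only [downCmd, WP_seq, WP_asg]
  refine ⟨by simp; omega, by simp; omega, by simp; omega, ?_⟩
  refine (WP_for' (x := .c) (y := .ll) (fun c τ => ∀ c' < c, τ.mem .lst c' = c') 20 (by decide)
    rfl rfl (by simp; omega) (by simp [hL]; omega) (by omega) (by simp) (by simp) ?_).mono ?_
  · rintro c τ - hc hF hxc hI
    simp [hL] at hc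
    simp only [WP_sto]
    refine ⟨by simp, by simp, by simp [hxc]; omega, ?_, by simp⟩
    intro c' hc'
    by_cases h : c' = c
    · subst h; simp [hxc]
    · simp [hxc, h, hI c' (by omega)]
  rintro τ₀ l₀ ⟨hI, -, hF₀, hl₀⟩
  simp [hL] at hI hl₀
  have e0 : τ₀.reg .ll = L := (hF₀.reg _ rfl).trans (by simp [hL])
  have e1 : τ₀.reg .lev = 0 := (hF₀.reg _ rfl).trans (by simp)
  have e2 : τ₀.reg .src = 0 := (hF₀.reg _ rfl).trans (by simp)
  have e3 : τ₀.reg .stp = 1 := (hF₀.reg _ rfl).trans (by simp)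
  have hsame₀ : SameMat σ τ₀ := ⟨hF₀.mem _ rfl, hF₀.mem _ rfl, (hF₀.reg _ rfl).trans (by simp),
      (hF₀.reg _ rfl).trans (by simp), (hF₀.reg _ rfl).trans (by simp)⟩
  rw [WP_sto]
  refine ⟨by simp; omega, by simp, by simp; omega, ?_⟩
  refine (WP_while (fun τ l => ∃ e, τ.reg .lev = e ∧ τ.reg .src = e * L ∧ τ.reg .stp = 2 ^ e ∧
      e ≤ L ∧ (∀ d < e, 2 ^ d ≤ L) ∧ Levels σ.mat L e (τ.lev L) (τ.mem .ln) ∧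
      -- The term `L / 2 ^ e` at least halves in each iteration, and the decrease pays for the
      -- level: this sums the geometric series without writing it down.
      l + 2800 * (L / 2 ^ e) ≤ k₀ + 2900 * L + 100)
    (fun τ => L + 1 - τ.reg .stp) ⟨0, by simpa using e1, by simpa using e2, by simpa using e3,
      by omega, by simp, ?_, ?_⟩ ?_).mono ?_
  · have hlev : ∀ c < L, (τ₀.setM .ln 0 (τ₀.reg .ll)).lev L 0 c = c := by
      intro c hc
      simp [St.lev, hI c hc]
    refine ⟨by simp [e0], fun i hi => ?_, by simp, by simp, by simp⟩
    obtain rfl : i = 0 := by omega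
    have hl : (τ₀.setM .ln 0 (τ₀.reg .ll)).mem .ln 0 = L := by simp [e0]
    simp only [Ex.eval_lit, Ex.eval_var]
    rw [hl]
    refine ⟨⟨fun a b hab hb => ?_, fun a ha => ?_⟩, fun q hq c hc => ⟨c, hc, ?_⟩⟩
    · rw [hlev a (by omega), hlev b hb]; exact hab
    · rw [hlev a ha]; exact ha
    · rw [hlev c hc]
  · simp at hl₀ ⊢; omega
  · rintro τ l hF ⟨e, he1, he2, he3, heL, hpow, hLev, hl⟩
    have f0 : τ.reg .ll = L := (hF.reg _ rfl).trans (by simp [e0])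
    have hsame : SameMat σ τ := ⟨(hF.mem _ rfl).trans (by simp [hsame₀.dt]),
      (hF.mem _ rfl).trans (by simp [hsame₀.gx]), (hF.reg _ rfl).trans (by simp [hsame₀.db]),
      (hF.reg _ rfl).trans (by simp [hsame₀.a]), (hF.reg _ rfl).trans (by simp [hsame₀.nn])⟩
    refine ⟨by simp, fun hle => ?_⟩
    have hle : 2 ^ e ≤ L := by simpa [he3, f0] using hle
    have he : e < L := lt_of_lt_of_le Nat.lt_two_pow_self hle
    have hn0 : 0 < L / 2 ^ e := Nat.div_pos hle (by positivity)
    have hlen := hLev.len_le (i := e) le_rfl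
    have hlen' := hLev.len_le' hle
    have heL2 : (e + 2) * L ≤ (L + 2) * L := Nat.mul_le_mul_right _ (by omega)
    have heL1 : (e + 2) * L = e * L + L + L := by ring
    simp only [WP_seq, WP_asg]
    refine ⟨by simp, by simp [he2, f0]; omega, by simp [he1]; omega, ?_⟩
    set σ' := ((τ.setR .nr (Ex.eval τ ((Var.ll : Ex) / Var.stp))).setR .dst _).setR .len _ with hσ'
    have c1 : σ'.reg .nr = L / 2 ^ e := by simp [σ', f0, he3]
    have c2 : σ'.reg .dst = e * L + L := by simp [σ', f0, he2]
    have c3 : σ'.reg .len = τ.mem .ln e := by simp [σ', he1]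
    have c4 : σ'.reg .src = e * L := by simp [σ', he2]
    have c5 : σ'.mem = τ.mem := by simp [σ']
    have c6 : σ'.reg .stp = 2 ^ e := by simp [σ', he3]
    have c7 : σ'.reg .lev = e := by simp [σ', he1]
    have hm' : SameMat σ σ' := ⟨by simp [σ', hsame.dt], by simp [σ', hsame.gx],
        by simp [σ', hsame.db], by simp [σ', hsame.a], by simp [σ', hsame.nn]⟩
    have hmo : MatOk B σ' L := ⟨by rw [hm'.nn]; exact hm.le, by rw [hm'.db, hm'.a]; exact hm.dt,
        by rw [hm'.nn]; exact hm.gx, hm.dtw, hm.gxw, by rw [hm'.mat_eq]; exact hm.sum⟩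
    refine (reduceCmd_spec (σ := σ') hmo (by rw [hm'.mat_eq]; exact hM) c3 c6 c1
      (by rw [c2, c4]) (by positivity) hn0 (Nat.div_mul_le_self _ _) hlen (by rw [c2]; omega) hw
      (by rw [c4, c5]; exact (hLev.dom e le_rfl).incr)).frame.mono ?_
    rintro ρ l₁ ⟨⟨hS, hlow, hl₁⟩, hFr⟩
    rw [hm'.mat_eq, c2, c4, c5] at hS
    rw [c2, c5] at hlow
    have d1 : ρ.reg .lev = e := (hFr.reg _ rfl).trans c7
    have d2 : ρ.reg .dst = e * L + L := (hFr.reg _ rfl).trans c2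
    have d3 : ρ.reg .stp = 2 ^ e := (hFr.reg _ rfl).trans c6
    have d4 : ρ.mem .ln = τ.mem .ln := (hFr.mem _ rfl).trans (by rw [c5])
    simp only [WP_sto]
    refine ⟨by simp [d1]; omega, by simp, by simp, by simp [d1]; omega, by simp, ?_⟩
    refine ⟨by simp [d3]; omega, ⟨e + 1, by simp [d1], ?_, ?_, by omega, ?_, ?_, ?_⟩, ?_⟩
    · simp [d2]; ring
    · simp [d3]; ring
    · intro d hd
      rcases Nat.lt_succ_iff_lt_or_eq.1 hd with hd | rfl
      · exact hpow d hd
      · exact hle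
    · refine hLev.succ ?_ ?_ ?_
      · intro i hi c hc
        have : (i + 1) * L ≤ (e + 1) * L := Nat.mul_le_mul_right _ (by omega)
        have h2 : (i + 1) * L = i * L + L := by ring
        have h3 : (e + 1) * L = e * L + L := by ring
        have := hlow (i * L + c) (by omega)
        simpa [St.lev] using this
      · intro i hi
        simp [d1, d4]
        rw [Function.update_of_ne (by omega)]
      · have h3 : (e + 1) * L = e * L + L := by ring
        have : ∀ (ρ' : St), ρ'.mem .lst = ρ.mem .lst → ρ'.mem .ln (e + 1) = ρ.reg .k →
          Stack σ.mat L (2 ^ e) (L / 2 ^ e) (τ.lev L e) (τ.mem .ln e) ∅ (ρ'.lev L (e + 1))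
            (ρ'.mem .ln (e + 1)) := by
          intro ρ' h1 h2
          rw [h2]
          refine hS.congr ?_
          intro t _
          simp [St.lev, h1, h3]
        refine this _ (by simp) (by simp [d1])
    · have h2 : L / 2 ^ (e + 1) = L / 2 ^ e / 2 := by rw [pow_succ, Nat.div_div_eq_div_mul]
      simp [] at hl₁ ⊢; omega
    · have : 0 < 2 ^ e := by positivity
      simp [d3, he3]; omega
  · rintro τ l ⟨l', rfl, ⟨e, he1, he2, he3, heL, hpow, hLev, hl⟩, hb, hF⟩
    have f0 : τ.reg .ll = L := (hF.reg _ rfl).trans (by simp [e0])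
    refine ⟨e, he1, he2, he3, heL, ?_, hpow, hLev, by simp; omega⟩
    simpa [f0, he3] using hb

/-- Compute the row minima from the lists of columns. -/
def upCmd : Cmd :=
  .while (.lt 0 Var.lev) (
    Var.stp ::= (Var.stp : Ex) / 2 ;;
    Var.nr ::= (Var.ll : Ex) / Var.stp ;;
    Var.len ::= .ld .ln Var.lev ;;
    levelCmd ;;
    Var.src ::= (Var.src : Ex) - Var.ll ;;
    Var.lev ::= (Var.lev : Ex) - 1)

/-- Find the row minima. -/
def minimaCmd : Cmd := downCmd ;; upCmd

set_option maxHeartbeats 1000000 in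
theorem minimaCmd_spec {B : Bound} {σ : St} {L k₀ : ℕ} (hm : MatOk B σ L)
    (hM : Monge L σ.mat) (hL : σ.reg .ll = L) (hL0 : 0 < L)
    (hlim : (L + 2) * L + 2 < B.lim .lst) (hw : B.lim .lst ≤ B.word)
    (hln : L + 2 < B.lim .ln) (hw' : B.lim .ln ≤ B.word)
    (hag : 2 * L + 2 < B.lim .ag) (hw'' : B.lim .ag ≤ B.word) :
    WP B minimaCmd σ k₀ fun τ l => (∀ i < L, τ.mem .ag i < L ∧
      ∀ j < L, σ.mat i (τ.mem .ag i) ≤ σ.mat i j) ∧ l ≤ k₀ + 10000 * L + 2000 := by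
  rw [minimaCmd, WP_seq]
  refine (downCmd_spec hm hM hL hL0 hlim hw hln hw').frame.mono ?_
  rintro τ₀ l₀ ⟨⟨e₀, h1, h2, h3, heL, hL2, hpow, hLev, hl₀⟩, hF₀⟩
  have e0 : τ₀.reg .ll = L := (hF₀.reg _ rfl).trans hL
  have hsame₀ : SameMat σ τ₀ := ⟨hF₀.mem _ rfl, hF₀.mem _ rfl, hF₀.reg _ rfl, hF₀.reg _ rfl,
    hF₀.reg _ rfl⟩
  refine (WP_while (fun τ l => ∃ e, e ≤ e₀ ∧ τ.reg .lev = e ∧ τ.reg .src = e * L ∧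
      τ.reg .stp = 2 ^ e ∧
      RowMins σ.mat L (2 ^ e) (τ₀.mem .ln e) (τ₀.lev L e) (· < L / 2 ^ e) (τ.mem .ag) ∧
      l ≤ k₀ + 3000 * L + 1000 + 3000 * (L / 2 ^ e))
    (fun τ => τ.reg .lev) ⟨e₀, le_rfl, h1, h2, h3, ?_, by omega⟩ ?_).mono ?_
  -- On the coarsest level the step exceeds `L`, so there are no rows and nothing is to be known.
  · rw [Nat.div_eq_of_lt hL2]
    exact ⟨by simp, by simp⟩
  · rintro τ l hF ⟨e, he, he1, he2, he3, hR, hl⟩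
    have f0 : τ.reg .ll = L := (hF.reg _ rfl).trans e0
    have f1 : τ.mem .lst = τ₀.mem .lst := hF.mem _ rfl
    have f2 : τ.mem .ln = τ₀.mem .ln := hF.mem _ rfl
    have hsame : SameMat σ τ := ⟨(hF.mem _ rfl).trans hsame₀.dt, (hF.mem _ rfl).trans hsame₀.gx,
      (hF.reg _ rfl).trans hsame₀.db, (hF.reg _ rfl).trans hsame₀.a, (hF.reg _ rfl).trans hsame₀.nn⟩
    refine ⟨by simp; omega, fun hpos => ?_⟩
    have hpos : 0 < e := by simpa [he1] using hpos
    obtain ⟨d, rfl⟩ : ∃ d, e = d + 1 := ⟨e - 1, by omega⟩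
    have hd := hLev.dom' d (by omega)
    have hdL := hLev.len_le (i := d + 1) (by omega)
    have hLd := hLev.le d (by omega)
    have hdle : 2 ^ d ≤ L := hpow d (by omega)
    have hn0 : 0 < L / 2 ^ d := Nat.div_pos hdle (by positivity)
    have h22 : L / 2 ^ (d + 1) = L / 2 ^ d / 2 := by rw [pow_succ, Nat.div_div_eq_div_mul]
    have hdiv : 2 ^ (d + 1) / 2 = 2 ^ d := by rw [pow_succ]; omega
    have heL2 : (d + 2) * L ≤ (L + 2) * L := Nat.mul_le_mul_right _ (by omega)
    have heL1 : (d + 2) * L = (d + 1) * L + L := by ring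
    simp only [WP_seq, WP_asg]
    refine ⟨by simp; omega, by simp, by simp [he1]; omega, ?_⟩
    set σ' := ((τ.setR .stp (Ex.eval τ ((Var.stp : Ex) / 2))).setR .nr _).setR .len _ with hσ'
    have c1 : σ'.reg .nr = L / 2 ^ d := by simp [σ', f0, he3, hdiv]
    have c3 : σ'.reg .len = τ₀.mem .ln (d + 1) := by simp [σ', he1, f2]
    have c4 : σ'.reg .src = (d + 1) * L := by simp [σ', he2]
    have c5 : σ'.mem = τ.mem := by simp [σ']
    have c6 : σ'.reg .stp = 2 ^ d := by simp [σ', he3, hdiv]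
    have c7 : σ'.reg .lev = d + 1 := by simp [σ', he1]
    have c8 : σ'.reg .ll = L := by simp [σ', f0]
    have hm' : SameMat σ σ' := ⟨by simp [σ', hsame.dt], by simp [σ', hsame.gx],
        by simp [σ', hsame.db], by simp [σ', hsame.a], by simp [σ', hsame.nn]⟩
    have hmo : MatOk B σ' L := ⟨by rw [hm'.nn]; exact hm.le, by rw [hm'.db, hm'.a]; exact hm.dt,
        by rw [hm'.nn]; exact hm.gx, hm.dtw, hm.gxw, by rw [hm'.mat_eq]; exact hm.sum⟩
    refine (levelCmd_spec (σ := σ') (len := τ₀.mem .ln (d + 1)) hmo (by rw [hm'.mat_eq]; exact hM)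
      c3 c6 c1 (by positivity) hn0 (Nat.div_mul_le_self _ _) (by rw [c4, c5, f1]; exact hd.incr)
      (by rw [c4, c5, f1, hm'.mat_eq]; exact hd.dom) ?_ (by rw [c4]; omega) hw hag hw'').frame.mono ?_
    -- The rows solved on the coarser level are the odd-numbered rows of the present one.
    · have hodd : ∀ q, Treated (L / 2 ^ d) 0 q → ∃ u, q = 2 * u + 1 ∧ u < L / 2 ^ (d + 1) := by
        intro q hq
        have h1 := hq.1
        have h2 : q % 2 = 1 := by have := hq.2; omega
        exact ⟨q / 2, by omega, by omega⟩
      have hdbl : ∀ u, rowOf (2 ^ d) (2 * u + 1) = rowOf (2 ^ (d + 1)) u := by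
        intro u; rw [pow_succ, mul_two, rowOf_double]
      rw [c4, c5, f1, hm'.mat_eq]
      refine ⟨fun q hq => ?_, fun q q' hq hq' hqq => ?_⟩
      · obtain ⟨u, rfl, hu⟩ := hodd q hq
        rw [hdbl]
        exact hR.min u hu
      · obtain ⟨u, rfl, hu⟩ := hodd q hq
        obtain ⟨u', rfl, hu'⟩ := hodd q' hq'
        rw [hdbl, hdbl]
        exact hR.mono u u' hu hu' (by omega)
    · rintro ρ l₁ ⟨⟨hR', hl₁⟩, hFr⟩
      rw [c4, c5, f1, hm'.mat_eq] at hR'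
      have d1 : ρ.reg .lev = d + 1 := (hFr.reg _ rfl).trans c7
      have d2 : ρ.reg .src = (d + 1) * L := (hFr.reg _ rfl).trans c4
      have d3 : ρ.reg .stp = 2 ^ d := (hFr.reg _ rfl).trans c6
      have d4 : ρ.reg .ll = L := (hFr.reg _ rfl).trans c8
      have hexp : (d + 1) * L = d * L + L := by ring
      refine ⟨by simp [d2, d4, hexp], by simp [d1]; omega, ⟨d, by omega, by simp [d1], ?_,
        by simp [d3], ⟨fun q hq => ?_, hR'.mono⟩, ?_⟩, ?_⟩
      · simp [d2, d4, hexp]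
      -- The minima were found in the reduced list `d + 1`. Its columns also occur in list `d`, in
      -- which the next level expects them.
      · obtain ⟨⟨t, ht, e'⟩, hmin⟩ := hR'.min q hq
        obtain ⟨c, hc, e''⟩ := hLev.sub d (by omega) t ht
        exact ⟨⟨c, hc, e''.symm.trans e'⟩, hmin⟩
      · simp at hl₁ ⊢; omega
      · simp [d1, he1]
  · rintro τ l ⟨l', rfl, ⟨e, he, he1, he2, he3, hR, hl⟩, hb, hF⟩
    obtain rfl : e = 0 := by simpa [he1] using hb
    refine ⟨fun i hi => ?_, ?_⟩
    · obtain ⟨⟨t, ht, e'⟩, hmin⟩ := hR.min i (by simpa using hi)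
      have hrow : rowOf (2 ^ 0) i = i := by simp [rowOf]
      rw [hrow] at e' hmin
      refine ⟨?_, hmin⟩
      rw [← e']
      exact (hLev.dom 0 (by omega)).incr.2 t ht
    · simp at hl ⊢; omega

end WordRAM

/-! ### Weighted selection -/

namespace WordRAM

/-- The total weight of the pairs of a key and a weight. -/
def total (l : List (ℕ × ℕ)) : ℕ := (l.map (·.2)).sum

/-- The total weight of the pairs with keys less than `p`. -/
def below (l : List (ℕ × ℕ)) (p : ℕ) : ℕ := total (l.filter (·.1 < p))

/-- `p` is the key at which the cumulative weight exceeds `W`. -/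
def Selected (l : List (ℕ × ℕ)) (W p : ℕ) : Prop :=
  ∃ wt, (p, wt) ∈ l ∧ below l p ≤ W ∧ W < below l p + wt

@[simp] theorem total_nil : total [] = 0 := rfl
@[simp] theorem total_cons (x : ℕ × ℕ) (l) : total (x :: l) = x.2 + total l := by simp [total]
@[simp] theorem total_append (l l') : total (l ++ l') = total l + total l' := by simp [total]

theorem below_append (l l' p) : below (l ++ l') p = below l p + below l' p := by simp [below]

theorem below_cons (x : ℕ × ℕ) (l p) :
    below (x :: l) p = (if x.1 < p then x.2 else 0) + below l p := by
  by_cases h : x.1 < p <;> simp [below, h]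

section
variable {l : List (ℕ × ℕ)} {W p q wt : ℕ}

theorem below_filter_lt (h : q ≤ p) : below (l.filter (·.1 < p)) q = below l q := by
  unfold below
  rw [List.filter_filter]
  congr 1
  apply List.filter_congr
  intro x _
  simp only [decide_eq_true_eq, Bool.and_eq_decide, decide_eq_decide]
  omega

theorem Selected.of_lt (hq : Selected (l.filter (·.1 < p)) W q) : Selected l W q := by
  obtain ⟨wt, hm, h1, h2⟩ := hq
  simp only [List.mem_filter, decide_eq_true_eq] at hm
  rw [below_filter_lt hm.2.le] at h1 h2
  exact ⟨wt, hm.1, h1, h2⟩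

/-- A split at the key `p` into smaller, equal and larger keys; since keys are distinct, the middle
part is one pair. The arbitrary filter `P` covers both the total weight and the weight below another
key. -/
theorem total_eq (hnd : (l.map Prod.fst).Nodup) (hp : (p, wt) ∈ l) (P : ℕ × ℕ → Bool) :
    total (l.filter P) = total ((l.filter (·.1 < p)).filter P) + (if P (p, wt) then wt else 0) +
      total ((l.filter (p < ·.1)).filter P) := by
  induction l with
  | nil => simp at hp
  | cons x l ih =>
    simp only [List.map_cons, List.nodup_cons] at hnd
    rcases List.mem_cons.1 hp with rfl | hp'
    · have h1 : ∀ y ∈ l, y.1 ≠ p := fun y hy h => hnd.1 (List.mem_map.2 ⟨y, hy, h⟩)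
      clear hp ih hnd
      have key : total (l.filter P) = total ((l.filter (·.1 < p)).filter P) +
          total ((l.filter (p < ·.1)).filter P) := by
        induction l with
        | nil => simp
        | cons y l ih =>
          have ih := ih fun z hz => h1 z (List.mem_cons_of_mem _ hz)
          have hy := h1 y (List.mem_cons_self ..)
          rcases lt_or_gt_of_ne hy with h | h
          · have h' : ¬ p < y.1 := by omega
            by_cases hP : P y <;> simp [h, h', hP, ih]; omega
          · have h' : ¬ y.1 < p := by omega
            by_cases hP : P y <;> simp [h, h', hP, ih]; omega
      by_cases hP : P (p, wt) <;> simp [hP, key]; omega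
    · have ih := ih hnd.2 hp'
      have hy : x.1 ≠ p := fun h => hnd.1 (by rw [h]; exact List.mem_map_of_mem (f := Prod.fst) hp')
      rcases lt_or_gt_of_ne hy with h | h
      · have h' : ¬ p < x.1 := by omega
        by_cases hP : P x <;> simp [h, h', hP, ih]; omega
      · have h' : ¬ x.1 < p := by omega
        by_cases hP : P x <;> simp [h, h', hP, ih]; omega

theorem total_split (hnd : (l.map Prod.fst).Nodup) (hp : (p, wt) ∈ l) :
    total l = below l p + wt + total (l.filter (p < ·.1)) := by
  have := total_eq hnd hp (fun _ => true)
  simpa [below] using this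

theorem below_split (hnd : (l.map Prod.fst).Nodup) (hp : (p, wt) ∈ l) (hq : p < q) :
    below l q = below l p + wt + below (l.filter (p < ·.1)) q := by
  have := total_eq hnd hp (fun x => x.1 < q)
  simp only [decide_eq_true_eq, hq, if_true] at this
  unfold below
  rw [this]
  congr 3
  rw [List.filter_filter]
  apply List.filter_congr
  intro x _
  simp only [decide_eq_true_eq, Bool.and_eq_decide, decide_eq_decide]
  omega

theorem Selected.of_gt (hnd : (l.map Prod.fst).Nodup) (hp : (p, wt) ∈ l)
    (hW : below l p + wt ≤ W) (hq : Selected (l.filter (p < ·.1)) (W - (below l p + wt)) q) :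
    Selected l W q := by
  obtain ⟨wt', hm, h1, h2⟩ := hq
  simp only [List.mem_filter, decide_eq_true_eq] at hm
  have := below_split hnd hp hm.2
  exact ⟨wt', hm.1, by omega, by omega⟩

end

/-- The pairs in the cells `b, …, b + m - 1` of two arrays. -/
def seg (K Z : ℕ → ℕ) (b m : ℕ) : List (ℕ × ℕ) := (List.range m).map fun j => (K (b + j), Z (b + j))

section
variable {K Z K' Z' : ℕ → ℕ} {b m : ℕ}

@[simp] theorem length_seg : (seg K Z b m).length = m := by simp [seg]

@[simp] theorem seg_zero : seg K Z b 0 = [] := by simp [seg]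

theorem seg_succ : seg K Z b (m + 1) = seg K Z b m ++ [(K (b + m), Z (b + m))] := by
  simp [seg, List.range_succ]

theorem seg_congr (hK : ∀ j, b ≤ j → j < b + m → K' j = K j)
    (hZ : ∀ j, b ≤ j → j < b + m → Z' j = Z j) : seg K' Z' b m = seg K Z b m := by
  apply List.map_congr_left
  intro j hj
  rw [List.mem_range] at hj
  rw [hK _ (by omega) (by omega), hZ _ (by omega) (by omega)]

theorem mem_seg {x : ℕ × ℕ} : x ∈ seg K Z b m ↔ ∃ j < m, (K (b + j), Z (b + j)) = x := by
  simp [seg]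

theorem seg_inj (h : ((seg K Z b m).map Prod.fst).Nodup) {i j : ℕ} (hi : i < m) (hj : j < m)
    (e : K (b + i) = K (b + j)) : i = j := by
  have h' : ((List.range m).map fun j => K (b + j)).Nodup := by
    simpa [seg, Function.comp_def] using h
  exact List.inj_on_of_nodup_map h' (by simpa using hi) (by simpa using hj) e

theorem card_filter_Ico_succ (P : ℕ → Prop) [DecidablePred P] {a b : ℕ} (h : a ≤ b) :
    ((Finset.Ico a (b + 1)).filter P).card = ((Finset.Ico a b).filter P).card +
      if P b then 1 else 0 := by
  rw [← Finset.insert_Ico_right_eq_Ico_add_one h, Finset.filter_insert]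
  split
  · rw [Finset.card_insert_of_notMem (by simp)]
  · rfl

theorem length_filter_seg (P : ℕ → Prop) [DecidablePred P] :
    ((seg K Z b m).filter (fun x => P x.1)).length =
      ((Finset.Ico b (b + m)).filter fun j => P (K j)).card := by
  induction m with
  | zero => simp
  | succ m ih =>
    rw [seg_succ, List.filter_append, List.length_append, ih, ← add_assoc,
      card_filter_Ico_succ _ (by omega)]
    by_cases h : P (K (b + m)) <;> simp [h]

end

/-- In a finite set with distinct keys there is an element of each rank. -/
theorem exists_rank (s : Finset ℕ) (K : ℕ → ℕ) (hK : Set.InjOn K s) {r : ℕ} (hr : r < s.card) :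
    ∃ a ∈ s, (s.filter fun b => K b < K a).card = r := by
  have h1 : ∀ a ∈ s, (s.filter fun b => K b < K a).card ∈ Finset.range s.card := by
    intro a ha
    rw [Finset.mem_range]
    exact Finset.card_lt_card (Finset.filter_ssubset.2 ⟨a, ha, lt_irrefl _⟩)
  have h2 : Set.InjOn (fun a => (s.filter fun b => K b < K a).card) s := by
    intro a ha b hb e
    by_contra hne
    have hlt : ∀ x ∈ s, ∀ y ∈ s, K x < K y → (s.filter fun b => K b < K x).card <
        (s.filter fun b => K b < K y).card := by
      intro x hx y hy hxy
      apply Finset.card_lt_card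
      rw [Finset.ssubset_iff_of_subset]
      · exact ⟨x, by simp [hx, hxy], by simp⟩
      · intro z hz
        simp only [Finset.mem_filter] at hz ⊢
        exact ⟨hz.1, hz.2.trans hxy⟩
    rcases lt_or_gt_of_ne (fun h => hne (hK ha hb h)) with h | h
    · have := hlt a ha b hb h; simp only at e; omega
    · have := hlt b hb a ha h; simp only at e; omega
  have h3 := Finset.surjOn_of_injOn_of_card_le (t := Finset.range s.card) _ h1 h2 (by simp)
  obtain ⟨a, ha, e⟩ := h3 (by simpa using hr : r ∈ (Finset.range s.card : Set ℕ))
  exact ⟨a, ha, e⟩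

/-- `v` is the median of the five keys from position `x` on. -/
def IsMedian (K : ℕ → ℕ) (x v : ℕ) : Prop :=
  ∃ a ∈ Finset.Ico x (x + 5), K a = v ∧ ((Finset.Ico x (x + 5)).filter fun b => K b < v).card = 2

/-- These are the two smaller keys and the median itself; dually, `IsMedian.ge` counts the five keys
without the two smaller ones. -/
theorem IsMedian.le {K : ℕ → ℕ} {x v : ℕ} (h : IsMedian K x v) :
    3 ≤ ((Finset.Ico x (x + 5)).filter fun b => K b ≤ v).card := by
  obtain ⟨a, ha, rfl, h⟩ := h
  have : ((Finset.Ico x (x + 5)).filter fun b => K b < K a).card <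
      ((Finset.Ico x (x + 5)).filter fun b => K b ≤ K a).card := by
    apply Finset.card_lt_card
    rw [Finset.ssubset_iff_of_subset]
    · exact ⟨a, by simpa using ha, by simp⟩
    · intro z hz
      simp only [Finset.mem_filter] at hz ⊢
      exact ⟨hz.1, hz.2.le⟩
  omega

theorem IsMedian.ge {K : ℕ → ℕ} {x v : ℕ} (h : IsMedian K x v) :
    3 ≤ ((Finset.Ico x (x + 5)).filter fun b => v ≤ K b).card := by
  obtain ⟨a, ha, rfl, h⟩ := h
  have := Finset.card_filter_add_card_filter_not (s := Finset.Ico x (x + 5)) (fun b => K b < K a)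
  simp only [not_lt, Nat.card_Ico] at this
  omega

/-- If enough medians of groups of five satisfy `Q`, then many keys satisfy `P`. -/
theorem three_mul_le (P Q : ℕ → Prop) [DecidablePred P] [DecidablePred Q] (x : ℕ) (g : ℕ)
    (med : ℕ → ℕ)
    (h : ∀ i < g, Q (med i) → 3 ≤ ((Finset.Ico (x + 5 * i) (x + 5 * i + 5)).filter P).card) :
    3 * ((Finset.Ico 0 g).filter fun i => Q (med i)).card ≤
      ((Finset.Ico x (x + 5 * g)).filter P).card := by
  induction g with
  | zero => simp
  | succ g ih =>
    have ih := ih fun i hi => h i (by omega)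
    rw [card_filter_Ico_succ _ (Nat.zero_le _)]
    have : ((Finset.Ico x (x + 5 * (g + 1))).filter P).card =
        ((Finset.Ico x (x + 5 * g)).filter P).card +
        ((Finset.Ico (x + 5 * g) (x + 5 * g + 5)).filter P).card := by
      rw [← Finset.card_union_of_disjoint, ← Finset.filter_union,
        Finset.Ico_union_Ico_eq_Ico (by omega) (by omega)]
      · rfl
      · apply Finset.disjoint_filter_filter
        exact Finset.Ico_disjoint_Ico_consecutive _ _ _
    rw [this]
    by_cases hQ : Q (med g)
    · have := h g (by omega) hQ
      simp only [hQ, if_true]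
      omega
    · simp only [hQ, if_false]
      omega

/-- Filtering by the median of the medians of groups of five leaves at most seven tenths. -/
theorem length_filter_le {K Z : ℕ → ℕ} {b m : ℕ} {med : ℕ → ℕ} {p : ℕ}
    (hmed : ∀ i < m / 5, IsMedian K (b + 5 * i) (med i))
    (hp : ∃ i < m / 5, med i = p)
    (hrank : ((Finset.Ico 0 (m / 5)).filter fun i => med i < p).card = m / 5 / 2) :
    2 * ((seg K Z b m).filter (fun x => x.1 < p)).length + 3 * (m / 5) ≤ 2 * m ∧
    2 * ((seg K Z b m).filter (fun x => p < x.1)).length + 3 * (m / 5) ≤ 2 * m := by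
  rw [length_filter_seg (fun k => k < p), length_filter_seg (fun k => p < k)]
  have hsub : ∀ (P : ℕ → Prop) [DecidablePred P],
      ((Finset.Ico b (b + 5 * (m / 5))).filter P).card ≤ ((Finset.Ico b (b + m)).filter P).card := by
    intro P _
    apply Finset.card_le_card
    apply Finset.filter_subset_filter
    exact Finset.Ico_subset_Ico_right (by omega)
  have key1 := three_mul_le (fun j => K j ≤ p) (fun v => v ≤ p) b (m / 5) med (by
    intro i hi hQ
    refine (hmed i hi).le.trans (Finset.card_le_card ?_)
    intro z hz
    simp only [Finset.mem_filter] at hz ⊢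
    exact ⟨hz.1, hz.2.trans hQ⟩)
  have key2 := three_mul_le (fun j => p ≤ K j) (fun v => p ≤ v) b (m / 5) med (by
    intro i hi hQ
    refine (hmed i hi).ge.trans (Finset.card_le_card ?_)
    intro z hz
    simp only [Finset.mem_filter] at hz ⊢
    exact ⟨hz.1, hQ.trans hz.2⟩)
  have h1 := Finset.card_filter_add_card_filter_not (s := Finset.Ico b (b + m)) (fun j => K j < p)
  have h2 := Finset.card_filter_add_card_filter_not (s := Finset.Ico b (b + m)) (fun j => p < K j)
  have h3 := Finset.card_filter_add_card_filter_not (s := Finset.Ico 0 (m / 5)) (fun i => med i < p)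
  simp only [not_lt, Nat.card_Ico] at h1 h2 h3
  have s1 := hsub (fun j => K j ≤ p)
  have s2 := hsub (fun j => p ≤ K j)
  -- `p` is one of the medians, so strictly more than `m / 5 / 2` of them are at most `p`. The extra
  -- one makes up for the rounding when `m / 5` is odd.
  have h4 : ((Finset.Ico 0 (m / 5)).filter fun i => med i < p).card <
      ((Finset.Ico 0 (m / 5)).filter fun i => med i ≤ p).card := by
    apply Finset.card_lt_card
    obtain ⟨i, hi, rfl⟩ := hp
    rw [Finset.ssubset_iff_of_subset]
    · exact ⟨i, by simpa using hi, by simp⟩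
    · intro z hz
      simp only [Finset.mem_filter] at hz ⊢
      exact ⟨hz.1, hz.2.le⟩
  omega

end WordRAM

/-! ### Passes over the buffer: filtering, weighing, medians of five -/

namespace WordRAM

/-- The list of keys and weights from position `b` on in the buffer. -/
def St.buf (σ : St) (b m : ℕ) : List (ℕ × ℕ) := seg (σ.mem .bk) (σ.mem .bw) b m

theorem St.buf_congr {σ τ : St} {b m : ℕ} (hk : ∀ j, j < b + m → τ.mem .bk j = σ.mem .bk j)
    (hw : ∀ j, j < b + m → τ.mem .bw j = σ.mem .bw j) : τ.buf b m = σ.buf b m :=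
  seg_congr (fun j _ h => hk j h) fun j _ h => hw j h

@[simp] theorem St.buf_setR (σ : St) (x : Var) (v : ℕ) : (σ.setR x v).buf = σ.buf := rfl

/-- The buffer is unchanged below position `b`. -/
def SameBelow (b : ℕ) (σ τ : St) : Prop :=
  ∀ j < b, τ.mem .bk j = σ.mem .bk j ∧ τ.mem .bw j = σ.mem .bw j

/-- The bounds allow for buffers of size `M`. -/
structure BufOk (B : Bound) (M : ℕ) : Prop where
  bk : M ≤ B.lim .bk
  bw : M ≤ B.lim .bw
  word : M < B.word
  big : 64 < B.word

/-- Keep only the pairs that satisfy a condition. -/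
def filterCmd (c : Cond) : Cmd :=
  Var.x1 ::= (Var.sb : Ex) + Var.sl ;; Var.so ::= Var.sb ;;
  .for .si Var.sb .x1 (
    .ite c (.sto .bk Var.so (.ld .bk Var.si) ;; .sto .bw Var.so (.ld .bw Var.si) ;;
      Var.so ::= (Var.so : Ex) + 1) .skip) ;;
  Var.sl ::= (Var.so : Ex) - Var.sb

/-- The list is compacted in place: the writing position never passes the reading position, so every
cell is still original when it is read. The relation `P` is abstract because both the keys below and
those above the pivot are kept by such a pass. -/
theorem filterCmd_spec {B : Bound} {σ : St} {b m k₀ : ℕ} (hb : σ.reg .sb = b) (hm : σ.reg .sl = m)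
    (hB : BufOk B (b + m)) (c : Cond) (P : ℕ → ℕ → Prop) [∀ p, DecidablePred (P p)]
    (hc : ∀ τ, c.eval τ ↔ P (τ.reg .pv) (τ.mem .bk (τ.reg .si)))
    (hok : ∀ τ : St, c.ok B τ ↔ τ.reg .si < B.lim .bk) (hcost : c.cost ≤ 20) :
    WP B (filterCmd c) σ k₀ fun τ l =>
      τ.buf b (τ.reg .sl) = (σ.buf b m).filter (fun x => P (σ.reg .pv) x.1) ∧
      SameBelow b σ τ ∧ l ≤ k₀ + 80 * m + 50 := by
  have h1 := hB.bk
  have h2 := hB.bw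
  have h3 := hB.word
  have h4 := hB.big
  simp only [filterCmd, WP_seq]
  rw [WP_asg, WP_asg]
  refine ⟨by simp [hb, hm]; omega, by simp, ?_⟩
  refine (WP_for' (x := .si) (y := .x1) (fun i τ => b ≤ τ.reg .so ∧ τ.reg .so ≤ i ∧
    τ.buf b (τ.reg .so - b) = (σ.buf b (i - b)).filter (fun x => P (σ.reg .pv) x.1) ∧
    SameBelow b σ τ ∧ ∀ j, i ≤ j → τ.mem .bk j = σ.mem .bk j ∧ τ.mem .bw j = σ.mem .bw j) 80
    (by decide) rfl rfl (by simp) (by simp [hb, hm]; omega) (by omega) (by simp) ?_ ?_).mono ?_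
  · simp [hb, SameBelow, St.buf]
  · rintro i τ hbi hi hF hsi ⟨hso1, hso2, hbuf, hlow, hhigh⟩
    simp [hb] at hbi
    simp [hb, hm] at hi
    have e1 : τ.reg .pv = σ.reg .pv := (hF.reg _ rfl).trans (by simp)
    have e2 : τ.reg .sb = b := (hF.reg _ rfl).trans (by simp [hb])
    obtain ⟨d, rfl⟩ : ∃ d, i = b + d := ⟨i - b, by omega⟩
    have hd : b + d + 1 - b = d + 1 := by omega
    have hd' : b + d - b = d := by omega
    rw [hd'] at hbuf
    have hlast := hhigh (b + d) le_rfl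
    rw [WP_ite]
    refine ⟨(hok _).2 (by omega), fun hc' => ?_, fun hc' => ?_⟩
    · have hP : P (σ.reg .pv) (σ.mem .bk (b + d)) := by
        have := (hc _).1 hc'
        rwa [e1, hsi, hlast.1] at this
      simp only [WP_seq, WP_sto, WP_asg]
      refine ⟨by simp, by simp [hsi]; omega, by simp; omega, by simp, by simp [hsi]; omega,
        by simp; omega, by simp; omega, ⟨?_, ?_, ?_, ?_, ?_⟩, ?_⟩
      · simp; omega
      · simp; omega
      · have e : (τ.reg .so + 1 - b) = (τ.reg .so - b) + 1 := by omega
        simp [hd, e, St.buf, seg_succ, List.filter_append, hP, hsi, hlast,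
          show b + (τ.reg .so - b) = τ.reg .so by omega]
        rw [← St.buf, ← hbuf]
        refine seg_congr ?_ ?_
        · intro j h1 h2
          rw [Function.update_of_ne (by omega)]
        · intro j h1 h2
          rw [Function.update_of_ne (by omega)]
      · intro j hj
        have := hlow j hj
        simp [hsi]
        rw [Function.update_of_ne (by omega), Function.update_of_ne (by omega)]
        exact this
      · intro j hj
        have := hhigh j (by omega)
        simp [hsi]
        rw [Function.update_of_ne (by omega), Function.update_of_ne (by omega)]
        exact this
      · simp; omega
    · have hP : ¬ P (σ.reg .pv) (σ.mem .bk (b + d)) := by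
        intro h
        apply hc'
        rw [hc, e1, hsi, hlast.1]
        exact h
      simp only [WP_skip]
      refine ⟨⟨by simpa using hso1, by simp; omega, ?_, ?_, ?_⟩, ?_⟩
      · simp [hd, St.buf, seg_succ, List.filter_append, hP]
        exact hbuf
      · exact hlow
      · intro j hj
        exact hhigh j (by omega)
      · omega
  · rintro τ l ⟨⟨hso1, hso2, hbuf, hlow, -⟩, -, hF, hl⟩
    simp [hb, hm] at hso1 hso2 hbuf hl
    have e2 : τ.reg .sb = b := (hF.reg _ rfl).trans (by simp [hb])
    rw [WP_asg]
    refine ⟨by simp [e2, hso1], ?_, hlow, ?_⟩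
    · simpa [e2] using hbuf
    · simp; omega

/-- Compute the weight below the pivot, and the weight of the pivot. -/
def weighCmd : Cmd :=
  Var.x1 ::= (Var.sb : Ex) + Var.sl ;; Var.lo ::= 0 ;; Var.ew ::= 0 ;;
  .for .si Var.sb .x1 (
    .ite (.lt (.ld .bk Var.si) Var.pv) (Var.lo ::= (Var.lo : Ex) + .ld .bw Var.si)
      (.ite (.eq (.ld .bk Var.si) Var.pv) (Var.ew ::= .ld .bw Var.si) .skip))

theorem total_seg_le {K Z : ℕ → ℕ} {b d m : ℕ} (h : d ≤ m) :
    total (seg K Z b d) ≤ total (seg K Z b m) := by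
  induction m, h using Nat.le_induction with
  | base => rfl
  | succ m _ ih => rw [seg_succ, total_append]; omega

theorem below_le_total (l : List (ℕ × ℕ)) (p : ℕ) : below l p ≤ total l := by
  induction l with
  | nil => simp [below]
  | cons x l ih => rw [below_cons, total_cons]; split <;> omega

theorem weighCmd_spec {B : Bound} {σ : St} {b m k₀ : ℕ} (hb : σ.reg .sb = b) (hm : σ.reg .sl = m)
    (hB : BufOk B (b + m)) (hnd : ((σ.buf b m).map Prod.fst).Nodup)
    (htot : total (σ.buf b m) < B.word) :
    WP B weighCmd σ k₀ fun τ l => τ.reg .lo = below (σ.buf b m) (σ.reg .pv) ∧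
      (∀ wt, (σ.reg .pv, wt) ∈ σ.buf b m → τ.reg .ew = wt) ∧ l ≤ k₀ + 80 * m + 50 := by
  have h1 := hB.bk
  have h2 := hB.bw
  have h3 := hB.word
  have h4 := hB.big
  simp only [weighCmd, WP_seq]
  rw [WP_asg, WP_asg, WP_asg]
  refine ⟨by simp [hb, hm]; omega, by simp; omega, by simp; omega, ?_⟩
  refine (WP_for' (x := .si) (y := .x1) (fun i τ =>
    τ.reg .lo = below (σ.buf b (i - b)) (σ.reg .pv) ∧
    ∀ d, b + d < i → σ.mem .bk (b + d) = σ.reg .pv → τ.reg .ew = σ.mem .bw (b + d)) 80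
    (by decide) rfl rfl (by simp) (by simp [hb, hm]; omega) (by omega) (by simp) ?_ ?_).mono ?_
  · simp [hb, St.buf, below]
  · rintro i τ hbi hi hF hsi ⟨hlo, hew⟩
    simp [hb] at hbi
    simp [hb, hm] at hi
    have e1 : τ.reg .pv = σ.reg .pv := (hF.reg _ rfl).trans (by simp)
    have e2 : τ.mem .bk = σ.mem .bk := hF.mem _ rfl
    have e3 : τ.mem .bw = σ.mem .bw := hF.mem _ rfl
    obtain ⟨d, rfl⟩ : ∃ d, i = b + d := ⟨i - b, by omega⟩
    have hd : b + d + 1 - b = d + 1 := by omega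
    have hd' : b + d - b = d := by omega
    rw [hd'] at hlo
    have hsum : below (σ.buf b d) (σ.reg .pv) + σ.mem .bw (b + d) < B.word := by
      have hle : total (σ.buf b (d + 1)) ≤ _ := total_seg_le (show d + 1 ≤ m by omega)
      have hle' := below_le_total (σ.buf b d) (σ.reg .pv)
      simp only [St.buf, seg_succ, total_append, total_cons, total_nil] at hle hle' htot ⊢
      omega
    rw [WP_ite]
    refine ⟨by simp [hsi]; omega, fun h => ?_, fun h => ?_⟩
    · have h : σ.mem .bk (b + d) < σ.reg .pv := by simpa [hsi, e1, e2] using h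
      rw [WP_asg]
      refine ⟨by simp [hsi, e3, hlo]; omega, ⟨?_, ?_⟩, by simp⟩
      · simp [hd, St.buf, seg_succ, below_append, below_cons, h, hlo, hsi, e3]
        simp [below]
      · intro d' hd' he
        simp
        by_cases hdd : d' = d
        · subst hdd; omega
        · exact hew d' (by omega) he
    · have h : ¬ σ.mem .bk (b + d) < σ.reg .pv := by simpa [hsi, e1, e2] using h
      have hlo' : τ.reg .lo = below (σ.buf b (d + 1)) (σ.reg .pv) := by
        rw [hlo]
        simp [St.buf, seg_succ, below_append, below_cons, h]
        simp [below]
      rw [WP_ite]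
      refine ⟨by simp [hsi]; omega, fun h' => ?_, fun h' => ?_⟩
      · have h' : σ.mem .bk (b + d) = σ.reg .pv := by simpa [hsi, e1, e2] using h'
        rw [WP_asg]
        refine ⟨by simp [hsi]; omega, ⟨?_, ?_⟩, by simp⟩
        · simpa [hd] using hlo'
        · intro d' hd' he
          have := seg_inj hnd (show d' < m by omega) (show d < m by omega) (he.trans h'.symm)
          subst this
          simp [hsi, e3]
      · have h' : ¬ σ.mem .bk (b + d) = σ.reg .pv := by simpa [hsi, e1, e2] using h'
        simp only [WP_skip]
        refine ⟨⟨by simpa [hd] using hlo', ?_⟩, by simp⟩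
        intro d' hd' he
        simp
        by_cases hdd : d' = d
        · subst hdd; exact absurd he h'
        · exact hew d' (by omega) he
  · rintro τ l ⟨⟨hlo, hew⟩, -, hF, hl⟩
    simp [hb, hm] at hlo hew hl
    refine ⟨hlo, fun wt hwt => ?_, by omega⟩
    obtain ⟨j, hj, e⟩ := mem_seg.1 hwt
    simp only [Prod.mk.injEq] at e
    rw [hew j hj e.1, e.2]

/-- Store the median of five keys. -/
def medianCmd : Cmd :=
  .for .ia Var.x0 .x1 (
    Var.cn ::= 0 ;;
    .for .ib Var.x0 .x1 (
      .ite (.lt (.ld .bk Var.ib) (.ld .bk Var.ia)) (Var.cn ::= (Var.cn : Ex) + 1) .skip) ;;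
    .ite (.eq Var.cn 2) (.sto .bk Var.so (.ld .bk Var.ia)) .skip)

/-- For each of the five keys the smaller ones are counted. Distinctness guarantees that exactly one
count is two (existence is `exists_rank`), so the output cell is certainly written. -/
theorem medianCmd_spec {B : Bound} {σ : St} {x k₀ : ℕ} (hx : σ.reg .x0 = x)
    (hx1 : σ.reg .x1 = x + 5) (hso : x + 5 ≤ σ.reg .so) (hB : BufOk B (σ.reg .so + 1))
    (hinj : Set.InjOn (σ.mem .bk) (Finset.Ico x (x + 5))) :
    WP B medianCmd σ k₀ fun τ l => IsMedian (σ.mem .bk) x (τ.mem .bk (σ.reg .so)) ∧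
      (∀ j < σ.reg .so, τ.mem .bk j = σ.mem .bk j) ∧ l ≤ k₀ + 2000 := by
  have h1 := hB.bk
  have h2 := hB.bw
  have h3 := hB.word
  have h4 := hB.big
  set K := σ.mem .bk with hK
  set s := Finset.Ico x (x + 5) with hs
  refine (WP_for' (x := .ia) (y := .x1) (fun i τ =>
    (∀ j < σ.reg .so, τ.mem .bk j = K j) ∧ ((∃ a ∈ s, K a = τ.mem .bk (σ.reg .so) ∧
      (s.filter fun b => K b < K a).card = 2) ∨
      ∀ a ∈ s, a < i → (s.filter fun b => K b < K a).card ≠ 2)) 350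
    (by decide) rfl rfl (by simp) (by simp [hx1]; omega) (by omega) (by simp [hx, hx1])
    ?_ ?_).mono ?_
  · refine ⟨by simp [K], .inr fun a ha hlt => ?_⟩
    simp [s] at ha
    simp [hx] at hlt
    omega
  · rintro i τ hi1 hi2 hF hia ⟨hlow, hI⟩
    simp [hx] at hi1
    simp [hx1] at hi2
    have e0 : τ.reg .x0 = x := (hF.reg _ rfl).trans hx
    have e1 : τ.reg .x1 = x + 5 := (hF.reg _ rfl).trans hx1
    have e2 : τ.reg .so = σ.reg .so := hF.reg _ rfl
    rw [WP_seq, WP_asg]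
    refine ⟨by simp; omega, ?_⟩
    rw [WP_seq]
    refine (WP_for' (x := .ib) (y := .x1) (fun j ρ => ρ.reg .cn =
      ((Finset.Ico x j).filter fun b => K b < K i).card) 40
      (by decide) rfl rfl (by simp) (by simp [e1]; omega) (by omega) (by simp [e0, e1])
      (by simp [e0]) ?_).mono ?_
    · rintro j ρ hj1 hj2 hF' hib hcn
      simp [e0] at hj1
      simp [e1] at hj2
      have f1 : ρ.reg .ia = i := (hF'.reg _ rfl).trans (by simp [hia])
      have f2 : ρ.mem .bk = τ.mem .bk := hF'.mem _ rfl
      have f3 : τ.mem .bk i = K i := hlow i (by omega)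
      have f4 : τ.mem .bk j = K j := hlow j (by omega)
      have hcard : ((Finset.Ico x j).filter fun b => K b < K i).card ≤ 5 := by
        refine (Finset.card_filter_le _ _).trans ?_
        simp; omega
      rw [WP_ite]
      refine ⟨by simp [hib, f1]; omega, fun h => ?_, fun h => ?_⟩
      · have h : K j < K i := by simpa [hib, f1, f2, f3, f4] using h
        rw [WP_asg]
        refine ⟨by simp [hcn]; omega, ?_, by simp⟩
        rw [card_filter_Ico_succ _ hj1]
        simp [h, hcn]
      · have h : ¬ K j < K i := by simpa [hib, f1, f2, f3, f4] using h
        simp only [WP_skip]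
        refine ⟨?_, by simp⟩
        rw [card_filter_Ico_succ _ hj1]
        simp [h, hcn]
    · rintro ρ l ⟨hcn, -, hF', hl⟩
      simp [e1] at hcn
      simp [e1, e0] at hl
      have f1 : ρ.reg .ia = i := (hF'.reg _ rfl).trans (by simp [hia])
      have f2 : ρ.mem .bk = τ.mem .bk := hF'.mem _ rfl
      have f3 : τ.mem .bk i = K i := hlow i (by omega)
      have f4 : ρ.reg .so = σ.reg .so := (hF'.reg _ rfl).trans (by simp [e2])
      rw [WP_ite]
      refine ⟨by simp; omega, fun h => ?_, fun h => ?_⟩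
      · have h : ((Finset.Ico x (x + 5)).filter fun b => K b < K i).card = 2 := by
          simpa [hcn] using h
        rw [WP_sto]
        refine ⟨by simp, by simp [f1]; omega, by simp [f4]; omega, ⟨?_, ?_⟩, ?_⟩
        · intro j hj
          simp [f4]
          rw [Function.update_of_ne (by omega), f2, hlow j hj]
        · left
          exact ⟨i, by simp [s]; omega, by simp [f4, f1, f2, f3], h⟩
        · simp; omega
      · have h : ¬ ((Finset.Ico x (x + 5)).filter fun b => K b < K i).card = 2 := by
          simpa [hcn] using h
        simp only [WP_skip]
        refine ⟨⟨?_, ?_⟩, ?_⟩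
        · intro j hj
          simp [f2, hlow j hj]
        · simp only [St.mem_setR, f2]
          refine hI.imp_right fun hI a ha hlt => ?_
          rcases Nat.lt_succ_iff_lt_or_eq.1 hlt with hlt | rfl
          · exact hI a ha hlt
          · exact h
        · simp; omega
  · rintro τ l ⟨⟨hlow, hI⟩, -, -, hl⟩
    simp [hx, hx1] at hl
    obtain ⟨a, ha, hr⟩ := exists_rank s K hinj (r := 2) (by simp [s])
    have hI := hI.resolve_right fun h => h a ha (by simp [hx1, s] at ha ⊢; omega) hr
    obtain ⟨a, ha, h, h'⟩ := hI
    exact ⟨⟨a, ha, h, by rw [← h]; exact h'⟩, hlow, by omega⟩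

/-- Append the medians of the groups of five to the buffer, with unit weights. -/
def mediansCmd : Cmd :=
  Var.g ::= (Var.sl : Ex) / 5 ;; Var.lo ::= (Var.sb : Ex) + Var.sl ;;
  .for .gi 0 .g (
    Var.x0 ::= (Var.sb : Ex) + 5 * Var.gi ;; Var.x1 ::= (Var.x0 : Ex) + 5 ;;
    Var.so ::= (Var.lo : Ex) + Var.gi ;; medianCmd ;; .sto .bw Var.so 1)

-- The medians are put directly behind the current segment, which is why a task at `b` of length `m`
-- asks for room up to `b + 2 * m`. Unit weights turn the weighted selection among them into a
-- selection by rank.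
set_option maxHeartbeats 400000 in
theorem mediansCmd_spec {B : Bound} {σ : St} {b m k₀ : ℕ} (hb : σ.reg .sb = b)
    (hm : σ.reg .sl = m) (hB : BufOk B (b + 2 * m))
    (hnd : ((σ.buf b m).map Prod.fst).Nodup) :
    WP B mediansCmd σ k₀ fun τ l => τ.reg .g = m / 5 ∧ τ.reg .lo = b + m ∧
      (∀ i < m / 5, IsMedian (σ.mem .bk) (b + 5 * i) (τ.mem .bk (b + m + i)) ∧
        τ.mem .bw (b + m + i) = 1) ∧ SameBelow (b + m) σ τ ∧ l ≤ k₀ + 500 * m + 50 := by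
  have h1 := hB.bk
  have h2 := hB.bw
  have h3 := hB.word
  have h4 := hB.big
  simp only [mediansCmd, WP_seq]
  rw [WP_asg, WP_asg]
  refine ⟨by simp; omega, by simp [hb, hm]; omega, ?_⟩
  refine (WP_for' (x := .gi) (y := .g) (fun i τ => (∀ i' < i,
      IsMedian (σ.mem .bk) (b + 5 * i') (τ.mem .bk (b + m + i')) ∧ τ.mem .bw (b + m + i') = 1) ∧
      SameBelow (b + m) σ τ) 2200
    (by decide) rfl rfl (by simp; omega) (by simp [hm]; omega) (by omega) (by simp)
    (by simp [SameBelow]) ?_).mono ?_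
  · rintro i τ - hi hF hgi ⟨hmed, hlow⟩
    simp [hm] at hi
    have e1 : τ.reg .sb = b := (hF.reg _ rfl).trans (by simp [hb])
    have e2 : τ.reg .lo = b + m := (hF.reg _ rfl).trans (by simp [hb, hm])
    rw [WP_seq, WP_asg, WP_seq, WP_asg, WP_seq, WP_asg, WP_seq]
    refine ⟨by simp [e1, hgi]; omega, by simp [e1, hgi]; omega, by simp [e2, hgi]; omega, ?_⟩
    set τ' := ((τ.setR .x0 _).setR .x1 _).setR .so _ with hτ'
    have c1 : τ'.reg .x0 = b + 5 * i := by simp [τ', e1, hgi]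
    have c2 : τ'.reg .x1 = b + 5 * i + 5 := by simp [τ', e1, hgi]
    have c3 : τ'.reg .so = b + m + i := by simp [τ', e2, hgi]
    have c4 : τ'.mem = τ.mem := by simp [τ']
    have hinj : Set.InjOn (τ'.mem .bk) (Finset.Ico (b + 5 * i) (b + 5 * i + 5)) := by
      intro y hy z hz e
      simp at hy hz
      rw [c4, (hlow y (by omega)).1, (hlow z (by omega)).1] at e
      have := seg_inj hnd (i := y - b) (j := z - b) (by omega) (by omega)
        (by rwa [show b + (y - b) = y by omega, show b + (z - b) = z by omega])
      omega
    refine (medianCmd_spec c1 c2 (by omega)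
      ⟨by omega, by omega, by omega, h4⟩ hinj).frame.mono ?_
    rintro ρ l ⟨⟨hM, hsame, hl⟩, hF'⟩
    rw [c3] at hM hsame
    rw [c4] at hM hsame
    have d1 : ρ.reg .so = b + m + i := (hF'.reg _ rfl).trans c3
    have d2 : ρ.mem .bw = τ.mem .bw := (hF'.mem _ rfl).trans (by rw [c4])
    rw [WP_sto]
    refine ⟨by simp, by simp; omega, by simp [d1]; omega, ⟨?_, ?_⟩, ?_⟩
    · intro i' hi'
      rcases Nat.lt_succ_iff_lt_or_eq.1 hi' with hi' | rfl
      · simp [d1, d2, Nat.ne_of_lt hi', hsame (b + m + i') (by omega)]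
        exact hmed i' hi'
      · simp [d1]
        obtain ⟨a, ha, h, h'⟩ := hM
        have hK : ∀ j ∈ Finset.Ico (b + 5 * i') (b + 5 * i' + 5),
            τ.mem .bk j = σ.mem .bk j := by
          intro j hj
          simp at hj
          exact (hlow j (by omega)).1
        refine ⟨a, ha, by rw [← hK a ha, h], ?_⟩
        rw [← h']
        congr 1
        apply Finset.filter_congr
        intro j hj
        rw [hK j hj]
    · intro j hj
      have := hlow j hj
      simp [d1, d2, hsame j (by omega)]
      rw [Function.update_of_ne (by omega)]
      exact this
    · simp at hl ⊢; omega
  · rintro τ l ⟨⟨hmed, hlow⟩, -, hF, hl⟩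
    simp [hm] at hl hmed
    refine ⟨(hF.reg _ rfl).trans (by simp [hm]), (hF.reg _ rfl).trans (by simp [hb, hm]), hmed,
      hlow, by omega⟩

end WordRAM

/-! ### Selection in linear time, with an explicit stack of tasks -/

namespace WordRAM

/-- The selection loop simulates a recursion. It is unrolled one turn at a time within an induction
on the length of the task, instead of being described by an invariant. -/
theorem WP_while_true {B : Bound} {b : Cond} {c : Cmd} {σ : St} {k : ℕ} {Q : St → ℕ → Prop}
    (hok : b.ok B σ) (hb : b.eval σ)
    (h : WP B c σ (k + (b.cost + 1)) fun τ l => WP B (.while b c) τ l Q) :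
    WP B (.while b c) σ k Q := by
  obtain ⟨τ, l, hr, ρ, l', hr', hQ⟩ := h
  refine ⟨ρ, _, .whileT hok hb hr hr', ?_⟩
  convert hQ using 1; ring

theorem WP_while_false {B : Bound} {b : Cond} {c : Cmd} {σ : St} {k : ℕ} {Q : St → ℕ → Prop}
    (hok : b.ok B σ) (hb : ¬ b.eval σ) (h : Q σ (k + b.cost)) : WP B (.while b c) σ k Q :=
  ⟨σ, _, .whileF hok hb, h⟩

/-- Continue with the part of the buffer in which the wanted key is, or return to the suspended
task if the pivot is the wanted key. -/
def partitionCmd : Cmd :=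
  .ite (.lt Var.sw Var.lo)
    (filterCmd (.lt (.ld .bk Var.si) Var.pv) ;; Var.st ::= 0)
    (.ite (.lt Var.sw ((Var.lo : Ex) + Var.ew))
      -- The answer stays in `pv` and becomes the pivot of the resumed task, since `st` is not
      -- reset. The outermost task reads the unused cells number `0` here, after which the loop
      -- ends.
      (Var.sp ::= (Var.sp : Ex) - 1 ;; Var.sb ::= .ld .tb Var.sp ;; Var.sl ::= .ld .tl Var.sp ;;
        Var.sw ::= .ld .tw Var.sp)
      (filterCmd (.lt Var.pv (.ld .bk Var.si)) ;;
        Var.sw ::= (Var.sw : Ex) - ((Var.lo : Ex) + Var.ew) ;; Var.st ::= 0))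

/-- Suspend the current task, and search the median of the medians. -/
def pushCmd : Cmd :=
  .sto .tb Var.sp Var.sb ;; .sto .tl Var.sp Var.sl ;; .sto .tw Var.sp Var.sw ;;
  Var.sp ::= (Var.sp : Ex) + 1 ;; Var.sb ::= Var.lo ;; Var.sl ::= Var.g ;;
  Var.sw ::= (Var.g : Ex) / 2

/-- If `st` is `0`, the current task still needs a pivot; if it is `1`, the pivot is in `pv`. Short
segments take their first key as pivot, and longer ones open a task for the median of their medians.
-/
def selectStep : Cmd :=
  .ite (.eq Var.st 0)
    (.ite (.lt Var.sl 5) (Var.pv ::= .ld .bk Var.sb ;; Var.st ::= 1) (mediansCmd ;; pushCmd))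
    (weighCmd ;; partitionCmd)

def selectLoop : Cmd := .while (.lt 0 Var.sp) selectStep

/-- Find the key of the element of rank `sw` among the `sl` elements of the buffer. -/
def selectCmd : Cmd := Var.sp ::= 1 ;; Var.sb ::= 0 ;; Var.st ::= 0 ;; selectLoop

/-- The current task is to find the element of rank `W` in the `m` cells of the buffer from `b` on,
and `d` further tasks are suspended. -/
structure Task (B : Bound) (σ : St) (b m W d : ℕ) : Prop where
  sb : σ.reg .sb = b
  sl : σ.reg .sl = m
  sw : σ.reg .sw = W
  sp : σ.reg .sp = d + 1
  nodup : ((σ.buf b m).map Prod.fst).Nodup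
  lt : W < total (σ.buf b m)
  word : total (σ.buf b m) < B.word
  ok : BufOk B (b + 2 * m)
  tb : d + m + 1 < B.lim .tb
  tl : d + m + 1 < B.lim .tl
  tw : d + m + 1 < B.lim .tw
  tbw : B.lim .tb ≤ B.word

/-- The suspended tasks below number `d` are unchanged. -/
def SameTasks (d : ℕ) (σ τ : St) : Prop :=
  ∀ e < d, τ.mem .tb e = σ.mem .tb e ∧ τ.mem .tl e = σ.mem .tl e ∧ τ.mem .tw e = σ.mem .tw e

/-- The uppermost of the suspended tasks has become the current one. -/
structure Resumed (σ τ : St) (d : ℕ) : Prop where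
  sp : τ.reg .sp = d
  sb : τ.reg .sb = σ.mem .tb d
  sl : τ.reg .sl = σ.mem .tl d
  sw : τ.reg .sw = σ.mem .tw d

theorem total_filter_le (l : List (ℕ × ℕ)) (P : ℕ × ℕ → Bool) : total (l.filter P) ≤ total l := by
  induction l with
  | nil => simp
  | cons x l ih => by_cases h : P x <;> simp [h] <;> omega

theorem nodup_filter {l : List (ℕ × ℕ)} (h : (l.map Prod.fst).Nodup) (P : ℕ × ℕ → Bool) :
    ((l.filter P).map Prod.fst).Nodup :=
  h.sublist (List.filter_sublist.map _)

theorem length_filter_lt {l : List (ℕ × ℕ)} {x : ℕ × ℕ} (hx : x ∈ l) {P : ℕ × ℕ → Bool}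
    (hP : P x = false) : (l.filter P).length < l.length := by
  apply lt_of_le_of_ne (List.length_filter_le _ _)
  intro h
  have := List.length_filter_eq_length_iff.1 h x hx
  simp [hP] at this

/-- Either the task is finished, or it is replaced by a shorter one in the same place all of whose
answers are answers of the old task. That it is shorter suffices for termination; the exact length
is reported because the time bound depends on the quality of the pivot. -/
theorem partition_spec {B : Bound} {σ : St} {b m W d k₀ wt : ℕ} (hT : Task B σ b m W d)
    (hp : (σ.reg .pv, wt) ∈ σ.buf b m) :
    WP B (weighCmd ;; partitionCmd) σ k₀ fun τ l => l ≤ k₀ + 200 * m + 300 ∧ SameBelow b σ τ ∧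
      τ.mem .tb = σ.mem .tb ∧ τ.mem .tl = σ.mem .tl ∧ τ.mem .tw = σ.mem .tw ∧
      ((Selected (σ.buf b m) W (σ.reg .pv) ∧ τ.reg .pv = σ.reg .pv ∧ τ.reg .st = σ.reg .st ∧
        Resumed σ τ d) ∨
      ∃ m' W', m' < m ∧ Task B τ b m' W' d ∧ τ.reg .st = 0 ∧
        (m' = ((σ.buf b m).filter (fun x => x.1 < σ.reg .pv)).length ∨
          m' = ((σ.buf b m).filter (fun x => σ.reg .pv < x.1)).length) ∧
        ∀ q, Selected (τ.buf b m') W' q → Selected (σ.buf b m) W q) := by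
  have hok := hT.ok
  have h1 := hok.bk
  have h2 := hok.bw
  have h3 := hok.word
  have h4 := hok.big
  have h5 := hT.tb
  have h6 := hT.tl
  have h7 := hT.tw
  have h8 := hT.tbw
  have hB : BufOk B (b + m) := ⟨by omega, by omega, by omega, h4⟩
  rw [WP_seq]
  refine (weighCmd_spec hT.sb hT.sl hB hT.nodup hT.word).frame.mono ?_
  rintro τ l ⟨⟨hlo, hew, hl⟩, hF⟩
  have hew := hew wt hp
  have e1 : τ.reg .sb = b := (hF.reg _ rfl).trans hT.sb
  have e2 : τ.reg .sl = m := (hF.reg _ rfl).trans hT.sl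
  have e3 : τ.reg .sw = W := (hF.reg _ rfl).trans hT.sw
  have e4 : τ.reg .sp = d + 1 := (hF.reg _ rfl).trans hT.sp
  have e5 : τ.reg .pv = σ.reg .pv := hF.reg _ rfl
  have e6 : τ.reg .st = σ.reg .st := hF.reg _ rfl
  have e7 : τ.mem = σ.mem := by
    funext A; exact hF.mem A rfl
  have e8 : τ.buf = σ.buf := by unfold St.buf; rw [e7]
  have hspl := total_split hT.nodup hp
  have hwd := hT.word
  rw [partitionCmd, WP_ite]
  refine ⟨by simp, fun hc => ?_, fun hc => ?_⟩
  · have hc : W < below (σ.buf b m) (σ.reg .pv) := by simpa [e3, hlo] using hc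
    rw [WP_seq]
    refine (filterCmd_spec e1 e2 hB (.lt (.ld .bk Var.si) Var.pv) (fun p x => x < p) (by simp)
      (by simp) (by simp)).frame.mono ?_
    rintro ρ l' ⟨⟨hbuf, hlow, hl'⟩, hF'⟩
    rw [e5, e8] at hbuf
    rw [WP_asg]
    have hlen : ρ.reg .sl = ((σ.buf b m).filter (fun x => x.1 < σ.reg .pv)).length := by
      rw [← hbuf]; simp [St.buf]
    have hlt : ρ.reg .sl < m := by
      have := length_filter_lt hp (P := fun x => x.1 < σ.reg .pv) (by simp)
      rw [hlen]
      simpa [St.buf] using this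
    refine ⟨by simp; omega, by simp at hl' ⊢; omega, ?_, ?_, ?_, ?_, .inr ⟨ρ.reg .sl, W, hlt,
      ⟨?_, ?_, ?_, ?_, ?_, ?_, ?_, ⟨?_, ?_, ?_, h4⟩, ?_, ?_, ?_, ?_⟩, ?_, .inl hlen, ?_⟩⟩
    · intro j hj
      have := hlow j hj
      rwa [e7] at this
    · exact (hF'.mem _ rfl).trans (by rw [e7])
    · exact (hF'.mem _ rfl).trans (by rw [e7])
    · exact (hF'.mem _ rfl).trans (by rw [e7])
    · exact (hF'.reg _ rfl).trans (by simp [e1])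
    · simp
    · exact (hF'.reg _ rfl).trans (by simp [e3])
    · exact (hF'.reg _ rfl).trans (by simp [e4])
    · rw [St.buf_setR, hbuf]; exact nodup_filter hT.nodup _
    · rw [St.buf_setR, hbuf]; exact hc
    · rw [St.buf_setR, hbuf]; exact (total_filter_le _ _).trans_lt hwd
    · omega
    · omega
    · omega
    · omega
    · omega
    · omega
    · exact h8
    · simp
    · intro q hq
      rw [St.buf_setR, hbuf] at hq
      exact hq.of_lt
  · have hc : below (σ.buf b m) (σ.reg .pv) ≤ W := by simpa [e3, hlo] using hc
    rw [WP_ite]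
    refine ⟨by simp [hlo, hew]; omega, fun hc' => ?_, fun hc' => ?_⟩
    · have hc' : W < below (σ.buf b m) (σ.reg .pv) + wt := by simpa [e3, hlo, hew] using hc'
      simp only [WP_seq, WP_asg]
      refine ⟨by simp [e4]; omega, by simp [e4]; omega, by simp [e4]; omega, by simp [e4]; omega,
        by simp; omega, ?_, by simp [e7], by simp [e7], by simp [e7],
        .inl ⟨⟨wt, hp, hc, hc'⟩, by simp [e5], by simp [e6], ?_, ?_, ?_, ?_⟩⟩
      · intro j _; simp [e7]
      · simp [e4]
      · simp [e4, e7]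
      · simp [e4, e7]
      · simp [e4, e7]
    · have hc' : below (σ.buf b m) (σ.reg .pv) + wt ≤ W := by simpa [e3, hlo, hew] using hc'
      rw [WP_seq]
      refine (filterCmd_spec e1 e2 hB (.lt Var.pv (.ld .bk Var.si)) (fun p x => p < x) (by simp)
        (by simp) (by simp)).frame.mono ?_
      rintro ρ l' ⟨⟨hbuf, hlow, hl'⟩, hF'⟩
      rw [e5, e8] at hbuf
      have f1 : ρ.reg .lo = below (σ.buf b m) (σ.reg .pv) := (hF'.reg _ rfl).trans hlo
      have f2 : ρ.reg .ew = wt := (hF'.reg _ rfl).trans hew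
      have f3 : ρ.reg .sw = W := (hF'.reg _ rfl).trans e3
      rw [WP_seq, WP_asg, WP_asg]
      have hlen : ρ.reg .sl = ((σ.buf b m).filter (fun x => σ.reg .pv < x.1)).length := by
        rw [← hbuf]; simp [St.buf]
      have hlt : ρ.reg .sl < m := by
        have := length_filter_lt hp (P := fun x => σ.reg .pv < x.1) (by simp)
        rw [hlen]
        simpa [St.buf] using this
      have hWt := hT.lt
      refine ⟨by simp [f1, f2, f3]; omega, by simp; omega, by simp at hl' ⊢; omega, ?_, ?_, ?_, ?_,
        .inr ⟨ρ.reg .sl, W - (below (σ.buf b m) (σ.reg .pv) + wt), hlt,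
        ⟨?_, ?_, ?_, ?_, ?_, ?_, ?_, ⟨?_, ?_, ?_, h4⟩, ?_, ?_, ?_, ?_⟩, ?_, .inr hlen, ?_⟩⟩
      · intro j hj
        have := hlow j hj
        rwa [e7] at this
      · exact (hF'.mem _ rfl).trans (by rw [e7])
      · exact (hF'.mem _ rfl).trans (by rw [e7])
      · exact (hF'.mem _ rfl).trans (by rw [e7])
      · exact (hF'.reg _ rfl).trans (by simp [e1])
      · simp
      · simp [f1, f2, f3]
      · exact (hF'.reg _ rfl).trans (by simp [e4])
      · simp only [St.buf_setR, hbuf]; exact nodup_filter hT.nodup _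
      · simp only [St.buf_setR, hbuf]; omega
      · simp only [St.buf_setR, hbuf]; exact (total_filter_le _ _).trans_lt hwd
      · omega
      · omega
      · omega
      · omega
      · omega
      · omega
      · exact h8
      · simp
      · intro q hq
        simp only [St.buf_setR, hbuf] at hq
        exact hq.of_gt hT.nodup hp hc'

theorem total_one {l : List (ℕ × ℕ)} (h : ∀ x ∈ l, x.2 = 1) : total l = l.length := by
  induction l with
  | nil => rfl
  | cons x l ih =>
    rw [total_cons, ih fun y hy => h y (List.mem_cons_of_mem _ hy), h x (List.mem_cons_self ..),
      List.length_cons, add_comm]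

-- The statement is in continuation-passing style: to run the loop from a task it suffices to run it
-- from any state in which this task has been solved and the one below it resumed. This fits both
-- recursive calls, the one for the medians and the one for the remaining segment. The time is
-- linear because the two lengths together are smaller than `m` by a constant fraction.
set_option maxHeartbeats 1000000 in
theorem selectLoop_spec {B : Bound} {R : St → ℕ → Prop} (m : ℕ) :
    ∀ {σ : St} {b W d k₀ : ℕ}, Task B σ b m W d → σ.reg .st = 0 →
    (∀ τ l, Selected (σ.buf b m) W (τ.reg .pv) → τ.reg .st = 1 → Resumed σ τ d →
      SameBelow b σ τ → SameTasks (d + 1) σ τ → l ≤ k₀ + 20000 * m → WP B selectLoop τ l R) →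
    WP B selectLoop σ k₀ R := by
  induction m using Nat.strong_induction_on with
  | _ m ih =>
  intro σ b W d k₀ hT hst hR
  have hok := hT.ok
  have h1 := hok.bk
  have h2 := hok.bw
  have h3 := hok.word
  have h4 := hok.big
  have h5 := hT.tb
  have h6 := hT.tl
  have h7 := hT.tw
  have h8 := hT.tbw
  have hm0 : 0 < m := by
    by_contra h
    obtain rfl : m = 0 := by omega
    have := hT.lt
    simp [St.buf] at this
  -- what happens when a pivot has been found
  have main : ∀ (σ₁ : St) (k₁ wt : ℕ), Task B σ₁ b m W d → σ₁.reg .st = 1 →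
      (σ₁.reg .pv, wt) ∈ σ.buf b m → SameBelow (b + m) σ σ₁ → SameTasks (d + 1) σ σ₁ →
      (∀ m' < m, (m' = ((σ.buf b m).filter (fun x => x.1 < σ₁.reg .pv)).length ∨
          m' = ((σ.buf b m).filter (fun x => σ₁.reg .pv < x.1)).length) →
          k₁ + 200 * m + 310 + 20000 * m' ≤ k₀ + 20000 * m) →
      k₁ + 200 * m + 310 ≤ k₀ + 20000 * m → WP B selectLoop σ₁ k₁ R := by
    intro σ₁ k₁ wt hT₁ hst₁ hp hsame hstack htime htime'
    have hbuf : σ₁.buf b m = σ.buf b m :=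
      St.buf_congr (fun j hj => (hsame j hj).1) (fun j hj => (hsame j hj).2)
    refine WP_while_true (by simp; omega) (by simp [hT₁.sp]) ?_
    rw [selectStep, WP_ite]
    refine ⟨by simp; omega, fun hc => ?_, fun _ => ?_⟩
    · simp [hst₁] at hc
    refine (partition_spec hT₁ (by rw [hbuf]; exact hp)).mono ?_
    rintro τ l ⟨hl, hlow, htb, htl, htw, hcase⟩
    rw [hbuf] at hcase
    have hlow' : SameBelow b σ τ := fun j hj => by
      have h1 := hsame j (by omega)
      have h2 := hlow j hj
      exact ⟨h2.1.trans h1.1, h2.2.trans h1.2⟩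
    have hstack' : SameTasks (d + 1) σ τ := fun e he => by
      rw [htb, htl, htw]; exact hstack e he
    rcases hcase with ⟨hsel, hpv, hst', hres⟩ | ⟨m', W', hm', hT', hst', hlen, hsel⟩
    · refine hR τ l (by rwa [hpv]) (by rw [hst', hst₁]) ?_ hlow' hstack' (by simp at hl ⊢; omega)
      have := hstack d (by omega)
      exact ⟨hres.sp, hres.sb.trans this.1, hres.sl.trans this.2.1, hres.sw.trans this.2.2⟩
    · refine ih m' hm' hT' hst' ?_
      intro τ' l' hsel' hst'' hres hlow'' hstack'' hl'
      refine hR τ' l' (hsel _ hsel') hst'' ?_ (fun j hj => ?_) (fun e he => ?_) ?_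
      · have := hstack' d (by omega)
        exact ⟨hres.sp, hres.sb.trans this.1, hres.sl.trans this.2.1, hres.sw.trans this.2.2⟩
      · have h1 := hlow' j hj
        have h2 := hlow'' j hj
        exact ⟨h2.1.trans h1.1, h2.2.trans h1.2⟩
      · have h1 := hstack' e he
        have h2 := hstack'' e he
        exact ⟨h2.1.trans h1.1, h2.2.1.trans h1.2.1, h2.2.2.trans h1.2.2⟩
      · have := htime m' hm' hlen
        simp at hl; omega
  refine WP_while_true (by simp; omega) (by simp [hT.sp]) ?_
  rw [selectStep, WP_ite]
  refine ⟨by simp; omega, fun _ => ?_, fun hc => ?_⟩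
  swap
  · simp [hst] at hc
  rw [WP_ite]
  refine ⟨by simp; omega, fun hc => ?_, fun hc => ?_⟩
  · have hm5 : m < 5 := by simpa [hT.sl] using hc
    rw [WP_seq, WP_asg, WP_asg]
    refine ⟨by simp [hT.sb]; omega, by simp; omega, ?_⟩
    refine main _ _ (σ.mem .bw b) ⟨by simp [hT.sb], by simp [hT.sl], by simp [hT.sw],
      by simp [hT.sp], hT.nodup, hT.lt, hT.word, hok, h5, h6, h7, h8⟩ (by simp) ?_
      (fun _ _ => ⟨rfl, rfl⟩) (fun _ _ => ⟨rfl, rfl, rfl⟩) ?_ ?_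
    · simp [hT.sb]
      exact mem_seg.2 ⟨0, hm0, by simp⟩
    · intro m' hm' _
      simp; omega
    · simp; omega
  · have hm5 : 5 ≤ m := by simpa [hT.sl] using hc
    rw [WP_seq]
    refine (mediansCmd_spec hT.sb hT.sl hok hT.nodup).frame.mono ?_
    rintro τ l ⟨⟨hg, hlo, hmed, hlow, hl⟩, hF⟩
    have e1 : τ.reg .sb = b := (hF.reg _ rfl).trans hT.sb
    have e2 : τ.reg .sl = m := (hF.reg _ rfl).trans hT.sl
    have e3 : τ.reg .sw = W := (hF.reg _ rfl).trans hT.sw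
    have e4 : τ.reg .sp = d + 1 := (hF.reg _ rfl).trans hT.sp
    have e6 : τ.reg .st = 0 := (hF.reg _ rfl).trans hst
    have e7 : τ.mem .tb = σ.mem .tb := hF.mem _ rfl
    have e8 : τ.mem .tl = σ.mem .tl := hF.mem _ rfl
    have e9 : τ.mem .tw = σ.mem .tw := hF.mem _ rfl
    set med := fun i => τ.mem .bk (b + m + i) with hmeddef
    have hinj : ∀ i < m / 5, ∀ j < m / 5, med i = med j → i = j := by
      intro i hi j hj e
      obtain ⟨x, hx, hx', -⟩ := (hmed i hi).1
      obtain ⟨y, hy, hy', -⟩ := (hmed j hj).1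
      simp at hx hy
      have := seg_inj hT.nodup (i := x - b) (j := y - b) (by omega) (by omega) (by
        rw [show b + (x - b) = x by omega, show b + (y - b) = y by omega, hx', hy']
        exact e)
      omega
    simp only [pushCmd, WP_seq, WP_sto, WP_asg]
    refine ⟨by simp, by simp, by simp [e4]; omega, by simp, by simp, by simp [e4]; omega,
      by simp, by simp, by simp [e4]; omega, by simp [e4]; omega, by simp, by simp,
      by simp; omega, ?_⟩
    set σ₁ := (((((((τ.setM .tb _ _).setM .tl _ _).setM .tw _ _).setR .sp _).setR .sb _).setR
      .sl _).setR .sw _) with hσ₁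
    have c1 : σ₁.reg .sb = b + m := by simp [σ₁, hlo]
    have c2 : σ₁.reg .sl = m / 5 := by simp [σ₁, hg]
    have c3 : σ₁.reg .sw = m / 5 / 2 := by simp [σ₁, hg]
    have c4 : σ₁.reg .sp = d + 1 + 1 := by simp [σ₁, e4]
    have c5 : σ₁.mem .bk = τ.mem .bk := by simp [σ₁]
    have c6 : σ₁.mem .bw = τ.mem .bw := by simp [σ₁]
    have c7 : σ₁.buf = τ.buf := by unfold St.buf; rw [c5, c6]
    have c8 : σ₁.reg .st = 0 := by simp [σ₁, e6]
    have c9 : σ₁.mem .tb = Function.update (σ.mem .tb) (d + 1) b := by simp [σ₁, e1, e4, e7]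
    have c10 : σ₁.mem .tl = Function.update (σ.mem .tl) (d + 1) m := by simp [σ₁, e2, e4, e8]
    have c11 : σ₁.mem .tw = Function.update (σ.mem .tw) (d + 1) W := by simp [σ₁, e3, e4, e9]
    have htot : total (τ.buf (b + m) (m / 5)) = m / 5 := by
      rw [total_one]
      · simp [St.buf]
      · intro x hx
        obtain ⟨j, hj, rfl⟩ := mem_seg.1 hx
        exact (hmed j hj).2
    refine ih (m / 5) (by omega) (b := b + m) (W := m / 5 / 2) (d := d + 1) ⟨c1, c2, c3, c4, ?_, ?_,
      ?_, ⟨?_, ?_, ?_, h4⟩, ?_, ?_, ?_, h8⟩ c8 ?_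
    · rw [c7]
      have : ((List.range (m / 5)).map med).Nodup := by
        apply List.Nodup.map_on _ List.nodup_range
        intro x hx y hy e
        exact hinj x (by simpa using hx) y (by simpa using hy) e
      simpa [St.buf, seg, Function.comp_def] using this
    · rw [c7, htot]; omega
    · rw [c7, htot]; omega
    · omega
    · omega
    · omega
    · omega
    · omega
    · omega
    intro τ' l' hsel hst' hres hlow' hstack' hl'
    rw [c7] at hsel
    obtain ⟨wt', hmem', hb1, hb2⟩ := hsel
    obtain ⟨i, hi, e⟩ := mem_seg.1 hmem'
    simp only [Prod.mk.injEq] at e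
    obtain rfl : wt' = 1 := e.2.symm.trans (hmed i hi).2
    -- With unit weights the weight below a key is its rank, so the key that was returned is the
    -- median of the medians.
    have hbelow : below (τ.buf (b + m) (m / 5)) (τ'.reg .pv) =
        ((Finset.Ico 0 (m / 5)).filter fun i => med i < τ'.reg .pv).card := by
      unfold below
      rw [total_one, St.buf, length_filter_seg (fun k => k < τ'.reg .pv)]
      · have : ((Finset.Ico 0 (m / 5)).map (addLeftEmbedding (b + m))) =
            Finset.Ico (b + m) (b + m + m / 5) := by
          rw [Finset.map_add_left_Ico]; simp
        rw [← this, Finset.filter_map, Finset.card_map]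
        rfl
      · intro x hx
        obtain ⟨j, hj, rfl⟩ := mem_seg.1 (List.mem_filter.1 hx).1
        exact (hmed j hj).2
    have hrank : ((Finset.Ico 0 (m / 5)).filter fun i => med i < τ'.reg .pv).card = m / 5 / 2 := by
      omega
    have hlen := length_filter_le (Z := σ.mem .bw) (fun i hi => (hmed i hi).1) ⟨i, hi, e.1⟩
      hrank
    have hsame' : SameBelow (b + m) σ τ' := fun j hj => by
      have h1 := hlow j hj
      have h2 := hlow' j hj
      rw [c5, c6] at h2
      exact ⟨h2.1.trans h1.1, h2.2.trans h1.2⟩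
    have hstk : SameTasks (d + 1) σ τ' := fun e he => by
      have := hstack' e (by omega)
      rw [c9, c10, c11] at this
      rwa [Function.update_of_ne (by omega), Function.update_of_ne (by omega),
        Function.update_of_ne (by omega)] at this
    have hbuf : τ'.buf b m = σ.buf b m :=
      St.buf_congr (fun j hj => (hsame' j hj).1) (fun j hj => (hsame' j hj).2)
    obtain ⟨x, hx, hx', -⟩ := (hmed i hi).1
    simp at hx
    refine main τ' l' (σ.mem .bw x) ⟨?_, ?_, ?_, hres.sp, by rw [hbuf]; exact hT.nodup,
      by rw [hbuf]; exact hT.lt, by rw [hbuf]; exact hT.word, hok, h5, h6, h7, h8⟩ hst' ?_ hsame'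
      hstk ?_ ?_
    · rw [hres.sb, c9]; simp
    · rw [hres.sl, c10]; simp
    · rw [hres.sw, c11]; simp
    · refine mem_seg.2 ⟨x - b, by omega, ?_⟩
      rw [show b + (x - b) = x by omega, hx', ← e.1]
    · intro m' hm' hlen'
      -- Hence the medians and the remaining segment together have at least half of `m / 5` cells
      -- fewer than the present segment. The allowance for these cells pays for the linear passes.
      have : 2 * m' + 3 * (m / 5) ≤ 2 * m := by
        rcases hlen' with rfl | rfl
        · exact hlen.1
        · exact hlen.2
      simp at hl hl'
      omega
    · simp at hl hl'
      omega

theorem selectCmd_spec {B : Bound} {σ : St} {m W k₀ : ℕ} (hm : σ.reg .sl = m) (hW : σ.reg .sw = W)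
    (hnd : ((σ.buf 0 m).map Prod.fst).Nodup) (hlt : W < total (σ.buf 0 m))
    (hword : total (σ.buf 0 m) < B.word) (hok : BufOk B (2 * m)) (htb : m + 1 < B.lim .tb)
    (htl : m + 1 < B.lim .tl) (htw : m + 1 < B.lim .tw) (hw : B.lim .tb ≤ B.word) :
    WP B selectCmd σ k₀ fun τ l => Selected (σ.buf 0 m) W (τ.reg .pv) ∧
      l ≤ k₀ + 20000 * m + 20 := by
  have h4 := hok.big
  simp only [selectCmd, WP_seq]
  rw [WP_asg, WP_asg, WP_asg]
  refine ⟨by simp; omega, by simp; omega, by simp; omega, ?_⟩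
  refine selectLoop_spec m (b := 0) (W := W) (d := 0) ⟨by simp, by simp [hm], by simp [hW],
    by simp, by simpa using hnd, by simpa using hlt, by simpa using hword, by simpa using hok,
    by omega, by omega, by omega, hw⟩ (by simp) ?_
  intro τ l hsel _ hres _ _ hl
  refine WP_while_false (by simp; omega) (by simp [hres.sp]) ⟨by simpa using hsel, ?_⟩
  simp at hl ⊢; omega

end WordRAM

/-! ### Optimal solutions close to a greedy solution -/

namespace WordRAM

/-- Bounded integers whose sum is bounded can be ordered such that all partial sums are bounded. -/
theorem exists_bounded_order {ι : Type*} (f : ι → ℤ) (V : ℤ) (M : Multiset ι) (P : ℤ)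
    (hf : ∀ i ∈ M, f i ≠ 0 ∧ |f i| ≤ V) (h1 : -V < P) (h2 : P ≤ V)
    (h3 : 0 ≤ P + (M.map f).sum) (h4 : P + (M.map f).sum ≤ V) :
    ∃ l : List ι, (l : Multiset ι) = M ∧
      ∀ k, -V < P + ((l.take k).map f).sum ∧ P + ((l.take k).map f).sum ≤ V := by
  induction hn : M.card generalizing M P with
  | zero =>
    obtain rfl := Multiset.card_eq_zero.1 hn
    exact ⟨[], rfl, fun k => by simp [h1, h2]⟩
  | succ n ih =>
    -- Continue with a positive number if the partial sum is not positive, and with a negative one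
    -- otherwise. In the first case one exists because the final sum is nonnegative. If in the
    -- second case no negative number is left, all further partial sums are bounded by the final
    -- one.
    have key : ∃ i ∈ M, -V < P + f i ∧ P + f i ≤ V := by
      by_cases hP : P ≤ 0
      · have : ∃ i ∈ M, 0 < f i := by
          by_contra! hno
          obtain ⟨i, hi⟩ := Multiset.card_pos_iff_exists_mem.1 (by omega : 0 < M.card)
          obtain ⟨M', rfl⟩ := Multiset.exists_cons_of_mem hi
          have h5 : 0 ≤ (M'.map fun i => -f i).sum := Multiset.sum_nonneg (by
            simpa using fun j hj => hno j (Multiset.mem_cons_of_mem hj))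
          rw [Multiset.sum_map_neg] at h5
          have h6 := hno i hi
          have h7 := (hf i hi).1
          rw [Multiset.map_cons, Multiset.sum_cons] at h3
          omega
        obtain ⟨i, hi, hpos⟩ := this
        have := abs_le.1 (hf i hi).2
        exact ⟨i, hi, by omega, by omega⟩
      · by_cases hneg : ∃ i ∈ M, f i < 0
        · obtain ⟨i, hi, hlt⟩ := hneg
          have := abs_le.1 (hf i hi).2
          exact ⟨i, hi, by omega, by omega⟩
        · push Not at hneg
          obtain ⟨i, hi⟩ := Multiset.card_pos_iff_exists_mem.1 (by omega : 0 < M.card)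
          obtain ⟨M', rfl⟩ := Multiset.exists_cons_of_mem hi
          have h5 : 0 ≤ (M'.map f).sum := Multiset.sum_nonneg (by
            simpa using fun j hj => hneg j (Multiset.mem_cons_of_mem hj))
          have h6 := hneg i hi
          rw [Multiset.map_cons, Multiset.sum_cons] at h4
          exact ⟨i, hi, by omega, by omega⟩
    obtain ⟨i, hi, h5, h6⟩ := key
    obtain ⟨M', rfl⟩ := Multiset.exists_cons_of_mem hi
    rw [Multiset.map_cons, Multiset.sum_cons] at h3 h4
    obtain ⟨l, rfl, hl⟩ := ih M' (P + f i) (fun j hj => hf j (Multiset.mem_cons_of_mem hj)) h5 h6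
      (by omega) (by omega) (by simpa using hn)
    refine ⟨i :: l, rfl, fun k => ?_⟩
    cases k with
    | zero => simp [h1, h2]
    | succ k => simpa [add_assoc] using hl k

/-- Many bounded integers whose sum is bounded have a nonempty part with sum zero. -/
theorem exists_zero_sum {ι : Type*} (f : ι → ℤ) (V : ℕ) (hV : 0 < V) (M : Multiset ι)
    (hf : ∀ i ∈ M, f i ≠ 0 ∧ |f i| ≤ V) (h3 : 0 ≤ (M.map f).sum) (h4 : (M.map f).sum ≤ V)
    (hM : 2 * V ≤ M.card) : ∃ M' ≤ M, M' ≠ 0 ∧ (M'.map f).sum = 0 := by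
  obtain ⟨l, rfl, hl⟩ := exists_bounded_order f V M 0 hf (by omega) (by omega) (by omega) (by omega)
  -- At least `2 * V + 1` partial sums, the empty one included, lie among the `2 * V` integers of
  -- the half-open interval, so two coincide and the block between them has sum zero.
  obtain ⟨x, hx, y, hy, hxy, he⟩ := Finset.exists_ne_map_eq_of_card_lt_of_maps_to
    (s := Finset.range (l.length + 1)) (t := Finset.Ioc (-V : ℤ) V)
    (f := fun k => ((l.take k).map f).sum) (by simp at hM ⊢; omega) (fun k _ => by
      have := hl k
      simp only [Finset.coe_Ioc, Set.mem_Ioc]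
      omega)
  wlog hlt : x < y generalizing x y
  · exact this y hy x hx hxy.symm he.symm (by omega)
  simp only [Finset.mem_range] at hx hy
  refine ⟨((l.take y).drop x : List ι), ?_, ?_, ?_⟩
  · exact Multiset.coe_le.2 (((l.take y).drop_sublist x).trans (l.take_sublist y)).subperm
  · intro h
    have := congrArg Multiset.card h
    simp at this
    omega
  · have h5 : ((l.take y).map f).sum = ((l.take x).map f).sum + (((l.take y).drop x).map f).sum := by
      rw [← List.sum_append, ← List.map_append]
      congr 2
      conv_lhs => rw [← List.take_append_drop x (l.take y)]
      rw [List.take_take, min_eq_left hlt.le]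
    simp only [Multiset.map_coe, Multiset.sum_coe]
    omega

/-! ### Proximity of optimal and greedy solutions -/

/-- Copies of items respect multiplicities and capacity. -/
def Feas (M : Finset ℕ) (s u : ℕ → ℕ) (t : ℕ) (x : ℕ → ℕ) : Prop :=
  (∀ i ∈ M, x i ≤ u i) ∧ ∑ i ∈ M, s i * x i ≤ t

theorem exists_optimal (M : Finset ℕ) (s v u : ℕ → ℕ) (t : ℕ) :
    ∃ y, Feas M s u t y ∧ ∀ x, Feas M s u t x → ∑ i ∈ M, v i * x i ≤ ∑ i ∈ M, v i * y i := by
  have hb : BddAbove {k | ∃ x, Feas M s u t x ∧ k = ∑ i ∈ M, v i * x i} := by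
    refine ⟨∑ i ∈ M, v i * u i, ?_⟩
    rintro k ⟨x, hx, rfl⟩
    exact Finset.sum_le_sum fun i hi => Nat.mul_le_mul_left _ (hx.1 i hi)
  obtain ⟨y, hy, he⟩ := Nat.sSup_mem (s := {k | ∃ x, Feas M s u t x ∧ k = ∑ i ∈ M, v i * x i})
    ⟨0, fun _ => 0, ⟨by simp, by simp⟩, by simp⟩ hb
  refine ⟨y, hy, fun x hx => ?_⟩
  rw [← he]
  exact le_csSup hb ⟨x, hx, rfl⟩

/-- Some optimal solution is close to a greedy solution. -/
theorem exists_optimal_near (M : Finset ℕ) (s v u g : ℕ → ℕ) (t V : ℕ)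
    (hv : ∀ i ∈ M, 0 < v i ∧ v i ≤ V) (hg : Feas M s u t g)
    (hc : (∀ i ∈ M, g i = u i) ∨ ∃ c ∈ M, t < ∑ i ∈ M, s i * g i + s c ∧
      ∀ i ∈ M, (g i < u i → s c * v i ≤ s i * v c) ∧ (0 < g i → s i * v c ≤ s c * v i)) :
    ∃ y, Feas M s u t y ∧ (∀ x, Feas M s u t x → ∑ i ∈ M, v i * x i ≤ ∑ i ∈ M, v i * y i) ∧
      ∑ i ∈ M, ((y i - g i) + (g i - y i)) ≤ 2 * V := by
  classical
  rcases hc with hc | ⟨c, hcM, hct, hcr⟩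
  · refine ⟨g, hg, fun x hx => Finset.sum_le_sum fun i hi => ?_, by simp⟩
    rw [hc i hi]
    exact Nat.mul_le_mul_left _ (hx.1 i hi)
  obtain ⟨y₀, hy₀, hopt₀⟩ := exists_optimal M s v u t
  -- Among the optimal solutions one of least distance to `g` is taken.
  have hex : ∃ d, ∃ y, Feas M s u t y ∧
      (∀ x, Feas M s u t x → ∑ i ∈ M, v i * x i ≤ ∑ i ∈ M, v i * y i) ∧
      ∑ i ∈ M, ((y i - g i) + (g i - y i)) = d := ⟨_, y₀, hy₀, hopt₀, rfl⟩
  obtain ⟨y, hy, hopt, hd⟩ := Nat.find_spec hex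
  have hmin := fun d hd' => Nat.find_min (m := d) hex hd'
  rw [← hd] at hmin
  refine ⟨y, hy, hopt, ?_⟩
  by_contra! hfar
  set e : ℕ → ℤ := fun i => (y i : ℤ) - g i with he
  set sg : ℕ → ℤ := fun i => if g i ≤ y i then 1 else -1 with hsg
  -- The unit changes that lead from `g` to `y`: each item occurs as often as the two solutions
  -- differ in it, and `sg` gives the direction.
  set W : Multiset ℕ := ∑ i ∈ M, Multiset.replicate ((y i - g i) + (g i - y i)) i with hW
  have hWmap : ∀ F : ℕ → ℤ, (W.map F).sum =
      ∑ i ∈ M, (((y i - g i) + (g i - y i) : ℕ) : ℤ) * F i := by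
    intro F
    rw [hW, ← Multiset.coe_mapAddMonoidHom, map_sum, Multiset.sum_sum]
    refine Finset.sum_congr rfl fun i _ => ?_
    simp
  have hWmem : ∀ i ∈ W, i ∈ M ∧ y i ≠ g i := by
    intro i hi
    rw [hW, Multiset.mem_sum] at hi
    obtain ⟨j, hj, hij⟩ := hi
    rw [Multiset.mem_replicate] at hij
    obtain ⟨h1, rfl⟩ := hij
    exact ⟨hj, by omega⟩
  have hWcard : W.card = ∑ i ∈ M, ((y i - g i) + (g i - y i)) := by
    rw [hW, Multiset.card_sum]; simp
  have hWcount : ∀ i ∈ M, W.count i = (y i - g i) + (g i - y i) := by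
    intro i hi
    rw [hW, Multiset.count_sum', Finset.sum_eq_single i]
    · simp
    · intro j _ hj
      simp [Multiset.count_replicate, hj]
    · exact fun h => absurd hi h
  -- Compared with the critical item `c`, no change is profitable: an added copy is at most as
  -- efficient as `c`, a removed one at least as efficient. The product form avoids division.
  have hratio : ∀ i ∈ M, y i ≠ g i → 0 ≤ sg i * ((s i : ℤ) * v c - s c * v i) := by
    intro i hi hne
    by_cases h : g i ≤ y i
    · have h1 := (hcr i hi).1 (by have := hy.1 i hi; omega)
      have h2 : (s c : ℤ) * v i ≤ s i * v c := by exact_mod_cast h1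
      simp only [hsg, h, if_true]; linarith
    · have h1 := (hcr i hi).2 (by omega)
      have h2 : (s i : ℤ) * v c ≤ s c * v i := by exact_mod_cast h1
      simp only [hsg, h, if_false]; linarith
  have hdist : ∀ i, (((y i - g i) + (g i - y i) : ℕ) : ℤ) * sg i = e i := by
    intro i
    by_cases h : g i ≤ y i
    · simp only [hsg, h, if_true, he]; omega
    · simp only [hsg, h, if_false, he]; omega
  have hvsum : (W.map fun i => sg i * v i).sum = ∑ i ∈ M, (v i : ℤ) * e i := by
    rw [hWmap]
    refine Finset.sum_congr rfl fun i _ => ?_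
    rw [← hdist]; ring
  have hval0 : 0 ≤ ∑ i ∈ M, (v i : ℤ) * e i := by
    have h1 : (∑ i ∈ M, (v i : ℤ) * g i) ≤ ∑ i ∈ M, (v i : ℤ) * y i := by
      exact_mod_cast hopt g hg
    have h2 : ∑ i ∈ M, (v i : ℤ) * e i = ∑ i ∈ M, (v i : ℤ) * y i - ∑ i ∈ M, (v i : ℤ) * g i := by
      rw [← Finset.sum_sub_distrib]
      exact Finset.sum_congr rfl fun i _ => by rw [he]; ring
    omega
  -- The changes add less than `s c` to the size, because `g` leaves less than that unused. At an
  -- efficiency no better than that of `c` they gain at most `v c`.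
  have hval1 : ∑ i ∈ M, (v i : ℤ) * e i ≤ V := by
    have h1 : 0 ≤ ∑ i ∈ M, e i * ((s i : ℤ) * v c - s c * v i) := by
      refine Finset.sum_nonneg fun i hi => ?_
      rw [← hdist, mul_assoc]
      by_cases h : y i = g i
      · simp [h]
      · exact mul_nonneg (by positivity) (hratio i hi h)
    have h2 : ∑ i ∈ M, e i * ((s i : ℤ) * v c - s c * v i) =
        v c * (∑ i ∈ M, (s i : ℤ) * e i) - s c * ∑ i ∈ M, (v i : ℤ) * e i := by
      rw [Finset.mul_sum, Finset.mul_sum, ← Finset.sum_sub_distrib]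
      exact Finset.sum_congr rfl fun i _ => by ring
    have h3 : ∑ i ∈ M, (s i : ℤ) * e i = ∑ i ∈ M, (s i : ℤ) * y i - ∑ i ∈ M, (s i : ℤ) * g i := by
      rw [← Finset.sum_sub_distrib]
      exact Finset.sum_congr rfl fun i _ => by rw [he]; ring
    have h4 : (∑ i ∈ M, (s i : ℤ) * y i) ≤ t := by exact_mod_cast hy.2
    have h5 : (t : ℤ) < ∑ i ∈ M, (s i : ℤ) * g i + s c := by exact_mod_cast hct
    have h6 : ((∑ i ∈ M, s i * g i : ℕ) : ℤ) ≤ t := by exact_mod_cast hg.2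
    push_cast at h6
    have h7 : (v c : ℤ) ≤ V := by exact_mod_cast (hv c hcM).2
    have h8 : (0 : ℤ) < v c := by exact_mod_cast (hv c hcM).1
    have h9 : (0 : ℤ) < s c := by omega
    set X := ∑ i ∈ M, (v i : ℤ) * e i
    by_contra! h
    have h10 : (v c : ℤ) * ∑ i ∈ M, (s i : ℤ) * e i ≤ v c * s c :=
      mul_le_mul_of_nonneg_left (by omega) h8.le
    have h11 : (s c : ℤ) * v c < s c * X := mul_lt_mul_of_pos_left (by omega) h9
    rw [mul_comm (s c : ℤ) (v c)] at h11
    omega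
  obtain ⟨W', hW', hne, hsum⟩ := exists_zero_sum (fun i => sg i * (v i : ℤ)) V
    (lt_of_lt_of_le (hv c hcM).1 (hv c hcM).2) W (by
      intro i hi
      obtain ⟨hi, -⟩ := hWmem i hi
      have := hv i hi
      by_cases h : g i ≤ y i <;> simp [hsg, h] <;> omega)
    (by rw [hvsum]; exact hval0) (by rw [hvsum]; exact hval1) (by omega)
  have hcount : ∀ i ∈ M, W'.count i ≤ (y i - g i) + (g i - y i) := fun i hi =>
    (Multiset.count_le_of_le i hW').trans (hWcount i hi).le
  have hW'map : ∀ F : ℕ → ℤ, (W'.map F).sum = ∑ i ∈ M, (W'.count i : ℤ) * F i := by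
    intro F
    rw [Finset.sum_multiset_map_count]
    simp only [nsmul_eq_mul]
    refine Finset.sum_subset (fun i hi => ?_) (fun i _ hi => ?_)
    · exact (hWmem i (Multiset.mem_of_le hW' (Multiset.mem_toFinset.1 hi))).1
    · rw [Multiset.mem_toFinset, ← Multiset.count_eq_zero] at hi
      simp [hi]
  -- The changes in the zero-sum part `W'` are undone. The result is still optimal but nearer to
  -- `g`.
  set z : ℕ → ℕ := fun i => if g i ≤ y i then y i - W'.count i else y i + W'.count i with hz
  have hze : ∀ i ∈ M, (z i : ℤ) = y i - W'.count i * sg i := by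
    intro i hi
    have := hcount i hi
    by_cases h : g i ≤ y i
    · simp only [hz, hsg, h, if_true]; omega
    · simp only [hz, hsg, h, if_false]; omega
  have hlin : ∀ F : ℕ → ℕ, ((∑ i ∈ M, F i * z i : ℕ) : ℤ) =
      (∑ i ∈ M, F i * y i : ℕ) - (W'.map fun i => sg i * (F i : ℤ)).sum := by
    intro F
    rw [hW'map]
    push_cast
    rw [← Finset.sum_sub_distrib]
    exact Finset.sum_congr rfl fun i hi => by rw [hze i hi]; ring
  have hzval : ∑ i ∈ M, v i * z i = ∑ i ∈ M, v i * y i := by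
    have := hlin v
    omega
  -- By `hratio`, changes of total value zero cannot have saved size, so undoing them does not
  -- exceed the capacity.
  have hzs : 0 ≤ (W'.map fun i => sg i * (s i : ℤ)).sum := by
    have h1 : 0 ≤ (W'.map fun i => sg i * ((s i : ℤ) * v c - s c * v i)).sum := by
      refine Multiset.sum_nonneg fun x hx => ?_
      obtain ⟨i, hi, rfl⟩ := Multiset.mem_map.1 hx
      obtain ⟨h1, h2⟩ := hWmem i (Multiset.mem_of_le hW' hi)
      exact hratio i h1 h2
    have h2 : (W'.map fun i => sg i * ((s i : ℤ) * v c - s c * v i)).sum =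
        v c * (W'.map fun i => sg i * (s i : ℤ)).sum -
          s c * (W'.map fun i => sg i * (v i : ℤ)).sum := by
      rw [hW'map, hW'map, hW'map, Finset.mul_sum, Finset.mul_sum, ← Finset.sum_sub_distrib]
      exact Finset.sum_congr rfl fun i _ => by ring
    rw [h2, hsum, mul_zero, sub_zero] at h1
    have h8 : (0 : ℤ) < v c := by exact_mod_cast (hv c hcM).1
    exact nonneg_of_mul_nonneg_right h1 h8
  have hzf : Feas M s u t z := by
    refine ⟨fun i hi => ?_, ?_⟩
    · have h1 := hcount i hi
      have h2 := hy.1 i hi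
      have h3 := hg.1 i hi
      by_cases h : g i ≤ y i
      · simp only [hz, h, if_true]; omega
      · simp only [hz, h, if_false]; omega
    · have := hlin s
      have := hy.2
      omega
  refine hmin (∑ i ∈ M, ((z i - g i) + (g i - z i))) ?_
    ⟨z, hzf, fun x hx => hzval ▸ hopt x hx, rfl⟩
  have hstep : ∀ i ∈ M, (z i - g i) + (g i - z i) + W'.count i = (y i - g i) + (g i - y i) := by
    intro i hi
    have h1 := hcount i hi
    by_cases h : g i ≤ y i
    · simp only [hz, h, if_true]; omega
    · simp only [hz, h, if_false]; omega
  have h0 : ∑ i ∈ M, ((z i - g i) + (g i - z i)) + ∑ i ∈ M, W'.count i =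
      ∑ i ∈ M, ((y i - g i) + (g i - y i)) := by
    rw [← Finset.sum_add_distrib]
    exact Finset.sum_congr rfl hstep
  obtain ⟨i, hi⟩ := Multiset.exists_mem_of_ne_zero hne
  have hiM := (hWmem i (Multiset.mem_of_le hW' hi)).1
  have h1 : W'.count i ≤ ∑ i ∈ M, W'.count i :=
    Finset.single_le_sum (f := fun i => W'.count i) (fun _ _ => Nat.zero_le _) hiM
  have h2 := Multiset.count_pos.2 hi
  omega

end WordRAM

/-! ### Classes of items with equal values -/

namespace WordRAM

/-- The data of an instance, with an upper bound `V` on the values of the items. -/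
structure Inst where
  n : ℕ
  t : ℕ
  V : ℕ
  s : ℕ → ℕ
  v : ℕ → ℕ
  u : ℕ → ℕ
  le : ∀ i < n, v i ≤ V

namespace Inst

variable (I : Inst)

/-- The items with positive values. -/
def items : Finset ℕ := (Finset.range I.n).filter (0 < I.v ·)

/-- The items of value `a`. -/
def cls (a : ℕ) : Finset ℕ := (Finset.range I.n).filter (I.v · = a)

/-- Keys order the items by the ratio of size and value. -/
def key (i : ℕ) : ℕ := (I.s i * I.V ^ 2 / I.v i) * I.n + i

/-- The number of copies in a class with keys less than `p`. -/
def cum (a p : ℕ) : ℕ := ∑ i ∈ (I.cls a).filter (I.key · < p), I.u i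

/-- The number of copies in a class. -/
def tot (a : ℕ) : ℕ := ∑ i ∈ I.cls a, I.u i

/-- How the first `c` copies of a class are distributed to the items. -/
def pre (a c i : ℕ) : ℕ := min (I.u i) (c - I.cum a (I.key i))

/-- The total size of the first `c` copies of a class. -/
def preSize (a c : ℕ) : ℕ := ∑ i ∈ I.cls a, I.s i * I.pre a c i

/-- Copy number `r` of class `a` is a copy of item `i`. -/
def AtRank (a r i : ℕ) : Prop :=
  i ∈ I.cls a ∧ I.cum a (I.key i) ≤ r ∧ r < I.cum a (I.key i) + I.u i

variable {I} {a i j r p : ℕ}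

theorem mem_cls : i ∈ I.cls a ↔ i < I.n ∧ I.v i = a := by simp [cls]

theorem mem_items : i ∈ I.items ↔ i < I.n ∧ 0 < I.v i := by simp [items]

/-- The index in the lowest digit makes keys distinct, and lets the program recover the item from
its key. -/
theorem key_mod (h : i < I.n) : I.key i % I.n = i := by
  rw [key, mul_comm, Nat.mul_add_mod, Nat.mod_eq_of_lt h]

theorem key_inj (hi : i < I.n) (hj : j < I.n) (h : I.key i = I.key j) : i = j := by
  rw [← key_mod hi, ← key_mod hj, h]

/-- Two different ratios with denominators at most `V` differ by at least `1 / V²`. So after scaling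
by `V²` their integer parts still differ, and rounding in the key loses nothing. -/
theorem key_ratio (hi : i < I.n) (hj : j < I.n) (hvi : 0 < I.v i) (hvj : 0 < I.v j)
    (h : I.key i ≤ I.key j) : I.s i * I.v j ≤ I.s j * I.v i := by
  by_contra! hlt
  have h1 : I.s j * I.V ^ 2 / I.v j + 1 ≤ I.s i * I.V ^ 2 / I.v i := by
    rw [Nat.le_div_iff_mul_le hvi]
    have h2 := Nat.div_mul_le_self (I.s j * I.V ^ 2) (I.v j)
    set x := I.s j * I.V ^ 2 / I.v j
    have h3 : I.v j * I.v i ≤ I.V ^ 2 := by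
      rw [sq]; exact Nat.mul_le_mul (I.le j hj) (I.le i hi)
    have h4 : (I.s j * I.v i + 1) * I.V ^ 2 ≤ I.s i * I.v j * I.V ^ 2 := Nat.mul_le_mul_right _ hlt
    have h5 : x * I.v j * I.v i ≤ I.s j * I.V ^ 2 * I.v i := Nat.mul_le_mul_right _ h2
    refine le_of_mul_le_mul_right ?_ hvj
    calc (x + 1) * I.v i * I.v j = x * I.v j * I.v i + I.v j * I.v i := by ring
      _ ≤ I.s j * I.V ^ 2 * I.v i + I.V ^ 2 := by omega
      _ = (I.s j * I.v i + 1) * I.V ^ 2 := by ring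
      _ ≤ I.s i * I.v j * I.V ^ 2 := h4
      _ = I.s i * I.V ^ 2 * I.v j := by ring
  have h2 : (I.s j * I.V ^ 2 / I.v j + 1) * I.n ≤ I.s i * I.V ^ 2 / I.v i * I.n :=
    Nat.mul_le_mul_right _ h1
  rw [add_mul, one_mul] at h2
  unfold key at h
  omega

theorem key_size (ha : 0 < a) (hi : i ∈ I.cls a) (hj : j ∈ I.cls a) (h : I.key i ≤ I.key j) :
    I.s i ≤ I.s j := by
  rw [mem_cls] at hi hj
  have := key_ratio hi.1 hj.1 (by omega) (by omega) h
  rw [hi.2, hj.2] at this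
  exact Nat.le_of_mul_le_mul_right this ha

theorem cum_mono (a : ℕ) {p q : ℕ} (h : p ≤ q) : I.cum a p ≤ I.cum a q := by
  refine Finset.sum_le_sum_of_subset fun i hi => ?_
  simp only [Finset.mem_filter] at hi ⊢
  exact ⟨hi.1, by omega⟩

theorem cum_le_tot (a p : ℕ) : I.cum a p ≤ I.tot a :=
  Finset.sum_le_sum_of_subset (Finset.filter_subset _ _)

theorem cum_eq_tot (h : ∀ i ∈ I.cls a, I.key i < p) : I.cum a p = I.tot a := by
  rw [cum, Finset.filter_true_of_mem h, tot]

theorem cum_succ_of_mem (hi : i ∈ I.cls a) : I.cum a (I.key i + 1) = I.cum a (I.key i) + I.u i := by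
  have : (I.cls a).filter (I.key · < I.key i + 1) =
      insert i ((I.cls a).filter (I.key · < I.key i)) := by
    ext j
    simp only [Finset.mem_filter, Finset.mem_insert]
    constructor
    · rintro ⟨h1, h2⟩
      rcases Nat.lt_succ_iff_lt_or_eq.1 h2 with h | h
      · exact .inr ⟨h1, h⟩
      · exact .inl (key_inj (mem_cls.1 h1).1 (mem_cls.1 hi).1 h)
    · rintro (rfl | h)
      · exact ⟨hi, by omega⟩
      · exact ⟨h.1, by omega⟩
  rw [cum, this, Finset.sum_insert (by simp), cum, add_comm]

theorem cum_succ_of_forall_ne (h : ∀ i ∈ I.cls a, I.key i ≠ p) : I.cum a (p + 1) = I.cum a p := by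
  rw [cum, cum]
  congr 1
  refine Finset.filter_congr fun i hi => ?_
  have := h i hi
  omega

theorem cum_add_le (hi : i ∈ I.cls a) (h : I.key i < p) : I.cum a (I.key i) + I.u i ≤ I.cum a p := by
  rw [← cum_succ_of_mem hi]
  exact cum_mono a h

/-- At the first key where the cumulative number of copies exceeds `r`, the number must jump, so
this key belongs to an item of the class. -/
theorem exists_atRank (h : r < I.tot a) : ∃ i, I.AtRank a r i := by
  have hex : ∃ p, r < I.cum a (p + 1) := by
    refine ⟨(I.cls a).sup I.key, ?_⟩
    rwa [cum_eq_tot fun i hi => Nat.lt_succ_of_le (Finset.le_sup hi)]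
  classical
  have h1 := Nat.find_spec hex
  have h2 : I.cum a (Nat.find hex) ≤ r := by
    rcases h0 : Nat.find hex with _ | p
    · simp [cum]
    · exact not_lt.1 (Nat.find_min hex (m := p) (by omega))
  by_cases h3 : ∃ i ∈ I.cls a, I.key i = Nat.find hex
  · obtain ⟨i, hi, he⟩ := h3
    rw [← he] at h1 h2
    exact ⟨i, hi, h2, by rwa [cum_succ_of_mem hi] at h1⟩
  · push Not at h3
    rw [cum_succ_of_forall_ne h3] at h1
    omega

theorem AtRank.lt (h : I.AtRank a r i) : r < I.tot a := by
  have := cum_add_le h.1 (Nat.lt_add_one (I.key i))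
  have := I.cum_le_tot a (I.key i + 1)
  have := h.2.2
  omega

theorem AtRank.key_le {r' : ℕ} (hi : I.AtRank a r i) (hj : I.AtRank a r' j) (h : r ≤ r') :
    I.key i ≤ I.key j := by
  by_contra! hlt
  have := cum_add_le hj.1 hlt
  have := hi.2.1
  have := hj.2.2
  omega

theorem AtRank.size_le {r' : ℕ} (ha : 0 < a) (hi : I.AtRank a r i) (hj : I.AtRank a r' j)
    (h : r ≤ r') : I.s i ≤ I.s j := key_size ha hi.1 hj.1 (hi.key_le hj h)

theorem AtRank.pre_lt (hi : I.AtRank a r i) (hj : j ∈ I.cls a) (h : I.key j < I.key i) {c : ℕ}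
    (hc : r ≤ c) : I.pre a c j = I.u j := by
  have := cum_add_le hj h
  have := hi.2.1
  unfold pre
  omega

theorem AtRank.pre_gt (hi : I.AtRank a r i) (h : I.key i < I.key j) {c : ℕ}
    (hc : c ≤ r + 1) : I.pre a c j = 0 := by
  have := cum_add_le hi.1 h
  have := hi.2.2
  unfold pre
  omega

theorem AtRank.pre_succ (hi : I.AtRank a r i) (hj : j ∈ I.cls a) :
    I.pre a (r + 1) j = I.pre a r j + if j = i then 1 else 0 := by
  rcases lt_trichotomy (I.key j) (I.key i) with h | h | h
  · have : j ≠ i := by rintro rfl; omega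
    rw [hi.pre_lt hj h (by omega), hi.pre_lt hj h le_rfl, if_neg this, add_zero]
  · obtain rfl := key_inj (mem_cls.1 hj).1 (mem_cls.1 hi.1).1 h
    have := hi.2
    rw [if_pos rfl]
    unfold pre
    omega
  · have : j ≠ i := by rintro rfl; omega
    rw [hi.pre_gt h le_rfl, hi.pre_gt h (by omega), if_neg this]

theorem pre_zero : I.pre a 0 i = 0 := by simp [pre]

theorem preSize_zero (I : Inst) (a : ℕ) : I.preSize a 0 = 0 := by simp [preSize, pre_zero]

theorem AtRank.preSize_succ (hi : I.AtRank a r i) :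
    I.preSize a (r + 1) = I.preSize a r + I.s i := by
  have : ∀ j ∈ I.cls a, I.s j * I.pre a (r + 1) j = I.s j * I.pre a r j +
      if j = i then I.s i else 0 := by
    intro j hj
    rw [hi.pre_succ hj]
    split
    · subst j; ring
    · ring
  rw [preSize, Finset.sum_congr rfl this, Finset.sum_add_distrib, Finset.sum_ite_eq' _ i,
    if_pos hi.1]
  rfl

theorem sum_pre {c : ℕ} (h : c ≤ I.tot a) : ∑ i ∈ I.cls a, I.pre a c i = c := by
  induction c with
  | zero => simp [pre_zero]
  | succ c ih =>
    obtain ⟨i, hi⟩ := exists_atRank h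
    rw [Finset.sum_congr rfl fun j hj => hi.pre_succ hj, Finset.sum_add_distrib, ih (by omega),
      Finset.sum_ite_eq' _ i, if_pos hi.1]

theorem preSize_mono_of_le {c d : ℕ} (h : c ≤ d) : I.preSize a c ≤ I.preSize a d :=
  Finset.sum_le_sum fun i _ => Nat.mul_le_mul_left _ (by unfold pre; omega)

/-- The first copies of a class have the least size among all choices of equally many copies. -/
theorem preSize_le (ha : 0 < a) {y : ℕ → ℕ} (hy : ∀ i ∈ I.cls a, y i ≤ I.u i) :
    I.preSize a (∑ i ∈ I.cls a, y i) ≤ ∑ i ∈ I.cls a, I.s i * y i := by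
  have hle : ∑ i ∈ I.cls a, y i ≤ I.tot a := Finset.sum_le_sum hy
  have hsum := sum_pre hle
  rcases hc : ∑ i ∈ I.cls a, y i with _ | r
  · simp [preSize_zero]
  rw [hc] at hsum hle
  obtain ⟨k, hk⟩ := exists_atRank (show r < I.tot a by omega)
  -- Exchange argument at the item `k` of the last copy taken. Items before `k` are taken completely
  -- and are no larger than `k`; items behind it are not taken and are no smaller. So both factors
  -- have the same sign. In the sum over the class the term with `s k` vanishes, as the numbers of
  -- copies agree.
  have h1 : ∀ i ∈ I.cls a, (0 : ℤ) ≤ ((y i : ℤ) - I.pre a (r + 1) i) * ((I.s i : ℤ) - I.s k) := by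
    intro i hi
    rcases lt_or_ge (I.key i) (I.key k) with h | h
    · have h2 := key_size ha hi hk.1 h.le
      have h3 := hk.pre_lt hi h (Nat.le_succ r)
      have h4 := hy i hi
      rw [Nat.succ_eq_add_one] at h3
      rw [h3]
      exact mul_nonneg_of_nonpos_of_nonpos (by omega) (by omega)
    · rcases h.eq_or_lt with h | h
      · obtain rfl := key_inj (mem_cls.1 hk.1).1 (mem_cls.1 hi).1 h
        simp
      · have h2 := key_size ha hk.1 hi h.le
        rw [hk.pre_gt h le_rfl]
        exact mul_nonneg (by omega) (by omega)
  have h2 := Finset.sum_nonneg h1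
  have h3 : ∑ i ∈ I.cls a, ((y i : ℤ) - I.pre a (r + 1) i) * ((I.s i : ℤ) - I.s k) =
      (∑ i ∈ I.cls a, I.s i * y i : ℕ) - (I.preSize a (r + 1) : ℕ) -
        I.s k * ((∑ i ∈ I.cls a, y i : ℕ) - (∑ i ∈ I.cls a, I.pre a (r + 1) i : ℕ)) := by
    rw [preSize]
    push_cast
    rw [← Finset.sum_sub_distrib, ← Finset.sum_sub_distrib, Finset.mul_sum,
      ← Finset.sum_sub_distrib]
    exact Finset.sum_congr rfl fun i _ => by ring
  rw [h3, hsum, hc] at h2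
  have h4 : ((r + 1 : ℕ) : ℤ) - ((r + 1 : ℕ) : ℤ) = 0 := sub_self _
  rw [h4, mul_zero] at h2
  omega

/-- Sums over all items of positive values, class by class. -/
theorem sum_items {M : Type*} [AddCommMonoid M] (I : Inst) (f : ℕ → M) :
    ∑ i ∈ I.items, f i = ∑ a ∈ Finset.Icc 1 I.V, ∑ i ∈ I.cls a, f i := by
  rw [← Finset.sum_fiberwise_of_maps_to (s := I.items) (t := Finset.Icc 1 I.V) (g := I.v)]
  · refine Finset.sum_congr rfl fun a ha => Finset.sum_congr ?_ fun _ _ => rfl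
    ext i
    simp only [Finset.mem_Icc] at ha
    simp only [Finset.mem_filter, mem_items, mem_cls]
    omega
  · intro i hi
    rw [mem_items] at hi
    have := I.le i hi.1
    simp only [Finset.mem_Icc]
    omega

/-! ### The greedy solution -/

variable (I)

/-- The total size of the copies with keys less than `p`. -/
def load (p : ℕ) : ℕ := ∑ i ∈ I.items.filter (I.key · < p), I.s i * I.u i

/-- The greedy solution with critical key `p`. -/
def greedy (p i : ℕ) : ℕ :=
  if I.key i < p then I.u i else if I.key i = p then (I.t - I.load p) / I.s i else 0

/-- `p` is the key at which the copies, in the order of the keys, exceed the capacity. -/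
def Critical (p : ℕ) : Prop :=
  ((∀ i ∈ I.items, I.key i < p) ∧ I.load p ≤ I.t) ∨
    ∃ c ∈ I.items, I.key c = p ∧ I.load p ≤ I.t ∧ I.t < I.load p + I.s c * I.u c

variable {I}

theorem greedy_le (hp : I.Critical p) (hi : i ∈ I.items) : I.greedy p i ≤ I.u i := by
  unfold greedy
  split
  · exact le_rfl
  split
  · rename_i h1 h2
    rcases hp with ⟨h3, -⟩ | ⟨c, hc, hk, h3, h4⟩
    · exact absurd (h3 i hi) h1
    · obtain rfl := key_inj (mem_items.1 hi).1 (mem_items.1 hc).1 (h2.trans hk.symm)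
      exact Nat.div_le_of_le_mul (by omega)
  · exact Nat.zero_le _

theorem sum_greedy_of_forall (h : ∀ i ∈ I.items, I.key i < p) :
    ∑ i ∈ I.items, I.s i * I.greedy p i = I.load p := by
  rw [load, Finset.filter_true_of_mem h]
  exact Finset.sum_congr rfl fun i hi => by rw [greedy, if_pos (h i hi)]

theorem sum_greedy_of_mem {c : ℕ} (hc : c ∈ I.items) (hk : I.key c = p) :
    ∑ i ∈ I.items, I.s i * I.greedy p i = I.load p + I.s c * ((I.t - I.load p) / I.s c) := by
  have : ∀ i ∈ I.items, I.s i * I.greedy p i = (if I.key i < p then I.s i * I.u i else 0) +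
      if i = c then I.s c * ((I.t - I.load p) / I.s c) else 0 := by
    intro i hi
    by_cases hic : i = c
    · subst i
      simp [greedy, hk]
    · have : I.key i ≠ p := fun h =>
        hic (key_inj (mem_items.1 hi).1 (mem_items.1 hc).1 (h.trans hk.symm))
      simp only [greedy, this, if_false, hic, add_zero]
      split <;> simp
  rw [Finset.sum_congr rfl this, Finset.sum_add_distrib, Finset.sum_ite_eq' _ c, if_pos hc,
    ← Finset.sum_filter]
  rfl

theorem Critical.sum_le (hp : I.Critical p) : ∑ i ∈ I.items, I.s i * I.greedy p i ≤ I.t := by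
  rcases hp with ⟨h3, h⟩ | ⟨c, hc, hk, h3, h4⟩
  · rwa [sum_greedy_of_forall h3]
  · rw [sum_greedy_of_mem hc hk]
    have := Nat.mul_div_le (I.t - I.load p) (I.s c)
    omega

/-- Some optimal solution is close to the greedy solution. -/
theorem Critical.exists_optimal (hp : I.Critical p) :
    ∃ y, Feas I.items I.s I.u I.t y ∧
      (∀ x, Feas I.items I.s I.u I.t x → ∑ i ∈ I.items, I.v i * x i ≤ ∑ i ∈ I.items, I.v i * y i) ∧
      ∑ i ∈ I.items, ((y i - I.greedy p i) + (I.greedy p i - y i)) ≤ 2 * I.V := by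
  refine exists_optimal_near _ _ _ _ _ _ _ (fun i hi => ?_) ⟨fun i hi => greedy_le hp hi,
    hp.sum_le⟩ ?_
  · rw [mem_items] at hi
    exact ⟨hi.2, I.le i hi.1⟩
  · rcases hp with ⟨h3, h⟩ | ⟨c, hc, hk, h3, h4⟩
    · exact .inl fun i hi => by rw [greedy, if_pos (h3 i hi)]
    · refine .inr ⟨c, hc, ?_, fun i hi => ⟨fun h => ?_, fun h => ?_⟩⟩
      · rw [sum_greedy_of_mem hc hk]
        have h5 : 0 < I.s c := by
          rcases Nat.eq_zero_or_pos (I.s c) with h0 | h0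
          · rw [h0, zero_mul] at h4; omega
          · exact h0
        -- The capacity left unused is the remainder of the division by the size of the critical
        -- item.
        have h6 := Nat.div_add_mod (I.t - I.load p) (I.s c)
        have h7 := Nat.mod_lt (I.t - I.load p) h5
        omega
      · have : I.key c ≤ I.key i := by
          by_contra! h'
          rw [greedy, if_pos (by omega)] at h
          omega
        exact key_ratio (mem_items.1 hc).1 (mem_items.1 hi).1 (mem_items.1 hc).2
          (mem_items.1 hi).2 this
      · have : I.key i ≤ I.key c := by
          by_contra! h'
          rw [greedy, if_neg (by omega), if_neg (by omega)] at h
          omega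
        exact key_ratio (mem_items.1 hi).1 (mem_items.1 hc).1 (mem_items.1 hi).2
          (mem_items.1 hc).2 this

end Inst

end WordRAM

/-! ### Dynamic programming around the greedy solution -/

namespace WordRAM

namespace Inst

variable (I : Inst)

/-- The number of copies of class `a` in the greedy solution. -/
def quota (p a : ℕ) : ℕ := ∑ i ∈ I.cls a, I.greedy p i

/-- The least number of copies of class `a` that is considered. -/
def low (p a : ℕ) : ℕ := I.quota p a - 2 * I.V

/-- The number of further copies of class `a` that are considered. -/
def width (p a : ℕ) : ℕ := min (I.tot a) (I.quota p a + 2 * I.V) - I.low p a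

/-- The number of further copies of class `a` in the greedy solution. -/
def shift (p a : ℕ) : ℕ := I.quota p a - I.low p a

/-- The size of the first `d` further copies of class `a`. -/
def gap (p a d : ℕ) : ℕ := I.preSize a (I.low p a + d) - I.preSize a (I.low p a)

/-- The size of the copies that are always taken. -/
def base (p : ℕ) : ℕ := ∑ a ∈ Finset.Icc 1 I.V, I.preSize a (I.low p a)

/-- The middle of the range of values. -/
def mid : ℕ := 2 * I.V ^ 2

/-- The number of values. -/
def span : ℕ := 4 * I.V ^ 2 + 1

/-- A table of least sizes `D a r` of choices from the classes up to `a`, where `r` describes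
the total value, and of predecessors `A a r` that attain them; sizes from `H` on are not
represented faithfully. -/
structure IsTable (p H : ℕ) (D A : ℕ → ℕ → ℕ) : Prop where
  zero : ∀ r < I.span, D 0 r = if r = I.mid then I.base p else H
  le : ∀ a, 1 ≤ a → a ≤ I.V → ∀ d ≤ I.width p a, ∀ r < I.span, ∀ r' < I.span,
    r + a * I.shift p a = r' + a * d → D a r ≤ D (a - 1) r' + I.gap p a d
  lt : ∀ a, 1 ≤ a → a ≤ I.V → ∀ r < I.span, A a r < I.span
  -- This keeps the sizes below `H` along a path of predecessors, so that `eq` applies at each of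
  -- its steps.
  pred_le : ∀ a, 1 ≤ a → a ≤ I.V → ∀ r < I.span, D (a - 1) (A a r) ≤ D a r
  eq : ∀ a, 1 ≤ a → a ≤ I.V → ∀ r < I.span, D a r < H → ∃ d ≤ I.width p a,
    r + a * I.shift p a = A a r + a * d ∧ D a r = D (a - 1) (A a r) + I.gap p a d

variable {I} {p H : ℕ} {D A : ℕ → ℕ → ℕ}

theorem quota_le (hp : I.Critical p) {a : ℕ} (ha : 0 < a) : I.quota p a ≤ I.tot a :=
  Finset.sum_le_sum fun i hi => greedy_le hp (mem_items.2 ⟨(mem_cls.1 hi).1, by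
    rw [(mem_cls.1 hi).2]; exact ha⟩)

theorem low_add_width_le (hp : I.Critical p) {a d : ℕ} (ha : 0 < a) (hd : d ≤ I.width p a) :
    I.low p a + d ≤ I.tot a := by
  have := quota_le hp ha
  unfold width low at *
  omega

theorem low_add_shift (p a : ℕ) : I.low p a + I.shift p a = I.quota p a := by
  unfold shift low; omega

theorem gap_add (p a d : ℕ) :
    I.preSize a (I.low p a) + I.gap p a d = I.preSize a (I.low p a + d) := by
  have := preSize_mono_of_le (I := I) (a := a) (Nat.le_add_right (I.low p a) d)
  unfold gap; omega

/-- The table bounds the sizes of all choices. -/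
theorem IsTable.le_sum (hT : I.IsTable p H D A) (d r : ℕ → ℕ)
    (hd : ∀ a, 1 ≤ a → a ≤ I.V → d a ≤ I.width p a) (hr : ∀ a ≤ I.V, r a < I.span)
    (h0 : r 0 = I.mid)
    (hstep : ∀ a, 1 ≤ a → a ≤ I.V → r a + a * I.shift p a = r (a - 1) + a * d a)
    (a : ℕ) (ha : a ≤ I.V) : D a (r a) ≤ I.base p + ∑ b ∈ Finset.Icc 1 a, I.gap p b (d b) := by
  induction a with
  | zero => rw [h0, hT.zero _ (h0 ▸ hr 0 ha)]; simp
  | succ a ih =>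
    have := hT.le (a + 1) (by omega) ha _ (hd _ (by omega) ha) _ (hr _ ha) (r a)
      (hr a (by omega)) (hstep (a + 1) (by omega) ha)
    rw [Finset.sum_Icc_succ_top (by omega)]
    have := ih (by omega)
    simp only [Nat.add_sub_cancel] at *
    omega

/-- The number of further copies of class `a` on a path of values. -/
def taken (I : Inst) (p : ℕ) (r : ℕ → ℕ) (a : ℕ) : ℕ := (a * I.shift p a + r a - r (a - 1)) / a

/-- Paths of predecessors describe choices of the given sizes. -/
theorem IsTable.path (hT : I.IsTable p H D A) (r : ℕ → ℕ) (hr : r I.V < I.span)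
    (hrH : D I.V (r I.V) < H) (hstep : ∀ a, 1 ≤ a → a ≤ I.V → r (a - 1) = A a (r a)) (a : ℕ)
    (ha : a ≤ I.V) :
    r a < I.span ∧ D a (r a) < H ∧
    D a (r a) = I.base p + ∑ b ∈ Finset.Icc 1 a, I.gap p b (I.taken p r b) ∧
    r a + ∑ b ∈ Finset.Icc 1 a, b * I.shift p b =
      I.mid + ∑ b ∈ Finset.Icc 1 a, b * I.taken p r b ∧
    ∀ b, 1 ≤ b → b ≤ a → I.taken p r b ≤ I.width p b := by
  have hlt : ∀ k ≤ I.V, r (I.V - k) < I.span ∧ D (I.V - k) (r (I.V - k)) < H := by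
    intro k
    induction k with
    | zero => exact fun _ => ⟨hr, hrH⟩
    | succ k ih =>
      intro hk
      obtain ⟨h1, h2⟩ := ih (by omega)
      have h3 := hstep (I.V - k) (by omega) (by omega)
      rw [show I.V - (k + 1) = I.V - k - 1 by omega, h3]
      exact ⟨hT.lt _ (by omega) (by omega) _ h1,
        (hT.pred_le _ (by omega) (by omega) _ h1).trans_lt h2⟩
  have hlt' : r a < I.span ∧ D a (r a) < H := by
    have := hlt (I.V - a) (by omega)
    rwa [show I.V - (I.V - a) = a by omega] at this
  refine ⟨hlt'.1, hlt'.2, ?_⟩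
  clear hlt'
  induction a with
  | zero =>
    have h := hlt I.V le_rfl
    rw [Nat.sub_self] at h
    have h1 := hT.zero _ h.1
    -- In row zero every entry but the one at `mid` equals `H`, so a path with sizes below `H` can
    -- only begin at `mid`.
    have h2 : r 0 = I.mid := by
      by_contra hne
      rw [if_neg hne] at h1
      omega
    rw [if_pos h2] at h1
    simp only [show Finset.Icc 1 0 = ∅ from rfl, Finset.sum_empty, add_zero]
    exact ⟨h1, h2, fun b h1 h2 => by omega⟩
  | succ a ih =>
    obtain ⟨h1, h2, h3⟩ := ih (by omega)
    have h := hlt (I.V - (a + 1)) (by omega)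
    rw [show I.V - (I.V - (a + 1)) = a + 1 by omega] at h
    obtain ⟨d, hd, he, hD⟩ := hT.eq (a + 1) (by omega) ha _ h.1 h.2
    rw [← hstep (a + 1) (by omega) ha, Nat.add_sub_cancel] at he hD
    have ht : I.taken p r (a + 1) = d := by
      unfold taken
      rw [Nat.add_sub_cancel, show (a + 1) * I.shift p (a + 1) + r (a + 1) - r a = (a + 1) * d by
        omega, Nat.mul_div_cancel_left _ (Nat.succ_pos a)]
    refine ⟨?_, ?_, fun b hb hb' => ?_⟩
    · rw [Finset.sum_Icc_succ_top (by omega), ht, hD]; omega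
    · rw [Finset.sum_Icc_succ_top (by omega), Finset.sum_Icc_succ_top (by omega), ht]; omega
    · rcases hb'.eq_or_lt with rfl | hb'
      · rw [ht]; exact hd
      · exact h3 b hb (by omega)

/-- The value that an optimal solution has in the table. -/
theorem IsTable.exists_le (hT : I.IsTable p H D A) (hp : I.Critical p) :
    ∃ r < I.span, D I.V r ≤ I.t ∧ ∀ x, Feas I.items I.s I.u I.t x →
      ∑ i ∈ I.items, I.v i * x i + I.mid ≤ r + ∑ a ∈ Finset.Icc 1 I.V, a * I.quota p a := by
  obtain ⟨y, hy, hopt, hnear⟩ := hp.exists_optimal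
  have hmem : ∀ a ∈ Finset.Icc 1 I.V, ∀ i ∈ I.cls a, i ∈ I.items := by
    intro a ha i hi
    rw [mem_cls] at hi
    rw [Finset.mem_Icc] at ha
    rw [mem_items]
    omega
  set Y : ℕ → ℕ := fun a => ∑ i ∈ I.cls a, y i with hY
  have hYT : ∀ a ∈ Finset.Icc 1 I.V, Y a ≤ I.tot a := fun a ha =>
    Finset.sum_le_sum fun i hi => hy.1 i (hmem a ha i hi)
  have hdist : ∀ a ∈ Finset.Icc 1 I.V, |(Y a : ℤ) - I.quota p a| ≤
      (∑ i ∈ I.cls a, ((y i - I.greedy p i) + (I.greedy p i - y i)) : ℕ) := by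
    intro a _
    simp only [hY, quota]
    push_cast
    rw [← Finset.sum_sub_distrib]
    refine (Finset.abs_sum_le_sum_abs _ _).trans (Finset.sum_le_sum fun i _ => ?_)
    rw [abs_le]
    omega
  have hsum : ∑ a ∈ Finset.Icc 1 I.V, |(Y a : ℤ) - I.quota p a| ≤ 2 * I.V := by
    refine (Finset.sum_le_sum hdist).trans ?_
    rw [← Nat.cast_sum, ← sum_items]
    exact_mod_cast hnear
  have hclose : ∀ a ∈ Finset.Icc 1 I.V, |(Y a : ℤ) - I.quota p a| ≤ 2 * I.V := fun a ha =>
    (Finset.single_le_sum (f := fun a => |(Y a : ℤ) - I.quota p a|)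
      (fun _ _ => abs_nonneg _) ha).trans hsum
  set F : ℕ → ℤ := fun a => ∑ b ∈ Finset.Icc 1 a, (b : ℤ) * ((Y b : ℤ) - I.quota p b) with hF
  -- The deviations of all classes add up to at most `2 * V` copies, each of value at most `V`. So
  -- the value never leaves the range of the table, no matter how many classes have been treated.
  have hFb : ∀ a ≤ I.V, |F a| ≤ I.mid := by
    intro a ha
    have h1 : |F a| ≤ ∑ b ∈ Finset.Icc 1 a, (I.V : ℤ) * |(Y b : ℤ) - I.quota p b| := by
      refine (Finset.abs_sum_le_sum_abs _ _).trans (Finset.sum_le_sum fun b hb => ?_)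
      rw [abs_mul, Nat.abs_cast]
      rw [Finset.mem_Icc] at hb
      exact mul_le_mul_of_nonneg_right (by exact_mod_cast hb.2.trans ha) (abs_nonneg _)
    rw [← Finset.mul_sum] at h1
    have h2 : ∑ b ∈ Finset.Icc 1 a, |(Y b : ℤ) - I.quota p b| ≤ 2 * I.V :=
      (Finset.sum_le_sum_of_subset_of_nonneg (Finset.Icc_subset_Icc_right ha)
        fun _ _ _ => abs_nonneg _).trans hsum
    have h3 : (I.V : ℤ) * ∑ b ∈ Finset.Icc 1 a, |(Y b : ℤ) - I.quota p b| ≤ I.V * (2 * I.V) :=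
      mul_le_mul_of_nonneg_left h2 (by positivity)
    have h4 : (I.mid : ℤ) = I.V * (2 * I.V) := by rw [mid]; push_cast; ring
    omega
  have hspan : I.span = 2 * I.mid + 1 := by rw [span, mid]; ring
  -- Column `mid` stands for the value of the greedy solution, so the column of `y` after class `a`
  -- is `mid` plus the deviation in value up to there.
  set r : ℕ → ℕ := fun a => (I.mid + F a).toNat with hr
  have hrZ : ∀ a ≤ I.V, (r a : ℤ) = I.mid + F a := by
    intro a ha
    have := abs_le.1 (hFb a ha)
    rw [hr]
    exact Int.toNat_of_nonneg (by omega)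
  have hlow : ∀ a ∈ Finset.Icc 1 I.V, I.low p a ≤ Y a := by
    intro a ha
    have := abs_le.1 (hclose a ha)
    unfold low
    omega
  have hle := hT.le_sum (fun a => Y a - I.low p a) r (fun a h1 h2 => by
      have h3 := Finset.mem_Icc.2 ⟨h1, h2⟩
      have := abs_le.1 (hclose a h3)
      have := hYT a h3
      have := hlow a h3
      show Y a - I.low p a ≤ _
      unfold width
      omega) (fun a ha => by
      have := abs_le.1 (hFb a ha)
      have := hrZ a ha
      omega) (by simp [hr, hF]) (fun a h1 h2 => by
      have h3 := hrZ a h2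
      have h4 := hrZ (a - 1) (by omega)
      have h5 : F a = F (a - 1) + a * ((Y a : ℤ) - I.quota p a) := by
        obtain ⟨b, rfl⟩ : ∃ b, a = b + 1 := ⟨a - 1, by omega⟩
        simp only [hF, Nat.add_sub_cancel]
        rw [Finset.sum_Icc_succ_top (by omega)]
      have h6 := hlow a (Finset.mem_Icc.2 ⟨h1, h2⟩)
      have h7 := low_add_shift (I := I) p a
      have : (r a : ℤ) + a * I.shift p a = r (a - 1) + a * ((Y a - I.low p a : ℕ) : ℤ) := by
        rw [h3, h4, h5, ← h7]
        push_cast [h6]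
        ring
      exact_mod_cast this) I.V le_rfl
  refine ⟨r I.V, ?_, hle.trans ?_, fun x hx => ?_⟩
  · have := abs_le.1 (hFb _ le_rfl)
    have := hrZ _ le_rfl
    omega
  · rw [base, ← Finset.sum_add_distrib]
    -- In each class the copies of `y` may be replaced by equally many first copies, by
    -- `preSize_le`. So the path that only knows the numbers of copies is at most as large as `y`.
    have h1 : ∑ a ∈ Finset.Icc 1 I.V, (I.preSize a (I.low p a) + I.gap p a (Y a - I.low p a)) ≤
        ∑ a ∈ Finset.Icc 1 I.V, ∑ i ∈ I.cls a, I.s i * y i := by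
      refine Finset.sum_le_sum fun a ha => ?_
      rw [gap_add, Nat.add_sub_cancel' (hlow a ha)]
      exact preSize_le (Finset.mem_Icc.1 ha).1 fun i hi => hy.1 i (hmem a ha i hi)
    rw [← sum_items] at h1
    exact h1.trans hy.2
  · refine (Nat.add_le_add_right (hopt x hx) _).trans (le_of_eq ?_)
    have h1 : ∑ i ∈ I.items, I.v i * y i = ∑ a ∈ Finset.Icc 1 I.V, a * Y a := by
      rw [sum_items]
      refine Finset.sum_congr rfl fun a _ => ?_
      rw [hY, Finset.mul_sum]
      exact Finset.sum_congr rfl fun i hi => by rw [(mem_cls.1 hi).2]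
    have h2 := hrZ _ le_rfl
    simp only [hF] at h2
    have h3 : ((∑ a ∈ Finset.Icc 1 I.V, a * Y a : ℕ) : ℤ) = ∑ a ∈ Finset.Icc 1 I.V,
        (a : ℤ) * ((Y a : ℤ) - I.quota p a) + (∑ a ∈ Finset.Icc 1 I.V, a * I.quota p a : ℕ) := by
      push_cast
      rw [← Finset.sum_add_distrib]
      exact Finset.sum_congr rfl fun a _ => by ring
    rw [h1]
    omega

/-- The choice that belongs to the best value in the table is optimal. -/
theorem IsTable.optimal (hT : I.IsTable p H D A) (hp : I.Critical p) (hH : I.t < H) (r : ℕ → ℕ)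
    (hr : r I.V < I.span) (hrt : D I.V (r I.V) ≤ I.t)
    (hmax : ∀ r' < I.span, D I.V r' ≤ I.t → r' ≤ r I.V)
    (hstep : ∀ a, 1 ≤ a → a ≤ I.V → r (a - 1) = A a (r a)) (x : ℕ → ℕ)
    (hx : ∀ i < I.n, x i = if 0 < I.v i then
      I.pre (I.v i) (I.low p (I.v i) + I.taken p r (I.v i)) i else 0) :
    Feas (Finset.range I.n) I.s I.u I.t x ∧ ∀ y, Feas (Finset.range I.n) I.s I.u I.t y →
      ∑ i ∈ Finset.range I.n, I.v i * y i ≤ ∑ i ∈ Finset.range I.n, I.v i * x i := by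
  obtain ⟨-, -, hD, hval, hw⟩ := hT.path r hr (hrt.trans_lt hH) hstep I.V le_rfl
  have hsub : I.items ⊆ Finset.range I.n := Finset.filter_subset _ _
  have hxc : ∀ a ∈ Finset.Icc 1 I.V, ∀ i ∈ I.cls a,
      x i = I.pre a (I.low p a + I.taken p r a) i := by
    intro a ha i hi
    rw [mem_cls] at hi
    rw [Finset.mem_Icc] at ha
    rw [hx i hi.1, if_pos (by omega), hi.2]
  have hx0 : ∀ i ∈ Finset.range I.n, i ∉ I.items → x i = 0 := by
    intro i hi hi'
    rw [Finset.mem_range] at hi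
    rw [mem_items] at hi'
    rw [hx i hi, if_neg (by omega)]
  have hv0 : ∀ i ∈ Finset.range I.n, i ∉ I.items → I.v i = 0 := by
    intro i hi hi'
    rw [Finset.mem_range] at hi
    rw [mem_items] at hi'
    omega
  have hsize : ∑ i ∈ Finset.range I.n, I.s i * x i ≤ I.t := by
    rw [← Finset.sum_subset hsub fun i hi hi' => by rw [hx0 i hi hi', mul_zero], sum_items]
    refine le_trans (le_of_eq ?_) hrt
    rw [hD, base, ← Finset.sum_add_distrib]
    refine Finset.sum_congr rfl fun a ha => ?_
    rw [gap_add, preSize]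
    exact Finset.sum_congr rfl fun i hi => by rw [hxc a ha i hi]
  refine ⟨⟨fun i hi => ?_, hsize⟩, fun y hy => ?_⟩
  · rw [hx i (Finset.mem_range.1 hi)]
    split
    · exact min_le_left _ _
    · exact Nat.zero_le _
  -- Up to one common constant, the value of `x` is `r V` by `path`, and every feasible value is at
  -- most `r'`. The choice of the largest admissible column gives `r' ≤ r V`.
  · obtain ⟨r', hr', hr't, hbest⟩ := hT.exists_le hp
    have h1 := hbest y ⟨fun i hi => hy.1 i (hsub hi),
      (Finset.sum_le_sum_of_subset hsub).trans hy.2⟩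
    have h2 := hmax r' hr' hr't
    rw [← Finset.sum_subset hsub fun i hi hi' => by rw [hv0 i hi hi', zero_mul],
      ← Finset.sum_subset hsub fun i hi hi' => by rw [hv0 i hi hi', zero_mul]]
    have h3 : ∑ i ∈ I.items, I.v i * x i =
        ∑ a ∈ Finset.Icc 1 I.V, a * (I.low p a + I.taken p r a) := by
      rw [sum_items]
      refine Finset.sum_congr rfl fun a ha => ?_
      have ha' := Finset.mem_Icc.1 ha
      conv_rhs => rw [← sum_pre (low_add_width_le hp ha'.1 (hw a ha'.1 ha'.2))]
      rw [Finset.mul_sum]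
      exact Finset.sum_congr rfl fun i hi => by rw [(mem_cls.1 hi).2, hxc a ha i hi]
    have h4 : ∑ a ∈ Finset.Icc 1 I.V, a * (I.low p a + I.taken p r a) =
        ∑ a ∈ Finset.Icc 1 I.V, a * I.low p a + ∑ a ∈ Finset.Icc 1 I.V, a * I.taken p r a := by
      rw [← Finset.sum_add_distrib]
      exact Finset.sum_congr rfl fun a _ => by ring
    have h5 : ∑ a ∈ Finset.Icc 1 I.V, a * I.quota p a =
        ∑ a ∈ Finset.Icc 1 I.V, a * I.low p a + ∑ a ∈ Finset.Icc 1 I.V, a * I.shift p a := by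
      rw [← Finset.sum_add_distrib]
      exact Finset.sum_congr rfl fun a _ => by rw [← low_add_shift]; ring
    omega

end Inst

end WordRAM

/-! ### Reading the instance -/

namespace WordRAM

/-- The size of an item. -/
def sizeAt (x : Ex) : Ex := .ld .raw (x + 2)
/-- The value of an item. -/
def valAt (x : Ex) : Ex := .ld .raw (x + Var.n + 2)
/-- The multiplicity of an item. -/
def multAt (x : Ex) : Ex := .ld .raw (x + Var.n + Var.n + 2)

section
variable (B : Bound) (σ : St) (x : Ex)
@[simp] theorem eval_sizeAt : (sizeAt x).eval σ = σ.mem .raw (x.eval σ + 2) := rfl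
@[simp] theorem eval_valAt : (valAt x).eval σ = σ.mem .raw (x.eval σ + σ.reg .n + 2) := rfl
@[simp] theorem eval_multAt :
    (multAt x).eval σ = σ.mem .raw (x.eval σ + σ.reg .n + σ.reg .n + 2) := rfl
@[simp] theorem cost_sizeAt : (sizeAt x).cost = x.cost + 8 := rfl
@[simp] theorem cost_valAt : (valAt x).cost = x.cost + 10 := rfl
@[simp] theorem cost_multAt : (multAt x).cost = x.cost + 12 := rfl
end

/-- The input is in the memory. -/
structure Loaded (I : Inst) (B : Bound) (σ : St) : Prop where
  n : σ.reg .n = I.n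
  t : σ.reg .t = I.t
  size : ∀ i < I.n, σ.mem .raw (i + 2) = I.s i
  val : ∀ i < I.n, σ.mem .raw (i + I.n + 2) = I.v i
  mult : ∀ i < I.n, σ.mem .raw (i + I.n + I.n + 2) = I.u i
  raw : 3 * I.n + 2 ≤ B.lim .raw
  word : B.lim .raw + 64 ≤ B.word

namespace Loaded
variable {I : Inst} {B : Bound} {σ τ : St}

theorem congr (h : Loaded I B σ) (hn : τ.reg .n = σ.reg .n) (ht : τ.reg .t = σ.reg .t)
    (hr : τ.mem .raw = σ.mem .raw) : Loaded I B τ :=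
  ⟨hn ▸ h.n, ht ▸ h.t, hr ▸ h.size, hr ▸ h.val, hr ▸ h.mult, h.raw, h.word⟩

theorem ok_sizeAt (h : Loaded I B σ) (x : Var) (hx : σ.reg x < I.n) : (sizeAt x).ok B σ := by
  have := h.raw
  have := h.word
  simp [sizeAt]; omega

theorem ok_valAt (h : Loaded I B σ) (x : Var) (hx : σ.reg x < I.n) : (valAt x).ok B σ := by
  have := h.raw
  have := h.word
  simp [valAt, h.n]; omega

theorem ok_multAt (h : Loaded I B σ) (x : Var) (hx : σ.reg x < I.n) : (multAt x).ok B σ := by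
  have := h.raw
  have := h.word
  simp [multAt, h.n]; omega

end Loaded

/-- The words and arrays are large enough for the instance; `X` bounds all numbers in the input. -/
structure Room (I : Inst) (B : Bound) (X : ℕ) : Prop where
  ten : 10 ≤ X
  n : I.n ≤ X
  t : I.t ≤ X
  V : I.V ≤ X
  s : ∑ i ∈ Finset.range I.n, I.s i ≤ X
  u : ∑ i ∈ Finset.range I.n, I.u i ≤ X
  raw : 3 * I.n + 2 ≤ B.lim .raw
  rawX : B.lim .raw ≤ X ^ 2
  lim : ∀ A, A ≠ .raw → X ^ 6 ≤ B.lim A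
  limw : ∀ A, B.lim A ≤ B.word
  word : X ^ 12 ≤ B.word

namespace Room
variable {I : Inst} {B : Bound} {X : ℕ}

theorem size_le (h : Room I B X) {i : ℕ} (hi : i < I.n) : I.s i ≤ X :=
  (Finset.single_le_sum (f := I.s) (fun _ _ => Nat.zero_le _) (Finset.mem_range.2 hi)).trans h.s

theorem mult_le (h : Room I B X) {i : ℕ} (hi : i < I.n) : I.u i ≤ X :=
  (Finset.single_le_sum (f := I.u) (fun _ _ => Nat.zero_le _) (Finset.mem_range.2 hi)).trans h.u

/-- As `X` is at least ten, one more factor `X` absorbs small constants. All overflow conditions are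
reduced to comparisons of such powers. -/
theorem pow_lt (h : Room I B X) (k : ℕ) (m : ℕ) (hkm : k < m) : 10 * X ^ k ≤ X ^ m := by
  calc 10 * X ^ k ≤ X * X ^ k := Nat.mul_le_mul_right _ h.ten
    _ = X ^ (k + 1) := by ring
    _ ≤ X ^ m := Nat.pow_le_pow_right (by have := h.ten; omega) hkm

/-- Powers of the bound, written for linear arithmetic. -/
theorem chain (h : Room I B X) : 10 * X ≤ X ^ 2 ∧ 10 * X ^ 2 ≤ X ^ 3 ∧ 10 * X ^ 3 ≤ X ^ 4 ∧
    10 * X ^ 4 ≤ X ^ 5 ∧ 10 * X ^ 5 ≤ X ^ 6 ∧ 10 * X ^ 6 ≤ X ^ 7 ∧ 10 * X ^ 7 ≤ X ^ 8 ∧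
    10 * X ^ 8 ≤ B.word := by
  have h1 := h.pow_lt 1 2 (by omega)
  rw [pow_one] at h1
  exact ⟨h1, h.pow_lt 2 3 (by omega), h.pow_lt 3 4 (by omega), h.pow_lt 4 5 (by omega),
    h.pow_lt 5 6 (by omega), h.pow_lt 6 7 (by omega), h.pow_lt 7 8 (by omega),
    (h.pow_lt 8 12 (by omega)).trans h.word⟩

theorem key_lt (h : Room I B X) {i : ℕ} (hi : i < I.n) :
    I.s i * I.V ^ 2 / I.v i * I.n + I.n ≤ X ^ 5 := by
  obtain ⟨h1, h2, h3, h4, -⟩ := h.chain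
  have h5 : I.s i * I.V ^ 2 / I.v i * I.n ≤ X * X ^ 2 * X :=
    Nat.mul_le_mul ((Nat.div_le_self _ _).trans (Nat.mul_le_mul (h.size_le hi)
      (Nat.pow_le_pow_left h.V 2))) h.n
  have h6 : X * X ^ 2 * X = X ^ 4 := by ring
  have := h.n
  omega

end Room

/-- Find the largest value. -/
def maxCmd : Cmd :=
  Var.vmax ::= 0 ;;
  .for .i 0 .n (
    .ite (.lt Var.vmax (valAt Var.i)) (Var.vmax ::= valAt Var.i) .skip)

theorem maxCmd_spec {I : Inst} {B : Bound} {σ : St} {k₀ : ℕ} (hL : Loaded I B σ)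
    (hV : I.V = (Finset.range I.n).sup I.v) :
    WP B maxCmd σ k₀ fun τ l => τ.reg .vmax = I.V ∧ l ≤ k₀ + 60 * I.n + 10 := by
  have h1 := hL.raw
  have h2 := hL.word
  rw [maxCmd, WP_seq, WP_asg]
  refine ⟨by simp; omega, ?_⟩
  refine (WP_for' (x := .i) (y := .n) (fun i τ => τ.reg .vmax = (Finset.range i).sup I.v) 60
    (by decide) rfl rfl (by simp; omega) (by simp [hL.n]; omega) (by omega) (by simp) ?_ ?_).mono ?_
  · simp
  · rintro i τ - hi hF hτi hI
    simp [hL.n] at hi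
    have hLτ : Loaded I B τ := hL.congr (hF.reg _ rfl) (hF.reg _ rfl) (hF.mem _ rfl)
    have hok := hLτ.ok_valAt .i (by omega)
    have hval := hLτ.val i hi
    rw [WP_ite]
    refine ⟨by simp [hok], fun hc => ?_, fun hc => ?_⟩
    · simp [hτi, hLτ.n, hval, hI] at hc
      simp only [WP_asg]
      refine ⟨hok, ?_, by simp⟩
      simp [hτi, hLτ.n, hval, Finset.range_add_one, Finset.sup_insert]
      intro j hj
      exact (Finset.le_sup (f := I.v) (Finset.mem_range.2 hj)).trans hc.le
    · simp only [Cond.eval_lt, Ex.eval_var, eval_valAt, hτi, hLτ.n, hval, hI, not_lt] at hc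
      simp only [WP_skip]
      refine ⟨?_, by simp⟩
      simp [hI, Finset.range_add_one, Finset.sup_insert, hc]
  · rintro τ l ⟨h, -, hF, hl⟩
    simp [hL.n] at h hl
    exact ⟨by rw [h, hV], by omega⟩

namespace Inst
variable (I : Inst)

/-- The items of value `a` in their order. -/
def row (a : ℕ) : List ℕ := (List.range I.n).filter (I.v · = a)

/-- A size that exceeds the capacity and all item sizes. -/
def inf : ℕ := I.t + 1 + ∑ i ∈ Finset.range I.n, I.s i

end Inst

/-- The derived constants of the instance are in their registers. -/
structure Ctx (I : Inst) (B : Bound) (σ : St) : Prop extends Loaded I B σ where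
  vmax : σ.reg .vmax = I.V
  kk : σ.reg .kk = 2 * I.V
  rr : σ.reg .rr = I.mid
  nn : σ.reg .nn = I.span
  str : σ.reg .str = 4 * I.V + 1
  cc : σ.reg .cc = I.V + 1
  hh : σ.reg .hh = I.inf

/-- Registers that hold constants. -/
def Var.fixed : Var → Bool
  | .n | .t | .vmax | .kk | .rr | .nn | .str | .cc | .hh => true
  | _ => false

/-- A command that does not change the input and the derived constants. -/
def Cmd.keeps (c : Cmd) : Bool :=
  !(c.wr .n || c.wr .t || c.wr .vmax || c.wr .kk || c.wr .rr || c.wr .nn || c.wr .str ||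
    c.wr .cc || c.wr .hh || c.wa .raw)

namespace Ctx
variable {I : Inst} {B : Bound} {σ τ : St}

theorem congr (h : Ctx I B σ) (hx : ∀ x : Var, x.fixed = true → τ.reg x = σ.reg x)
    (hr : τ.mem .raw = σ.mem .raw) : Ctx I B τ :=
  ⟨h.toLoaded.congr (hx _ rfl) (hx _ rfl) hr, (hx _ rfl).trans h.vmax, (hx _ rfl).trans h.kk,
    (hx _ rfl).trans h.rr, (hx _ rfl).trans h.nn, (hx _ rfl).trans h.str, (hx _ rfl).trans h.cc,
    (hx _ rfl).trans h.hh⟩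

theorem frame {c : Cmd} (h : Ctx I B σ) (hF : Frame c σ τ) (hc : c.keeps = true) : Ctx I B τ := by
  simp only [Cmd.keeps, Bool.not_eq_true', Bool.or_eq_false_iff] at hc
  refine h.congr (fun x hx => hF.reg x ?_) (hF.mem _ hc.2)
  cases x <;> simp_all [Var.fixed]

theorem setR (h : Ctx I B σ) {x : Var} {v : ℕ} (hx : x.fixed = false) : Ctx I B (σ.setR x v) :=
  h.congr (fun y hy => St.reg_setR_ne _ _ _ _ (by rintro rfl; simp_all)) rfl

theorem setM (h : Ctx I B σ) {A : Arr} {i v : ℕ} (hA : A ≠ .raw) : Ctx I B (σ.setM A i v) :=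
  h.congr (fun _ _ => rfl) (St.mem_setM_ne _ _ _ _ _ hA.symm)

end Ctx

/-- Enter an item into the row of its value and into the buffer for the selection. -/
def enterCmd : Cmd :=
  .sto .key Var.i ((sizeAt Var.i * ((Var.vmax : Ex) * Var.vmax) / Var.val) * Var.n + Var.i) ;;
  .sto .cls ((Var.val : Ex) * Var.n + .ld .cnt Var.val) Var.i ;;
  .sto .cnt Var.val (.ld .cnt Var.val + 1) ;;
  .sto .tot Var.val (.ld .tot Var.val + multAt Var.i) ;;
  .sto .bk Var.sl (.ld .key Var.i) ;;
  .sto .bw Var.sl (sizeAt Var.i * multAt Var.i) ;;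
  Var.wl ::= (Var.wl : Ex) + .ld .bw Var.sl ;;
  Var.sl ::= (Var.sl : Ex) + 1

/-- Enter all items of positive value, and compute a size that is larger than all others. -/
def enterAllCmd : Cmd :=
  Var.hh ::= (Var.t : Ex) + 1 ;; Var.sl ::= 0 ;; Var.wl ::= 0 ;;
  .for .i 0 .n (
    Var.hh ::= (Var.hh : Ex) + sizeAt Var.i ;;
    Var.val ::= valAt Var.i ;;
    .ite (.lt 0 Var.val) enterCmd .skip)

/-- The first `m` items have been entered. -/
structure Entered (I : Inst) (m : ℕ) (τ : St) : Prop where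
  hh : τ.reg .hh = I.t + 1 + ∑ i ∈ Finset.range m, I.s i
  key : ∀ i < m, 0 < I.v i → τ.mem .key i = I.key i
  row : ∀ a, 0 < a → (List.range (τ.mem .cnt a)).map (fun k => τ.mem .cls (a * I.n + k)) =
    (List.range m).filter (I.v · = a)
  tot : ∀ a, 0 < a → τ.mem .tot a = (((List.range m).filter (I.v · = a)).map I.u).sum
  buf : τ.buf 0 (τ.reg .sl) = ((List.range m).filter (0 < I.v ·)).map
    fun i => (I.key i, I.s i * I.u i)
  wl : τ.reg .wl = total (((List.range m).filter (0 < I.v ·)).map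
    fun i => (I.key i, I.s i * I.u i))

theorem Entered.cnt {I : Inst} {m a : ℕ} {τ : St} (h : Entered I m τ) (ha : 0 < a) :
    τ.mem .cnt a = ((List.range m).filter (I.v · = a)).length := by
  rw [← h.row a ha]; simp

theorem Entered.sl {I : Inst} {m : ℕ} {τ : St} (h : Entered I m τ) :
    τ.reg .sl = ((List.range m).filter (0 < I.v ·)).length := by
  simpa [St.buf] using congrArg List.length h.buf

theorem index_ne {n a b i j : ℕ} (hi : i < n) (hj : j < n) (h : a ≠ b ∨ i ≠ j) :
    a * n + i ≠ b * n + j := by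
  intro e
  have h1 : (a * n + i) % n = (b * n + j) % n := by rw [e]
  rw [Nat.mul_add_mod', Nat.mul_add_mod', Nat.mod_eq_of_lt hi, Nat.mod_eq_of_lt hj] at h1
  subst h1
  rcases h with h | h
  · exact h (Nat.eq_of_mul_eq_mul_right (by omega) (by omega : a * n = b * n))
  · exact h rfl

theorem filter_range_succ (P : ℕ → Prop) [DecidablePred P] (m : ℕ) :
    (List.range (m + 1)).filter (P ·) =
      (List.range m).filter (P ·) ++ if P m then [m] else [] := by
  rw [List.range_succ, List.filter_append]
  by_cases h : P m <;> simp [h]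

theorem sum_filter_range {M : Type*} [AddCommMonoid M] (P : ℕ → Prop) [DecidablePred P]
    (f : ℕ → M) (m : ℕ) :
    (((List.range m).filter (P ·)).map f).sum = ∑ i ∈ (Finset.range m).filter P, f i := by
  induction m with
  | zero => simp
  | succ m ih =>
    rw [filter_range_succ, List.map_append, List.sum_append, ih, Finset.range_add_one,
      Finset.filter_insert]
    by_cases h : P m
    · simp [h, add_comm]
    · simp [h]

theorem length_filter_range_le (P : ℕ → Prop) [DecidablePred P] (m : ℕ) :
    ((List.range m).filter (P ·)).length ≤ m := by
  simpa using (List.range m).length_filter_le (P ·)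

set_option maxHeartbeats 1000000 in
theorem enterCmd_spec {I : Inst} {B : Bound} {X m : ℕ} {σ : St} (hR : Room I B X)
    (hL : Loaded I B σ) (hV : σ.reg .vmax = I.V) (hm : m < I.n) (hi : σ.reg .i = m)
    (hval : σ.reg .val = I.v m) (hpos : 0 < I.v m)
    (hh : σ.reg .hh = I.t + 1 + ∑ i ∈ Finset.range (m + 1), I.s i)
    -- The loop has already added the size of item `m` to `hh`, so the invariant for the first `m`
    -- items only holds with `hh` set back.
    (hE : Entered I m (σ.setR .hh (I.t + 1 + ∑ i ∈ Finset.range m, I.s i))) :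
    WP B enterCmd σ 0 fun τ l => Entered I (m + 1) τ ∧ l ≤ 200 := by
  obtain ⟨c1, c2, c3, c4, c5, c6, c7, c8⟩ := hR.chain
  have b1 := hR.ten
  have b2 := hR.n
  have b3 := hR.V
  have b4 := hR.size_le hm
  have b5 := hR.mult_le hm
  have b6 := I.le m hm
  have hcnt := hE.cnt hpos
  have hsl := hE.sl
  have hcnt' := length_filter_range_le (I.v · = I.v m) m
  have hsl' := length_filter_range_le (0 < I.v ·) m
  simp only [St.mem_setR] at hcnt
  rw [St.reg_setR_ne _ _ _ _ (by decide)] at hsl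
  rw [← hcnt] at hcnt'
  rw [← hsl] at hsl'
  have hkl := hR.key_lt hm
  have d1 : I.V * I.V ≤ X ^ 2 := by rw [sq]; exact Nat.mul_le_mul b3 b3
  have d2 : I.s m * (I.V * I.V) ≤ X ^ 3 := by
    calc _ ≤ X * X ^ 2 := Nat.mul_le_mul b4 d1
      _ = X ^ 3 := by ring
  have d3 : I.v m * I.n ≤ X ^ 2 := by rw [sq]; exact Nat.mul_le_mul (b6.trans b3) b2
  have d4 : I.s m * I.u m ≤ X ^ 2 := by rw [sq]; exact Nat.mul_le_mul b4 b5
  have lim := hR.lim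
  have l1 := lim .key (by decide)
  have l2 := lim .cls (by decide)
  have l3 := lim .cnt (by decide)
  have l4 := lim .tot (by decide)
  have l5 := lim .bk (by decide)
  have l6 := lim .bw (by decide)
  have htot := hE.tot (I.v m) hpos
  have hwl := hE.wl
  simp only [St.mem_setR] at htot
  rw [St.reg_setR_ne _ _ _ _ (by decide)] at hwl
  have htot' : σ.mem .tot (I.v m) ≤ X := by
    rw [htot, sum_filter_range]
    refine le_trans (Finset.sum_le_sum_of_subset ?_) hR.u
    intro i hi
    simp at hi ⊢
    omega
  have hwl' : σ.reg .wl ≤ X ^ 2 := by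
    rw [hwl, total, List.map_map, sum_filter_range]
    calc _ ≤ ∑ i ∈ Finset.range I.n, I.s i * X := by
          refine (Finset.sum_le_sum_of_subset (t := Finset.range I.n) ?_).trans
            (Finset.sum_le_sum fun i hi => Nat.mul_le_mul_left _ (hR.mult_le (by simpa using hi)))
          intro i hi
          simp at hi ⊢
          omega
      _ ≤ X * X := by rw [← Finset.sum_mul]; exact Nat.mul_le_mul_right _ hR.s
      _ = X ^ 2 := by ring
  have q1 : σ.mem .raw (m + 2) = I.s m := hL.size m hm
  have q2 : σ.mem .raw (m + I.n + I.n + 2) = I.u m := hL.mult m hm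
  have q3 := hL.n
  have q4 := hL.raw
  have q5 := hL.word
  have hkey : I.s m * (I.V * I.V) / I.v m * I.n + m = I.key m := by rw [Inst.key, sq]
  simp only [enterCmd, WP_seq, WP_sto, WP_asg]
  refine ⟨by simp, ?_, by simp [hi]; omega, ?_⟩
  · simp [hi, sizeAt, hV, q1, q3, hval]
    rw [← sq] at *
    omega
  refine ⟨by simp [hval, q3]; omega, by simp, by simp [hval, q3]; omega, ?_⟩
  refine ⟨by simp, by simp [hval]; omega, by simp [hval]; omega, ?_⟩
  refine ⟨by simp, by simp [hval, hi, q2, q3, multAt]; omega, by simp [hval]; omega, ?_⟩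
  refine ⟨by simp, by simp [hi]; omega, by simp; omega, ?_⟩
  refine ⟨by simp, by simp [sizeAt, multAt, hi, q1, q2, q3]; omega, by simp; omega, ?_⟩
  refine ⟨by simp [hi, q1, q2, q3]; omega, by simp; omega, ⟨?_, ?_, ?_, ?_, ?_, ?_⟩, by simp⟩
  · simpa using hh
  · intro i hi' hv
    rcases Nat.lt_succ_iff_lt_or_eq.1 hi' with h | rfl
    · simp [hi, h.ne]
      simpa using hE.key i h hv
    · simp [hi, hV, q1, q3, hval, hkey]
  · intro a ha
    have hrow := hE.row a ha
    simp only [St.mem_setR] at hrow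
    rw [filter_range_succ, ← hrow]
    by_cases hav : I.v m = a
    · subst hav
      simp [hval, hi, q3, List.range_succ]
      intro k hk
      rw [Function.update_of_ne (by omega)]
    · have hav' : a ≠ I.v m := fun h => hav h.symm
      simp [hval, hi, q3, hav, Function.update_of_ne hav']
      intro k hk
      rw [Function.update_of_ne]
      refine index_ne ?_ (by omega) (.inl hav')
      have := hE.cnt ha
      have := length_filter_range_le (I.v · = a) m
      simp only [St.mem_setR] at *
      omega
  · intro a ha
    have htot := hE.tot a ha
    simp only [St.mem_setR] at htot
    rw [filter_range_succ, List.map_append, List.sum_append, ← htot]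
    by_cases hav : I.v m = a
    · subst hav
      simp [hval, hi, q3, q2]
    · have hav' : a ≠ I.v m := fun h => hav h.symm
      simp [hval, hav, Function.update_of_ne hav']
  · rw [filter_range_succ, List.map_append]
    have hbuf := hE.buf
    rw [St.reg_setR_ne _ _ _ _ (by decide), St.buf_setR] at hbuf
    rw [← hbuf]
    simp only [St.buf, St.reg_setR_self, Ex.eval_add, Ex.eval_var, Ex.eval_lit]
    simp only [St.reg_setR_ne, St.reg_setM, ne_eq, reduceCtorEq, not_false_eq_true]
    rw [seg_succ]
    congr 1
    · refine seg_congr (fun j h1 h2 => ?_) (fun j h1 h2 => ?_)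
      · simp
        rw [Function.update_of_ne (by omega)]
      · simp
        rw [Function.update_of_ne (by omega)]
    · simp [hpos, hi, hV, q1, q2, q3, hval, hkey]
  · rw [filter_range_succ, List.map_append, total_append, ← hwl]
    simp [hi, hpos, q1, q2, q3]

theorem enterAllCmd_spec {I : Inst} {B : Bound} {X k₀ : ℕ} {σ : St} (hR : Room I B X)
    (hL : Loaded I B σ) (hV : σ.reg .vmax = I.V) (h0 : ∀ A, A ≠ .raw → σ.mem A = 0) :
    WP B enterAllCmd σ k₀ fun τ l => Entered I I.n τ ∧ l ≤ k₀ + 300 * I.n + 20 := by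
  obtain ⟨c1, c2, c3, c4, c5, c6, c7, c8⟩ := hR.chain
  have b1 := hR.ten
  have b2 := hR.n
  have b3 := hR.t
  have b4 := hR.s
  have q3 := hL.n
  simp only [enterAllCmd, WP_seq]
  rw [WP_asg, WP_asg, WP_asg]
  refine ⟨by simp [hL.t]; omega, by simp; omega, by simp; omega, ?_⟩
  refine (WP_for' (x := .i) (y := .n) (fun m τ => Entered I m τ) 300
    (by decide) rfl rfl (by simp; omega) (by simp [hL.n]; omega) (by omega) (by simp) ?_ ?_).mono ?_
  · refine ⟨by simp [hL.t], by simp, fun a _ => ?_, fun a _ => ?_, ?_, ?_⟩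
    · simp [h0 .cnt (by decide)]
    · simp [h0 .tot (by decide)]
    · simp [St.buf]
    · simp
  · rintro i τ - hi hF hτi hE
    simp [hL.n] at hi
    have hLτ : Loaded I B τ := hL.congr ((hF.reg _ rfl).trans (by simp))
      ((hF.reg _ rfl).trans (by simp)) (hF.mem _ rfl)
    have hVτ : τ.reg .vmax = I.V := (hF.reg _ rfl).trans (by simp [hV])
    have hval := hLτ.val i hi
    have hsz := hLτ.size i hi
    have hsum : ∑ j ∈ Finset.range (i + 1), I.s j ≤ X :=
      (Finset.sum_le_sum_of_subset (Finset.range_subset_range.2 (by omega))).trans hR.s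
    rw [Finset.sum_range_succ] at hsum
    rw [WP_seq, WP_asg]
    refine ⟨⟨by simp, hLτ.ok_sizeAt .i (by omega), by simp [hE.hh, hτi, hsz]; omega⟩, ?_⟩
    rw [WP_seq, WP_asg]
    refine ⟨Loaded.ok_valAt (I := I) (hLτ.congr (by simp) (by simp) (by simp)) .i
      (by simp; omega), ?_⟩
    have e1 : (τ.setR .hh (I.t + 1 + ∑ i ∈ Finset.range i, I.s i)) = τ := by
      rw [← hE.hh]
      ext x
      · by_cases h : x = .hh
        · subst h; simp
        · simp [h]
      · rfl
    rw [WP_ite]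
    refine ⟨by simp; omega, fun hc => ?_, fun hc => ?_⟩
    · simp [hτi, hLτ.n, hval] at hc
      apply WP.shift
      refine (enterCmd_spec (m := i) hR (hLτ.congr (by simp) (by simp) (by simp)) (by simp [hVτ])
        hi (by simp [hτi]) (by simp [hτi, hLτ.n, hval]) hc ?_ ?_).mono ?_
      · simp [hE.hh, hτi, hsz, Finset.sum_range_succ]; omega
      · refine ⟨by simp, ?_, ?_, ?_, ?_, ?_⟩
        · simpa using hE.key
        · simpa using hE.row
        · simpa using hE.tot
        · simpa using hE.buf
        · simpa using hE.wl
      · rintro τ' l' ⟨hE', hl'⟩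
        refine ⟨⟨?_, ?_, ?_, ?_, ?_, ?_⟩, ?_⟩
        · simpa using hE'.hh
        · simpa using hE'.key
        · simpa using hE'.row
        · simpa using hE'.tot
        · simpa using hE'.buf
        · simpa using hE'.wl
        · simp; omega
    · simp [hτi, hLτ.n, hval] at hc
      simp only [WP_skip]
      refine ⟨⟨?_, ?_, ?_, ?_, ?_, ?_⟩, by simp⟩
      · simp [hE.hh, hτi, hsz, Finset.sum_range_succ]; omega
      · intro j hj hv
        have := hE.key j (by rcases Nat.lt_succ_iff_lt_or_eq.1 hj with h | rfl <;> omega) hv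
        simpa using this
      · intro a ha
        rw [filter_range_succ, if_neg (by omega), List.append_nil]
        simpa using hE.row a ha
      · intro a ha
        rw [filter_range_succ, if_neg (by omega), List.append_nil]
        simpa using hE.tot a ha
      · rw [filter_range_succ, if_neg (by omega), List.append_nil]
        simpa using hE.buf
      · rw [filter_range_succ, if_neg (by omega), List.append_nil]
        simpa using hE.wl
  · rintro τ l ⟨h, -, hF, hl⟩
    simp [hL.n] at h hl
    exact ⟨h, by omega⟩

end WordRAM

/-! ### The greedy solution -/

namespace WordRAM

/-- Find the critical key. -/
def criticalCmd : Cmd :=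
  .ite (.lt Var.t Var.wl) (Var.sw ::= Var.t ;; selectCmd)
    (Var.pv ::= ((Var.hh : Ex) * ((Var.vmax : Ex) * Var.vmax) + 1) * Var.n)

/-- Compute the size of the copies before the critical key. -/
def loadCmd : Cmd :=
  Var.used ::= 0 ;;
  .for .i 0 .n (
    .ite (.and (.lt 0 (valAt Var.i)) (.lt (.ld .key Var.i) Var.pv))
      (Var.used ::= (Var.used : Ex) + sizeAt Var.i * multAt Var.i) .skip)

/-- Count the copies of each value in the greedy solution. -/
def quotaCmd : Cmd :=
  .for .i 0 .n (
    Var.val ::= valAt Var.i ;;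
    .ite (.lt 0 Var.val)
      (.ite (.lt (.ld .key Var.i) Var.pv)
        (.sto .gcnt Var.val (.ld .gcnt Var.val + multAt Var.i))
        (.ite (.eq (.ld .key Var.i) Var.pv)
          (.sto .gcnt Var.val (.ld .gcnt Var.val + ((Var.t : Ex) - Var.used) / sizeAt Var.i))
          .skip))
      .skip)

namespace Inst
variable (I : Inst)

/-- The keys and total sizes of the items of positive value. -/
def weights : List (ℕ × ℕ) :=
  ((List.range I.n).filter (0 < I.v ·)).map fun i => (I.key i, I.s i * I.u i)

theorem below_weights (p : ℕ) : below I.weights p = I.load p := by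
  rw [below, weights, List.filter_map, total, List.map_map, List.filter_filter, load]
  have h := sum_filter_range (fun i => I.key i < p ∧ 0 < I.v i) (fun i => I.s i * I.u i) I.n
  have e : ((Finset.range I.n).filter fun i => I.key i < p ∧ 0 < I.v i) =
      I.items.filter (I.key · < p) := by
    ext i
    simp only [Finset.mem_filter, mem_items, Finset.mem_range]
    tauto
  rw [e] at h
  rw [← h]
  simp [Function.comp_def]

theorem load_of_forall {p : ℕ} (h : ∀ i ∈ I.items, I.key i < p) : I.load p = total I.weights := by
  rw [load, Finset.filter_true_of_mem h, weights, total, List.map_map, sum_filter_range]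
  rfl

theorem mem_weights {x : ℕ × ℕ} :
    x ∈ I.weights ↔ ∃ i ∈ I.items, (I.key i, I.s i * I.u i) = x := by
  simp [weights, mem_items]

theorem nodup_weights : (I.weights.map Prod.fst).Nodup := by
  rw [weights, List.map_map]
  refine List.Nodup.map_on ?_ (List.nodup_range.filter _)
  intro i hi j hj h
  simp at hi hj
  exact key_inj hi.1 hj.1 h

theorem total_weights_le {B : Bound} {X : ℕ} (hR : Room I B X) : total I.weights ≤ X ^ 2 := by
  rw [weights, total, List.map_map, sum_filter_range]
  calc _ ≤ ∑ i ∈ Finset.range I.n, I.s i * X :=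
        (Finset.sum_le_sum_of_subset (Finset.filter_subset _ _)).trans
          (Finset.sum_le_sum fun i hi => Nat.mul_le_mul_left _ (hR.mult_le (by simpa using hi)))
    _ ≤ X * X := by rw [← Finset.sum_mul]; exact Nat.mul_le_mul_right _ hR.s
    _ = X ^ 2 := by ring

theorem le_inf {i : ℕ} (h : i < I.n) : I.s i ≤ I.inf := by
  have := Finset.single_le_sum (f := I.s) (fun _ _ => Nat.zero_le _) (Finset.mem_range.2 h)
  unfold inf; omega

theorem inf_le {B : Bound} {X : ℕ} (hR : Room I B X) : I.inf ≤ 3 * X := by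
  have := hR.s
  have := hR.t
  have := hR.ten
  unfold inf; omega

theorem t_lt_inf : I.t < I.inf := by unfold inf; omega

end Inst

/-- If not all copies fit, weighted selection with the total sizes of the items as weights and the
capacity as target returns exactly the critical key. If all fit, any number beyond all keys will do,
and `(inf * V² + 1) * n` is one. -/
theorem criticalCmd_spec {I : Inst} {B : Bound} {X k₀ : ℕ} {σ : St} (hR : Room I B X)
    (hC : Ctx I B σ) (hE : Entered I I.n σ) :
    WP B criticalCmd σ k₀ fun τ l => I.Critical (τ.reg .pv) ∧ l ≤ k₀ + 20000 * I.n + 100 := by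
  obtain ⟨c1, c2, c3, c4, c5, c6, c7, c8⟩ := hR.chain
  have b1 := hR.ten
  have b2 := hR.n
  have b3 := hR.V
  have hinf := I.inf_le hR
  have hsl : σ.reg .sl ≤ I.n := by
    rw [hE.sl]
    exact length_filter_range_le _ _
  have hbuf : σ.buf 0 (σ.reg .sl) = I.weights := hE.buf
  have hwl : σ.reg .wl = total I.weights := hE.wl
  have htw := I.total_weights_le hR
  rw [criticalCmd, WP_ite]
  refine ⟨by simp, fun hc => ?_, fun hc => ?_⟩
  · simp [hC.t, hwl] at hc
    rw [WP_seq, WP_asg]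
    refine ⟨by simp, ?_⟩
    have lim := hR.lim
    have l1 := lim .bk (by decide)
    have l2 := lim .bw (by decide)
    have l3 := lim .tb (by decide)
    have l4 := lim .tl (by decide)
    have l5 := lim .tw (by decide)
    refine (selectCmd_spec (m := σ.reg .sl) (W := I.t) (by simp) (by simp [hC.t]) ?_ ?_ ?_
      ⟨by omega, by omega, by omega, by omega⟩ (by omega) (by omega) (by omega)
      (hR.limw _)).mono ?_
    · rw [St.buf_setR, hbuf]; exact I.nodup_weights
    · rw [St.buf_setR, hbuf]; exact hc
    · rw [St.buf_setR, hbuf]; omega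
    · rintro τ l ⟨⟨wt, hm, h1, h2⟩, hl⟩
      simp only [St.buf_setR, hbuf, I.below_weights] at hm h1 h2
      obtain ⟨c, hc, e⟩ := I.mem_weights.1 hm
      simp only [Prod.mk.injEq] at e
      refine ⟨.inr ⟨c, hc, e.1, h1, by rw [e.2]; exact h2⟩, ?_⟩
      simp at hl
      omega
  · simp [hC.t, hwl] at hc
    have hok : I.inf * (I.V * I.V) + 1 ≤ X ^ 4 := by
      have : I.inf * (I.V * I.V) ≤ 3 * X * (X * X) :=
        Nat.mul_le_mul hinf (Nat.mul_le_mul b3 b3)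
      have e : 3 * X * (X * X) = 3 * X ^ 3 := by ring
      omega
    have hok' : (I.inf * (I.V * I.V) + 1) * I.n ≤ X ^ 5 := by
      calc _ ≤ X ^ 4 * X := Nat.mul_le_mul hok b2
        _ = X ^ 5 := by ring
    have hVV : I.V * I.V ≤ X ^ 2 := by rw [sq]; exact Nat.mul_le_mul b3 b3
    rw [WP_asg]
    refine ⟨by simp [hC.hh, hC.vmax, hC.n]; omega, ?_, by simp; omega⟩
    have hkey : ∀ i ∈ I.items, I.key i < (I.inf * (I.V * I.V) + 1) * I.n := by
      intro i hi
      rw [Inst.mem_items] at hi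
      have h1 : I.s i * I.V ^ 2 / I.v i ≤ I.inf * (I.V * I.V) :=
        (Nat.div_le_self _ _).trans (by rw [sq]; exact Nat.mul_le_mul_right _ (I.le_inf hi.1))
      have h2 := Nat.mul_le_mul_right I.n h1
      rw [Inst.key, add_mul, one_mul]
      omega
    refine .inl ⟨?_, ?_⟩
    · simpa [hC.hh, hC.vmax, hC.n] using hkey
    · simp only [St.reg_setR_self, Ex.eval_mul, Ex.eval_add, Ex.eval_var, Ex.eval_lit, hC.hh,
        hC.vmax, hC.n]
      rw [I.load_of_forall hkey]
      exact hc

theorem loadCmd_spec {I : Inst} {B : Bound} {X k₀ p : ℕ} {σ : St} (hR : Room I B X)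
    (hC : Ctx I B σ) (hp : σ.reg .pv = p)
    (hkey : ∀ i < I.n, 0 < I.v i → σ.mem .key i = I.key i) :
    WP B loadCmd σ k₀ fun τ l => τ.reg .used = I.load p ∧ l ≤ k₀ + 100 * I.n + 20 := by
  obtain ⟨c1, c2, c3, c4, c5, c6, c7, c8⟩ := hR.chain
  have b1 := hR.ten
  have b2 := hR.n
  have htw := I.total_weights_le hR
  have l1 := hR.lim .key (by decide)
  have q3 := hC.n
  rw [loadCmd, WP_seq, WP_asg]
  refine ⟨by simp; omega, ?_⟩
  refine (WP_for' (x := .i) (y := .n) (fun m τ => τ.reg .used =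
    ∑ i ∈ (Finset.range m).filter (fun i => 0 < I.v i ∧ I.key i < p), I.s i * I.u i) 100
    (by decide) rfl rfl (by simp; omega) (by simp [hC.n]; omega) (by omega) (by simp) ?_ ?_).mono ?_
  · simp
  · rintro i τ - hi hF hτi hI
    simp [hC.n] at hi
    have hCτ : Ctx I B τ := (hC.setR rfl).frame hF rfl
    have hval := hCτ.val i hi
    have hsz := hCτ.size i hi
    have hmu := hCτ.mult i hi
    have hpτ : τ.reg .pv = p := (hF.reg _ rfl).trans (by simp [hp])
    have hk : τ.mem .key i = σ.mem .key i := congrFun (hF.mem _ rfl) i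
    have hok1 := hCτ.ok_valAt .i (by omega)
    have hok2 := hCτ.ok_sizeAt .i (by omega)
    have hok3 := hCτ.ok_multAt .i (by omega)
    have hle : ∑ i ∈ (Finset.range (i + 1)).filter (fun i => 0 < I.v i ∧ I.key i < p),
        I.s i * I.u i ≤ X ^ 2 := by
      refine le_trans ?_ htw
      rw [Inst.weights, total, List.map_map, sum_filter_range]
      refine Finset.sum_le_sum_of_subset fun j hj => ?_
      simp at hj ⊢
      exact ⟨by omega, hj.2.1⟩
    rw [Finset.range_add_one, Finset.filter_insert] at hle ⊢
    rw [WP_ite]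
    refine ⟨by simp [hok1, hτi]; omega, fun hc => ?_, fun hc => ?_⟩
    · simp [hτi, hCτ.n, hval, hpτ, hk] at hc
      rw [hkey i hi hc.1] at hc
      rw [if_pos hc, Finset.sum_insert (by simp)] at hle ⊢
      rw [WP_asg]
      refine ⟨⟨by simp, ⟨hok2, hok3, ?_⟩, ?_⟩, ?_, by simp⟩
      · simp [hτi, hsz, hCτ.n, hmu]; omega
      · simp [hτi, hI, hsz, hmu, hCτ.n]; omega
      · simp [hI, hτi, hsz, hmu, hCτ.n]; omega
    · simp [hτi, hCτ.n, hval, hpτ, hk] at hc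
      have : ¬ (0 < I.v i ∧ I.key i < p) := by
        rintro ⟨h1, h2⟩
        have := hc h1
        rw [hkey i hi h1] at this
        omega
      rw [if_neg this]
      simp only [WP_skip]
      exact ⟨by simpa using hI, by simp⟩
  · rintro τ l ⟨h, -, hF, hl⟩
    simp [hC.n] at h hl
    refine ⟨?_, by omega⟩
    rw [h, Inst.load]
    refine Finset.sum_congr ?_ fun _ _ => rfl
    ext i
    simp only [Finset.mem_filter, Inst.mem_items, Finset.mem_range]
    tauto

/-- Everything that depends on the whole instance is known; `p` is the critical key. -/
structure Prepared (I : Inst) (B : Bound) (p : ℕ) (σ : St) : Prop extends Ctx I B σ where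
  crit : I.Critical p
  key : ∀ i < I.n, 0 < I.v i → σ.mem .key i = I.key i
  cnt : ∀ a, 0 < a → σ.mem .cnt a = (I.row a).length
  row : ∀ a, 0 < a → (List.range (σ.mem .cnt a)).map (fun k => σ.mem .cls (a * I.n + k)) = I.row a
  tot : ∀ a, 0 < a → σ.mem .tot a = I.tot a
  gcnt : ∀ a, 0 < a → σ.mem .gcnt a = I.quota p a

theorem quotaCmd_spec {I : Inst} {B : Bound} {X k₀ p : ℕ} {σ : St} (hR : Room I B X)
    (hC : Ctx I B σ) (hp : σ.reg .pv = p) (hcrit : I.Critical p) (hused : σ.reg .used = I.load p)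
    (hkey : ∀ i < I.n, 0 < I.v i → σ.mem .key i = I.key i) (h0 : ∀ a, σ.mem .gcnt a = 0) :
    WP B quotaCmd σ k₀ fun τ l => (∀ a, 0 < a → τ.mem .gcnt a = I.quota p a) ∧
      l ≤ k₀ + 200 * I.n + 20 := by
  obtain ⟨c1, c2, c3, c4, c5, c6, c7, c8⟩ := hR.chain
  have b1 := hR.ten
  have b2 := hR.n
  have b3 := hR.V
  have b4 := hR.t
  have l1 := hR.lim .key (by decide)
  have l2 := hR.lim .gcnt (by decide)
  have q3 := hC.n
  have hload : I.load p ≤ I.t := by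
    rcases hcrit with h | ⟨c, h⟩
    · exact h.2
    · exact h.2.2.1
  rw [quotaCmd]
  refine (WP_for' (x := .i) (y := .n) (fun m τ => ∀ a, 0 < a → τ.mem .gcnt a =
    ∑ i ∈ (Finset.range m).filter (fun i => I.v i = a), I.greedy p i) 200
    (by decide) rfl rfl (by simp; omega) (by simp [hC.n]; omega) (by omega) (by simp) ?_ ?_).mono ?_
  · simp [h0]
  · rintro i τ - hi hF hτi hI
    simp [hC.n] at hi
    have hCτ : Ctx I B τ := hC.frame hF rfl
    have hval := hCτ.val i hi
    have hpτ : τ.reg .pv = p := (hF.reg _ rfl).trans hp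
    have hk : τ.mem .key i = σ.mem .key i := congrFun (hF.mem _ rfl) i
    have hu : τ.reg .used = I.load p := (hF.reg _ rfl).trans hused
    have hok1 := hCτ.ok_valAt .i (by omega)
    rw [WP_seq, WP_asg]
    refine ⟨hok1, ?_⟩
    set τ₁ := τ.setR .val ((valAt Var.i).eval τ) with hτ₁
    have hC₁ : Ctx I B τ₁ := hCτ.setR rfl
    have r1 : τ₁.reg .i = i := by simp [τ₁, hτi]
    have r2 : τ₁.reg .val = I.v i := by simp [τ₁, hτi, hCτ.n, hval]
    have r3 : τ₁.mem = τ.mem := by simp [τ₁]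
    have r4 : τ₁.reg .pv = p := by simp [τ₁, hpτ]
    have r5 : τ₁.reg .used = I.load p := by simp [τ₁, hu]
    clear_value τ₁
    have hsz := hC₁.size i hi
    have hmu := hC₁.mult i hi
    have hok2 := hC₁.ok_sizeAt .i (by omega)
    have hok3 := hC₁.ok_multAt .i (by omega)
    have hVi := I.le i hi
    rw [WP_ite]
    refine ⟨by simp; omega, fun hc => ?_, fun hc => ?_⟩
    swap
    · simp [r2] at hc
      simp only [WP_skip]
      refine ⟨fun a ha => ?_, by simp⟩
      rw [Finset.range_add_one, Finset.filter_insert, if_neg (by omega)]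
      simpa [r3] using hI a ha
    simp [r2] at hc
    have hgi : I.greedy p i ≤ I.u i := Inst.greedy_le hcrit (Inst.mem_items.2 ⟨hi, hc⟩)
    have hstep : ∀ τ₂ : St, τ₂.mem .gcnt = Function.update (τ.mem .gcnt) (I.v i)
        (τ.mem .gcnt (I.v i) + I.greedy p i) → ∀ a, 0 < a → τ₂.mem .gcnt a =
        ∑ j ∈ (Finset.range (i + 1)).filter (fun j => I.v j = a), I.greedy p j := by
      intro τ₂ h a ha
      rw [Finset.range_add_one, Finset.filter_insert, h]
      by_cases hav : I.v i = a
      · subst hav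
        rw [if_pos rfl, Finset.sum_insert (by simp), Function.update_self, hI _ ha, add_comm]
      · rw [if_neg hav, Function.update_of_ne (fun h => hav h.symm), hI _ ha]
    have hcur : τ.mem .gcnt (I.v i) ≤ X := by
      rw [hI _ hc]
      refine le_trans (Finset.sum_le_sum fun j hj => ?_) (le_trans (Finset.sum_le_sum_of_subset
        (t := Finset.range I.n) ?_) hR.u)
      · simp at hj
        exact Inst.greedy_le hcrit (Inst.mem_items.2 ⟨by omega, by omega⟩)
      · intro j hj
        simp at hj ⊢
        omega
    have hub := hR.mult_le hi
    rw [WP_ite]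
    refine ⟨by simp [r1]; omega, fun hc' => ?_, fun hc' => ?_⟩
    · simp [r1, r3, r4, hk, hkey i hi hc] at hc'
      have hg : I.greedy p i = I.u i := by rw [Inst.greedy, if_pos hc']
      rw [WP_sto]
      refine ⟨by simp, ⟨by simp [r2]; omega, hok3, ?_⟩, by simp [r2]; omega, hstep _ ?_, by simp⟩
      · simp [r1, r2, r3, hC₁.n] at hmu ⊢
        simp [hmu]; omega
      · simp [r1, r2, r3, hC₁.n, hg] at hmu ⊢
        simp [hmu]
    · simp [r1, r3, r4, hk, hkey i hi hc] at hc'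
      rw [WP_ite]
      refine ⟨by simp [r1]; omega, fun hc'' => ?_, fun hc'' => ?_⟩
      · simp [r1, r3, r4, hk, hkey i hi hc] at hc''
        have hg : I.greedy p i = (I.t - I.load p) / I.s i := by
          rw [Inst.greedy, if_neg (by omega), if_pos hc'']
        have hd := Nat.div_le_self (I.t - I.load p) (I.s i)
        rw [WP_sto]
        refine ⟨by simp, ⟨by simp [r2]; omega, ⟨by simp [r5, hC₁.t, hload], hok2⟩, ?_⟩,
          by simp [r2]; omega, hstep _ ?_, by simp⟩
        · simp [r1, r2, r3, r5, hC₁.t] at hsz ⊢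
          simp [hsz]; omega
        · simp [r1, r2, r3, r5, hC₁.t, hg] at hsz ⊢
          simp [hsz]
      · simp [r1, r3, r4, hk, hkey i hi hc] at hc''
        have hg : I.greedy p i = 0 := by
          rw [Inst.greedy, if_neg (by omega), if_neg hc'']
        simp only [WP_skip]
        refine ⟨hstep _ ?_, by simp⟩
        simp [r3, hg]
  · rintro τ l ⟨h, -, hF, hl⟩
    simp [hC.n] at h hl
    exact ⟨h, by omega⟩

/-- Read the input and compute the greedy solution. -/
def prepareCmd : Cmd :=
  Var.n ::= .ld .raw 0 ;; Var.t ::= .ld .raw 1 ;; maxCmd ;;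
  Var.kk ::= (Var.vmax : Ex) + Var.vmax ;; Var.rr ::= (Var.kk : Ex) * Var.vmax ;;
  Var.nn ::= (Var.rr : Ex) + Var.rr + 1 ;; Var.str ::= (Var.kk : Ex) + Var.kk + 1 ;;
  Var.cc ::= (Var.vmax : Ex) + 1 ;;
  enterAllCmd ;; criticalCmd ;; loadCmd ;; quotaCmd

theorem prepareCmd_spec {I : Inst} {B : Bound} {X k₀ : ℕ} {σ : St} (hR : Room I B X)
    (hV : I.V = (Finset.range I.n).sup I.v) (hn : σ.mem .raw 0 = I.n) (ht : σ.mem .raw 1 = I.t)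
    (hs : ∀ i < I.n, σ.mem .raw (i + 2) = I.s i)
    (hv : ∀ i < I.n, σ.mem .raw (i + I.n + 2) = I.v i)
    (hu : ∀ i < I.n, σ.mem .raw (i + I.n + I.n + 2) = I.u i)
    (h0 : ∀ A, A ≠ .raw → σ.mem A = 0) :
    WP B prepareCmd σ k₀ fun τ l => Prepared I B (τ.reg .pv) τ ∧ τ.mem .sol = 0 ∧
      l ≤ k₀ + 21000 * I.n + 1000 := by
  obtain ⟨c1, c2, c3, c4, c5, c6, c7, c8⟩ := hR.chain
  have b1 := hR.ten
  have b3 := hR.V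
  have hraw := hR.raw
  have hrawX := hR.rawX
  have hVV : (I.V + I.V) * I.V ≤ 2 * X ^ 2 := by
    calc (I.V + I.V) * I.V ≤ (X + X) * X := Nat.mul_le_mul (by omega) b3
      _ = 2 * X ^ 2 := by ring
  simp only [prepareCmd, WP_seq]
  rw [WP_asg, WP_asg]
  refine ⟨by simp; omega, by simp; omega, ?_⟩
  set σ₁ := (σ.setR .n _).setR .t _ with hσ₁
  have hL₁ : Loaded I B σ₁ := ⟨by simp [σ₁, hn], by simp [σ₁, ht], by simpa [σ₁] using hs,
    by simpa [σ₁] using hv, by simpa [σ₁] using hu, hraw, by omega⟩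
  have h0₁ : ∀ A, A ≠ .raw → σ₁.mem A = 0 := by simpa [σ₁] using h0
  refine (maxCmd_spec hL₁ hV).frame.mono ?_
  rintro τ₂ l₂ ⟨⟨hV₂, hl₂⟩, hF₂⟩
  have hL₂ : Loaded I B τ₂ := hL₁.congr (hF₂.reg _ rfl) (hF₂.reg _ rfl) (hF₂.mem _ rfl)
  have h0₂ : τ₂.mem = σ₁.mem := funext fun A => hF₂.mem _ rfl
  simp only [WP_asg]
  refine ⟨by simp [hV₂]; omega, by simp [hV₂]; omega, by simp [hV₂]; omega, by simp [hV₂]; omega,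
    by simp [hV₂]; omega, ?_⟩
  set σ₃ := (((((τ₂.setR .kk _).setR .rr _).setR .nn _).setR .str _).setR .cc _) with hσ₃
  have e1 : σ₃.reg .n = I.n := by simp [σ₃, hL₂.n]
  have e2 : σ₃.reg .t = I.t := by simp [σ₃, hL₂.t]
  have e3 : σ₃.reg .vmax = I.V := by simp [σ₃, hV₂]
  have e4 : σ₃.reg .kk = 2 * I.V := by simp [σ₃, hV₂]; ring
  have e5 : σ₃.reg .rr = I.mid := by simp [σ₃, hV₂, Inst.mid]; ring
  have e6 : σ₃.reg .nn = I.span := by simp [σ₃, hV₂, Inst.span]; ring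
  have e7 : σ₃.reg .str = 4 * I.V + 1 := by simp [σ₃, hV₂]; ring
  have e8 : σ₃.reg .cc = I.V + 1 := by simp [σ₃, hV₂]
  have e9 : σ₃.mem = σ₁.mem := by simp [σ₃, h0₂]
  clear_value σ₃
  have hL₃ : Loaded I B σ₃ := ⟨e1, e2, e9 ▸ hL₁.size, e9 ▸ hL₁.val, e9 ▸ hL₁.mult, hL₁.raw, hL₁.word⟩
  refine (enterAllCmd_spec hR hL₃ e3 (e9 ▸ h0₁)).frame.mono ?_
  rintro τ₄ l₄ ⟨⟨hE₄, hl₄⟩, hF₄⟩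
  have hC₄ : Ctx I B τ₄ := ⟨hL₃.congr (hF₄.reg _ rfl) (hF₄.reg _ rfl) (hF₄.mem _ rfl),
    (hF₄.reg _ rfl).trans e3, (hF₄.reg _ rfl).trans e4, (hF₄.reg _ rfl).trans e5,
    (hF₄.reg _ rfl).trans e6, (hF₄.reg _ rfl).trans e7, (hF₄.reg _ rfl).trans e8, hE₄.hh⟩
  have hg₄ : τ₄.mem .gcnt = 0 := (hF₄.mem _ rfl).trans (by rw [e9]; exact h0₁ _ (by decide))
  have hs₄ : τ₄.mem .sol = 0 := (hF₄.mem _ rfl).trans (by rw [e9]; exact h0₁ _ (by decide))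
  refine (criticalCmd_spec hR hC₄ hE₄).frame.mono ?_
  rintro τ₅ l₅ ⟨⟨hcrit, hl₅⟩, hF₅⟩
  have hC₅ : Ctx I B τ₅ := hC₄.frame hF₅ rfl
  have hk₅ : τ₅.mem .key = τ₄.mem .key := hF₅.mem _ rfl
  refine (loadCmd_spec hR hC₅ rfl (by rw [hk₅]; exact hE₄.key)).frame.mono ?_
  rintro τ₆ l₆ ⟨⟨hload, hl₆⟩, hF₆⟩
  have hC₆ : Ctx I B τ₆ := hC₅.frame hF₆ rfl
  have hk₆ : τ₆.mem .key = τ₄.mem .key := (hF₆.mem _ rfl).trans hk₅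
  have hp₆ : τ₆.reg .pv = τ₅.reg .pv := hF₆.reg _ rfl
  have hg₆ : τ₆.mem .gcnt = 0 := (hF₆.mem _ rfl).trans ((hF₅.mem _ rfl).trans hg₄)
  refine (quotaCmd_spec hR hC₆ hp₆ hcrit hload (by rw [hk₆]; exact hE₄.key)
    (by simp [hg₆])).frame.mono ?_
  rintro τ₇ l₇ ⟨⟨hg₇, hl₇⟩, hF₇⟩
  have hp₇ : τ₇.reg .pv = τ₅.reg .pv := (hF₇.reg _ rfl).trans hp₆
  have hk₇ : τ₇.mem .key = τ₄.mem .key := (hF₇.mem _ rfl).trans hk₆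
  have hcnt₇ : τ₇.mem .cnt = τ₄.mem .cnt :=
    (hF₇.mem _ rfl).trans ((hF₆.mem _ rfl).trans (hF₅.mem _ rfl))
  have hcls₇ : τ₇.mem .cls = τ₄.mem .cls :=
    (hF₇.mem _ rfl).trans ((hF₆.mem _ rfl).trans (hF₅.mem _ rfl))
  have htot₇ : τ₇.mem .tot = τ₄.mem .tot :=
    (hF₇.mem _ rfl).trans ((hF₆.mem _ rfl).trans (hF₅.mem _ rfl))
  refine ⟨⟨hC₆.frame hF₇ rfl, hp₇ ▸ hcrit, hk₇ ▸ hE₄.key, fun a ha => ?_, fun a ha => ?_,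
    fun a ha => ?_, hp₇ ▸ hg₇⟩, ?_, ?_⟩
  · rw [hcnt₇, hE₄.cnt ha]; rfl
  · rw [hcnt₇, hcls₇, hE₄.row a ha]; rfl
  · rw [htot₇, hE₄.tot a ha, sum_filter_range]; rfl
  · rw [hF₇.mem _ rfl, hF₆.mem _ rfl, hF₅.mem _ rfl, hs₄]
  · simp at hl₂ hl₄
    omega

end WordRAM

/-! ### The copies of one class that are always taken -/

namespace WordRAM

namespace Inst
variable {I : Inst} {a i p r : ℕ}

theorem mem_row : i ∈ I.row a ↔ i ∈ I.cls a := by simp [row, mem_cls]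

theorem sum_row {M : Type*} [AddCommMonoid M] (P : ℕ → Prop) [DecidablePred P] (f : ℕ → M) :
    (((I.row a).filter (P ·)).map f).sum = ∑ i ∈ (I.cls a).filter P, f i := by
  have h := sum_filter_range (fun i => I.v i = a ∧ P i) f I.n
  rw [row, List.filter_filter, cls, Finset.filter_filter, ← h]
  congr 2
  refine List.filter_congr fun i _ => ?_
  simp only [Bool.decide_and, Bool.and_comm]

theorem nodup_row (I : Inst) (a : ℕ) : (I.row a).Nodup := List.nodup_range.filter _

theorem length_row_le (I : Inst) (a : ℕ) : (I.row a).length ≤ I.n := length_filter_range_le _ _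

/-- The keys and multiplicities of the items of a class. -/
def copies (I : Inst) (a : ℕ) : List (ℕ × ℕ) := (I.row a).map fun i => (I.key i, I.u i)

theorem below_copies : below (I.copies a) p = I.cum a p := by
  have h := sum_row (I := I) (a := a) (fun i => I.key i < p) I.u
  rw [below, copies, List.filter_map, total, List.map_map, cum, ← h]
  simp [Function.comp_def]

theorem total_copies : total (I.copies a) = I.tot a := by
  have h := sum_row (I := I) (a := a) (fun _ => True) I.u
  simp only [decide_true, List.filter_true, Finset.filter_true] at h
  rw [copies, total, List.map_map, tot, ← h]
  rfl

theorem nodup_copies : ((I.copies a).map Prod.fst).Nodup := by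
  rw [copies, List.map_map]
  refine List.Nodup.map_on ?_ (I.nodup_row a)
  intro i hi j hj h
  rw [mem_row, mem_cls] at hi hj
  exact key_inj hi.1 hj.1 h

/-- With multiplicities as weights, selection finds the item that contains copy number `r` without
spelling out the copies, whose number is not bounded by `n` and `V`. -/
theorem exists_of_selected (h : Selected (I.copies a) r p) : ∃ i, I.AtRank a r i ∧ I.key i = p := by
  obtain ⟨wt, hm, h1, h2⟩ := h
  rw [below_copies] at h1 h2
  obtain ⟨i, hi, e⟩ := List.mem_map.1 hm
  simp only [Prod.mk.injEq] at e
  obtain ⟨rfl, rfl⟩ := e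
  exact ⟨i, ⟨mem_row.1 hi, h1, h2⟩, rfl⟩

theorem tot_le {B : Bound} {X : ℕ} (hR : Room I B X) (a : ℕ) : I.tot a ≤ X :=
  (Finset.sum_le_sum_of_subset (Finset.filter_subset _ _)).trans hR.u

end Inst

namespace Loaded
variable {I : Inst} {B : Bound} {σ τ : St}

theorem sizeAt_ok (h : Loaded I B σ) (x : Var) (hx : τ.reg x < I.n) :
    (sizeAt x).ok B τ := by
  have := h.raw
  have := h.word
  simp [sizeAt]; omega

theorem multAt_ok (h : Loaded I B σ) (x : Var) (hn : τ.reg .n = I.n) (hx : τ.reg x < I.n) :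
    (multAt x).ok B τ := by
  have := h.raw
  have := h.word
  simp [multAt, hn]; omega

end Loaded

namespace Prepared
variable {I : Inst} {B : Bound} {p : ℕ} {σ τ : St}

theorem frame {c : Cmd} (h : Prepared I B p σ) (hF : Frame c σ τ) (hc : c.keeps = true)
    (hc' : (c.wa .key || c.wa .cnt || c.wa .cls || c.wa .tot || c.wa .gcnt) = false) :
    Prepared I B p τ := by
  simp only [Bool.or_eq_false_iff] at hc'
  obtain ⟨⟨⟨⟨h1, h2⟩, h3⟩, h4⟩, h5⟩ := hc'
  refine ⟨h.toCtx.frame hF hc, h.crit, ?_, ?_, ?_, ?_, ?_⟩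
  · rw [hF.mem _ h1]; exact h.key
  · rw [hF.mem _ h2]; exact h.cnt
  · rw [hF.mem _ h2, hF.mem _ h3]; exact h.row
  · rw [hF.mem _ h4]; exact h.tot
  · rw [hF.mem _ h5]; exact h.gcnt

theorem setR (h : Prepared I B p σ) {x : Var} {v : ℕ} (hx : x.fixed = false) :
    Prepared I B p (σ.setR x v) :=
  ⟨h.toCtx.setR hx, h.crit, h.key, h.cnt, h.row, h.tot, h.gcnt⟩

theorem cls (h : Prepared I B p σ) {a k : ℕ} (ha : 0 < a) (hk : k < (I.row a).length) :
    σ.mem .cls (a * I.n + k) = (I.row a)[k] := by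
  have h1 := h.row a ha
  have h2 : k < ((List.range (σ.mem .cnt a)).map
    (fun k => σ.mem .cls (a * I.n + k))).length := by rw [h1]; exact hk
  have h3 : ((List.range (σ.mem .cnt a)).map (fun k => σ.mem .cls (a * I.n + k)))[k]'h2 =
      (I.row a)[k] := by simp only [h1]
  simpa using h3

end Prepared

/-- The item at position `ci` in the row of the class. -/
def rowItem : Ex := .ld .cls ((Var.a : Ex) * Var.n + Var.ci)

/-- Copy the class to the buffer for the selection. -/
def fillCmd : Cmd :=
  .for .ci 0 .ac (
    Var.i ::= rowItem ;;
    .sto .bk Var.ci (.ld .key Var.i) ;;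
    .sto .bw Var.ci (multAt Var.i))

theorem getElem_row_lt {I : Inst} {a k : ℕ} (hk : k < (I.row a).length) :
    (I.row a)[k] < I.n ∧ I.v (I.row a)[k] = a := by
  have := List.getElem_mem hk
  rwa [Inst.mem_row, Inst.mem_cls] at this

theorem rowItem_ok {I : Inst} {B : Bound} {X k p a : ℕ} {σ : St} (hR : Room I B X)
    (hP : Prepared I B p σ) (ha : σ.reg .a = a) (ha0 : 0 < a) (haV : a ≤ I.V)
    (hci : σ.reg .ci = k) (hk : k < (I.row a).length) :
    rowItem.ok B σ ∧ rowItem.eval σ = (I.row a)[k] := by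
  obtain ⟨c1, c2, c3, c4, c5, c6, c7, c8⟩ := hR.chain
  have b2 := hR.n
  have b3 := hR.V
  have h1 : a * I.n ≤ X ^ 2 := by rw [sq]; exact Nat.mul_le_mul (haV.trans b3) b2
  have h2 := I.length_row_le a
  have l1 := hR.lim .cls (by decide)
  constructor
  · simp [rowItem, ha, hP.n, hci]; omega
  · simp [rowItem, ha, hP.n, hci, hP.cls ha0 hk]

theorem fillCmd_spec {I : Inst} {B : Bound} {X k₀ p a : ℕ} {σ : St} (hR : Room I B X)
    (hP : Prepared I B p σ) (ha : σ.reg .a = a) (ha0 : 0 < a) (haV : a ≤ I.V)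
    (hac : σ.reg .ac = (I.row a).length) :
    WP B fillCmd σ k₀ fun τ l => τ.buf 0 (I.row a).length = I.copies a ∧
      l ≤ k₀ + 100 * (I.row a).length + 10 := by
  obtain ⟨c1, c2, c3, c4, c5, c6, c7, c8⟩ := hR.chain
  have b1 := hR.ten
  have b2 := hR.n
  have hlen := I.length_row_le a
  have l1 := hR.lim .key (by decide)
  have l2 := hR.lim .bk (by decide)
  have l3 := hR.lim .bw (by decide)
  refine (WP_for' (x := .ci) (y := .ac) (fun m τ => τ.buf 0 m = (I.copies a).take m) 100
    (by decide) rfl rfl (by simp; omega) (by simp [hac]; omega) (by omega) (by simp) ?_ ?_).mono ?_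
  · simp [St.buf]
  · rintro k τ - hk hF hτk hI
    rw [hac] at hk
    have hPτ : Prepared I B p τ := hP.frame hF rfl rfl
    obtain ⟨h1, h2⟩ := rowItem_ok hR hPτ ((hF.reg _ rfl).trans ha) ha0 haV hτk hk
    obtain ⟨h3, h4⟩ := getElem_row_lt hk
    rw [WP_seq, WP_asg]
    refine ⟨h1, ?_⟩
    rw [h2]
    set i := (I.row a)[k] with hi
    have h5 : τ.mem .key i = I.key i := hPτ.key i h3 (by omega)
    have h6 := hPτ.mult i h3
    simp only [WP_seq, WP_sto]
    refine ⟨by simp, by simp; omega, by simp [hτk]; omega, by simp,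
      hPτ.multAt_ok .i (by simp [hPτ.n]) (by simpa using h3),
      by simp [hτk]; omega, ?_, ?_⟩
    · rw [Inst.copies, ← List.map_take, List.take_add_one, List.getElem?_eq_getElem hk,
        List.map_append, List.map_take, ← Inst.copies, ← hI]
      simp only [St.buf, seg_succ]
      congr 1
      · refine seg_congr (fun j h1 h2 => ?_) (fun j h1 h2 => ?_)
        · simp [hτk]
          rw [Function.update_of_ne (by omega)]
        · simp [hτk]
          rw [Function.update_of_ne (by omega)]
      · simp [hτk, h5, hPτ.n, h6, ← hi]
    · simp [rowItem]
  · rintro τ l ⟨h, -, hF, hl⟩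
    simp [hac] at h hl
    refine ⟨?_, by omega⟩
    rw [h, List.take_of_length_le (by simp [Inst.copies])]

/-- Find the key of the copy whose number in the class is `sw`. -/
def rankCmd : Cmd := fillCmd ;; Var.sl ::= Var.ac ;; selectCmd

theorem rankCmd_spec {I : Inst} {B : Bound} {X k₀ p a r : ℕ} {σ : St} (hR : Room I B X)
    (hP : Prepared I B p σ) (ha : σ.reg .a = a) (ha0 : 0 < a) (haV : a ≤ I.V)
    (hac : σ.reg .ac = (I.row a).length) (hr : σ.reg .sw = r) (hr' : r < I.tot a) :
    WP B rankCmd σ k₀ fun τ l => (∃ i, I.AtRank a r i ∧ I.key i = τ.reg .pv) ∧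
      l ≤ k₀ + 20100 * (I.row a).length + 50 := by
  obtain ⟨c1, c2, c3, c4, c5, c6, c7, c8⟩ := hR.chain
  have b1 := hR.ten
  have b2 := hR.n
  have hlen := I.length_row_le a
  have htot := I.tot_le hR a
  have lim := hR.lim
  have l1 := lim .bk (by decide)
  have l2 := lim .bw (by decide)
  have l3 := lim .tb (by decide)
  have l4 := lim .tl (by decide)
  have l5 := lim .tw (by decide)
  rw [rankCmd, WP_seq]
  refine (fillCmd_spec hR hP ha ha0 haV hac).frame.mono ?_
  rintro τ l ⟨⟨hbuf, hl⟩, hF⟩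
  have e1 : τ.reg .ac = (I.row a).length := (hF.reg _ rfl).trans hac
  have e2 : τ.reg .sw = r := (hF.reg _ rfl).trans hr
  rw [WP_seq, WP_asg]
  refine ⟨by simp, ?_⟩
  refine (selectCmd_spec (m := (I.row a).length) (W := r) (by simp [e1]) (by simp [e2]) ?_ ?_ ?_
    ⟨by omega, by omega, by omega, by omega⟩ (by omega) (by omega) (by omega)
    (hR.limw _)).mono ?_
  · rw [St.buf_setR, hbuf]; exact Inst.nodup_copies
  · rw [St.buf_setR, hbuf, Inst.total_copies]; exact hr'
  · rw [St.buf_setR, hbuf, Inst.total_copies]; omega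
  · rintro τ' l' ⟨hs, hl'⟩
    rw [St.buf_setR, hbuf] at hs
    refine ⟨Inst.exists_of_selected hs, ?_⟩
    simp at hl'
    omega

/-- Take the copies with keys less than `p`, and collect the items with keys up to `pq`. -/
def windowLoop : Cmd :=
  .for .ci 0 .ac (
    Var.i ::= rowItem ;;
    .ite (.lt (.ld .key Var.i) Var.p)
      (.sto .sol Var.i (multAt Var.i) ;; Var.used ::= (Var.used : Ex) + multAt Var.i ;;
        Var.z0 ::= (Var.z0 : Ex) + sizeAt Var.i * multAt Var.i)
      (.ite (.and (.le (.ld .key Var.i) Var.pq) (.lt 0 (multAt Var.i)))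
        (.sto .win Var.wl Var.i ;; Var.wl ::= (Var.wl : Ex) + 1) .skip))

/-- The items in the first `m` places of the row have been treated. -/
structure Windowed (I : Inst) (a p pq : ℕ) (L : List ℕ) (σ τ : St) : Prop where
  used : τ.reg .used = ((L.filter (I.key · < p)).map I.u).sum
  z0 : τ.reg .z0 = σ.reg .z0 + ((L.filter (I.key · < p)).map fun i => I.s i * I.u i).sum
  sol : ∀ i ∈ L, I.key i < p → τ.mem .sol i = I.u i
  sol' : ∀ i, (i ∈ L → ¬ I.key i < p) → τ.mem .sol i = σ.mem .sol i
  win : (List.range (τ.reg .wl)).map (τ.mem .win) =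
    L.filter fun i => p ≤ I.key i ∧ I.key i ≤ pq ∧ 0 < I.u i

set_option maxHeartbeats 1000000 in
theorem windowLoop_spec {I : Inst} {B : Bound} {X k₀ p₀ a p pq : ℕ} {σ : St} (hR : Room I B X)
    (hP : Prepared I B p₀ σ) (ha : σ.reg .a = a) (ha0 : 0 < a) (haV : a ≤ I.V)
    (hac : σ.reg .ac = (I.row a).length) (hp : σ.reg .p = p) (hpq : σ.reg .pq = pq)
    (hu : σ.reg .used = 0) (hwl : σ.reg .wl = 0)
    (hz0 : σ.reg .z0 + ∑ i ∈ I.cls a, I.s i * I.u i ≤ X ^ 3) :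
    WP B windowLoop σ k₀ fun τ l => Windowed I a p pq (I.row a) σ τ ∧
      l ≤ k₀ + 200 * (I.row a).length + 10 := by
  obtain ⟨c1, c2, c3, c4, c5, c6, c7, c8⟩ := hR.chain
  have b1 := hR.ten
  have b2 := hR.n
  have hlen := I.length_row_le a
  have l1 := hR.lim .key (by decide)
  have l2 := hR.lim .sol (by decide)
  have l3 := hR.lim .win (by decide)
  refine (WP_for' (x := .ci) (y := .ac) (fun m τ => Windowed I a p pq ((I.row a).take m) σ τ) 200
    (by decide) rfl rfl (by simp; omega) (by simp [hac]; omega) (by omega) (by simp) ?_ ?_).mono ?_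
  · refine ⟨by simp [hu], by simp, by simp, by simp, by simp [hwl]⟩
  · rintro k τ - hk hF hτk hW
    rw [hac] at hk
    have hPτ : Prepared I B p₀ τ := hP.frame hF rfl rfl
    obtain ⟨h1, h2⟩ := rowItem_ok hR hPτ ((hF.reg _ rfl).trans ha) ha0 haV hτk hk
    obtain ⟨h3, h4⟩ := getElem_row_lt hk
    have e1 : τ.reg .p = p := (hF.reg _ rfl).trans hp
    have e2 : τ.reg .pq = pq := (hF.reg _ rfl).trans hpq
    have htake : (I.row a).take (k + 1) = (I.row a).take k ++ [(I.row a)[k]] := by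
      rw [List.take_add_one, List.getElem?_eq_getElem hk]; rfl
    have hsub : ((I.row a).take (k + 1)).Sublist (I.row a) := List.take_sublist _ _
    have hnot : (I.row a)[k] ∉ (I.row a).take k := by
      have := (I.nodup_row a).sublist hsub
      rw [htake, List.nodup_append] at this
      intro hmem
      exact this.2.2 _ hmem _ (List.mem_singleton_self _) rfl
    have hused : ((((I.row a).take (k + 1)).filter (I.key · < p)).map I.u).sum ≤ X := by
      have : (((I.row a).filter (I.key · < p)).map I.u).sum ≤ X := by
        rw [Inst.sum_row]
        exact (Finset.sum_le_sum_of_subset (Finset.filter_subset _ _)).trans (I.tot_le hR a)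
      exact (((hsub.filter _).map _).sum_le_sum (fun _ _ => Nat.zero_le _)).trans this
    have hsize : ((((I.row a).take (k + 1)).filter (I.key · < p)).map
        fun i => I.s i * I.u i).sum ≤ ∑ i ∈ I.cls a, I.s i * I.u i := by
      have : (((I.row a).filter (I.key · < p)).map fun i => I.s i * I.u i).sum ≤
          ∑ i ∈ I.cls a, I.s i * I.u i := by
        rw [Inst.sum_row]
        exact Finset.sum_le_sum_of_subset (Finset.filter_subset _ _)
      exact (((hsub.filter _).map _).sum_le_sum (fun _ _ => Nat.zero_le _)).trans this
    have hwlen : τ.reg .wl ≤ k := by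
      have h5 := congrArg List.length hW.win
      have h6 := List.length_filter_le (fun i => decide (p ≤ I.key i ∧ I.key i ≤ pq ∧ 0 < I.u i))
        ((I.row a).take k)
      simp only [List.length_map, List.length_range] at h5
      rw [← h5, List.length_take] at h6
      omega
    rw [htake] at hused hsize ⊢
    rw [WP_seq, WP_asg]
    refine ⟨h1, ?_⟩
    rw [h2]
    set i := (I.row a)[k] with hi
    have h5 : τ.mem .key i = I.key i := hPτ.key i h3 (by omega)
    have h6 := hPτ.mult i h3
    have h7 := hPτ.size i h3
    have h8 := hR.size_le h3
    have h9 := hR.mult_le h3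
    have h10 : I.s i * I.u i ≤ X ^ 2 := by rw [sq]; exact Nat.mul_le_mul h8 h9
    rw [WP_ite]
    refine ⟨by simp; omega, fun hc => ?_, fun hc => ?_⟩
    · simp [h5, e1] at hc
      simp [hc] at hused hsize
      simp only [WP_seq, WP_sto, WP_asg]
      refine ⟨by simp, hPτ.multAt_ok .i (by simp [hPτ.n]) (by simpa using h3), by simp; omega,
        ⟨by simp, hPτ.multAt_ok .i (by simp [hPτ.n]) (by simpa using h3), ?_⟩,
        ⟨by simp, ⟨hPτ.sizeAt_ok .i (by simpa using h3),
          hPτ.multAt_ok .i (by simp [hPτ.n]) (by simpa using h3), ?_⟩, ?_⟩, ⟨?_, ?_, ?_, ?_, ?_⟩, ?_⟩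
      · simp [hPτ.n, h6, hW.used]; omega
      · simp [hPτ.n, h6, h7]; omega
      · simp [hPτ.n, h6, h7, hW.z0]; omega
      · simp [hPτ.n, h6, hW.used, hc]
      · simp [hPτ.n, h6, h7, hW.z0, hc]; omega
      · intro j hj hjp
        by_cases hji : j = i
        · subst hji
          simp [hPτ.n, h6]
        · have hj' : j ∈ (I.row a).take k := by simpa [hji] using hj
          simpa [Function.update_of_ne hji] using hW.sol j hj' hjp
      · intro j hj
        have hji : j ≠ i := by
          rintro rfl
          exact hj (by simp) hc
        simpa [Function.update_of_ne hji] using hW.sol' j fun h =>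
          hj (List.mem_append_left _ h)
      · have : ¬ p ≤ I.key i := by omega
        simpa [List.filter_append, this] using hW.win
      · simp [rowItem]
    · simp [h5, e1] at hc
      have hnc : ¬ I.key i < p := by omega
      rw [WP_ite]
      refine ⟨⟨by simp; omega, fun _ => ⟨by simp; omega,
        hPτ.multAt_ok .i (by simp [hPτ.n]) (by simpa using h3)⟩⟩, fun hc' => ?_, fun hc' => ?_⟩
      · simp [h5, e2, hPτ.n, h6] at hc'
        simp only [WP_seq, WP_sto, WP_asg]
        refine ⟨by simp, by simp, by simp; omega, by simp; omega, ⟨?_, ?_, ?_, ?_, ?_⟩, ?_⟩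
        · simp [hW.used, hnc]
        · simp [hW.z0, hnc]
        · intro j hj hjp
          have hji : j ≠ i := by rintro rfl; omega
          have hj' : j ∈ (I.row a).take k := by simpa [hji] using hj
          simpa using hW.sol j hj' hjp
        · intro j hj
          simpa using hW.sol' j fun h => hj (List.mem_append_left _ h)
        · rw [List.filter_append, ← hW.win]
          simp [hc, hc', List.range_succ]
          intro j hj
          rw [Function.update_of_ne (by omega)]
        · simp [rowItem]
      · simp [h5, e2, hPτ.n, h6] at hc'
        simp only [WP_skip]
        refine ⟨⟨?_, ?_, ?_, ?_, ?_⟩, ?_⟩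
        · simp [hW.used, hnc]
        · simp [hW.z0, hnc]
        · intro j hj hjp
          have hji : j ≠ i := by rintro rfl; omega
          have hj' : j ∈ (I.row a).take k := by simpa [hji] using hj
          simpa using hW.sol j hj' hjp
        · intro j hj
          simpa using hW.sol' j fun h => hj (List.mem_append_left _ h)
        · have : ¬ (p ≤ I.key i ∧ I.key i ≤ pq ∧ 0 < I.u i) := by
            rintro ⟨-, h, h'⟩
            have := hc' h
            omega
          simpa [List.filter_append, this] using hW.win
        · simp [rowItem]
  · rintro τ l ⟨h, -, hF, hl⟩
    simp [hac] at h hl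
    exact ⟨h, by omega⟩

end WordRAM

/-! ### The copies of one class around the greedy solution -/

namespace WordRAM

namespace Inst
variable {I : Inst} {a : ℕ}

theorem preSize_le_total {B : Bound} {X : ℕ} (hR : Room I B X) (a c : ℕ) :
    I.preSize a c ≤ X ^ 2 := by
  calc _ ≤ ∑ i ∈ I.cls a, I.s i * X := Finset.sum_le_sum fun i hi =>
        Nat.mul_le_mul_left _ ((min_le_left _ _).trans (hR.mult_le (mem_cls.1 hi).1))
    _ = (∑ i ∈ I.cls a, I.s i) * X := by rw [Finset.sum_mul]
    _ ≤ X * X := Nat.mul_le_mul_right _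
        ((Finset.sum_le_sum_of_subset (Finset.filter_subset _ _)).trans hR.s)
    _ = X ^ 2 := by ring

theorem sum_size_mul_le {B : Bound} {X : ℕ} (hR : Room I B X) (a : ℕ) :
    ∑ i ∈ I.cls a, I.s i * I.u i ≤ X ^ 2 := by
  calc _ ≤ ∑ i ∈ I.cls a, I.s i * X := Finset.sum_le_sum fun i hi =>
        Nat.mul_le_mul_left _ (hR.mult_le (mem_cls.1 hi).1)
    _ = (∑ i ∈ I.cls a, I.s i) * X := by rw [Finset.sum_mul]
    _ ≤ X * X := Nat.mul_le_mul_right _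
        ((Finset.sum_le_sum_of_subset (Finset.filter_subset _ _)).trans hR.s)
    _ = X ^ 2 := by ring

/-- Items before `i` contribute all their copies, `i` the rest, and later items nothing. The program
computes the size in this form. -/
theorem AtRank.preSize_eq {r i : ℕ} (h : I.AtRank a r i) : I.preSize a r =
    ∑ j ∈ (I.cls a).filter (I.key · < I.key i), I.s j * I.u j +
      I.s i * (r - I.cum a (I.key i)) := by
  have h1 : ∀ j ∈ I.cls a, I.s j * I.pre a r j =
      (if I.key j < I.key i then I.s j * I.u j else 0) +
        if j = i then I.s i * (r - I.cum a (I.key i)) else 0 := by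
    intro j hj
    by_cases hji : j = i
    · subst hji
      have := h.2
      rw [if_neg (by omega), if_pos rfl, pre, min_eq_right (by omega), zero_add]
    · rw [if_neg hji, add_zero]
      split
      · rename_i h2
        rw [h.pre_lt hj h2 le_rfl]
      · rename_i h2
        have : I.key j ≠ I.key i := fun h3 => hji (key_inj (mem_cls.1 hj).1 (mem_cls.1 h.1).1 h3)
        rw [h.pre_gt (by omega) (by omega), mul_zero]
  rw [preSize, Finset.sum_congr rfl h1, Finset.sum_add_distrib, Finset.sum_ite_eq' _ i,
    if_pos h.1, ← Finset.sum_filter]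

end Inst

/-- The window holds the items of the class with keys from `p` to `pq`. -/
def IsWindow (I : Inst) (a p pq : ℕ) (σ : St) : Prop :=
  ∀ i, (∃ k < σ.reg .wl, σ.mem .win k = i) ↔
    i ∈ I.cls a ∧ p ≤ I.key i ∧ I.key i ≤ pq ∧ 0 < I.u i

/-- Take the first copies of a class. -/
def baseCmd : Cmd :=
  Var.used ::= 0 ;; Var.wl ::= 0 ;; windowLoop ;;
  Var.i ::= (Var.p : Ex) % Var.n ;;
  .sto .sol Var.i ((Var.cum : Ex) - Var.used) ;;
  Var.z0 ::= (Var.z0 : Ex) + sizeAt Var.i * ((Var.cum : Ex) - Var.used) ;;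
  Var.rem ::= (Var.used : Ex) + multAt Var.i - Var.cum ;;
  Var.cur ::= Var.p

/-- Map an item of the window to the first of the copies `r`, …, `r'` that it contains.
Multiplicities are positive, so this is injective. The maximum is needed for the item `i`, which may
begin before copy `r`. -/
theorem length_window_le {I : Inst} {a r r' i i' : ℕ} (hi : I.AtRank a r i)
    (hi' : I.AtRank a r' i') (hrr : r ≤ r') : ((I.row a).filter fun j =>
      I.key i ≤ I.key j ∧ I.key j ≤ I.key i' ∧ 0 < I.u j).length ≤ r' + 1 - r := by
  have hnd := (I.nodup_row a).filter fun j => I.key i ≤ I.key j ∧ I.key j ≤ I.key i' ∧ 0 < I.u j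
  rw [← List.toFinset_card_of_nodup hnd]
  rw [show r' + 1 - r = (Finset.Ico r (r' + 1)).card by simp]
  refine Finset.card_le_card_of_injOn (fun j => max r (I.cum a (I.key j))) ?_ ?_
  · intro j hj
    simp [Inst.mem_row] at hj
    have h1 := I.cum_mono a hj.2.2.1
    have h2 := hi'.2.1
    simp
    omega
  · intro j hj j' hj' he
    simp [Inst.mem_row] at hj hj' he
    have key : ∀ x y, x ∈ I.cls a ∧ I.key i ≤ I.key x ∧ I.key x ≤ I.key i' ∧ 0 < I.u x →
        y ∈ I.cls a ∧ I.key i ≤ I.key y ∧ I.key y ≤ I.key i' ∧ 0 < I.u y →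
        I.key x < I.key y → max r (I.cum a (I.key x)) < max r (I.cum a (I.key y)) := by
      intro x y hx hy hxy
      have h1 := Inst.cum_add_le hx.1 hxy
      have h2 : r < I.cum a (I.key y) := by
        have := Inst.cum_add_le hi.1 (hx.2.1.trans_lt hxy)
        have := hi.2.2
        omega
      omega
    rcases lt_trichotomy (I.key j) (I.key j') with h | h | h
    · have := key j j' hj hj' h
      omega
    · exact Inst.key_inj (Inst.mem_cls.1 hj.1).1 (Inst.mem_cls.1 hj'.1).1 h
    · have := key j' j hj' hj h
      omega

/-- The first `lo` copies consist of all items before `i₀` and a part of `i₀`, which is recovered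
from its key modulo `n`. What `rem` records of `i₀` is the point at which the listing of further
copies begins. -/
theorem baseCmd_spec {I : Inst} {B : Bound} {X k₀ p₀ a lo hi i₀ i₁ : ℕ} {σ : St}
    (hR : Room I B X) (hP : Prepared I B p₀ σ) (ha : σ.reg .a = a) (ha0 : 0 < a) (haV : a ≤ I.V)
    (hac : σ.reg .ac = (I.row a).length) (hi₀ : I.AtRank a lo i₀) (hi₁ : I.AtRank a hi i₁) (hle : lo ≤ hi)
    (hp : σ.reg .p = I.key i₀) (hpq : σ.reg .pq = I.key i₁) (hlo : σ.reg .cum = lo)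
    (hz0 : σ.reg .z0 ≤ X ^ 2) (hsol : ∀ i ∈ I.cls a, σ.mem .sol i = 0) :
    WP B baseCmd σ k₀ fun τ l => (∀ i ∈ I.cls a, τ.mem .sol i = I.pre a lo i) ∧
      (∀ i ∉ I.cls a, τ.mem .sol i = σ.mem .sol i) ∧
      τ.reg .z0 = σ.reg .z0 + I.preSize a lo ∧ τ.reg .i = i₀ ∧ τ.reg .cur = I.key i₀ ∧
      τ.reg .rem = I.cum a (I.key i₀) + I.u i₀ - lo ∧ IsWindow I a (I.key i₀) (I.key i₁) τ ∧
      τ.reg .wl ≤ hi + 1 - lo ∧ l ≤ k₀ + 200 * (I.row a).length + 150 := by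
  obtain ⟨c1, c2, c3, c4, c5, c6, c7, c8⟩ := hR.chain
  have b1 := hR.ten
  have b2 := hR.n
  have l1 := hR.lim .sol (by decide)
  have hsum := I.sum_size_mul_le hR a
  simp only [baseCmd, WP_seq]
  rw [WP_asg, WP_asg]
  refine ⟨by simp; omega, by simp; omega, ?_⟩
  refine (windowLoop_spec (p := I.key i₀) (pq := I.key i₁) hR ((hP.setR rfl).setR rfl) (by simp [ha]) ha0 haV (by simp [hac])
    (by simp [hp]) (by simp [hpq]) (by simp) (by simp) (by simp; omega)).frame.mono ?_
  rintro τ l ⟨⟨hW, hl⟩, hF⟩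
  have hPτ : Prepared I B p₀ τ := ((hP.setR (x := .used) rfl).setR (x := .wl) rfl).frame hF rfl rfl
  have e1 : τ.reg .p = I.key i₀ := (hF.reg _ rfl).trans (by simp [hp])
  have e2 : τ.reg .cum = lo := (hF.reg _ rfl).trans (by simp [hlo])
  obtain ⟨hn, hv⟩ := Inst.mem_cls.1 hi₀.1
  have hmod : I.key i₀ % I.n = i₀ := Inst.key_mod hn
  have hused := hW.used
  have hz := hW.z0
  rw [Inst.sum_row (fun i => I.key i < I.key i₀)] at hused hz
  change _ = I.cum a (I.key i₀) at hused
  simp at hz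
  have hr := hi₀.2
  have hmu := hPτ.mult i₀ hn
  have hsz := hPτ.size i₀ hn
  have h8 := hR.size_le hn
  have h9 := hR.mult_le hn
  have htot := I.tot_le hR a
  have hcum := I.cum_le_tot a (I.key i₀)
  have hpre := hi₀.preSize_eq
  have hpre' := I.preSize_le_total hR a lo
  have hprei : I.pre a lo i₀ = lo - I.cum a (I.key i₀) := by
    unfold Inst.pre
    omega
  have hprod : I.s i₀ * (lo - I.cum a (I.key i₀)) ≤ X ^ 2 := by
    rw [sq]
    exact Nat.mul_le_mul h8 (by omega)
  simp only [WP_asg, WP_sto]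
  refine ⟨by simp, by simp, by simp [e2, hused]; omega, by simp [e1, hPτ.n, hmod]; omega,
    ⟨by simp, ⟨hPτ.sizeAt_ok .i (by simpa [e1, hPτ.n, hmod] using hn),
      by simp [e2, hused]; omega, ?_⟩, ?_⟩,
    ⟨⟨by simp, hPτ.multAt_ok .i (by simp [hPτ.n]) (by simpa [e1, hPτ.n, hmod] using hn), ?_⟩,
      by simp, ?_⟩, by simp, ?_, ?_, ?_, ?_, ?_, ?_, ?_, ?_, ?_⟩
  · simp [e1, e2, hPτ.n, hmod, hused, hsz]; omega
  · simp [e1, e2, hPτ.n, hmod, hused, hsz, hz]; omega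
  · simp [e1, hPτ.n, hmod, hused, hmu]; omega
  · simp [e1, e2, hPτ.n, hmod, hused, hmu]; omega
  · intro i hi
    by_cases hii : i = i₀
    · subst hii
      simp [e1, e2, hPτ.n, hmod, hused, hprei]
    · simp [e1, hPτ.n, hmod, Function.update_of_ne hii]
      have hne : I.key i ≠ I.key i₀ := fun h => hii (Inst.key_inj (Inst.mem_cls.1 hi).1 hn h)
      by_cases hlt : I.key i < I.key i₀
      · rw [hW.sol i (Inst.mem_row.2 hi) hlt, hi₀.pre_lt hi hlt le_rfl]
      · rw [hW.sol' i fun _ => hlt, hi₀.pre_gt (by omega) (by omega)]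
        simpa using hsol i hi
  · intro i hi
    have hii : i ≠ i₀ := by
      rintro rfl
      exact hi hi₀.1
    simp [e1, hPτ.n, hmod, Function.update_of_ne hii]
    simpa using hW.sol' i fun h => absurd (Inst.mem_row.1 h) hi
  · simp [e1, e2, hPτ.n, hmod, hused, hsz, hz, hpre]; omega
  · simp [e1, hPτ.n, hmod]
  · simp [e1]
  · simp [e1, e2, hPτ.n, hmod, hused, hmu]
  · intro i
    have h := congrArg (fun L => i ∈ L) hW.win
    simp only [List.mem_map, List.mem_range, List.mem_filter, Inst.mem_row, decide_eq_true_eq,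
      eq_iff_iff] at h
    simpa using h
  · have h := congrArg List.length hW.win
    simp only [List.length_map, List.length_range] at h
    have h' := length_window_le hi₀ hi₁ hle
    simp
    rw [h]
    exact h'
  · simp at hl ⊢
    omega

/-- Go on to the item of the window with the next key. -/
def nextCmd : Cmd :=
  Var.best ::= (Var.pq : Ex) + 1 ;;
  .for .k 0 .wl (
    Var.cx ::= .ld .key (.ld .win Var.k) ;;
    .ite (.and (.lt Var.cur Var.cx) (.lt Var.cx Var.best)) (Var.best ::= Var.cx) .skip) ;;
  Var.cur ::= Var.best ;; Var.i ::= (Var.cur : Ex) % Var.n ;; Var.rem ::= multAt Var.i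

/-- The next item is found by a scan of the whole window. When the further copies are listed, the
window has at most `4 * V` items and is scanned at most `4 * V` times, so this takes quadratic time
for each class and no sorting is needed. Starting `best` at `pq + 1` makes every item of the window
eligible. -/
theorem nextCmd_spec {I : Inst} {B : Bound} {X k₀ p₀ a p pq i : ℕ} {σ : St}
    (hR : Room I B X) (hP : Prepared I B p₀ σ) (ha0 : 0 < a) (hW : IsWindow I a p pq σ)
    (hpq : σ.reg .pq = pq) (hpq' : pq ≤ X ^ 5) (hwl : σ.reg .wl ≤ 4 * X) (hi : i ∈ I.cls a)
    (hi1 : p ≤ I.key i)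
    (hi2 : I.key i ≤ pq) (hi3 : 0 < I.u i) (hcur : σ.reg .cur < I.key i)
    (hmin : ∀ j ∈ I.cls a, 0 < I.u j → σ.reg .cur < I.key j → I.key i ≤ I.key j) :
    WP B nextCmd σ k₀ fun τ l => τ.reg .i = i ∧ τ.reg .cur = I.key i ∧ τ.reg .rem = I.u i ∧
      l ≤ k₀ + 100 * σ.reg .wl + 60 := by
  obtain ⟨c1, c2, c3, c4, c5, c6, c7, c8⟩ := hR.chain
  have b1 := hR.ten
  have b2 := hR.n
  have l1 := hR.lim .win (by decide)
  have l2 := hR.lim .key (by decide)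
  obtain ⟨hn, hv⟩ := Inst.mem_cls.1 hi
  have hmod : I.key i % I.n = i := Inst.key_mod hn
  simp only [nextCmd, WP_seq]
  rw [WP_asg]
  refine ⟨by simp [hpq]; omega, ?_⟩
  refine (WP_for' (x := .k) (y := .wl) (fun m τ => I.key i ≤ τ.reg .best ∧
    ∀ k < m, σ.reg .cur < I.key (σ.mem .win k) → τ.reg .best ≤ I.key (σ.mem .win k)) 100
    (by decide) rfl rfl (by simp; omega) (by simp; omega) (by omega) (by simp) ?_ ?_).mono ?_
  · simp [hpq]; omega
  · rintro k τ - hk hF hτk ⟨hI1, hI2⟩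
    simp at hk
    have hPτ : Prepared I B p₀ τ := (hP.setR (x := .best) rfl).frame hF rfl rfl
    have e1 : τ.reg .cur = σ.reg .cur := (hF.reg _ rfl).trans (by simp)
    have e2 : τ.mem .win = σ.mem .win := hF.mem _ rfl
    obtain ⟨hj1, hj2, hj3, hj4⟩ := (hW (σ.mem .win k)).1 ⟨k, hk, rfl⟩
    set j := σ.mem .win k with hj
    obtain ⟨hjn, hjv⟩ := Inst.mem_cls.1 hj1
    have hkey := hPτ.key j hjn (by omega)
    rw [WP_seq, WP_asg]
    refine ⟨by simp [hτk, e2, ← hj]; omega, ?_⟩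
    rw [WP_ite]
    refine ⟨by simp, fun hc => ?_, fun hc => ?_⟩
    · simp [hτk, e1, e2, ← hj, hkey] at hc
      rw [WP_asg]
      refine ⟨by simp, ⟨?_, ?_⟩, by simp⟩
      · simpa [hτk, e2, ← hj, hkey] using hmin j hj1 hj4 hc.1
      · intro k' hk' hlt
        simp [hτk, e2, ← hj, hkey]
        rcases Nat.lt_succ_iff_lt_or_eq.1 hk' with h | rfl
        · exact hc.2.le.trans (hI2 k' h hlt)
        · exact le_rfl
    · simp [hτk, e1, e2, ← hj, hkey] at hc
      simp only [WP_skip]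
      refine ⟨⟨by simpa using hI1, ?_⟩, by simp⟩
      intro k' hk' hlt
      simp
      rcases Nat.lt_succ_iff_lt_or_eq.1 hk' with h | rfl
      · exact hI2 k' h hlt
      · exact hc hlt
  · rintro τ l ⟨⟨hI1, hI2⟩, -, hF, hl⟩
    have hPτ : Prepared I B p₀ τ := (hP.setR (x := .best) rfl).frame hF rfl rfl
    simp at hI2 hl
    obtain ⟨k, hk, hke⟩ := (hW i).2 ⟨hi, hi1, hi2, hi3⟩
    have hb : τ.reg .best = I.key i := by
      have := hI2 k hk (by rw [hke]; exact hcur)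
      rw [hke] at this
      omega
    have hmu := hPτ.mult i hn
    simp only [WP_asg]
    refine ⟨by simp, by simp, hPτ.multAt_ok .i (by simp [hPτ.n])
      (by simpa [hb, hPτ.n, hmod] using hn), ?_, ?_, ?_, ?_⟩
    · simp [hb, hPτ.n, hmod]
    · simp [hb]
    · simp [hb, hPτ.n, hmod, hmu]
    · simp; omega

/-- List the further copies of a class and their total sizes. -/
def expandCmd : Cmd :=
  .for .j 0 .qa (
    .ite (.eq 0 Var.rem) nextCmd .skip ;;
    .sto .el ((Var.a : Ex) * Var.str + Var.j) Var.i ;;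
    .sto .pg ((Var.a : Ex) * Var.str + Var.j + 1)
      (.ld .pg ((Var.a : Ex) * Var.str + Var.j) + sizeAt Var.i) ;;
    Var.rem ::= (Var.rem : Ex) - 1)

/-- The first `m` further copies of class `a` have been listed. -/
structure Expanded (I : Inst) (a lo m : ℕ) (σ τ : St) : Prop where
  el : ∀ j < m, I.AtRank a (lo + j) (τ.mem .el (a * (4 * I.V + 1) + j))
  pg : ∀ j ≤ m, I.preSize a lo + τ.mem .pg (a * (4 * I.V + 1) + j) = I.preSize a (lo + j)
  el' : ∀ b ≠ a, ∀ j < 4 * I.V + 1,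
    τ.mem .el (b * (4 * I.V + 1) + j) = σ.mem .el (b * (4 * I.V + 1) + j)
  pg' : ∀ b ≠ a, ∀ j < 4 * I.V + 1,
    τ.mem .pg (b * (4 * I.V + 1) + j) = σ.mem .pg (b * (4 * I.V + 1) + j)

set_option maxHeartbeats 1000000 in
theorem expandCmd_spec {I : Inst} {B : Bound} {X k₀ p₀ a lo hi i₀ i₁ : ℕ} {σ : St}
    (hR : Room I B X) (hP : Prepared I B p₀ σ) (ha : σ.reg .a = a) (ha0 : 0 < a) (haV : a ≤ I.V)
    (hi₀ : I.AtRank a lo i₀) (hi₁ : I.AtRank a hi i₁) (hpq : σ.reg .pq = I.key i₁)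
    (hqa : σ.reg .qa = hi + 1 - lo) (hq : hi + 1 - lo ≤ 4 * I.V) (hri : σ.reg .i = i₀)
    (hcur : σ.reg .cur = I.key i₀) (hrem : σ.reg .rem = I.cum a (I.key i₀) + I.u i₀ - lo)
    (hW : IsWindow I a (I.key i₀) (I.key i₁) σ) (hwl : σ.reg .wl ≤ 4 * I.V)
    (hpg : σ.mem .pg (a * (4 * I.V + 1)) = 0) :
    WP B expandCmd σ k₀ fun τ l => Expanded I a lo (hi + 1 - lo) σ τ ∧
      l ≤ k₀ + 10 + (400 * I.V + 200) * (4 * I.V) := by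
  obtain ⟨c1, c2, c3, c4, c5, c6, c7, c8⟩ := hR.chain
  have b1 := hR.ten
  have b2 := hR.n
  have b3 := hR.V
  have l1 := hR.lim .el (by decide)
  have l2 := hR.lim .pg (by decide)
  have hrow : a * (4 * I.V + 1) ≤ 5 * X ^ 2 := by
    calc _ ≤ X * (4 * X + X) := Nat.mul_le_mul (haV.trans b3) (by omega)
      _ = 5 * X ^ 2 := by ring
  have hi₁n := (Inst.mem_cls.1 hi₁.1).1
  have hpq' : I.key i₁ ≤ X ^ 5 := by
    have := hR.key_lt hi₁n
    unfold Inst.key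
    omega
  refine (WP_for' (x := .j) (y := .qa) (fun m τ => Expanded I a lo m σ τ ∧
    ∃ i ∈ I.cls a, τ.reg .i = i ∧ τ.reg .cur = I.key i ∧
      I.cum a (I.key i) + I.u i = lo + m + τ.reg .rem ∧ τ.reg .rem ≤ I.u i) (400 * I.V + 200)
    (by decide) rfl rfl (by simp; omega) (by simp [hqa]; omega) (by omega) (by simp) ?_ ?_).mono ?_
  · have := hi₀.2
    refine ⟨⟨by simp, by simp [hpg], by simp, by simp⟩, i₀, hi₀.1, by simp [hri], by simp [hcur],
      by simp [hrem]; omega, by simp [hrem]; omega⟩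
  · rintro m τ - hm hF hτm ⟨hE, i, hic, hri, hrcur, hsum, hrle⟩
    rw [hqa] at hm
    have hPτ : Prepared I B p₀ τ := hP.frame hF rfl rfl
    have e1 : τ.reg .a = a := (hF.reg _ rfl).trans ha
    have e2 : τ.reg .pq = I.key i₁ := (hF.reg _ rfl).trans hpq
    have e3 : τ.reg .wl = σ.reg .wl := hF.reg _ rfl
    have e4 : τ.mem .win = σ.mem .win := hF.mem _ rfl
    have hWτ : IsWindow I a (I.key i₀) (I.key i₁) τ := by
      unfold IsWindow
      rw [e3, e4]
      exact hW
    -- Whether or not a new item had to be found, the current item now contains copy number `lo +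
    -- m`. From here on both cases are the same.
    have main : ∀ τ' l', τ'.reg .n = I.n → τ'.mem = τ.mem → τ'.reg .j = m → τ'.reg .a = a →
        τ'.reg .str = 4 * I.V + 1 → l' ≤ 400 * I.V + 100 →
        (∃ i, I.AtRank a (lo + m) i ∧ τ'.reg .i = i ∧ τ'.reg .cur = I.key i ∧
          I.cum a (I.key i) + I.u i = lo + m + τ'.reg .rem) →
        WP B (.sto .el ((Var.a : Ex) * Var.str + Var.j) Var.i ;;
          .sto .pg ((Var.a : Ex) * Var.str + Var.j + 1)
            (.ld .pg ((Var.a : Ex) * Var.str + Var.j) + sizeAt Var.i) ;;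
          Var.rem ::= (Var.rem : Ex) - 1) τ' l' fun τ'' l'' =>
        (Expanded I a lo (m + 1) σ (τ''.setR .j (m + 1)) ∧
          ∃ i ∈ I.cls a, (τ''.setR .j (m + 1)).reg .i = i ∧
            (τ''.setR .j (m + 1)).reg .cur = I.key i ∧
            I.cum a (I.key i) + I.u i = lo + (m + 1) + (τ''.setR .j (m + 1)).reg .rem ∧
            (τ''.setR .j (m + 1)).reg .rem ≤ I.u i) ∧ l'' + 9 ≤ 400 * I.V + 200 := by
      rintro τ' l' f1 f2 f3 f4 f5 hl' ⟨i, hai, f6, f7, f8⟩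
      obtain ⟨hn, hv⟩ := Inst.mem_cls.1 hai.1
      have f2' : ∀ A, τ'.mem A = τ.mem A := fun A => congrFun f2 A
      have hsz := hPτ.size i hn
      have hsle := hR.size_le hn
      have hr := hai.2
      have hpgm := hE.pg m le_rfl
      have hple := I.preSize_le_total hR a (lo + m)
      have hps := hai.preSize_succ
      simp only [WP_seq, WP_sto, WP_asg]
      refine ⟨by simp [f4, f5, f3]; omega, by simp, by simp [f4, f5, f3]; omega,
        by simp [f4, f5, f3]; omega, ⟨by simp [f4, f5, f3]; omega,
          hPτ.sizeAt_ok .i (by simpa [f6] using hn), ?_⟩,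
        by simp [f4, f5, f3]; omega, by simp; omega,
        ⟨⟨?_, ?_, ?_, ?_⟩, i, hai.1, by simp [f6], by simp [f7], by simp; omega,
          by simp; omega⟩, ?_⟩
      · simp [f4, f5, f3, f6, f2', hsz]; omega
      · intro j hj
        simp [f4, f5, f3, f6, f2']
        rcases Nat.lt_succ_iff_lt_or_eq.1 hj with h | rfl
        · rw [Function.update_of_ne (by omega)]
          exact hE.el j h
        · simpa using hai
      · intro j hj
        simp [f4, f5, f3, f6, f2', hsz]
        rcases hj.lt_or_eq with h | rfl
        · rw [Function.update_of_ne (by omega)]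
          exact hE.pg j (by omega)
        · rw [add_assoc, Function.update_self, ← add_assoc lo m 1, hps]
          omega
      · intro b hb j hj
        simp [f4, f5, f3, f6, f2']
        rw [Function.update_of_ne (index_ne hj (by omega) (.inl hb))]
        exact hE.el' b hb j hj
      · intro b hb j hj
        simp [f4, f5, f3, f6, f2']
        rw [add_assoc, Function.update_of_ne (index_ne hj (by omega) (.inl hb))]
        exact hE.pg' b hb j hj
      · simp; omega
    rw [WP_seq, WP_ite]
    refine ⟨by simp; omega, fun hc => ?_, fun hc => ?_⟩
    · have hc : τ.reg .rem = 0 := Eq.symm hc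
      -- The current item is used up, so copy `lo + m` is the first copy of the item with the next
      -- key of positive multiplicity.
      have hlt : lo + m < I.tot a := by
        have := hi₁.lt
        omega
      obtain ⟨i', hi'⟩ := Inst.exists_atRank hlt
      have hr' := hi'.2
      refine (nextCmd_spec hR hPτ ha0 hWτ e2 hpq' (by omega) hi'.1
        (hi₀.key_le hi' (by omega)) (hi'.key_le hi₁ (by omega)) (by omega) ?_ ?_).frame.mono ?_
      · rw [hrcur]
        by_contra! hle
        rcases hle.lt_or_eq with h | h
        · have h1 := Inst.cum_add_le hi'.1 h
          omega
        · have h1 := Inst.key_inj (Inst.mem_cls.1 hi'.1).1 (Inst.mem_cls.1 hic).1 h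
          subst h1
          omega
      · intro j hj hju hjc
        rw [hrcur] at hjc
        by_contra! hlt
        have h1 := Inst.cum_add_le hj hlt
        have h2 := Inst.cum_add_le hic hjc
        omega
      · rintro τ' l' ⟨⟨g1, g2, g3, hl'⟩, hF'⟩
        refine main τ' l' ((hF'.reg _ rfl).trans hPτ.n) (funext fun A => hF'.mem _ rfl)
          ((hF'.reg _ rfl).trans hτm) ((hF'.reg _ rfl).trans e1) ((hF'.reg _ rfl).trans hPτ.str)
          ?_ ⟨i', hi', g1, g2, ?_⟩
        · simp at hl'
          omega
        · -- all earlier items are used up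
          rw [g3]
          have h3 : I.cum a (I.key i') = lo + m := by
            refine le_antisymm hr'.1 ?_
            have h4 : I.key i < I.key i' := by
              by_contra! hle
              rcases hle.lt_or_eq with h | h
              · have h1 := Inst.cum_add_le hi'.1 h
                omega
              · have h1 := Inst.key_inj (Inst.mem_cls.1 hi'.1).1 (Inst.mem_cls.1 hic).1 h
                subst h1
                omega
            have h5 := Inst.cum_add_le hic h4
            omega
          omega
    · have hc : τ.reg .rem ≠ 0 := fun h => hc h.symm
      simp only [WP_skip]
      refine main τ _ hPτ.n rfl hτm e1 hPτ.str (by simp)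
        ⟨i, ⟨hic, by omega, by omega⟩, hri, hrcur, hsum⟩
  · rintro τ l ⟨⟨h, -⟩, -, hF, hl⟩
    rw [hqa] at h
    simp [hqa] at hl
    refine ⟨h, ?_⟩
    have := Nat.mul_le_mul_left (400 * I.V + 200) hq
    omega

end WordRAM

/-! ### All classes -/

namespace WordRAM

/-- Compute the range of the numbers of copies that are considered. -/
def rangeCmd : Cmd :=
  Var.ac ::= .ld .cnt Var.a ;; Var.cx ::= .ld .gcnt Var.a ;;
  .ite (.le Var.kk Var.cx) (Var.cum ::= (Var.cx : Ex) - Var.kk) (Var.cum ::= 0) ;;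
  .ite (.le (.ld .tot Var.a) ((Var.cx : Ex) + Var.kk))
    (Var.qa ::= .ld .tot Var.a - (Var.cum : Ex))
    (Var.qa ::= (Var.cx : Ex) + Var.kk - Var.cum) ;;
  .sto .ofs Var.a ((Var.cx : Ex) - Var.cum) ;; .sto .qn Var.a Var.qa ;;
  .sto .pg ((Var.a : Ex) * Var.str) 0

theorem rangeCmd_spec {I : Inst} {B : Bound} {X k₀ p a : ℕ} {σ : St} (hR : Room I B X)
    (hP : Prepared I B p σ) (ha : σ.reg .a = a) (ha0 : 0 < a) (haV : a ≤ I.V) :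
    WP B rangeCmd σ k₀ fun τ l => τ.reg .ac = (I.row a).length ∧ τ.reg .cum = I.low p a ∧
      τ.reg .qa = I.width p a ∧
      τ.mem .ofs = Function.update (σ.mem .ofs) a (I.shift p a) ∧
      τ.mem .qn = Function.update (σ.mem .qn) a (I.width p a) ∧
      τ.mem .pg = Function.update (σ.mem .pg) (a * (4 * I.V + 1)) 0 ∧ l ≤ k₀ + 200 := by
  obtain ⟨c1, c2, c3, c4, c5, c6, c7, c8⟩ := hR.chain
  have b1 := hR.ten
  have b3 := hR.V
  have htot := I.tot_le hR a
  have hq := Inst.quota_le hP.crit ha0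
  have hrow : a * (4 * I.V + 1) ≤ 5 * X ^ 2 := by
    calc _ ≤ X * (4 * X + X) := Nat.mul_le_mul (haV.trans b3) (by omega)
      _ = 5 * X ^ 2 := by ring
  have lim := hR.lim
  have l1 := lim .cnt (by decide)
  have l2 := lim .gcnt (by decide)
  have l3 := lim .tot (by decide)
  have l4 := lim .ofs (by decide)
  have l5 := lim .qn (by decide)
  have l6 := lim .pg (by decide)
  have hcnt := hP.cnt a ha0
  have hg := hP.gcnt a ha0
  have ht := hP.tot a ha0
  simp only [rangeCmd, WP_seq]
  rw [WP_asg, WP_asg]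
  refine ⟨by simp [ha]; omega, by simp [ha]; omega, ?_⟩
  rw [WP_ite]
  have main : ∀ τ l, τ.reg .cum = I.low p a → τ.mem = σ.mem → τ.reg .a = a →
      τ.reg .ac = (I.row a).length → τ.reg .cx = I.quota p a → τ.reg .kk = 2 * I.V →
      τ.reg .str = 4 * I.V + 1 → l ≤ k₀ + 50 →
      WP B (.ite (.le (.ld .tot Var.a) ((Var.cx : Ex) + Var.kk))
        (Var.qa ::= .ld .tot Var.a - (Var.cum : Ex))
        (Var.qa ::= (Var.cx : Ex) + Var.kk - Var.cum)) τ l fun τ l =>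
      WP B (.sto .ofs Var.a ((Var.cx : Ex) - Var.cum)) τ l fun τ l =>
      WP B (.sto .qn Var.a Var.qa) τ l fun τ l =>
      WP B (.sto .pg ((Var.a : Ex) * Var.str) 0) τ l fun τ l =>
      τ.reg .ac = (I.row a).length ∧ τ.reg .cum = I.low p a ∧ τ.reg .qa = I.width p a ∧
      τ.mem .ofs = Function.update (σ.mem .ofs) a (I.shift p a) ∧
      τ.mem .qn = Function.update (σ.mem .qn) a (I.width p a) ∧
      τ.mem .pg = Function.update (σ.mem .pg) (a * (4 * I.V + 1)) 0 ∧ l ≤ k₀ + 200 := by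
    intro τ l f1 f2 f3 f4 f5 f6 f7 hl
    have f2' : ∀ A, τ.mem A = σ.mem A := fun A => congrFun f2 A
    have hlow : I.low p a = I.quota p a - 2 * I.V := rfl
    have hw : I.width p a = min (I.tot a) (I.quota p a + 2 * I.V) - I.low p a := rfl
    have main' : ∀ τ l, τ.reg .cum = I.low p a → τ.mem = σ.mem → τ.reg .a = a →
        τ.reg .ac = (I.row a).length → τ.reg .cx = I.quota p a → τ.reg .qa = I.width p a →
        τ.reg .str = 4 * I.V + 1 → l ≤ k₀ + 100 →
        WP B (.sto .ofs Var.a ((Var.cx : Ex) - Var.cum)) τ l fun τ l =>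
        WP B (.sto .qn Var.a Var.qa) τ l fun τ l =>
        WP B (.sto .pg ((Var.a : Ex) * Var.str) 0) τ l fun τ l =>
        τ.reg .ac = (I.row a).length ∧ τ.reg .cum = I.low p a ∧ τ.reg .qa = I.width p a ∧
        τ.mem .ofs = Function.update (σ.mem .ofs) a (I.shift p a) ∧
        τ.mem .qn = Function.update (σ.mem .qn) a (I.width p a) ∧
        τ.mem .pg = Function.update (σ.mem .pg) (a * (4 * I.V + 1)) 0 ∧ l ≤ k₀ + 200 := by
      intro τ l f1 f2 f3 f4 f5 f6 f7 hl
      have f2' : ∀ A, τ.mem A = σ.mem A := fun A => congrFun f2 A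
      simp only [WP_sto]
      refine ⟨by simp, by simp [f1, f5]; omega, by simp [f3]; omega, by simp, by simp,
        by simp [f3]; omega, by simp [f3, f7]; omega, by simp; omega, by simp [f3, f7]; omega,
        by simp [f4], by simp [f1], by simp [f6], ?_, ?_, ?_, by simp; omega⟩
      · simp [f2', f1, f3, f5, Inst.shift]
      · simp [f2', f3, f6]
      · simp [f2', f3, f7]
    rw [WP_ite]
    refine ⟨by simp [f3, f5, f6]; omega, fun hc => ?_, fun hc => ?_⟩
    · simp [f2', f3, f5, f6, ht] at hc
      rw [WP_asg]
      refine ⟨by simp [f2', f1, f3, ht]; omega, ?_⟩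
      exact main' _ _ (by simp [f1]) (by simp [f2]) (by simp [f3]) (by simp [f4]) (by simp [f5])
        (by simp [f2', f1, f3, ht]; omega) (by simp [f7]) (by simp; omega)
    · simp [f2', f3, f5, f6, ht] at hc
      rw [WP_asg]
      refine ⟨by simp [f1, f5, f6]; omega, ?_⟩
      exact main' _ _ (by simp [f1]) (by simp [f2]) (by simp [f3]) (by simp [f4]) (by simp [f5])
        (by simp [f1, f5, f6]; omega) (by simp [f7]) (by simp; omega)
  refine ⟨by simp, fun hc => ?_, fun hc => ?_⟩
  · simp [ha, hg, hP.kk] at hc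
    rw [WP_asg]
    refine ⟨by simp [ha, hg, hP.kk, hc], ?_⟩
    exact main _ _ (by simp [ha, hg, hP.kk, Inst.low]) (by simp) (by simp [ha])
      (by simp [ha, hcnt]) (by simp [ha, hg]) (by simp [hP.kk]) (by simp [hP.str]) (by simp)
  · simp [ha, hg, hP.kk] at hc
    rw [WP_asg]
    refine ⟨by simp; omega, ?_⟩
    exact main _ _ (by simp [Inst.low]; omega) (by simp) (by simp [ha])
      (by simp [ha, hcnt]) (by simp [ha, hg]) (by simp [hP.kk]) (by simp [hP.str]) (by simp)

/-- Treat one class. -/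
def classCmd : Cmd :=
  rangeCmd ;;
  .ite (.lt 0 Var.qa)
    (Var.sw ::= Var.cum ;; rankCmd ;; Var.p ::= Var.pv ;;
      Var.sw ::= (Var.cum : Ex) + Var.qa - 1 ;; rankCmd ;; Var.pq ::= Var.pv ;;
      baseCmd ;; expandCmd) .skip

/-- Class `b` has been treated. -/
structure ClassDone (I : Inst) (p b : ℕ) (σ : St) : Prop where
  ofs : σ.mem .ofs b = I.shift p b
  qn : σ.mem .qn b = I.width p b
  sol : ∀ i ∈ I.cls b, σ.mem .sol i = I.pre b (I.low p b) i
  el : ∀ j < I.width p b, I.AtRank b (I.low p b + j) (σ.mem .el (b * (4 * I.V + 1) + j))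
  pg : ∀ j ≤ I.width p b, σ.mem .pg (b * (4 * I.V + 1) + j) = I.gap p b j

/-- The classes below `a` have been treated. -/
structure Listed (I : Inst) (p a : ℕ) (σ : St) : Prop where
  done : ∀ b, 0 < b → b < a → ClassDone I p b σ
  sol : ∀ i, (i < I.n → I.v i = 0 ∨ a ≤ I.v i) → σ.mem .sol i = 0
  z0 : σ.reg .z0 = ∑ b ∈ Finset.Ico 1 a, I.preSize b (I.low p b)

theorem width_le (I : Inst) (p a : ℕ) : I.width p a ≤ 4 * I.V := by
  unfold Inst.width Inst.low; omega

/-- As `V` is positive here, the range around the quota can only be empty if the class has no copies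
at all. The program may then skip the class. -/
theorem Inst.preSize_eq_zero {I : Inst} {p a : ℕ} (hp : I.Critical p) (ha0 : 0 < a) (haV : a ≤ I.V)
    (h : I.width p a = 0) : I.low p a = 0 := by
  have := Inst.quota_le hp ha0
  unfold Inst.width Inst.low at *
  omega

theorem Inst.sum_preSize_le {I : Inst} {B : Bound} {X : ℕ} (hR : Room I B X) (p : ℕ) {a : ℕ}
    (ha : a ≤ I.V + 1) : ∑ b ∈ Finset.Ico 1 a, I.preSize b (I.low p b) ≤ X ^ 2 := by
  refine le_trans ?_ (I.total_weights_le hR)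
  calc _ ≤ ∑ b ∈ Finset.Icc 1 I.V, I.preSize b (I.low p b) := by
        refine Finset.sum_le_sum_of_subset fun b hb => ?_
        simp at hb ⊢
        omega
    _ ≤ ∑ b ∈ Finset.Icc 1 I.V, ∑ i ∈ I.cls b, I.s i * I.u i :=
        Finset.sum_le_sum fun b _ => Finset.sum_le_sum fun i _ =>
          Nat.mul_le_mul_left _ (min_le_left _ _)
    _ = total I.weights := by
        rw [← Inst.sum_items, Inst.weights, total, List.map_map, sum_filter_range]
        rfl

set_option maxHeartbeats 1000000 in
theorem classCmd_spec {I : Inst} {B : Bound} {X k₀ p a : ℕ} {σ : St} (hR : Room I B X)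
    (hP : Prepared I B p σ) (hL : Listed I p a σ) (ha : σ.reg .a = a) (ha0 : 0 < a)
    (haV : a ≤ I.V) :
    WP B classCmd σ k₀ fun τ l => Listed I p (a + 1) τ ∧
      l ≤ k₀ + 41000 * (I.row a).length + 5000 * (I.V * I.V) := by
  obtain ⟨c1, c2, c3, c4, c5, c6, c7, c8⟩ := hR.chain
  have b1 := hR.ten
  have b3 := hR.V
  have htot := I.tot_le hR a
  have hwid := width_le I p a
  have hVV : I.V ≤ I.V * I.V := Nat.le_mul_self _
  have hVV' : 1 ≤ I.V * I.V := Nat.one_le_iff_ne_zero.2 (by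
    have : 0 < I.V := by omega
    positivity)
  have hz0 : σ.reg .z0 ≤ X ^ 2 := by
    rw [hL.z0]; exact Inst.sum_preSize_le hR p (by omega)
  rw [classCmd, WP_seq]
  refine (rangeCmd_spec hR hP ha ha0 haV).frame.mono ?_
  rintro τ l ⟨⟨f1, f2, f3, f4, f5, f6, hl⟩, hF⟩
  have hP₁ : Prepared I B p τ := hP.frame hF rfl rfl
  have e1 : τ.reg .a = a := (hF.reg _ rfl).trans ha
  have e2 : τ.mem .sol = σ.mem .sol := hF.mem _ rfl
  have e3 : τ.mem .el = σ.mem .el := hF.mem _ rfl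
  have e4 : τ.reg .z0 = σ.reg .z0 := hF.reg _ rfl
  -- Results for earlier classes survive: their items are not in class `a`, and their rows of `el`
  -- and `pg` are disjoint from row `a`.
  have hkeep : ∀ (τ' : St) (b : ℕ), 0 < b → b < a → τ'.mem .ofs = τ.mem .ofs →
      τ'.mem .qn = τ.mem .qn → (∀ i ∉ I.cls a, τ'.mem .sol i = τ.mem .sol i) →
      (∀ j < 4 * I.V + 1, τ'.mem .el (b * (4 * I.V + 1) + j) =
        τ.mem .el (b * (4 * I.V + 1) + j)) →
      (∀ j < 4 * I.V + 1, τ'.mem .pg (b * (4 * I.V + 1) + j) =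
        τ.mem .pg (b * (4 * I.V + 1) + j)) → ClassDone I p b τ' := by
    intro τ' b hb hba g1 g2 g3 g4 g5
    have hD := hL.done b hb hba
    have hwb := width_le I p b
    refine ⟨?_, ?_, fun i hi => ?_, fun j hj => ?_, fun j hj => ?_⟩
    · rw [g1, f4, Function.update_of_ne (by omega), hD.ofs]
    · rw [g2, f5, Function.update_of_ne (by omega), hD.qn]
    · rw [g3 i fun h => by rw [Inst.mem_cls] at h hi; omega, e2, hD.sol i hi]
    · rw [g4 j (by omega), e3]
      exact hD.el j hj
    · rw [g5 j (by omega), f6, Function.update_of_ne, hD.pg j hj]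
      exact index_ne (i := j) (j := 0) (by omega) (by omega) (.inl (by omega))
  rw [WP_ite]
  refine ⟨by simp; omega, fun hc => ?_, fun hc => ?_⟩
  swap
  · simp [f3] at hc
    have hlow := Inst.preSize_eq_zero hP.crit ha0 haV hc
    simp only [WP_skip]
    refine ⟨⟨fun b hb hba => ?_, fun i hi => ?_, ?_⟩, ?_⟩
    · rcases Nat.lt_succ_iff_lt_or_eq.1 hba with h | rfl
      · exact hkeep τ b hb h rfl rfl (fun _ _ => rfl) (fun _ _ => rfl) fun _ _ => rfl
      · refine ⟨by rw [f4, Function.update_self], by rw [f5, Function.update_self], fun i hi => ?_,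
          fun j hj => by omega, fun j hj => ?_⟩
        · rw [e2, hlow, Inst.pre_zero]
          exact hL.sol i fun _ => .inr (Inst.mem_cls.1 hi).2.ge
        · rw [f6, show j = 0 by omega]
          simp [Inst.gap]
    · rw [e2]
      exact hL.sol i fun h => by have := hi h; omega
    · rw [e4, hL.z0, Finset.sum_Ico_succ_top (by omega), hlow, I.preSize_zero, add_zero]
    · simp; omega
  simp [f3] at hc
  have hhi : I.low p a + I.width p a ≤ I.tot a := Inst.low_add_width_le hP.crit ha0 le_rfl
  rw [WP_seq, WP_asg]
  refine ⟨by simp, ?_⟩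
  rw [WP_seq]
  refine (rankCmd_spec (r := I.low p a) hR (hP₁.setR rfl) (by simp [e1]) ha0 haV (by simp [f1])
    (by simp [f2]) (by omega)).frame.mono ?_
  rintro τ₂ l₂ ⟨⟨⟨i₀, hi₀, hk₀⟩, hl₂⟩, hF₂⟩
  have hP₂ : Prepared I B p τ₂ := (hP₁.setR (x := .sw) rfl).frame hF₂ rfl rfl
  rw [WP_seq, WP_asg]
  refine ⟨by simp, ?_⟩
  have d1 : τ₂.reg .cum = I.low p a := (hF₂.reg _ rfl).trans (by simp [f2])
  have d2 : τ₂.reg .qa = I.width p a := (hF₂.reg _ rfl).trans (by simp [f3])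
  have d3 : τ₂.reg .ac = (I.row a).length := (hF₂.reg _ rfl).trans (by simp [f1])
  have d4 : τ₂.reg .a = a := (hF₂.reg _ rfl).trans (by simp [e1])
  rw [WP_seq, WP_asg]
  refine ⟨by simp [d1, d2]; omega, ?_⟩
  rw [WP_seq]
  refine (rankCmd_spec (r := I.low p a + I.width p a - 1) hR ((hP₂.setR rfl).setR rfl)
    (by simp [d4]) ha0 haV (by simp [d3]) (by simp [d1, d2]) (by omega)).frame.mono ?_
  rintro τ₃ l₃ ⟨⟨⟨i₁, hi₁, hk₁⟩, hl₃⟩, hF₃⟩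
  have hP₃ : Prepared I B p τ₃ := ((hP₂.setR (x := .p) rfl).setR (x := .sw) rfl).frame hF₃ rfl rfl
  have d5 : τ₃.reg .cum = I.low p a := (hF₃.reg _ rfl).trans (by simp [d1])
  have d6 : τ₃.reg .qa = I.width p a := (hF₃.reg _ rfl).trans (by simp [d2])
  have d7 : τ₃.reg .ac = (I.row a).length := (hF₃.reg _ rfl).trans (by simp [d3])
  have d8 : τ₃.reg .a = a := (hF₃.reg _ rfl).trans (by simp [d4])
  have d9 : τ₃.reg .p = I.key i₀ := (hF₃.reg _ rfl).trans (by simp [hk₀])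
  have m1 : τ₃.mem .sol = σ.mem .sol := by rw [hF₃.mem _ rfl, St.mem_setR, St.mem_setR,
    hF₂.mem _ rfl, St.mem_setR, e2]
  have m2 : τ₃.reg .z0 = σ.reg .z0 := (hF₃.reg _ rfl).trans (by
    simp only [ne_eq, reduceCtorEq, not_false_eq_true, St.reg_setR_ne]
    exact (hF₂.reg _ rfl).trans (by simp [e4]))
  rw [WP_seq, WP_asg]
  refine ⟨by simp, ?_⟩
  rw [WP_seq]
  refine (baseCmd_spec hR (hP₃.setR rfl) (by simp [d8]) ha0 haV (by simp [d7]) hi₀ hi₁ (by omega)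
    (by simp [d9]) (by simp [hk₁]) (by simp [d5]) (by simp [m2, hz0]) (by
      intro i hi
      rw [St.mem_setR, m1]
      exact hL.sol i fun _ => .inr (Inst.mem_cls.1 hi).2.ge)).frame.mono ?_
  rintro τ₄ l₄ ⟨⟨g1, g2, g3, g4, g5, g6, g7, g8, hl₄⟩, hF₄⟩
  have hP₄ : Prepared I B p τ₄ := (hP₃.setR (x := .pq) rfl).frame hF₄ rfl rfl
  have hm : ∀ A, A ≠ .sol → A ≠ .win → A ≠ .bk → A ≠ .bw → A ≠ .tb → A ≠ .tl → A ≠ .tw →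
      τ₄.mem A = τ.mem A := by
    intro A h1 h2 h3 h4 h5 h6 h7
    rw [hF₄.mem A (by cases A <;> first | rfl | contradiction), St.mem_setR,
      hF₃.mem A (by cases A <;> first | rfl | contradiction), St.mem_setR, St.mem_setR,
      hF₂.mem A (by cases A <;> first | rfl | contradiction), St.mem_setR]
  refine (expandCmd_spec hR hP₄ ((hF₄.reg _ rfl).trans (by simp [d8])) ha0 haV hi₀ hi₁
    ((hF₄.reg _ rfl).trans (by simp [hk₁])) ((hF₄.reg _ rfl).trans (by simp [d6]; omega))
    (by omega) g4 g5 g6 g7 (by omega) ?_).frame.mono ?_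
  · rw [hm .pg (by decide) (by decide) (by decide) (by decide) (by decide) (by decide) (by decide),
      f6, Function.update_self]
  rintro τ₅ l₅ ⟨⟨hE, hl₅⟩, hF₅⟩
  have hw1 : I.low p a + I.width p a - 1 + 1 - I.low p a = I.width p a := by omega
  rw [hw1] at hE
  have hs5 : τ₅.mem .sol = τ₄.mem .sol := hF₅.mem _ rfl
  have ho5 : τ₅.mem .ofs = τ.mem .ofs := (hF₅.mem _ rfl).trans
    (hm _ (by decide) (by decide) (by decide) (by decide) (by decide) (by decide) (by decide))
  have hq5 : τ₅.mem .qn = τ.mem .qn := (hF₅.mem _ rfl).trans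
    (hm _ (by decide) (by decide) (by decide) (by decide) (by decide) (by decide) (by decide))
  have hel : τ₄.mem .el = τ.mem .el :=
    hm _ (by decide) (by decide) (by decide) (by decide) (by decide) (by decide) (by decide)
  have hpg : τ₄.mem .pg = τ.mem .pg :=
    hm _ (by decide) (by decide) (by decide) (by decide) (by decide) (by decide) (by decide)
  have hsol' : ∀ i ∉ I.cls a, τ₅.mem .sol i = τ.mem .sol i := by
    intro i hi
    rw [hs5, g2 i hi, St.mem_setR, m1, e2]
  refine ⟨⟨fun b hb hba => ?_, fun i hi => ?_, ?_⟩, ?_⟩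
  · rcases Nat.lt_succ_iff_lt_or_eq.1 hba with h | rfl
    · refine hkeep τ₅ b hb h ho5 hq5 hsol' (fun j hj => ?_) fun j hj => ?_
      · rw [hE.el' b (by omega) j hj, hel]
      · rw [hE.pg' b (by omega) j hj, hpg]
    · refine ⟨by rw [ho5, f4, Function.update_self], by rw [hq5, f5, Function.update_self],
        fun i hi => ?_, hE.el, fun j hj => ?_⟩
      · rw [hs5]; exact g1 i hi
      · have := hE.pg j hj
        have := Inst.gap_add (I := I) p b j
        omega
  · rw [hsol' i fun h => by rw [Inst.mem_cls] at h; have := hi h.1; omega, e2]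
    exact hL.sol i fun h => by have := hi h; omega
  · rw [hF₅.reg _ rfl, g3, St.reg_setR_ne _ _ _ _ (by decide), m2, hL.z0,
      Finset.sum_Ico_succ_top (by omega)]
  · simp at hl₂ hl₃ hl₄
    have e : (400 * I.V + 200) * (4 * I.V) = 1600 * (I.V * I.V) + 800 * I.V := by ring
    rw [e] at hl₅

    omega

/-- Treat all classes. -/
def classesCmd : Cmd := Var.z0 ::= 0 ;; .for .a 1 .cc classCmd

theorem classesCmd_spec {I : Inst} {B : Bound} {X k₀ p : ℕ} {σ : St} (hR : Room I B X)
    (hP : Prepared I B p σ) (hsol : σ.mem .sol = 0) :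
    WP B classesCmd σ k₀ fun τ l => Listed I p (I.V + 1) τ ∧
      l ≤ k₀ + 41000 * I.n + 5009 * I.V ^ 3 + 20 := by
  obtain ⟨c1, c2, c3, c4, c5, c6, c7, c8⟩ := hR.chain
  have b1 := hR.ten
  have b3 := hR.V
  rw [classesCmd, WP_seq, WP_asg]
  refine ⟨by simp; omega, ?_⟩
  have hcc := hP.cc
  -- A uniform bound for one iteration would be of order `n`, which gives `n * V` in total. So the
  -- lengths of the rows are added up; together they are at most `n`.
  refine (WP_for (x := .a) (y := .cc) (fun a τ l => Listed I p a τ ∧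
    l ≤ k₀ + 10 + 41000 * ∑ b ∈ Finset.Ico 1 a, (I.row b).length +
      (5000 * (I.V * I.V) + 9) * (a - 1)) (by decide) rfl rfl (by simp; omega)
      (by simp [hP.cc]; omega) (by omega) (by simp [hP.cc]) ?_ ?_).mono ?_
  · refine ⟨⟨fun b hb hb1 => ?_, fun i _ => ?_, by simp⟩, by simp⟩
    · simp at hb1; omega
    · simp [hsol]
  · rintro a τ l ha ha' hF hτa ⟨hL, hl⟩
    simp at ha
    simp [hP.cc] at ha'
    have hPτ : Prepared I B p τ := (hP.setR (x := .z0) rfl).frame hF rfl rfl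
    refine (classCmd_spec hR hPτ hL hτa ha (by omega)).mono ?_
    rintro τ' l' ⟨hL', hl'⟩
    refine ⟨⟨fun b hb hba => ?_, hL'.sol, by simpa using hL'.z0⟩, ?_⟩
    · have hD := hL'.done b hb hba
      exact ⟨hD.ofs, hD.qn, hD.sol, hD.el, hD.pg⟩
    · rw [Finset.sum_Ico_succ_top ha, mul_add]
      have e : (5000 * (I.V * I.V) + 9) * (a + 1 - 1) =
          (5000 * (I.V * I.V) + 9) * (a - 1) + (5000 * (I.V * I.V) + 9) := by
        rw [Nat.add_sub_cancel]
        obtain ⟨c, rfl⟩ : ∃ c, a = c + 1 := ⟨a - 1, by omega⟩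
        rw [Nat.add_sub_cancel]; ring
      omega
  · rintro τ l ⟨l', hl, ⟨hL, hl'⟩, -, hF⟩
    simp [hP.cc] at hL hl'
    refine ⟨hL, ?_⟩
    have hsum : ∑ b ∈ Finset.Ico 1 (I.V + 1), (I.row b).length ≤ I.n := by
      have h1 : ∀ b, (I.row b).length = ∑ i ∈ I.cls b, 1 := by
        intro b
        have := Inst.sum_row (I := I) (a := b) (fun _ => True) (fun _ => 1)
        simpa using this
      have h2 : Finset.Ico 1 (I.V + 1) = Finset.Icc 1 I.V := by ext; simp
      rw [h2, Finset.sum_congr rfl fun b _ => h1 b, ← Inst.sum_items]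
      simpa [Inst.items] using Finset.card_filter_le (Finset.range I.n) (0 < I.v ·)
    have h3 : (5000 * (I.V * I.V) + 9) * I.V ≤ 5009 * I.V ^ 3 := by
      have : I.V ≤ I.V ^ 3 := Nat.le_self_pow (by omega) _
      have e : (5000 * (I.V * I.V) + 9) * I.V = 5000 * I.V ^ 3 + 9 * I.V := by ring
      omega
    omega

end WordRAM

/-! ### The dynamic program -/

namespace WordRAM

/-- A function with nondecreasing differences. -/
theorem add_le_add_of_slope {f : ℕ → ℕ} {sl : ℕ → ℤ} (hf : ∀ x, (f (x + 1) : ℤ) = f x + sl x)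
    (hs : ∀ x y, x ≤ y → sl x ≤ sl y) (x d e : ℕ) :
    f (x + d) + f (x + e) ≤ f x + f (x + d + e) := by
  induction d with
  | zero => simp
  | succ d ih =>
    have h1 := hf (x + d)
    have h2 := hf (x + d + e)
    have h3 := hs (x + d) (x + d + e) (by omega)
    rw [show x + (d + 1) = x + d + 1 by omega, show x + d + 1 + e = x + d + e + 1 by omega]
    omega

namespace Inst
variable (I : Inst)

/-- The cost of a step, extended to all numbers of copies such that it stays convex.  The number
of further copies is `x + shift - span`. -/
def ext (p a x : ℕ) : ℕ :=
  if x + I.shift p a < I.span then (I.span - (x + I.shift p a)) * I.inf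
  else if x + I.shift p a - I.span ≤ I.width p a then I.gap p a (x + I.shift p a - I.span)
  else I.gap p a (I.width p a) + (x + I.shift p a - I.span - I.width p a) * I.inf

variable {I} {p a : ℕ}

theorem gap_succ (hp : I.Critical p) (ha : 0 < a) {d : ℕ} (hd : d < I.width p a) :
    ∃ i, I.AtRank a (I.low p a + d) i ∧ I.gap p a (d + 1) = I.gap p a d + I.s i := by
  obtain ⟨i, hi⟩ := exists_atRank (I := I) (a := a) (r := I.low p a + d)
    (low_add_width_le hp ha hd)
  refine ⟨i, hi, ?_⟩
  have h1 := hi.preSize_succ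
  have h2 := I.gap_add p a d
  have h3 := I.gap_add p a (d + 1)
  rw [← add_assoc] at h3
  omega

/-- The slopes are `-inf`, then the sizes of successive copies, which increase because a class is
ordered by size, and then `inf`. As `inf` exceeds every size, they increase throughout. Linear
continuation keeps convexity where a constant infinite value would have to be handled apart. -/
theorem ext_convex (hp : I.Critical p) (ha : 0 < a) (x d e : ℕ) :
    I.ext p a (x + d) + I.ext p a (x + e) ≤ I.ext p a x + I.ext p a (x + d + e) := by
  have hgap0 : I.gap p a 0 = 0 := by simp [gap]
  refine add_le_add_of_slope (sl := fun x => if x + I.shift p a < I.span then -(I.inf : ℤ) else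
    if x + I.shift p a - I.span < I.width p a then (I.gap p a (x + I.shift p a - I.span + 1) : ℤ) -
      I.gap p a (x + I.shift p a - I.span) else I.inf) (fun x => ?_) (fun x y hxy => ?_) x d e
  · unfold ext
    by_cases h1 : x + I.shift p a < I.span
    · rw [if_pos h1, if_pos h1]
      obtain ⟨k, hk⟩ : ∃ k, I.span - (x + I.shift p a) = k + 1 :=
        ⟨I.span - (x + I.shift p a) - 1, by omega⟩
      rw [hk]
      by_cases h2 : x + 1 + I.shift p a < I.span
      · rw [if_pos h2, show I.span - (x + 1 + I.shift p a) = k by omega]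
        push_cast; ring
      · rw [if_neg h2, show x + 1 + I.shift p a - I.span = 0 by omega, if_pos (Nat.zero_le _),
          hgap0, show k = 0 by omega]
        simp
    · rw [if_neg h1, if_neg h1, if_neg (by omega)]
      set d := x + I.shift p a - I.span with hd
      rw [show x + 1 + I.shift p a - I.span = d + 1 by omega]
      by_cases h2 : d < I.width p a
      · rw [if_pos h2, if_pos (by omega), if_pos h2.le]; ring
      · rw [if_neg h2, if_neg (by omega)]
        by_cases h3 : d ≤ I.width p a
        · rw [if_pos h3, show d = I.width p a by omega]; simp
        · rw [if_neg h3, show d + 1 - I.width p a = d - I.width p a + 1 by omega]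
          push_cast; ring
  · have hsz : ∀ d < I.width p a, ((I.gap p a (d + 1) : ℤ) - I.gap p a d) ≤ I.inf ∧
        (0 : ℤ) ≤ (I.gap p a (d + 1) : ℤ) - I.gap p a d := by
      intro d hd
      obtain ⟨i, hi, e⟩ := gap_succ hp ha hd
      have := I.le_inf (mem_cls.1 hi.1).1
      omega
    by_cases h1 : x + I.shift p a < I.span
    · simp only [h1, if_true]
      split
      · exact le_rfl
      split
      · rename_i h
        have := hsz _ h
        omega
      · omega
    · have h2 : ¬ y + I.shift p a < I.span := by omega
      simp only [h1, h2, if_false]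
      by_cases h3 : x + I.shift p a - I.span < I.width p a
      · rw [if_pos h3]
        split
        · rename_i h4
          obtain ⟨i, hi, e⟩ := gap_succ hp ha h3
          obtain ⟨j, hj, e'⟩ := gap_succ hp ha h4
          have := hi.size_le ha hj (by omega)
          omega
        · exact (hsz _ h3).1
      · rw [if_neg h3, if_neg (by omega)]

theorem span_le {B : Bound} {X : ℕ} (hR : Room I B X) : I.span ≤ 5 * X ^ 2 := by
  have h1 : I.V ^ 2 ≤ X ^ 2 := Nat.pow_le_pow_left hR.V 2
  have h2 : 1 ≤ X ^ 2 := Nat.one_le_pow _ _ (by have := hR.ten; omega)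
  unfold span; omega

theorem shift_lt_span (I : Inst) (p a : ℕ) : I.shift p a < I.span := by
  have : 4 * I.V ≤ 4 * I.V ^ 2 := by
    have := Nat.le_self_pow (show 2 ≠ 0 by omega) I.V
    omega
  unfold shift low span
  omega

theorem ext_le {B : Bound} {X : ℕ} (hR : Room I B X) {x : ℕ} (hx : x < 2 * I.span) :
    I.ext p a x ≤ X ^ 5 := by
  obtain ⟨c1, c2, c3, c4, c5, c6, c7, c8⟩ := hR.chain
  have h1 := I.shift_lt_span p a
  have hg : ∀ d, I.gap p a d ≤ X ^ 2 := fun d =>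
    (Nat.sub_le _ _).trans (I.preSize_le_total hR a _)
  have hm : ∀ k ≤ 2 * I.span, k * I.inf ≤ 30 * X ^ 3 := by
    intro k hk
    calc k * I.inf ≤ (10 * X ^ 2) * (3 * X) :=
          Nat.mul_le_mul (by have := I.span_le hR; omega) (I.inf_le hR)
      _ = 30 * X ^ 3 := by ring
  unfold ext
  split
  · have := hm (I.span - (x + I.shift p a)) (by omega); omega
  split
  · have := hg (x + I.shift p a - I.span); omega
  · have := hm (x + I.shift p a - I.span - I.width p a) (by omega)
    have := hg (I.width p a)
    omega

/-- Entry `r` of row `a` of a table has been computed from the row before. -/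
structure EntryDone (I : Inst) (p : ℕ) (D A : ℕ → ℕ → ℕ) (a r : ℕ) : Prop where
  lt : A a r < I.span
  eq : ∃ x, r + a * I.span = A a r + a * x ∧ D a r = D (a - 1) (A a r) + I.ext p a x
  le : ∀ r' < I.span, ∀ x, r + a * I.span = r' + a * x → D a r ≤ D (a - 1) r' + I.ext p a x

/-- An argument `x` outside the true range costs at least `inf`, so an entry below `inf` comes from
a true number of copies. Conversely `d` further copies correspond to `x = span + d - shift`, and the
shift by `span` keeps all arguments nonnegative. -/
theorem isTable {D A : ℕ → ℕ → ℕ} (h0 : ∀ r < I.span, D 0 r = if r = I.mid then I.base p else I.inf)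
    (h : ∀ a, 1 ≤ a → a ≤ I.V → ∀ r < I.span, EntryDone I p D A a r) :
    I.IsTable p I.inf D A := by
  refine ⟨h0, fun a ha haV d hd r hr r' hr' he => ?_, fun a ha haV r hr => (h a ha haV r hr).lt,
    fun a ha haV r hr => ?_, fun a ha haV r hr hD => ?_⟩
  · have hs := I.shift_lt_span p a
    have hx := (h a ha haV r hr).le r' hr' (I.span + d - I.shift p a) (by
      obtain ⟨k, hk⟩ : ∃ k, I.span = I.shift p a + k := ⟨I.span - I.shift p a, by omega⟩
      rw [hk, show I.shift p a + k + d - I.shift p a = k + d by omega, mul_add, mul_add]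
      omega)
    rw [ext, if_neg (by omega), show I.span + d - I.shift p a + I.shift p a - I.span = d by omega,
      if_pos hd] at hx
    exact hx
  · obtain ⟨x, -, e⟩ := (h a ha haV r hr).eq
    omega
  · obtain ⟨x, hx, e⟩ := (h a ha haV r hr).eq
    rw [e] at hD
    have hge : ∀ k, 0 < k → I.inf ≤ k * I.inf := fun k hk => Nat.le_mul_of_pos_left _ hk
    have h1 : I.span ≤ x + I.shift p a := by
      by_contra! hlt
      have := hge (I.span - (x + I.shift p a)) (by omega)
      rw [ext, if_pos hlt] at hD
      omega
    have h2 : x + I.shift p a - I.span ≤ I.width p a := by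
      by_contra! hlt
      have := hge (x + I.shift p a - I.span - I.width p a) (by omega)
      rw [ext, if_neg (by omega), if_neg (by omega)] at hD
      omega
    refine ⟨_, h2, ?_, by rw [e, ext, if_neg (by omega), if_pos h2]⟩
    obtain ⟨d, hd⟩ : ∃ d, x + I.shift p a = I.span + d := ⟨_, (Nat.add_sub_cancel' h1).symm⟩
    have := congrArg (a * ·) hd
    simp only [mul_add] at this
    rw [hd, Nat.add_sub_cancel_left]
    omega

end Inst

/-- Tabulate the costs of a step. -/
def gxCmd : Cmd :=
  Var.pq ::= (Var.nn : Ex) + Var.nn ;; Var.cx ::= .ld .ofs Var.a ;; Var.rem ::= .ld .qn Var.a ;;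
  .for .k 0 .pq (
    .ite (.lt ((Var.k : Ex) + Var.cx) Var.nn)
      (.sto .gx Var.k (((Var.nn : Ex) - ((Var.k : Ex) + Var.cx)) * Var.hh))
      (Var.best ::= (Var.k : Ex) + Var.cx - Var.nn ;;
        .ite (.le Var.best Var.rem)
          (.sto .gx Var.k (.ld .pg ((Var.a : Ex) * Var.str + Var.best)))
          (.sto .gx Var.k (.ld .pg ((Var.a : Ex) * Var.str + Var.rem) +
            ((Var.best : Ex) - Var.rem) * Var.hh))))

theorem gxCmd_spec {I : Inst} {B : Bound} {X k₀ p a : ℕ} {σ : St} (hR : Room I B X)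
    (hC : Ctx I B σ) (hD : ClassDone I p a σ) (ha : σ.reg .a = a) (haV : a ≤ I.V) :
    WP B gxCmd σ k₀ fun τ l => (∀ x < 2 * I.span, τ.mem .gx x = I.ext p a x) ∧
      l ≤ k₀ + 100 * (2 * I.span) + 50 := by
  obtain ⟨c1, c2, c3, c4, c5, c6, c7, c8⟩ := hR.chain
  have b1 := hR.ten
  have b3 := hR.V
  have hsp := I.span_le hR
  have hw := width_le I p a
  have hs := I.shift_lt_span p a
  have hrow : a * (4 * I.V + 1) ≤ 5 * X ^ 2 := by
    calc _ ≤ X * (4 * X + X) := Nat.mul_le_mul (haV.trans b3) (by omega)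
      _ = 5 * X ^ 2 := by ring
  have l1 := hR.lim .ofs (by decide)
  have l2 := hR.lim .qn (by decide)
  have l3 := hR.lim .gx (by decide)
  have l4 := hR.lim .pg (by decide)
  simp only [gxCmd, WP_seq]
  rw [WP_asg, WP_asg, WP_asg]
  refine ⟨by simp [hC.nn]; omega, by simp [ha]; omega, by simp [ha]; omega, ?_⟩
  refine (WP_for' (x := .k) (y := .pq) (fun m τ => ∀ x < m, τ.mem .gx x = I.ext p a x) 100
    (by decide) rfl rfl (by simp; omega) (by simp [hC.nn]; omega) (by omega) (by simp) ?_ ?_).mono ?_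
  · simp
  · rintro x τ - hx hF hτx hI
    simp [hC.nn] at hx
    have hCτ : Ctx I B τ := (((hC.setR (x := .pq) rfl).setR (x := .cx) rfl).setR
      (x := .rem) rfl).frame hF rfl
    have e1 : τ.reg .cx = I.shift p a := (hF.reg _ rfl).trans (by simp [ha, hD.ofs])
    have e2 : τ.reg .rem = I.width p a := (hF.reg _ rfl).trans (by simp [ha, hD.qn])
    have e3 : τ.reg .a = a := (hF.reg _ rfl).trans (by simp [ha])
    have e4 : τ.mem .pg = σ.mem .pg := (hF.mem _ rfl).trans (by simp)
    have hle : I.ext p a x ≤ X ^ 5 := I.ext_le hR (by omega)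
    have main : ∀ τ' : St, τ'.mem .gx = Function.update (τ.mem .gx) x (I.ext p a x) →
        ∀ x' < x + 1, τ'.mem .gx x' = I.ext p a x' := by
      intro τ' h x' hx'
      rw [h]
      rcases Nat.lt_succ_iff_lt_or_eq.1 hx' with h' | rfl
      · rw [Function.update_of_ne h'.ne, hI _ h']
      · rw [Function.update_self]
    rw [WP_ite]
    refine ⟨by simp [hτx, e1]; omega, fun hc => ?_, fun hc => ?_⟩
    · simp [hτx, e1, hCτ.nn] at hc
      rw [Inst.ext, if_pos hc] at hle
      rw [WP_sto]
      refine ⟨by simp, by simp [hτx, e1, hCτ.nn, hCτ.hh]; omega, by simp [hτx]; omega, main _ ?_,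
        by simp⟩
      simp [hτx, e1, hCτ.nn, hCτ.hh, Inst.ext, hc]
    · simp [hτx, e1, hCτ.nn] at hc
      have hc' : ¬ x + I.shift p a < I.span := by omega
      rw [WP_seq, WP_asg]
      refine ⟨by simp [hτx, e1, hCτ.nn]; omega, ?_⟩
      rw [WP_ite]
      refine ⟨by simp, fun hd => ?_, fun hd => ?_⟩
      · simp [hτx, e1, e2, hCτ.nn] at hd
        have hd' : x + I.shift p a - I.span ≤ I.width p a := by omega
        rw [WP_sto]
        refine ⟨by simp, by simp [hτx, e1, e3, hCτ.nn, hCτ.str]; omega, by simp [hτx]; omega,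
          main _ ?_, by simp⟩
        simp [hτx, e1, e3, e4, hCτ.nn, hCτ.str, Inst.ext, hc', hd, hD.pg _ hd']
      · simp [hτx, e1, e2, hCτ.nn] at hd
        have hd' : ¬ x + I.shift p a - I.span ≤ I.width p a := by omega
        rw [Inst.ext, if_neg hc', if_neg hd'] at hle
        have hpg := hD.pg _ le_rfl
        rw [← e4] at hpg
        rw [WP_sto]
        refine ⟨by simp, by simp [hτx, e1, e2, e3, hCτ.nn, hCτ.str, hCτ.hh, hpg]; omega,
          by simp [hτx]; omega, main _ ?_, by simp⟩
        have hd'' : ¬ x + I.shift p a ≤ I.width p a + I.span := by omega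
        simp [hτx, e1, e2, e3, hCτ.nn, hCτ.str, hCτ.hh, Inst.ext, hc', hd'', hpg]
  · rintro τ l ⟨h, -, hF, hl⟩
    simp [hC.nn] at h hl
    exact ⟨fun x hx => h x (by omega), by omega⟩

end WordRAM

/-! ### Filling the table -/

namespace WordRAM

/-- Compute the entries of a row that are congruent to `rs` modulo `a`. -/
def residueCmd : Cmd :=
  Var.ll ::= ((Var.nn : Ex) - Var.rs + Var.a - 1) / Var.a ;;
  Var.db ::= ((Var.a : Ex) - 1) * Var.nn + Var.rs ;;
  minimaCmd ;;
  .for .i 0 .ll (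
    Var.j ::= .ld .ag Var.i ;;
    .sto .dt ((Var.db : Ex) + Var.nn + Var.a * Var.i)
      (.ld .dt ((Var.db : Ex) + Var.a * Var.j) + .ld .gx ((Var.nn : Ex) + Var.i - Var.j)) ;;
    .sto .ar ((Var.db : Ex) + Var.nn + Var.a * Var.i) ((Var.rs : Ex) + Var.a * Var.j))

/-- An array as a table with the rows of the dynamic program. -/
def tab (I : Inst) (f : ℕ → ℕ) (b r : ℕ) : ℕ := f (b * I.span + r)

-- Entry `rs + a * i` depends only on the entries `rs + a * j` of the row before, with `x = span + i
-- - j` in the cost of the step. So one residue class is a problem of row minima by itself, for a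
-- square matrix of about `span / a` rows.
set_option maxHeartbeats 1000000 in
theorem residueCmd_spec {I : Inst} {B : Bound} {X k₀ p a rs : ℕ} {σ : St} (hR : Room I B X)
    (hC : Ctx I B σ) (hp : I.Critical p) (ha : σ.reg .a = a) (ha0 : 0 < a) (haV : a ≤ I.V)
    (hrs : σ.reg .rs = rs) (hrsa : rs < a) (hgx : ∀ x < 2 * I.span, σ.mem .gx x = I.ext p a x)
    (hdt : ∀ r < I.span, tab I (σ.mem .dt) (a - 1) r ≤ X ^ 7) :
    WP B residueCmd σ k₀ fun τ l =>
      (∀ r < I.span, r % a = rs → I.EntryDone p (tab I (τ.mem .dt)) (tab I (τ.mem .ar)) a r) ∧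
      (∀ x, (∀ r < I.span, r % a = rs → x ≠ a * I.span + r) →
        τ.mem .dt x = σ.mem .dt x ∧ τ.mem .ar x = σ.mem .ar x) ∧
      l ≤ k₀ + 10100 * ((I.span + a) / a) + 2100 := by
  obtain ⟨c1, c2, c3, c4, c5, c6, c7, c8⟩ := hR.chain
  have b1 := hR.ten
  have b3 := hR.V
  have hsp := I.span_le hR
  have hVs : I.V < I.span := by
    have := Nat.le_self_pow (show 2 ≠ 0 by omega) I.V
    unfold Inst.span; omega
  have hN : (a - 1) * I.span + I.span = a * I.span := by
    obtain ⟨b, rfl⟩ : ∃ b, a = b + 1 := ⟨a - 1, by omega⟩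
    rw [Nat.add_sub_cancel]; ring
  have haN : a * I.span ≤ X ^ 4 := by
    calc _ ≤ X * (5 * X ^ 2) := Nat.mul_le_mul (haV.trans b3) hsp
      _ = 5 * X ^ 3 := by ring
      _ ≤ X ^ 4 := by omega
  set L := (I.span - rs + a - 1) / a with hL
  -- `L` is the number of columns of the table that are congruent to `rs`; the rounding is upwards.
  have hLlt : ∀ i, i < L ↔ rs + a * i < I.span := by
    intro i
    rw [hL, Nat.lt_iff_add_one_le, Nat.le_div_iff_mul_le ha0, add_mul, mul_comm i a]
    omega
  have hL0 : 0 < L := (hLlt 0).2 (by omega)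
  have hai : ∀ i, i ≤ a * i := fun i => Nat.le_mul_of_pos_left _ ha0
  have hLN : L ≤ I.span := by
    by_contra! h
    have := (hLlt I.span).1 h
    have := hai I.span
    omega
  have hLa : L ≤ (I.span + a) / a := Nat.div_le_div_right (by omega)
  have l1 := hR.lim .dt (by decide)
  have l2 := hR.lim .ar (by decide)
  have l3 := hR.lim .gx (by decide)
  have l4 := hR.lim .ag (by decide)
  have l5 := hR.lim .lst (by decide)
  have l6 := hR.lim .ln (by decide)
  have hLL : (L + 2) * L + 2 < X ^ 6 := by
    have : (L + 2) * L ≤ (6 * X ^ 2) * (5 * X ^ 2) := Nat.mul_le_mul (by omega) (by omega)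
    have e : (6 * X ^ 2) * (5 * X ^ 2) = 30 * X ^ 4 := by ring
    omega
  simp only [residueCmd, WP_seq]
  rw [WP_asg, WP_asg]
  refine ⟨by simp [hC.nn, ha, hrs]; omega, by simp [hC.nn, ha, hrs]; omega, ?_⟩
  set σ₁ := (σ.setR .ll _).setR .db _ with hσ₁
  have e1 : σ₁.reg .ll = L := by simp [σ₁, hC.nn, ha, hrs, hL]
  have e2 : σ₁.reg .db = (a - 1) * I.span + rs := by simp [σ₁, hC.nn, ha, hrs]
  have e3 : σ₁.reg .a = a := by simp [σ₁, ha]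
  have e4 : σ₁.reg .nn = I.span := by simp [σ₁, hC.nn]
  have e5 : σ₁.reg .rs = rs := by simp [σ₁, hrs]
  have e6 : σ₁.mem = σ.mem := by simp [σ₁]
  clear_value σ₁
  have hmat : ∀ i < L, ∀ j < L, σ₁.mat i j = tab I (σ.mem .dt) (a - 1) (rs + a * j) +
      I.ext p a (I.span + i - j) := by
    intro i hi j hj
    rw [St.mat, e2, e3, e4, e6, hgx _ (by omega), tab, add_assoc]
  have hent : ∀ i < L, ∀ j < L, tab I (σ.mem .dt) (a - 1) (rs + a * j) +
      I.ext p a (I.span + i - j) ≤ 2 * X ^ 7 := by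
    intro i hi j hj
    have := hdt (rs + a * j) ((hLlt j).1 hj)
    have := I.ext_le hR (p := p) (a := a) (x := I.span + i - j) (by omega)
    omega
  refine (minimaCmd_spec (L := L) ⟨by omega, fun j hj => ?_, by omega, hR.limw _, hR.limw _,
    fun i hi j hj => ?_⟩ ?_ e1 hL0 (by omega) (hR.limw _) (by omega) (hR.limw _) (by omega)
    (hR.limw _)).frame.mono ?_
  · have := (hLlt j).1 hj
    rw [e2, e3]
    omega
  · rw [hmat i hi j hj]
    have := hent i hi j hj
    omega
  -- The entries of the previous row cancel in the Monge inequality, and what remains is convexity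
  -- of `ext`, whose argument depends only on `i - j`.
  · intro i i' j j' hi hi' hj hj'
    rw [hmat i (by omega) j (by omega), hmat i' hi' j' hj', hmat i (by omega) j' hj',
      hmat i' hi' j (by omega)]
    have := I.ext_convex hp ha0 (I.span + i - j') (j' - j) (i' - i)
    rw [show I.span + i - j' + (j' - j) = I.span + i - j by omega,
      show I.span + i - j' + (i' - i) = I.span + i' - j' by omega,
      show I.span + i - j + (i' - i) = I.span + i' - j by omega] at this
    omega
  rintro τ₁ l₁ ⟨⟨hmin, hl₁⟩, hF₁⟩
  have f1 : τ₁.reg .ll = L := (hF₁.reg _ rfl).trans e1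
  have f2 : τ₁.reg .db = (a - 1) * I.span + rs := (hF₁.reg _ rfl).trans e2
  have f3 : τ₁.reg .a = a := (hF₁.reg _ rfl).trans e3
  have f4 : τ₁.reg .nn = I.span := (hF₁.reg _ rfl).trans e4
  have f5 : τ₁.reg .rs = rs := (hF₁.reg _ rfl).trans e5
  have f6 : τ₁.mem .dt = σ.mem .dt := (hF₁.mem _ rfl).trans (by rw [e6])
  have f7 : τ₁.mem .ar = σ.mem .ar := (hF₁.mem _ rfl).trans (by rw [e6])
  have f8 : τ₁.mem .gx = σ.mem .gx := (hF₁.mem _ rfl).trans (by rw [e6])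
  set ag := τ₁.mem .ag with hag
  refine (WP_for' (x := .i) (y := .ll) (fun k τ =>
    (∀ i < k, τ.mem .dt (a * I.span + (rs + a * i)) =
      tab I (σ.mem .dt) (a - 1) (rs + a * ag i) + I.ext p a (I.span + i - ag i) ∧
      τ.mem .ar (a * I.span + (rs + a * i)) = rs + a * ag i) ∧
    ∀ x, (∀ i < k, x ≠ a * I.span + (rs + a * i)) → τ.mem .dt x = σ.mem .dt x ∧
      τ.mem .ar x = σ.mem .ar x) 100 (by decide) rfl rfl (by simp; omega) (by simp [f1]; omega)
    (by omega) (by simp) ?_ ?_).mono ?_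
  · simp [f6, f7]
  · rintro k τ - hk hF hτk ⟨hI1, hI2⟩
    rw [f1] at hk
    have g1 : τ.reg .db = (a - 1) * I.span + rs := (hF.reg _ rfl).trans f2
    have g2 : τ.reg .a = a := (hF.reg _ rfl).trans f3
    have g3 : τ.reg .nn = I.span := (hF.reg _ rfl).trans f4
    have g4 : τ.reg .rs = rs := (hF.reg _ rfl).trans f5
    have g5 : τ.mem .ag = ag := hF.mem _ rfl
    have g6 : τ.mem .gx = σ.mem .gx := (hF.mem _ rfl).trans f8
    obtain ⟨hagL, -⟩ := hmin k hk
    have hk' := (hLlt k).1 hk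
    have hj' := (hLlt _).1 hagL
    have hold : τ.mem .dt ((a - 1) * I.span + rs + a * ag k) =
        tab I (σ.mem .dt) (a - 1) (rs + a * ag k) := by
      rw [(hI2 _ fun i hi => by omega).1, tab, add_assoc]
    have hgxk : τ.mem .gx (I.span + k - ag k) = I.ext p a (I.span + k - ag k) := by
      rw [g6, hgx _ (by omega)]
    have hidx : (a - 1) * I.span + rs + I.span + a * k = a * I.span + (rs + a * k) := by omega
    have hb := hent k hk _ hagL
    have hmono : ∀ i, i < k → a * i < a * k := fun i hi => Nat.mul_lt_mul_of_pos_left hi ha0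
    simp only [WP_seq, WP_asg, WP_sto]
    refine ⟨by simp [hτk]; omega, by simp [g1, g2, g3, hτk]; omega, ?_,
      by simp [g1, g2, g3, hτk]; omega, by simp [g1, g2, g3, hτk]; omega,
      by simp [g2, g4, g5, hτk]; omega, by simp [g1, g2, g3, hτk]; omega, ⟨fun i hi => ?_,
        fun x hx => ?_⟩, by simp⟩
    · simp [g1, g2, g3, g5, hτk, hold, hgxk]; omega
    · simp [g1, g2, g3, g4, g5, hτk, hidx, hold, hgxk]
      rcases Nat.lt_succ_iff_lt_or_eq.1 hi with h | rfl
      · have := hmono i h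
        rw [Function.update_of_ne (by omega), Function.update_of_ne (by omega)]
        exact hI1 i h
      · simp
    · have h1 := hx k (by omega)
      simp [g1, g2, g3, g4, g5, hτk, hidx]
      rw [Function.update_of_ne h1, Function.update_of_ne h1]
      exact hI2 x fun i hi => hx i (by omega)
  · rintro τ l ⟨⟨hI1, hI2⟩, -, hF, hl⟩
    rw [f1] at hI1 hI2
    simp [f1] at hl
    simp at hl₁
    refine ⟨fun r hr hra => ?_, fun x hx => hI2 x fun i hi => ?_, by omega⟩
    · have hr' : r = rs + a * (r / a) := by rw [← hra]; exact (Nat.mod_add_div r a).symm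
      set i := r / a with hi
      have hiL : i < L := (hLlt i).2 (by omega)
      obtain ⟨h1, h2⟩ := hI1 i hiL
      obtain ⟨h3, h4⟩ := hmin i hiL
      have h5 := (hLlt _).1 h3
      rw [← hr'] at h1 h2
      have hprev : ∀ r' < I.span, tab I (τ.mem .dt) (a - 1) r' = tab I (σ.mem .dt) (a - 1) r' := by
        intro r' h'
        rw [tab, (hI2 _ fun i hi => by omega).1, tab]
      have hmul : a * (I.span + i - ag i) + a * ag i = a * I.span + a * i := by
        have := Nat.le_mul_of_pos_left (ag i) ha0
        rw [← mul_add, ← mul_add, Nat.sub_add_cancel ((this.trans (Nat.le_add_left _ rs)).trans (h5.le.trans (Nat.le_add_right _ i)))]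
      replace h1 : tab I (τ.mem .dt) a r = _ := h1
      replace h2 : tab I (τ.mem .ar) a r = _ := h2
      refine ⟨by rw [h2]; exact h5, ⟨I.span + i - ag i, by rw [h2]; omega, ?_⟩,
        fun r' hr' x hx => ?_⟩
      · rw [h1, h2, hprev _ h5]
      · have hr'a : r' % a = rs := by
          have h6 := congrArg (· % a) hx
          simp only [Nat.add_mul_mod_self_left, hra] at h6
          exact h6.symm
        have hr'' : r' = rs + a * (r' / a) := by rw [← hr'a]; exact (Nat.mod_add_div r' a).symm
        set j := r' / a with hj
        have hjL : j < L := (hLlt j).2 (by omega)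
        have hxe : x = I.span + i - j := by
          have h7 : a * (x + j) = a * (I.span + i) := by rw [mul_add, mul_add]; omega
          have := Nat.eq_of_mul_eq_mul_left ha0 h7
          omega
        have h8 := h4 j hjL
        rw [hmat i hiL _ h3, hmat i hiL j hjL, ← hr'', ← hxe] at h8
        rw [hprev _ hr', h1]
        exact h8
    · have := (hLlt i).1 hi
      refine hx _ this ?_
      rw [Nat.add_mul_mod_self_left, Nat.mod_eq_of_lt hrsa]

/-- Fill the table. -/
def tableCmd : Cmd :=
  .for .j 0 .nn (.sto .dt Var.j Var.hh) ;; .sto .dt Var.rr Var.z0 ;;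
  .for .a 1 .cc (gxCmd ;; .for .rs 0 .a residueCmd)

/-- The rows below `a` of the table have been filled. -/
structure Tabled (I : Inst) (p a : ℕ) (σ : St) : Prop where
  zero : ∀ r < I.span, tab I (σ.mem .dt) 0 r = if r = I.mid then I.base p else I.inf
  entry : ∀ b, 0 < b → b < a → ∀ r < I.span,
    I.EntryDone p (tab I (σ.mem .dt)) (tab I (σ.mem .ar)) b r

/-- With `x = span`, that is, with the number of copies in the greedy solution, column `r` leads to
column `r`. So each row adds at most the cost of one step, and even the unfaithful entries stay
polynomial. -/
theorem Tabled.le {I : Inst} {B : Bound} {X p a b r : ℕ} {σ : St} (hR : Room I B X)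
    (h : Tabled I p a σ) (hb : b < a) (hr : r < I.span) :
    tab I (σ.mem .dt) b r ≤ (b + 1) * X ^ 5 := by
  obtain ⟨c1, c2, c3, c4, c5, c6, c7, c8⟩ := hR.chain
  induction b with
  | zero =>
    have h1 := I.inf_le hR
    have h2 : I.base p ≤ X ^ 2 := by
      have := Inst.sum_preSize_le hR p (le_refl (I.V + 1))
      rwa [show Finset.Ico 1 (I.V + 1) = Finset.Icc 1 I.V by ext; simp] at this
    rw [h.zero r hr]
    split <;> omega
  | succ b ih =>
    have h1 := (h.entry (b + 1) (by omega) hb r hr).le r hr I.span rfl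
    have h2 := I.ext_le hR (p := p) (a := b + 1) (x := I.span) (by unfold Inst.span; omega)
    have h3 := ih (by omega)
    rw [Nat.add_sub_cancel] at h1
    have e : (b + 1 + 1) * X ^ 5 = (b + 1) * X ^ 5 + X ^ 5 := by ring
    omega

theorem ClassDone.frame {I : Inst} {p b : ℕ} {c : Cmd} {σ τ : St} (h : ClassDone I p b σ)
    (hF : Frame c σ τ)
    (hc : (c.wa .ofs || c.wa .qn || c.wa .sol || c.wa .el || c.wa .pg) = false) :
    ClassDone I p b τ := by
  simp only [Bool.or_eq_false_iff] at hc
  obtain ⟨⟨⟨⟨h1, h2⟩, h3⟩, h4⟩, h5⟩ := hc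
  exact ⟨by rw [hF.mem _ h1, h.ofs], by rw [hF.mem _ h2, h.qn], by rw [hF.mem _ h3]; exact h.sol,
    by rw [hF.mem _ h4]; exact h.el, by rw [hF.mem _ h5]; exact h.pg⟩

theorem row_lt {b a N r r' : ℕ} (hb : b < a) (hr : r < N) : b * N + r < a * N + r' := by
  have := Nat.mul_le_mul_right N (Nat.succ_le_of_lt hb)
  rw [Nat.succ_mul] at this
  omega

theorem Tabled.congr {I : Inst} {p a : ℕ} {σ τ : St} (h : Tabled I p a σ) (ha : 0 < a)
    (hx : ∀ x < a * I.span, τ.mem .dt x = σ.mem .dt x ∧ τ.mem .ar x = σ.mem .ar x) :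
    Tabled I p a τ := by
  have key : ∀ b < a, ∀ r < I.span, tab I (τ.mem .dt) b r = tab I (σ.mem .dt) b r ∧
      tab I (τ.mem .ar) b r = tab I (σ.mem .ar) b r := fun b hb r hr =>
    hx _ (by simpa using row_lt (r' := 0) hb hr)
  refine ⟨fun r hr => by rw [(key 0 ha r hr).1, h.zero r hr], fun b hb hba r hr => ?_⟩
  obtain ⟨h1, ⟨x, h2, h3⟩, h4⟩ := h.entry b hb hba r hr
  have k1 := key b hba r hr
  refine ⟨by rw [k1.2]; exact h1, ⟨x, by rw [k1.2]; exact h2, ?_⟩, fun r' hr' x hx' => ?_⟩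
  · rw [k1.1, k1.2, (key (b - 1) (by omega) _ h1).1, h3]
  · rw [k1.1, (key (b - 1) (by omega) _ hr').1]
    exact h4 r' hr' x hx'

set_option maxHeartbeats 1000000 in
theorem tableCmd_spec {I : Inst} {B : Bound} {X k₀ p : ℕ} {σ : St} (hR : Room I B X)
    (hC : Ctx I B σ) (hp : I.Critical p) (hL : Listed I p (I.V + 1) σ) :
    WP B tableCmd σ k₀ fun τ l => Tabled I p (I.V + 1) τ ∧
      l ≤ k₀ + 100000 * (I.V ^ 3 + 1) := by
  obtain ⟨c1, c2, c3, c4, c5, c6, c7, c8⟩ := hR.chain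
  have b1 := hR.ten
  have b3 := hR.V
  have hsp := I.span_le hR
  have hmid : I.mid < I.span := by unfold Inst.mid Inst.span; omega
  have l1 := hR.lim .dt (by decide)
  have hz : σ.reg .z0 = I.base p := by
    rw [hL.z0, Inst.base, show Finset.Ico 1 (I.V + 1) = Finset.Icc 1 I.V by ext; simp]
  simp only [tableCmd, WP_seq]
  refine (WP_for' (x := .j) (y := .nn) (fun m τ => ∀ r < m, τ.mem .dt r = I.inf) 30
    (by decide) rfl rfl (by simp; omega) (by simp [hC.nn]; omega) (by omega) (by simp)
    (by simp) ?_).mono ?_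
  · rintro r τ - hr hF hτr hI
    rw [hC.nn] at hr
    have hh : τ.reg .hh = I.inf := (hF.reg _ rfl).trans hC.hh
    rw [WP_sto]
    refine ⟨by simp, by simp, by simp [hτr]; omega, fun x hx => ?_, by simp⟩
    simp [hτr, hh]
    rcases Nat.lt_succ_iff_lt_or_eq.1 hx with h | rfl
    · rw [Function.update_of_ne h.ne, hI x h]
    · rw [Function.update_self]
  rintro τ₁ l₁ ⟨h1, -, hF₁, hl₁⟩
  have hC₁ : Ctx I B τ₁ := hC.frame hF₁ rfl
  have hz₁ : τ₁.reg .z0 = I.base p := (hF₁.reg _ rfl).trans hz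
  simp [hC.nn] at h1 hl₁
  rw [WP_sto]
  refine ⟨by simp, by simp, by simp [hC₁.rr]; omega, ?_⟩
  set σ₂ := τ₁.setM .dt _ _ with hσ₂
  have hC₂ : Ctx I B σ₂ := hC₁.setM (by decide)
  have hD₂ : ∀ b, 0 < b → b < I.V + 1 → ClassDone I p b σ₂ := by
    intro b hb hbV
    have h := (hL.done b hb hbV).frame hF₁ rfl
    exact ⟨by simpa [σ₂] using h.ofs, by simpa [σ₂] using h.qn, by simpa [σ₂] using h.sol,
      by simpa [σ₂] using h.el, by simpa [σ₂] using h.pg⟩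
  refine (WP_for' (x := .a) (y := .cc) (fun a τ => Tabled I p a τ) (80000 * I.V ^ 2)
    (by decide) rfl rfl (by simp; omega) (by simp [hC₂.cc]; omega) (by omega) (by simp [hC₂.cc])
    ⟨fun r hr => ?_, fun b hb hb' => by simp at hb'; omega⟩ ?_).mono ?_
  · simp [σ₂, tab, hC₁.rr, hz₁, Function.update_apply]
    split
    · rfl
    · exact h1 r hr
  · rintro a τ ha haV hF hτa hT
    simp at ha
    simp [hC₂.cc] at haV
    have hCτ : Ctx I B τ := hC₂.frame hF rfl
    have hDτ := (hD₂ a ha (by omega)).frame hF rfl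
    rw [WP_seq]
    refine (gxCmd_spec hR hCτ hDτ hτa (by omega)).frame.mono ?_
    rintro τ₃ l₃ ⟨⟨hgx, hl₃⟩, hF₃⟩
    have hC₃ : Ctx I B τ₃ := hCτ.frame hF₃ rfl
    have ha₃ : τ₃.reg .a = a := (hF₃.reg _ rfl).trans hτa
    have hT₃ : Tabled I p a τ₃ := hT.congr ha fun x _ =>
      ⟨congrFun (hF₃.mem _ rfl) x, congrFun (hF₃.mem _ rfl) x⟩
    refine (WP_for' (x := .rs) (y := .a) (fun rs τ => Tabled I p a τ ∧ ∀ r < I.span, r % a < rs →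
      I.EntryDone p (tab I (τ.mem .dt)) (tab I (τ.mem .ar)) a r)
      (10100 * ((I.span + a) / a) + 2110) (by decide) rfl rfl (by simp; omega)
      (by simp [ha₃]; omega) (by omega) (by simp) ⟨⟨hT₃.zero, hT₃.entry⟩, by simp⟩ ?_).mono ?_
    · rintro rs τ' - hrs hF' hτrs ⟨hT', hE'⟩
      rw [ha₃] at hrs
      have hC' : Ctx I B τ' := hC₃.frame hF' rfl
      have hgx' : τ'.mem .gx = τ₃.mem .gx := hF'.mem _ rfl
      refine (residueCmd_spec (p := p) hR hC' hp ((hF'.reg _ rfl).trans ha₃) ha (by omega) hτrs hrs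
        (by rw [hgx']; exact hgx) fun r hr => ?_).mono ?_
      · refine (hT'.le hR (b := a - 1) (by omega) hr).trans ?_
        calc (a - 1 + 1) * X ^ 5 ≤ X ^ 2 * X ^ 5 := Nat.mul_le_mul_right _ (by omega)
          _ = X ^ 7 := by ring
      · rintro τ'' l'' ⟨g1, g2, hl''⟩
        have hprev : ∀ x < a * I.span, τ''.mem .dt x = τ'.mem .dt x ∧
            τ''.mem .ar x = τ'.mem .ar x := fun x hx => g2 x fun r _ _ => by omega
        have hT'' := hT'.congr ha hprev
        refine ⟨⟨⟨hT''.zero, hT''.entry⟩, fun r hr hra => ?_⟩, by omega⟩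
        rcases Nat.lt_succ_iff_lt_or_eq.1 hra with h | h
        · have hrow : ∀ r' < I.span, tab I (τ''.mem .dt) (a - 1) r' =
              tab I (τ'.mem .dt) (a - 1) r' := fun r' hr' =>
            (hprev _ (by simpa using row_lt (r' := 0) (show a - 1 < a by omega) hr')).1
          have hsame := g2 (a * I.span + r) fun r' _ h2 h3 => by
            rw [Nat.add_left_cancel h3] at h; omega
          obtain ⟨k1, ⟨x, k2, k3⟩, k4⟩ := hE' r hr h
          refine ⟨by simpa [tab, hsame.2] using k1, ⟨x, by simpa [tab, hsame.2] using k2, ?_⟩,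
            fun r' hr' x hx => ?_⟩
          · show _ = tab I (τ''.mem .dt) (a - 1) (tab I (τ''.mem .ar) a r) + _
            rw [show tab I (τ''.mem .ar) a r = tab I (τ'.mem .ar) a r from hsame.2, hrow _ k1, ← k3]
            exact hsame.1
          · show tab I (τ''.mem .dt) a r ≤ tab I (τ''.mem .dt) (a - 1) r' + _
            rw [hrow _ hr', show tab I (τ''.mem .dt) a r = tab I (τ'.mem .dt) a r from hsame.1]
            exact k4 r' hr' x hx
        · exact g1 r hr h
    · rintro τ' l' ⟨⟨hT', hE'⟩, -, hF', hl'⟩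
      rw [ha₃] at hE'
      simp [ha₃] at hl'
      refine ⟨⟨hT'.zero, fun b hb hba r hr => ?_⟩, ?_⟩
      · rcases Nat.lt_succ_iff_lt_or_eq.1 hba with h | rfl
        · exact hT'.entry b hb h r hr
        · exact hE' r hr (Nat.mod_lt _ hb)
      -- There are `a` residue classes with about `span / a` entries each, so the factor `a`
      -- cancels. One row takes time of order `span + a`, which is quadratic in `V`.
      · have h2 : (10100 * ((I.span + a) / a) + 2110) * a ≤ 10100 * (I.span + a) + 2110 * a := by
          rw [add_mul, mul_assoc]
          have := Nat.div_mul_le_self (I.span + a) a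
          omega
        have h3 : I.V ≤ I.V ^ 2 := Nat.le_self_pow (by omega) _
        have h4 : I.span = 4 * I.V ^ 2 + 1 := rfl
        omega
  · rintro τ l ⟨hT, -, hF, hl⟩
    rw [hC₂.cc] at hT
    simp [hC₂.cc] at hl
    refine ⟨hT, ?_⟩
    have h4 : I.span = 4 * I.V ^ 2 + 1 := rfl
    have h5 : 80000 * I.V ^ 2 * I.V = 80000 * I.V ^ 3 := by ring
    have h6 : I.V ^ 2 ≤ I.V ^ 3 := by
      rcases Nat.eq_zero_or_pos I.V with h | h
      · simp [h]
      · exact Nat.pow_le_pow_right h (by omega)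
    omega

end WordRAM

/-! ### Reading off a solution -/

namespace WordRAM

/-- Find the largest value that the capacity permits. -/
def bestCmd : Cmd :=
  Var.best ::= 0 ;;
  .for .j 0 .nn (
    .ite (.le (.ld .dt ((Var.vmax : Ex) * Var.nn + Var.j)) Var.t) (Var.best ::= Var.j) .skip)

theorem bestCmd_spec {I : Inst} {B : Bound} {X k₀ : ℕ} {σ : St} (hR : Room I B X)
    (hC : Ctx I B σ) (hex : ∃ r < I.span, tab I (σ.mem .dt) I.V r ≤ I.t) :
    WP B bestCmd σ k₀ fun τ l =>
      (τ.reg .best < I.span ∧ tab I (σ.mem .dt) I.V (τ.reg .best) ≤ I.t ∧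
        ∀ r < I.span, tab I (σ.mem .dt) I.V r ≤ I.t → r ≤ τ.reg .best) ∧
      l ≤ k₀ + 40 * I.span + 10 := by
  obtain ⟨c1, c2, c3, c4, c5, c6, c7, c8⟩ := hR.chain
  have b1 := hR.ten
  have hsp := I.span_le hR
  have l1 := hR.lim .dt (by decide)
  have hVN : I.V * I.span ≤ X * (5 * X ^ 2) := Nat.mul_le_mul hR.V hsp
  have e : X * (5 * X ^ 2) = 5 * X ^ 3 := by ring
  rw [bestCmd, WP_seq, WP_asg]
  refine ⟨by simp; omega, ?_⟩
  refine (WP_for' (x := .j) (y := .nn) (fun m τ => ∀ r < m, tab I (σ.mem .dt) I.V r ≤ I.t →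
      τ.reg .best < I.span ∧ tab I (σ.mem .dt) I.V (τ.reg .best) ≤ I.t ∧ r ≤ τ.reg .best) 40
    (by decide) rfl rfl (by simp; omega) (by simp [hC.nn]; omega) (by omega) (by simp)
    (by simp) ?_).mono ?_
  · rintro m τ - hm hF hτm hI
    simp [hC.nn] at hm
    have hCτ : Ctx I B τ := (hC.setR rfl).frame hF rfl
    have hdt : τ.mem .dt = σ.mem .dt := hF.mem _ rfl
    rw [WP_ite]
    refine ⟨by simp [hτm, hCτ.vmax, hCτ.nn]; omega, fun hc => ?_, fun hc => ?_⟩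
    · simp [hτm, hCτ.vmax, hCτ.nn, hCτ.t, hdt] at hc
      simp only [WP_asg]
      refine ⟨by simp, fun r hr _ => ?_, by simp⟩
      simp [hτm]
      exact ⟨hm, hc, by omega⟩
    · simp [hτm, hCτ.vmax, hCτ.nn, hCτ.t, hdt] at hc
      simp only [WP_skip]
      refine ⟨fun r hr hrt => ?_, by simp⟩
      rcases Nat.lt_succ_iff_lt_or_eq.1 hr with h | rfl
      · simpa using hI r h hrt
      · exact absurd hrt hc.not_ge
  · rintro τ l ⟨hI, -, -, hl⟩
    simp [hC.nn] at hI hl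
    obtain ⟨r, hr, hrt⟩ := hex
    exact ⟨⟨(hI r hr hrt).1, (hI r hr hrt).2.1, fun r hr hrt => (hI r hr hrt).2.2⟩, by omega⟩

/-- Take the further copies of class `a` that the table asks for. -/
def takeCmd : Cmd :=
  .for .j 0 .rem (
    Var.i ::= .ld .el ((Var.a : Ex) * Var.str + Var.j) ;;
    .sto .sol Var.i ((.ld .sol Var.i : Ex) + 1))

/-- Adding the item of copy `low + j` leads from the first `low + j` copies to the first `low + j +
1`, by `pre_succ`. So the listed further copies are simply taken one after the other. -/
theorem takeCmd_spec {I : Inst} {B : Bound} {X k₀ p a d : ℕ} {σ : St} (hR : Room I B X)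
    (hC : Ctx I B σ) (ha : σ.reg .a = a) (haV : a ≤ I.V) (hd : σ.reg .rem = d)
    (hw : d ≤ I.width p a)
    (hel : ∀ j < I.width p a, I.AtRank a (I.low p a + j) (σ.mem .el (a * (4 * I.V + 1) + j)))
    (hsol : ∀ i ∈ I.cls a, σ.mem .sol i = I.pre a (I.low p a) i) :
    WP B takeCmd σ k₀ fun τ l =>
      (∀ i, τ.mem .sol i = if i ∈ I.cls a then I.pre a (I.low p a + d) i else σ.mem .sol i) ∧
      l ≤ k₀ + 160 * I.V + 10 := by
  obtain ⟨c1, c2, c3, c4, c5, c6, c7, c8⟩ := hR.chain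
  have b1 := hR.ten
  have b2 := hR.V
  have b3 := width_le I p a
  have l1 := hR.lim .el (by decide)
  have l2 := hR.lim .sol (by decide)
  have hVN : a * (4 * I.V + 1) ≤ X * (5 * X) := Nat.mul_le_mul (by omega) (by omega)
  have e : X * (5 * X) = 5 * X ^ 2 := by ring
  refine (WP_for' (x := .j) (y := .rem) (fun j τ => ∀ i, τ.mem .sol i =
      if i ∈ I.cls a then I.pre a (I.low p a + j) i else σ.mem .sol i) 40
    (by decide) rfl rfl (by simp; omega) (by simp [hd]; omega) (by omega) (by simp) ?_ ?_).mono ?_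
  · intro i
    simp only [St.mem_setR, Ex.eval_lit, add_zero]
    split
    · exact hsol i ‹_›
    · rfl
  · rintro j τ - hj hF hτj hI
    rw [hd] at hj
    have hCτ : Ctx I B τ := hC.frame hF rfl
    have ha' : τ.reg .a = a := (hF.reg _ rfl).trans ha
    have hat := hel j (by omega)
    rw [← show τ.mem .el = σ.mem .el from hF.mem _ rfl] at hat
    set i := τ.mem .el (a * (4 * I.V + 1) + j) with hi
    have hin : i < I.n := (Inst.mem_cls.1 hat.1).1
    have hn := hR.n
    have hpre : τ.mem .sol i ≤ X := by
      rw [hI, if_pos hat.1]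
      have := hR.mult_le hin
      unfold Inst.pre
      omega
    simp only [WP_seq, WP_asg, WP_sto]
    refine ⟨by simp [ha', hCτ.str, hτj]; omega, by simp [ha', hCτ.str, hτj, ← hi],
      by simp [ha', hCτ.str, hτj, ← hi]; omega, by simp [ha', hCτ.str, hτj, ← hi]; omega,
      fun x => ?_, by simp⟩
    simp [ha', hCτ.str, hτj, ← hi, Function.update_apply]
    by_cases hx : x ∈ I.cls a
    · rw [if_pos hx, ← add_assoc, hat.pre_succ hx, hI, hI, if_pos hx, if_pos hat.1]
      split <;> simp_all
    · rw [if_neg hx, if_neg (by rintro rfl; exact hx hat.1), hI, if_neg hx]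
  · rintro τ l ⟨hI, -, -, hl⟩
    rw [hd] at hI
    simp [hd] at hl
    exact ⟨hI, by omega⟩

/-- Follow the predecessors in the table. -/
def pathCmd : Cmd :=
  Var.p ::= Var.best ;;
  .for .ci 0 .vmax (
    Var.a ::= (Var.vmax : Ex) - Var.ci ;;
    Var.pq ::= .ld .ar ((Var.a : Ex) * Var.nn + Var.p) ;;
    Var.rem ::= ((Var.a : Ex) * .ld .ofs Var.a + Var.p - Var.pq) / (Var.a : Ex) ;;
    takeCmd ;;
    Var.p ::= Var.pq)

set_option maxHeartbeats 1000000 in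
theorem pathCmd_spec {I : Inst} {B : Bound} {X k₀ p : ℕ} {σ : St} (hR : Room I B X)
    (hC : Ctx I B σ) (hL : Listed I p (I.V + 1) σ)
    (hT : I.IsTable p I.inf (tab I (σ.mem .dt)) (tab I (σ.mem .ar))) (r : ℕ → ℕ)
    (hr : r I.V < I.span) (hrt : tab I (σ.mem .dt) I.V (r I.V) ≤ I.t)
    (hstep : ∀ a, 1 ≤ a → a ≤ I.V → r (a - 1) = tab I (σ.mem .ar) a (r a))
    (hb : σ.reg .best = r I.V) (hv : ∀ i < I.n, I.v i ≤ I.V) :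
    WP B pathCmd σ k₀ fun τ l =>
      (∀ i < I.n, τ.mem .sol i = if 0 < I.v i then
        I.pre (I.v i) (I.low p (I.v i) + I.taken p r (I.v i)) i else 0) ∧
      l ≤ k₀ + (160 * I.V + 100) * I.V + 10 := by
  obtain ⟨c1, c2, c3, c4, c5, c6, c7, c8⟩ := hR.chain
  have b1 := hR.ten
  have b2 := hR.V
  have hsp := I.span_le hR
  have l1 := hR.lim .ar (by decide)
  have l2 := hR.lim .ofs (by decide)
  have hpath := hT.path r hr (hrt.trans_lt I.t_lt_inf) hstep
  rw [pathCmd, WP_seq, WP_asg]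
  refine ⟨by simp, ?_⟩
  refine (WP_for' (x := .ci) (y := .vmax) (fun k τ => τ.reg .p = r (I.V - k) ∧
      ∀ i < I.n, τ.mem .sol i = if 0 < I.v i then I.pre (I.v i) (I.low p (I.v i) +
        if I.V - k < I.v i then I.taken p r (I.v i) else 0) i else 0) (160 * I.V + 100)
    (by decide) rfl rfl (by simp; omega) (by simp [hC.vmax]; omega) (by omega) (by simp)
    ⟨by simp [hb], fun i hi => ?_⟩ ?_).mono ?_
  · have h := hv i hi
    simp only [St.mem_setR, Ex.eval_lit, Nat.sub_zero, not_lt.2 h, if_false, add_zero]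
    split
    · exact (hL.done _ ‹_› (by omega)).sol i (Inst.mem_cls.2 ⟨hi, rfl⟩)
    · exact hL.sol i fun _ => Or.inl (by omega)
  · rintro k τ - hk hF hτk ⟨hI1, hI2⟩
    simp [hC.vmax] at hk
    have hCτ : Ctx I B τ := (hC.setR rfl).frame hF rfl
    have har : τ.mem .ar = σ.mem .ar := hF.mem _ rfl
    have hofs : τ.mem .ofs = σ.mem .ofs := hF.mem _ rfl
    have hel : τ.mem .el = σ.mem .el := hF.mem _ rfl
    set a := I.V - k with ha
    have ha0 : 0 < a := by omega
    have haV : a ≤ I.V := by omega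
    have hD := hL.done a ha0 (by omega)
    obtain ⟨g1, g2, -⟩ := hpath a haV
    -- The equation for a predecessor shows that the subtraction before the division by `a` is not
    -- truncated.
    obtain ⟨d, -, g3, -⟩ := hT.eq a ha0 haV _ g1 g2
    rw [← hstep a ha0 haV] at g3
    have g4 := (hpath a haV).2.2.2.2 a ha0 le_rfl
    have g5 : r (a - 1) = τ.mem .ar (a * I.span + r a) := by rw [har]; exact hstep a ha0 haV
    have g6 : τ.mem .ofs a = I.shift p a := by rw [hofs, hD.ofs]
    have g7 : a * I.shift p a ≤ X * (2 * X) :=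
      Nat.mul_le_mul (by omega) (by unfold Inst.shift Inst.low; omega)
    have g8 : a * I.span ≤ X * (5 * X ^ 2) := Nat.mul_le_mul (by omega) hsp
    have e1 : X * (2 * X) = 2 * X ^ 2 := by ring
    have e2 : X * (5 * X ^ 2) = 5 * X ^ 3 := by ring
    simp only [WP_seq, WP_asg]
    refine ⟨by simp [hCτ.vmax, hτk]; omega, by simp [hCτ.vmax, hτk, hCτ.nn, hI1, ← ha]; omega,
      by simp [hCτ.vmax, hτk, hCτ.nn, hI1, ← ha, ← g5, g6]; omega, ?_⟩
    set τ₁ := St.setR _ Var.rem _ with hτ₁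
    have f1 : τ₁.reg .a = a := by simp [τ₁, hCτ.vmax, hτk, ha]
    have f2 : τ₁.reg .pq = r (a - 1) := by simp [τ₁, hCτ.vmax, hτk, hCτ.nn, hI1, ← ha, ← g5]
    have f3 : τ₁.reg .rem = I.taken p r a := by
      simp [τ₁, hCτ.vmax, hτk, hCτ.nn, hI1, ← ha, ← g5, g6, Inst.taken]
    have f4 : τ₁.mem = τ.mem := by simp [τ₁]
    have f5 : Ctx I B τ₁ := ((hCτ.setR rfl).setR rfl).setR rfl
    clear_value τ₁
    have hsola : ∀ i ∈ I.cls a, τ₁.mem .sol i = I.pre a (I.low p a) i := by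
      intro i hi
      obtain ⟨h1, h2⟩ := Inst.mem_cls.1 hi
      rw [f4, hI2 i h1, h2, if_pos ha0, if_neg (lt_irrefl a), add_zero]
    refine (takeCmd_spec (p := p) hR f5 f1 haV f3 g4 (by rw [f4, hel]; exact hD.el) hsola).frame.mono ?_
    rintro τ₂ l ⟨⟨h1, h2⟩, hF₂⟩
    have f6 : τ₂.reg .pq = r (a - 1) := (hF₂.reg _ rfl).trans f2
    refine ⟨by simp, ⟨by simp [f6]; congr 1, fun i hi => ?_⟩, by simp at h2 ⊢; omega⟩
    simp only [St.mem_setR, h1, Inst.mem_cls]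
    by_cases h : I.v i = a
    · rw [if_pos ⟨hi, h⟩, h, if_pos ha0, if_pos (by omega)]
    · rw [if_neg fun h' => h h'.2, f4, hI2 i hi]
      by_cases h' : a < I.v i
      · rw [if_pos h', if_pos (show I.V - (k + 1) < I.v i by omega)]
      · rw [if_neg h', if_neg (show ¬ I.V - (k + 1) < I.v i by omega)]
  · rintro τ l ⟨⟨-, h⟩, -, -, hl⟩
    simp [hC.vmax] at h hl
    refine ⟨fun i hi => ?_, by omega⟩
    rw [h i hi]
    split <;> rfl

/-- Solve the problem. -/
def solveCmd : Cmd :=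
  prepareCmd ;; classesCmd ;; tableCmd ;; bestCmd ;; pathCmd ;;
  .for .i 0 .n (.sto .raw Var.i (.ld .sol Var.i))

set_option maxHeartbeats 1000000 in
theorem solveCmd_spec {I : Inst} {B : Bound} {X : ℕ} {σ : St} (hR : Room I B X)
    (hV : I.V = (Finset.range I.n).sup I.v) (hn : σ.mem .raw 0 = I.n) (ht : σ.mem .raw 1 = I.t)
    (hs : ∀ i < I.n, σ.mem .raw (i + 2) = I.s i)
    (hv : ∀ i < I.n, σ.mem .raw (i + I.n + 2) = I.v i)
    (hu : ∀ i < I.n, σ.mem .raw (i + I.n + I.n + 2) = I.u i)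
    (h0 : ∀ A, A ≠ .raw → σ.mem A = 0) :
    WP B solveCmd σ 0 fun τ l =>
      (Feas (Finset.range I.n) I.s I.u I.t (τ.mem .raw) ∧
        ∀ y, Feas (Finset.range I.n) I.s I.u I.t y →
          ∑ i ∈ Finset.range I.n, I.v i * y i ≤ ∑ i ∈ Finset.range I.n, I.v i * τ.mem .raw i) ∧
      l ≤ 200000 * (I.n + I.V ^ 3 + 1) := by
  obtain ⟨c1, c2, c3, c4, c5, c6, c7, c8⟩ := hR.chain
  have b1 := hR.ten
  simp only [solveCmd, WP_seq]
  refine (prepareCmd_spec hR hV hn ht hs hv hu h0).mono ?_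
  rintro σ₁ l₁ ⟨hP₁, hsol₁, hl₁⟩
  set p := σ₁.reg .pv
  refine (classesCmd_spec hR hP₁ hsol₁).frame.mono ?_
  rintro σ₂ l₂ ⟨⟨hL₂, hl₂⟩, hF₂⟩
  have hC₂ : Ctx I B σ₂ := hP₁.toCtx.frame hF₂ rfl
  refine (tableCmd_spec hR hC₂ hP₁.crit hL₂).frame.mono ?_
  rintro σ₃ l₃ ⟨⟨hT₃, hl₃⟩, hF₃⟩
  have hC₃ : Ctx I B σ₃ := hC₂.frame hF₃ rfl
  have hT : I.IsTable p I.inf (tab I (σ₃.mem .dt)) (tab I (σ₃.mem .ar)) :=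
    I.isTable hT₃.zero fun a ha haV r hr => hT₃.entry a ha (by omega) r hr
  obtain ⟨r₀, h1, h2, -⟩ := hT.exists_le hP₁.crit
  refine (bestCmd_spec hR hC₃ ⟨r₀, h1, h2⟩).frame.mono ?_
  rintro σ₄ l₄ ⟨⟨⟨hb1, hb2, hb3⟩, hl₄⟩, hF₄⟩
  have hC₄ : Ctx I B σ₄ := hC₃.frame hF₄ rfl
  have hdt : σ₄.mem .dt = σ₃.mem .dt := hF₄.mem _ rfl
  have har : σ₄.mem .ar = σ₃.mem .ar := hF₄.mem _ rfl
  have hL₄ : Listed I p (I.V + 1) σ₄ :=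
    ⟨fun b hb hbV => ((hL₂.done b hb hbV).frame hF₃ rfl).frame hF₄ rfl, fun i hi => by
      rw [hF₄.mem _ rfl, hF₃.mem _ rfl]; exact hL₂.sol i hi,
      by rw [hF₄.reg _ rfl, hF₃.reg _ rfl]; exact hL₂.z0⟩
  -- The path is determined from its last column downwards: `q k` is the column after `k` steps
  -- back, so `r a` is `q (V - a)`.
  let q : ℕ → ℕ := fun k => Nat.rec (σ₄.reg .best) (fun j x => tab I (σ₃.mem .ar) (I.V - j) x) k
  let r : ℕ → ℕ := fun a => q (I.V - a)
  have hrV : r I.V = σ₄.reg .best := by simp [r, q]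
  have hstep : ∀ a, 1 ≤ a → a ≤ I.V → r (a - 1) = tab I (σ₃.mem .ar) a (r a) := by
    intro a ha haV
    show q (I.V - (a - 1)) = tab I (σ₃.mem .ar) a (q (I.V - a))
    rw [show I.V - (a - 1) = I.V - a + 1 by omega]
    show tab I (σ₃.mem .ar) (I.V - (I.V - a)) (q (I.V - a)) = _
    rw [Nat.sub_sub_self haV]
  rw [← hrV] at hb1 hb2 hb3
  refine (pathCmd_spec hR hC₄ hL₄ (by rw [hdt, har]; exact hT) r hb1 (by rw [hdt]; exact hb2)
    (by rw [har]; exact hstep) hrV.symm I.le).frame.mono ?_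
  rintro σ₅ l₅ ⟨⟨hx, hl₅⟩, hF₅⟩
  have hC₅ : Ctx I B σ₅ := hC₄.frame hF₅ rfl
  have b2 := hR.n
  have m1 := hR.raw
  have m2 := hR.lim .sol (by decide)
  -- The output overwrites the input, which is no longer needed: the solution is complete in `sol`,
  -- and `n` is in a register.
  refine (WP_for' (x := .i) (y := .n) (fun i τ => ∀ j < i, τ.mem .raw j = σ₅.mem .sol j) 30
    (by decide) rfl rfl (by simp; omega) (by simp [hC₅.n]; omega) (by omega) (by simp)
    (by simp) ?_).mono ?_
  · rintro i τ - hi hF hτi hI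
    rw [hC₅.n] at hi
    have hs : τ.mem .sol = σ₅.mem .sol := hF.mem _ rfl
    rw [WP_sto]
    refine ⟨by simp, by simp [hτi]; omega, by simp [hτi]; omega, fun j hj => ?_, by simp⟩
    simp [hτi, hs]
    rcases Nat.lt_succ_iff_lt_or_eq.1 hj with h | rfl
    · rw [Function.update_of_ne h.ne, hI j h]
    · rw [Function.update_self]
  · rintro τ l ⟨h, -, -, hl⟩
    rw [hC₅.n] at h
    simp [hC₅.n] at hl
    refine ⟨hT.optimal hP₁.crit I.t_lt_inf r hb1 hb2 hb3 hstep _ fun i hi => by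
      rw [h i hi]; exact hx i hi, ?_⟩
    have h4 : I.span = 4 * I.V ^ 2 + 1 := rfl
    have h5 : (160 * I.V + 100) * I.V = 160 * I.V ^ 2 + 100 * I.V := by ring
    have h3 : I.V ≤ I.V ^ 2 := Nat.le_self_pow (by omega) _
    have h6 : I.V ^ 2 ≤ I.V ^ 3 := by
      rcases Nat.eq_zero_or_pos I.V with h | h
      · simp [h]
      · exact Nat.pow_le_pow_right h (by omega)
    omega

end WordRAM

/-! ### The machine -/

namespace Knapsack

/-- Extend a family by zeros. -/
def extend {n : ℕ} (f : Fin n → ℕ) (i : ℕ) : ℕ := if h : i < n then f ⟨i, h⟩ else 0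

@[simp] theorem extend_coe {n : ℕ} (f : Fin n → ℕ) (i : Fin n) : extend f i = f i := by
  simp [extend]

theorem extend_getElem? {n : ℕ} (f : Fin n → ℕ) (l : List ℕ) {i : ℕ} (h : i < n) :
    (List.ofFn f ++ l)[i]? = some (extend f i) := by
  rw [List.getElem?_append_left (by simpa using h)]
  simp [extend, h]

theorem sum_extend {n : ℕ} (f : Fin n → ℕ) :
    ∑ i ∈ Finset.range n, extend f i = ∑ i, f i := by
  simp [Finset.sum_range]

/-- The instance with items indexed by natural numbers. -/
def inst (K : Knapsack) : WordRAM.Inst where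
  n := K.n
  t := K.capacity
  V := K.maxValue
  s := extend K.size
  v := extend K.value
  u := extend K.mult
  le i hi := by
    simp only [extend, hi, dif_pos, maxValue]
    exact Finset.le_sup (f := K.value) (Finset.mem_univ _)

theorem sup_extend (K : Knapsack) : K.maxValue = (Finset.range K.n).sup (extend K.value) := by
  refine le_antisymm (Finset.sup_le fun i _ => ?_) (Finset.sup_le fun i hi =>
    K.inst.le i (Finset.mem_range.1 hi))
  rw [← extend_coe K.value i]
  exact Finset.le_sup (Finset.mem_range.2 i.2)

theorem feas_iff (K : Knapsack) (x : ℕ → ℕ) :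
    WordRAM.Feas (Finset.range K.n) K.inst.s K.inst.u K.inst.t x ↔ K.Feasible fun i => x i := by
  simp only [WordRAM.Feas, Feasible, Finset.sum_range, inst, extend_coe, Finset.mem_range]
  refine and_congr_left fun _ => ⟨fun h i => ?_, fun h i hi => ?_⟩
  · simpa using h i i.2
  · simpa [extend, hi] using h ⟨i, hi⟩

theorem isOptimal_of (K : Knapsack) {x : ℕ → ℕ}
    (hx : WordRAM.Feas (Finset.range K.n) K.inst.s K.inst.u K.inst.t x)
    (h : ∀ y, WordRAM.Feas (Finset.range K.n) K.inst.s K.inst.u K.inst.t y →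
      ∑ i ∈ Finset.range K.n, K.inst.v i * y i ≤ ∑ i ∈ Finset.range K.n, K.inst.v i * x i) :
    K.IsOptimal fun i => x i := by
  refine ⟨(K.feas_iff x).1 hx, fun y hy => ?_⟩
  have := h (extend y) ((K.feas_iff _).2 (by simpa using hy))
  simpa [Finset.sum_range, inst] using this

theorem length_encode (K : Knapsack) : K.encode.length = 3 * K.n + 2 := by
  simp [encode]; ring

theorem sum_encode (K : Knapsack) : K.encode.sum =
    K.n + K.capacity + (∑ i, K.size i + ∑ i, K.value i + ∑ i, K.mult i) := by
  simp [encode, List.sum_ofFn]; ring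

theorem maxValue_le (K : Knapsack) : K.maxValue ≤ ∑ i, K.value i :=
  Finset.sup_le fun _ hi => Finset.single_le_sum (f := K.value) (fun _ _ => Nat.zero_le _) hi

theorem encode_size (K : Knapsack) {i : ℕ} (h : i < K.n) :
    K.encode.getD (i + 2) 0 = extend K.size i := by
  rw [List.getD_eq_getElem?_getD, encode, List.getElem?_cons_succ, List.getElem?_cons_succ,
    List.append_assoc, extend_getElem? _ _ h, Option.getD_some]

theorem encode_value (K : Knapsack) {i : ℕ} (h : i < K.n) :
    K.encode.getD (i + K.n + 2) 0 = extend K.value i := by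
  rw [List.getD_eq_getElem?_getD, encode, List.getElem?_cons_succ, List.getElem?_cons_succ,
    List.append_assoc, List.getElem?_append_right (by simp), List.length_ofFn,
    Nat.add_sub_cancel, extend_getElem? _ _ h, Option.getD_some]

theorem encode_mult (K : Knapsack) {i : ℕ} (h : i < K.n) :
    K.encode.getD (i + K.n + K.n + 2) 0 = extend K.mult i := by
  rw [List.getD_eq_getElem?_getD, encode, List.getElem?_cons_succ, List.getElem?_cons_succ,
    List.getElem?_append_right (by simp), List.length_append, List.length_ofFn,
    List.length_ofFn, show i + K.n + K.n - (K.n + K.n) = i by omega,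
    ← List.append_nil (List.ofFn K.mult), extend_getElem? _ _ h, Option.getD_some]

end Knapsack

namespace WordRAM

theorem getD_le_sum (l : List ℕ) (i : ℕ) : l.getD i 0 ≤ l.sum := by
  rcases lt_or_ge i l.length with h | h
  · rw [List.getD_eq_getElem _ _ h]
    exact List.single_le_sum (by simp) _ (List.getElem_mem h)
  · rw [List.getD_eq_default _ _ h]
    exact Nat.zero_le _

/-- Put the first address behind the input into register `0`. -/
def prelude : List Instr :=
  -- All registers are zero at first, so the load reads `n` from cell zero. Register `1` is used as
  -- scratch space and is zero again at the end, as it is the base of `raw`.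
  [.load 0 0, .const 1 3, .op .mul 0 0 1, .const 1 2, .op .add 0 0 1, .const 1 0]

def knapsackProgram : Program := prelude ++ solveCmd.code 6

theorem reach_prelude {w : ℕ} {input : List ℕ} {P : Program} (hP : At P 0 prelude)
    (h : 3 * input.getD 0 0 + 2 < 2 ^ w) :
    ∃ m, Reach w P (init input) 6 m ∧ m.pc = 6 ∧ m.mem = (init input).mem ∧
      m.reg 0 = 3 * input.getD 0 0 + 2 ∧ ∀ r, r ≠ 0 → m.reg r = 0 := by
  simp only [prelude, At_cons] at hP
  obtain ⟨p0, p1, p2, p3, p4, p5, -⟩ := hP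
  refine ⟨_, ((((((Reach.one p0).trans (.one p1)).trans (.one p2)).trans (.one p3)).trans
    (.one p4)).trans (.one p5)), rfl, rfl, ?_, fun r hr => ?_⟩
  · simp [Instr.exec, init, Op.eval]
    rw [Nat.mod_eq_of_lt (by simp at h; omega)]
    ring
  · simp [Instr.exec, init, Op.eval, Function.update_apply, hr]
    intro h1
    rw [if_neg h1, if_neg h1]

/-- The initial state of the structured program. -/
def start (input : List ℕ) : St := ⟨0, Function.update 0 .raw fun i => input.getD i 0⟩

end WordRAM

theorem theorem2 :
    ∃ (P : WordRAM.Program) (c C : ℕ), ∀ (I : Knapsack) (w : ℕ),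
      (I.encode.sum + 2) ^ c ≤ 2 ^ w →
      WordRAM.HaltsWithin w P I.encode (C * (I.n + I.maxValue ^ 3 + 1))
        (fun mem => I.IsOptimal (fun i => mem i)) := by
  open WordRAM in
  -- The algorithm needs words for `X ^ 12`, and `X = S + 10` is at most `(S + 2) ^ 4`, which gives
  -- the exponent 48. The time is that of `solveCmd_spec`, and the 6 covers the prelude.
  refine ⟨knapsackProgram, 48, 200006, fun K w hw => ?_⟩
  set X := K.encode.sum + 10 with hX
  have hXw : X ^ 12 ≤ 2 ^ w := by
    refine le_trans ?_ hw
    have h1 : X ≤ (K.encode.sum + 2) ^ 4 := by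
      have h2 : 2 ^ 3 ≤ (K.encode.sum + 2) ^ 3 := Nat.pow_le_pow_left (by omega) 3
      calc X ≤ 2 ^ 3 * (K.encode.sum + 2) := by omega
        _ ≤ (K.encode.sum + 2) ^ 3 * (K.encode.sum + 2) := Nat.mul_le_mul_right _ h2
        _ = _ := (pow_succ _ 3).symm
    calc X ^ 12 ≤ ((K.encode.sum + 2) ^ 4) ^ 12 := Nat.pow_le_pow_left h1 12
      _ = (K.encode.sum + 2) ^ 48 := by rw [← pow_mul]
  have hsum := K.sum_encode
  have hmax := K.maxValue_le
  have hX2 : 10 * X ≤ X ^ 2 := by rw [pow_two]; exact Nat.mul_le_mul_right _ (by omega)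
  let B : Bound := ⟨2 ^ w, fun A => if A = .raw then 3 * K.n + 2 else X ^ 6⟩
  have hraw : B.lim .raw = 3 * K.n + 2 := rfl
  have hlim : ∀ A, A ≠ .raw → B.lim A = X ^ 6 := fun A hA => if_neg hA
  have hp : ∀ k < 12, X * X ^ k ≤ 2 ^ w := fun k hk => by
    rw [← pow_succ']
    exact (Nat.pow_le_pow_right (by omega) (by omega)).trans hXw
  have hp1 := hp 1 (by omega)
  have hp6 : X ^ 2 * X ^ 6 ≤ 2 ^ w := by
    rw [← pow_add]; exact (Nat.pow_le_pow_right (by omega) (by omega)).trans hXw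
  have hX6 : X ≤ X ^ 6 := Nat.le_self_pow (by omega) _
  have hX26 : 100 * X ^ 6 ≤ X ^ 2 * X ^ 6 := Nat.mul_le_mul_right _ (by omega)
  have hR : Room K.inst B X := by
    refine ⟨by omega, ?_, ?_, ?_, ?_, ?_, le_rfl, ?_, fun A hA => (hlim A hA).ge, fun A => ?_, hXw⟩
    · show K.n ≤ X; omega
    · show K.capacity ≤ X; omega
    · show K.maxValue ≤ X; omega
    · have := Knapsack.sum_extend K.size
      show ∑ i ∈ Finset.range K.n, Knapsack.extend K.size i ≤ X; omega
    · have := Knapsack.sum_extend K.mult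
      show ∑ i ∈ Finset.range K.n, Knapsack.extend K.mult i ≤ X; omega
    · rw [hraw]; omega
    · show B.lim A ≤ 2 ^ w
      by_cases hA : A = .raw
      · subst hA; rw [hraw]; omega
      · rw [hlim A hA]; omega
  obtain ⟨τ, k, hrun, hopt, hk⟩ := solveCmd_spec (σ := start K.encode) hR K.sup_extend rfl rfl
    (fun i hi => K.encode_size hi) (fun i hi => K.encode_value hi) (fun i hi => K.encode_mult hi)
    fun A hA => Function.update_of_ne hA _ _
  have hat : At knapsackProgram 0 prelude ∧ At knapsackProgram 6 (solveCmd.code 6) := by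
    simpa [prelude] using At_append.1 (At_self knapsackProgram)
  have hn : K.encode.getD 0 0 = K.n := rfl
  obtain ⟨m, hm, hpc, hmem, hr0, hr⟩ := reach_prelude (w := w) hat.1
    (by rw [hn]; omega)
  have hfits : Fits w (3 * K.n + 2) B := by
    refine ⟨rfl, by omega, le_rfl, fun A i hi => ?_⟩
    have hoff := A.off_lt
    by_cases hA : A = .raw
    · subst hA
      rw [hraw] at hi
      simp [addr, Arr.scale, Arr.off]
      omega
    · rw [hlim A hA] at hi
      have hs : A.scale = 64 := by cases A <;> simp_all [Arr.scale]
      simp only [addr, hs, hA, if_false]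
      omega
  have hrel : Rel (3 * K.n + 2) B (start K.encode) m := by
    refine ⟨fun x => hr _ (by simp [Var.idx]), by rw [hr0, hn], hr 1 (by simp), fun A i hi => ?_,
      fun x => ?_, fun A i hi => ?_⟩
    · rw [hmem]
      by_cases hA : A = .raw
      · subst hA; simp [start, init, addr, Arr.scale, Arr.off]
      -- The interleaved arrays begin just behind the input, where the memory is zero, so they start
      -- out empty.
      · rw [show (start K.encode).mem A = 0 from Function.update_of_ne hA _ _]
        refine List.getD_eq_default _ _ ?_
        simp only [K.length_encode, addr, hA, if_false]
        omega
    · show 0 < 2 ^ w; omega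
    · show _ < 2 ^ w
      by_cases hA : A = .raw
      · subst hA
        have := getD_le_sum K.encode i
        simp [start] at this ⊢
        omega
      · rw [show (start K.encode).mem A = 0 from Function.update_of_ne hA _ _]
        simp
  obtain ⟨m', hm', hrel', hpc'⟩ := hrun.sim hfits m hrel (by rw [hpc]; exact hat.2)
  obtain ⟨j, hj, rfl⟩ := hm.trans hm'
  refine ⟨j, ?_, ?_, ?_⟩
  · have h1 : k ≤ 200000 * (K.n + K.maxValue ^ 3 + 1) := (Nat.zero_add k).symm.le.trans hk
    omega
  · rw [Halted, hpc', hpc, knapsackProgram, List.length_append, Cmd.length_code]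
    simp [prelude]
  · have : (fun i : Fin K.n => ((step w knapsackProgram)^[j] (init K.encode)).mem i) =
        fun i : Fin K.n => τ.mem .raw i := by
      funext i
      have := hrel'.mem .raw i (by rw [hraw]; omega)
      simpa [addr, Arr.scale, Arr.off] using this
    show K.IsOptimal _
    rw [this]
    exact K.isOptimal_of hopt.1 hopt.2
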